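/- The ground field is $\mathbb{C}$. A (strict) monoidal supercategory is enriched in $\mathbb{Z}/2$-graded vector spaces, composition and tensor product preserve parities, and $(f\otimes g)\circ(h\otimes k)=(-1)^{|g||h|}(f\circ h)\otimes(g\circ k)$ for homogeneous morphisms. A symmetric braiding on it is a family of even isomorphisms $\beta_{a,b}\colon a\otimes b\to b\otimes a$ with $\beta_{b,a}\beta_{a,b}=1$ and $\beta_{a',b'}(f\otimes g)=(-1)^{|f||g|}(g\otimes f)\beta_{a,b}$ for homogeneous $f\colon a\to a'$, $g\colon b\to b'$, satisfying the hexagon axioms. **Upward webs.** $\mathfrak q\text{-}\mathbf{Web}_{\uparrow}$ is the strict monoidal supercategory with generating objects $\uparrow_k$ ($k\ge 1$; $\uparrow_0$ denotes the unit object) and generating morphisms, for $k,l\ge1$: odd dots $d_k\colon\uparrow_k\to\uparrow_k$, even merges $m_{k,l}\colon\uparrow_k\uparrow_l\to\uparrow_{k+l}$ and even splits $s_{k,l}\colon\uparrow_{k+l}\to\uparrow_k\uparrow_l$. By convention $m_{k,l}$ and $s_{k,l}$ are identities if $k=0$ or $l=0$, and $d_0=0$. Put $d=d_1$. For $\rho\in\{1_{\uparrow_1},d\}$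 let $$E^{\rho}=(m_{k,1}\otimes 1)(1\otimes\rho\otimes1)(1\otimes s_{1,l})\colon\ \uparrow_k\uparrow_{l+1}\to\uparrow_{k+1}\uparrow_l,\qquad F^{\rho}=(1\otimes m_{1,l})(1\otimes\rho\otimes 1)(s_{k,1}\otimes1)\colon\ \uparrow_{k+1}\uparrow_l\to\uparrow_k\uparrow_{l+1},$$ and write $e,f$ for $\rho=1$ and $e^{\bullet},f^{\bullet}$ for $\rho=d$; on three strands $e_1,f_1$ act on the first two and $e_2,f_2$ on the last two. A composite that passes through a negative label is zero. The relations are, for all integers $h,k,l\ge 0$: 1. $m_{h+k,l}(m_{h,k}\otimes1)=m_{h,k+l}(1\otimes m_{k,l})$ and $(s_{h,k}\otimes1)s_{h+k,l}=(1\otimes s_{k,l})s_{h,k+l}$; 2. $m_{k,l}s_{k,l}=\binom{k+l}{l}1$; 3. $d_kd_k=k\cdot 1$; 4. $d_{k+l}m_{k,l}=m_{k,l}(d_k\otimes1)+m_{k,l}(1\otimes d_l)$ and $s_{k,l}d_{k+l}=(d_k\otimes1)s_{k,l}+(1\otimes d_l)s_{k,l}$; 5. $s_{1,1}m_{1,1}=2\cdot1+(d\otimes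 d)\,s_{1,1}m_{1,1}\,(d\otimes d)$; 6. on $\uparrow_k\uparrow_l$: $ef-fe=(k-l)1$ and $e^{\bullet}f-fe^{\bullet}=ef^{\bullet}-f^{\bullet}e=d_k\otimes1-1\otimes d_l$; 7. as morphisms $\uparrow_h\uparrow_k\uparrow_{l+1}\to\uparrow_{h+1}\uparrow_k\uparrow_l$: $e_1e_2-e_2e_1=e_1^{\bullet}e_2^{\bullet}+e_2^{\bullet}e_1^{\bullet}$ and $e_1e_2^{\bullet}-e_2^{\bullet}e_1=e_1^{\bullet}e_2-e_2e_1^{\bullet}$; 8. as morphisms $\uparrow_{h+1}\uparrow_k\uparrow_l\to\uparrow_h\uparrow_k\uparrow_{l+1}$: $f_2f_1-f_1f_2=f_2^{\bullet}f_1^{\bullet}+f_1^{\bullet}f_2^{\bullet}$ and $f_1f_2^{\bullet}-f_2^{\bullet}f_1=f_1^{\bullet}f_2-f_2f_1^{\bullet}$. The thin crossing is $s_{1,1}m_{1,1}-1\in\operatorname{End}(\uparrow_1\uparrow_1)$; the crossing $\beta_{\uparrow_k,\uparrow_l}\colon\uparrow_k\uparrow_l\to\uparrow_l\uparrow_k$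 is $\frac1{k!\,l!}$ times the morphism that splits both strands completely into strands of thickness one, crosses the $k$ thin strands with the $l$ thin strands by thin crossings, and merges them again. **Oriented webs.** $\mathfrak q\text{-}\mathbf{Web}_{\uparrow\downarrow}$ is the strict monoidal supercategory with generating objects $\uparrow_k,\downarrow_k$ ($k\ge1$), generating morphisms the dots, merges and splits above (between upward objects) together with even cups $\cup_k\colon\mathbb 1\to\uparrow_k\downarrow_k$, even caps $\cap_k\colon\downarrow_k\uparrow_k\to\mathbb 1$ and even rightward crossings $\uparrow_k\downarrow_l\to\downarrow_l\uparrow_k$, subject to the relations above, the relations $(1_{\uparrow_k}\otimes\cap_k)(\cup_k\otimes1_{\uparrow_k})=1_{\uparrow_k}$ and $(\cap_k\otimes1_{\downarrow_k})(1_{\downarrow_k}\otimes\cup_k)=1_{\downarrow_k}$, the relations saying that the rightward crossing $\uparrow_l\downarrow_k\to\downarrow_k\uparrow_l$ is a two-sided inverse of the leftward crossing $$(\cap_k\otimes1\otimes1)(1\otimes\beta_{\uparrow_l,\uparrow_k}\otimes1)(1\otimes1\otimes\cup_k)\colon\ \downarrow_k\uparrow_l\to\uparrow_l\downarrow_k ,$$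 and the relation that $\cap_k\circ(1_{\downarrow_k}\otimes d_k)\circ(\text{rightward crossing }\uparrow_k\downarrow_k\to\downarrow_k\uparrow_k)\circ\cup_k=0$. The crossing $\downarrow_k\downarrow_l\to\downarrow_l\downarrow_k$ is obtained from $\beta_{\uparrow_k,\uparrow_l}$ by rotating it with nested caps on its left and nested cups on its right. In both categories, for objects $a$ and $b$ let $\beta_{a,b}$ be the morphism in which all strands of $a$ cross all strands of $b$ by the crossings above. A web is a morphism obtained from identities and generating morphisms by compositions and tensor products; it is called upward or oriented according to the category. **Theorem.** The morphisms $\beta_{a,b}$ are symmetric braidings on $\mathfrak q\text{-}\mathbf{Web}_{\uparrow}$ and on $\mathfrak q\text{-}\mathbf{Web}_{\uparrow\downarrow}$. Sending objects and morphisms of $\mathfrak q\text{-}\mathbf{Web}_{\uparrow}$ to objects and morphisms of the same name defines a fully faithful functor of symmetric monoidal supercategories $\mathfrak q\text{-}\mathbf{Web}_{\uparrow}\to\mathfrak q\text{-}\mathbf{Web}_{\uparrow\downarrow}$, that is, a parity-preserving linear monoidal functor, compatible with the braidings, which is bijective on morphism spaces. Moreover, every oriented web whose source and target are products of upward objects is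 equal in $\mathfrak q\text{-}\mathbf{Web}_{\uparrow\downarrow}$ to a linear combination of (images of) upward webs. -/

import Mathlib

open CategoryTheory

namespace QWeb

/-! ### Monoidal supercategories -/

section Supercategories

universe u v u' v'

/-- The Koszul sign `(-1)^(p q)`. -/
def koszul (p q : ZMod 2) : ℂ := (-1) ^ (p.val * q.val)

/-- A supercategory over `ℂ`: every morphism space is a superspace, composition is bilinear and
even, and identities are even. -/
class Supercategory (C : Type u) [Category.{v} C] [Preadditive C] [Linear ℂ C] where
  /-- `parity X Y p` is the space of morphisms of parity `p`. -/
  parity : ∀ X Y : C, ZMod 2 → Submodule ℂ (X ⟶ Y)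
  parity_internal : ∀ X Y : C, DirectSum.IsInternal (parity X Y)
  id_parity : ∀ X : C, 𝟙 X ∈ parity X X 0
  comp_parity : ∀ {X Y Z : C} {f : X ⟶ Y} {g : Y ⟶ Z} {p q : ZMod 2},
    f ∈ parity X Y p → g ∈ parity Y Z q → f ≫ g ∈ parity X Z (p + q)

open Supercategory

/-- A monoidal supercategory. A bilinear even `tensorHom` satisfying the super interchange law is
the same as a superfunctor `C ⊠ C → C`. -/
class MonoidalSupercategory (C : Type u) [Category.{v} C] [Preadditive C] [Linear ℂ C]
    [Supercategory C] where
  tensorObj : C → C → C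
  tensorUnit : C
  tensorHom : ∀ {X X' Y Y' : C},
    (X ⟶ X') →ₗ[ℂ] (Y ⟶ Y') →ₗ[ℂ] (tensorObj X Y ⟶ tensorObj X' Y')
  tensorHom_parity : ∀ {X X' Y Y' : C} {f : X ⟶ X'} {g : Y ⟶ Y'} {p q : ZMod 2},
    f ∈ parity X X' p → g ∈ parity Y Y' q → tensorHom f g ∈ parity _ _ (p + q)
  tensorHom_id : ∀ X Y : C, tensorHom (𝟙 X) (𝟙 Y) = 𝟙 (tensorObj X Y)
  interchange : ∀ {X X' X'' Y Y' Y'' : C} (f : X ⟶ X') (g : Y ⟶ Y') (f' : X' ⟶ X'')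
    (g' : Y' ⟶ Y'') {p q : ZMod 2}, g' ∈ parity Y' Y'' p → f ∈ parity X X' q →
    tensorHom f g ≫ tensorHom f' g' = koszul p q • tensorHom (f ≫ f') (g ≫ g')
  associator : ∀ X Y Z : C, tensorObj (tensorObj X Y) Z ≅ tensorObj X (tensorObj Y Z)
  leftUnitor : ∀ X : C, tensorObj tensorUnit X ≅ X
  rightUnitor : ∀ X : C, tensorObj X tensorUnit ≅ X
  associator_parity : ∀ X Y Z : C, (associator X Y Z).hom ∈ parity _ _ 0
  leftUnitor_parity : ∀ X : C, (leftUnitor X).hom ∈ parity _ _ 0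
  rightUnitor_parity : ∀ X : C, (rightUnitor X).hom ∈ parity _ _ 0
  associator_naturality : ∀ {X X' Y Y' Z Z' : C} (f : X ⟶ X') (g : Y ⟶ Y') (h : Z ⟶ Z'),
    tensorHom (tensorHom f g) h ≫ (associator X' Y' Z').hom =
      (associator X Y Z).hom ≫ tensorHom f (tensorHom g h)
  leftUnitor_naturality : ∀ {X X' : C} (f : X ⟶ X'),
    tensorHom (𝟙 tensorUnit) f ≫ (leftUnitor X').hom = (leftUnitor X).hom ≫ f
  rightUnitor_naturality : ∀ {X X' : C} (f : X ⟶ X'),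
    tensorHom f (𝟙 tensorUnit) ≫ (rightUnitor X').hom = (rightUnitor X).hom ≫ f
  pentagon : ∀ W X Y Z : C,
    tensorHom (associator W X Y).hom (𝟙 Z) ≫ (associator W (tensorObj X Y) Z).hom ≫
        tensorHom (𝟙 W) (associator X Y Z).hom =
      (associator (tensorObj W X) Y Z).hom ≫ (associator W X (tensorObj Y Z)).hom
  triangle : ∀ X Y : C,
    (associator X tensorUnit Y).hom ≫ tensorHom (𝟙 X) (leftUnitor Y).hom =
      tensorHom (rightUnitor X).hom (𝟙 Y)

open MonoidalSupercategory

/-- `β` is an even symmetric braiding: an even supernatural isomorphism `X ⊗ Y ≅ Y ⊗ X` satisfying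
the hexagon axioms, with `β X Y` and `β Y X` mutually inverse. -/
structure IsSymmetricBraiding {C : Type u} [Category.{v} C] [Preadditive C] [Linear ℂ C]
    [Supercategory C] [MonoidalSupercategory C]
    (β : ∀ X Y : C, tensorObj X Y ⟶ tensorObj Y X) : Prop where
  even : ∀ X Y : C, β X Y ∈ parity _ _ 0
  symmetric : ∀ X Y : C, β X Y ≫ β Y X = 𝟙 _
  supernatural : ∀ {X X' Y Y' : C} (f : X ⟶ X') (g : Y ⟶ Y') {p q : ZMod 2},
    f ∈ parity X X' p → g ∈ parity Y Y' q →
    tensorHom f g ≫ β X' Y' = koszul p q • (β X Y ≫ tensorHom g f)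
  hexagon_forward : ∀ X Y Z : C,
    (associator X Y Z).hom ≫ β X (tensorObj Y Z) ≫ (associator Y Z X).hom =
      tensorHom (β X Y) (𝟙 Z) ≫ (associator Y X Z).hom ≫ tensorHom (𝟙 Y) (β X Z)
  hexagon_reverse : ∀ X Y Z : C,
    (associator X Y Z).inv ≫ β (tensorObj X Y) Z ≫ (associator Z X Y).inv =
      tensorHom (𝟙 X) (β Y Z) ≫ (associator X Z Y).inv ≫ tensorHom (β X Z) (𝟙 Y)

/-- A (strong) monoidal superfunctor: linear, parity preserving, with even coherence
isomorphisms. -/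
structure MonoidalSuperfunctor (C : Type u) [Category.{v} C] [Preadditive C] [Linear ℂ C]
    [Supercategory C] [MonoidalSupercategory C] (D : Type u') [Category.{v'} D] [Preadditive D]
    [Linear ℂ D] [Supercategory D] [MonoidalSupercategory D] extends C ⥤ D where
  map_add : ∀ {X Y : C} (f g : X ⟶ Y), map (f + g) = map f + map g
  map_smul : ∀ {X Y : C} (z : ℂ) (f : X ⟶ Y), map (z • f) = z • map f
  map_parity : ∀ {X Y : C} {f : X ⟶ Y} {p : ZMod 2}, f ∈ parity X Y p →
    map f ∈ parity (obj X) (obj Y) p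
  tensorIso : ∀ X Y : C, tensorObj (obj X) (obj Y) ≅ obj (tensorObj X Y)
  unitIso : (tensorUnit : D) ≅ obj tensorUnit
  tensorIso_parity : ∀ X Y : C, (tensorIso X Y).hom ∈ parity _ _ 0
  unitIso_parity : unitIso.hom ∈ parity _ _ 0
  tensorIso_naturality : ∀ {X X' Y Y' : C} (f : X ⟶ X') (g : Y ⟶ Y'),
    tensorHom (map f) (map g) ≫ (tensorIso X' Y').hom =
      (tensorIso X Y).hom ≫ map (tensorHom f g)
  associativity : ∀ X Y Z : C,
    tensorHom (tensorIso X Y).hom (𝟙 (obj Z)) ≫ (tensorIso (tensorObj X Y) Z).hom ≫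
        map (associator X Y Z).hom =
      (associator (obj X) (obj Y) (obj Z)).hom ≫
        tensorHom (𝟙 (obj X)) (tensorIso Y Z).hom ≫ (tensorIso X (tensorObj Y Z)).hom
  left_unitality : ∀ X : C, (leftUnitor (obj X)).hom =
    tensorHom unitIso.hom (𝟙 (obj X)) ≫ (tensorIso tensorUnit X).hom ≫ map (leftUnitor X).hom
  right_unitality : ∀ X : C, (rightUnitor (obj X)).hom =
    tensorHom (𝟙 (obj X)) unitIso.hom ≫ (tensorIso X tensorUnit).hom ≫ map (rightUnitor X).hom

/-- Compatibility of a monoidal superfunctor with braidings of its source and target. -/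
def MonoidalSuperfunctor.PreservesBraiding {C : Type u} [Category.{v} C] [Preadditive C]
    [Linear ℂ C] [Supercategory C] [MonoidalSupercategory C] {D : Type u'} [Category.{v'} D]
    [Preadditive D] [Linear ℂ D] [Supercategory D] [MonoidalSupercategory D]
    (F : MonoidalSuperfunctor C D) (β : ∀ X Y : C, tensorObj X Y ⟶ tensorObj Y X)
    (γ : ∀ X Y : D, tensorObj X Y ⟶ tensorObj Y X) : Prop :=
  ∀ X Y : C, (F.tensorIso X Y).hom ≫ F.map (β X Y) =
    γ (F.obj X) (F.obj Y) ≫ (F.tensorIso Y X).hom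

end Supercategories

/-! ### Strict monoidal supercategories given by generators and relations -/

/-- Formal linear combinations of composites of tensor products of generators. Objects are words in
the generating objects `Ob`, and `Gen` is the family of generating morphisms. Composition is
written in diagrammatic order (the first factor is at the bottom). The equations in `tensor` allow
words that are equal, but not syntactically so, as source and target. -/
inductive Term {Ob : Type} (Gen : List Ob → List Ob → Type) : List Ob → List Ob → Type
  | id (a : List Ob) : Term Gen a a
  | gen {a b : List Ob} (g : Gen a b) : Term Gen a b
  | comp {a b c : List Ob} (s : Term Gen a b) (t : Term Gen b c) : Term Gen a c
  | tensor {a b c d x y : List Ob} (s : Term Gen a b) (t : Term Gen c d)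
      (hx : x = a ++ c) (hy : y = b ++ d) : Term Gen x y
  | zero {a b : List Ob} : Term Gen a b
  | add {a b : List Ob} (s t : Term Gen a b) : Term Gen a b
  | smul {a b : List Ob} (z : ℂ) (t : Term Gen a b) : Term Gen a b

namespace Term

variable {Ob : Type} {Gen : List Ob → List Ob → Type}

instance (a b : List Ob) : Zero (Term Gen a b) := ⟨Term.zero⟩
instance (a b : List Ob) : Add (Term Gen a b) := ⟨Term.add⟩
instance (a b : List Ob) : SMul ℂ (Term Gen a b) := ⟨Term.smul⟩
instance (a b : List Ob) : Sub (Term Gen a b) := ⟨fun s t => Term.add s (Term.smul (-1) t)⟩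

/-- The identity, read as a term between two equal words. -/
def ofEq {a b : List Ob} (h : a = b) : Term Gen a b := h ▸ Term.id a

/-- The tensor product, with its evident source and target. -/
def tens {a b c d : List Ob} (s : Term Gen a b) (t : Term Gen c d) : Term Gen (a ++ c) (b ++ d) :=
  Term.tensor s t rfl rfl

/-- A single web: a term built without linear operations. -/
inductive IsWeb : ∀ {a b : List Ob}, Term Gen a b → Prop
  | id (a : List Ob) : IsWeb (Term.id a)
  | gen {a b : List Ob} (g : Gen a b) : IsWeb (Term.gen g)
  | comp {a b c : List Ob} {s : Term Gen a b} {t : Term Gen b c} (hs : IsWeb s) (ht : IsWeb t) :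
      IsWeb (Term.comp s t)
  | tensor {a b c d x y : List Ob} {s : Term Gen a b} {t : Term Gen c d} (hs : IsWeb s)
      (ht : IsWeb t) (hx : x = a ++ c) (hy : y = b ++ d) : IsWeb (Term.tensor s t hx hy)

/-- `HasParity par t p`: given the parities of the generators, `t` is homogeneous of parity `p`. -/
inductive HasParity (par : ∀ a b : List Ob, Gen a b → ZMod 2) :
    ∀ {a b : List Ob}, Term Gen a b → ZMod 2 → Prop
  | id (a : List Ob) : HasParity par (Term.id a) 0
  | gen {a b : List Ob} (g : Gen a b) : HasParity par (Term.gen g) (par a b g)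
  | comp {a b c : List Ob} {s : Term Gen a b} {t : Term Gen b c} {p q : ZMod 2}
      (hs : HasParity par s p) (ht : HasParity par t q) : HasParity par (Term.comp s t) (p + q)
  | tensor {a b c d x y : List Ob} {s : Term Gen a b} {t : Term Gen c d} {p q : ZMod 2}
      (hs : HasParity par s p) (ht : HasParity par t q) (hx : x = a ++ c) (hy : y = b ++ d) :
      HasParity par (Term.tensor s t hx hy) (p + q)
  | zero {a b : List Ob} (p : ZMod 2) : HasParity par (Term.zero : Term Gen a b) p
  | add {a b : List Ob} {s t : Term Gen a b} {p : ZMod 2} (hs : HasParity par s p)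
      (ht : HasParity par t p) : HasParity par (Term.add s t) p
  | smul {a b : List Ob} {t : Term Gen a b} {p : ZMod 2} (z : ℂ) (ht : HasParity par t p) :
      HasParity par (Term.smul z t) p

end Term

/-- A presentation: generating objects, generating morphisms (with parities) between words in them,
and homogeneous relations between terms. -/
structure Presentation where
  Ob : Type
  Gen : List Ob → List Ob → Type
  par : ∀ a b : List Ob, Gen a b → ZMod 2
  Rel : ∀ {a b : List Ob}, Term Gen a b → Term Gen a b → Prop
  rel_parity : ∀ {a b : List Ob} {s t : Term Gen a b}, Rel s t →
    ∃ p, s.HasParity par p ∧ t.HasParity par p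

/-- Equality in the presented strict monoidal supercategory: the smallest congruence that contains
the relations and the axioms of a strict monoidal supercategory. -/
inductive Presentation.Eqv (P : Presentation) :
    ∀ {a b : List P.Ob}, Term P.Gen a b → Term P.Gen a b → Prop
  | rel {a b : List P.Ob} {s t : Term P.Gen a b} (h : P.Rel s t) : P.Eqv s t
  | refl {a b : List P.Ob} (s : Term P.Gen a b) : P.Eqv s s
  | symm {a b : List P.Ob} {s t : Term P.Gen a b} (h : P.Eqv s t) : P.Eqv t s
  | trans {a b : List P.Ob} {s t r : Term P.Gen a b} (h : P.Eqv s t) (h' : P.Eqv t r) :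
      P.Eqv s r
  | comp {a b c : List P.Ob} {s s' : Term P.Gen a b} {t t' : Term P.Gen b c}
      (h : P.Eqv s s') (h' : P.Eqv t t') : P.Eqv (s.comp t) (s'.comp t')
  | tensor {a b c d x y : List P.Ob} {s s' : Term P.Gen a b}
      {t t' : Term P.Gen c d} (h : P.Eqv s s') (h' : P.Eqv t t')
      (hx : x = a ++ c) (hy : y = b ++ d) : P.Eqv (s.tensor t hx hy) (s'.tensor t' hx hy)
  | add {a b : List P.Ob} {s s' t t' : Term P.Gen a b} (h : P.Eqv s s')
      (h' : P.Eqv t t') : P.Eqv (s.add t) (s'.add t')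
  | smul {a b : List P.Ob} {t t' : Term P.Gen a b} (z : ℂ) (h : P.Eqv t t') :
      P.Eqv (t.smul z) (t'.smul z)
  -- vector space axioms
  | add_comm {a b : List P.Ob} (s t : Term P.Gen a b) : P.Eqv (s.add t) (t.add s)
  | add_assoc {a b : List P.Ob} (s t r : Term P.Gen a b) :
      P.Eqv ((s.add t).add r) (s.add (t.add r))
  | add_zero {a b : List P.Ob} (s : Term P.Gen a b) : P.Eqv (s.add .zero) s
  | add_neg {a b : List P.Ob} (s : Term P.Gen a b) : P.Eqv (s.add (s.smul (-1))) .zero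
  | one_smul {a b : List P.Ob} (s : Term P.Gen a b) : P.Eqv (s.smul 1) s
  | mul_smul {a b : List P.Ob} (z w : ℂ) (s : Term P.Gen a b) :
      P.Eqv (s.smul (z * w)) ((s.smul w).smul z)
  | smul_add {a b : List P.Ob} (z : ℂ) (s t : Term P.Gen a b) :
      P.Eqv ((s.add t).smul z) ((s.smul z).add (t.smul z))
  | add_smul {a b : List P.Ob} (z w : ℂ) (s : Term P.Gen a b) :
      P.Eqv (s.smul (z + w)) ((s.smul z).add (s.smul w))
  -- bilinearity of composition and tensor product
  | add_comp {a b c : List P.Ob} (s s' : Term P.Gen a b) (t : Term P.Gen b c) :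
      P.Eqv ((s.add s').comp t) ((s.comp t).add (s'.comp t))
  | comp_add {a b c : List P.Ob} (s : Term P.Gen a b) (t t' : Term P.Gen b c) :
      P.Eqv (s.comp (t.add t')) ((s.comp t).add (s.comp t'))
  | smul_comp {a b c : List P.Ob} (z : ℂ) (s : Term P.Gen a b)
      (t : Term P.Gen b c) : P.Eqv ((s.smul z).comp t) ((s.comp t).smul z)
  | comp_smul {a b c : List P.Ob} (z : ℂ) (s : Term P.Gen a b)
      (t : Term P.Gen b c) : P.Eqv (s.comp (t.smul z)) ((s.comp t).smul z)
  | add_tensor {a b c d x y : List P.Ob} (s s' : Term P.Gen a b)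
      (t : Term P.Gen c d) (hx : x = a ++ c) (hy : y = b ++ d) :
      P.Eqv ((s.add s').tensor t hx hy) ((s.tensor t hx hy).add (s'.tensor t hx hy))
  | tensor_add {a b c d x y : List P.Ob} (s : Term P.Gen a b)
      (t t' : Term P.Gen c d) (hx : x = a ++ c) (hy : y = b ++ d) :
      P.Eqv (s.tensor (t.add t') hx hy) ((s.tensor t hx hy).add (s.tensor t' hx hy))
  | smul_tensor {a b c d x y : List P.Ob} (z : ℂ) (s : Term P.Gen a b)
      (t : Term P.Gen c d) (hx : x = a ++ c) (hy : y = b ++ d) :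
      P.Eqv ((s.smul z).tensor t hx hy) ((s.tensor t hx hy).smul z)
  | tensor_smul {a b c d x y : List P.Ob} (z : ℂ) (s : Term P.Gen a b)
      (t : Term P.Gen c d) (hx : x = a ++ c) (hy : y = b ++ d) :
      P.Eqv (s.tensor (t.smul z) hx hy) ((s.tensor t hx hy).smul z)
  -- category axioms
  | id_comp {a b : List P.Ob} (s : Term P.Gen a b) : P.Eqv ((Term.id a).comp s) s
  | comp_id {a b : List P.Ob} (s : Term P.Gen a b) : P.Eqv (s.comp (Term.id b)) s
  | comp_assoc {a b c d : List P.Ob} (s : Term P.Gen a b) (t : Term P.Gen b c)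
      (r : Term P.Gen c d) : P.Eqv ((s.comp t).comp r) (s.comp (t.comp r))
  -- the tensor product is a superfunctor
  | tensor_id {a c x : List P.Ob} (hx hx' : x = a ++ c) :
      P.Eqv ((Term.id a).tensor (Term.id c) hx hx') (Term.id x)
  | interchange {a b c a' b' c' x y z : List P.Ob} (s : Term P.Gen a b)
      (t : Term P.Gen a' b') (s' : Term P.Gen b c)
      (t' : Term P.Gen b' c') {p q : ZMod 2} (ht' : t'.HasParity P.par p)
      (hs : s.HasParity P.par q) (hx : x = a ++ a') (hy : y = b ++ b') (hz : z = c ++ c') :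
      P.Eqv ((s.tensor t hx hy).comp (s'.tensor t' hy hz))
        (((s.comp s').tensor (t.comp t') hx hz).smul (koszul p q))
  -- strictness
  | tensor_assoc {a b c d e f ac bd ce df x y : List P.Ob} (s : Term P.Gen a b)
      (t : Term P.Gen c d) (r : Term P.Gen e f) (h₁ : ac = a ++ c)
      (h₂ : bd = b ++ d) (h₃ : x = ac ++ e) (h₄ : y = bd ++ f) (h₅ : ce = c ++ e)
      (h₆ : df = d ++ f) (h₇ : x = a ++ ce) (h₈ : y = b ++ df) :
      P.Eqv ((s.tensor t h₁ h₂).tensor r h₃ h₄) (s.tensor (t.tensor r h₅ h₆) h₇ h₈)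
  | unit_tensor {a b : List P.Ob} (s : Term P.Gen a b) (ha : a = [] ++ a)
      (hb : b = [] ++ b) : P.Eqv ((Term.id []).tensor s ha hb) s
  | tensor_unit {a b : List P.Ob} (s : Term P.Gen a b) (ha : a = a ++ [])
      (hb : b = b ++ []) : P.Eqv (s.tensor (Term.id []) ha hb) s

end QWeb
namespace QWeb

namespace Presentation

variable (P : Presentation)

/-- The objects of the presented category: words in the generating objects. -/
@[ext] structure Cat where
  /-- The underlying word. -/
  word : List P.Ob

/-- Equality of terms as a setoid. -/
def setoid (a b : List P.Ob) : Setoid (Term P.Gen a b) where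
  r := P.Eqv
  iseqv := ⟨Eqv.refl, Eqv.symm, Eqv.trans⟩

/-- The morphisms of the presented category. -/
def Hom (a b : List P.Ob) : Type := Quotient (P.setoid a b)

variable {P}

/-- The morphism that a term represents. -/
def cls {a b : List P.Ob} (t : Term P.Gen a b) : P.Hom a b := Quotient.mk (P.setoid a b) t

theorem cls_eq {a b : List P.Ob} {s t : Term P.Gen a b} (h : P.Eqv s t) : cls s = cls t :=
  Quotient.sound (s := P.setoid a b) h

theorem exact {a b : List P.Ob} {s t : Term P.Gen a b} (h : cls s = cls t) : P.Eqv s t :=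
  Quotient.exact (s := P.setoid a b) h

theorem cls_surj {a b : List P.Ob} (f : P.Hom a b) : ∃ t, cls t = f := Quotient.exists_rep f

instance (a b : List P.Ob) : Zero (P.Hom a b) := ⟨cls .zero⟩

instance (a b : List P.Ob) : Add (P.Hom a b) :=
  ⟨Quotient.map₂ Term.add fun _ _ h _ _ h' => Eqv.add h h'⟩

instance (a b : List P.Ob) : SMul ℂ (P.Hom a b) :=
  ⟨fun z => Quotient.map (Term.smul z) fun _ _ h => Eqv.smul z h⟩

instance (a b : List P.Ob) : Neg (P.Hom a b) := ⟨fun f => (-1 : ℂ) • f⟩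

theorem cls_zero (a b : List P.Ob) : cls (.zero : Term P.Gen a b) = 0 := rfl
theorem cls_add {a b : List P.Ob} (s t : Term P.Gen a b) : cls (s.add t) = cls s + cls t := rfl
theorem cls_smul {a b : List P.Ob} (z : ℂ) (t : Term P.Gen a b) :
    cls (t.smul z) = z • cls t := rfl

instance (a b : List P.Ob) : AddCommGroup (P.Hom a b) where
  add_assoc f g h := by
    obtain ⟨s, rfl⟩ := cls_surj f; obtain ⟨t, rfl⟩ := cls_surj g; obtain ⟨r, rfl⟩ := cls_surj h
    exact cls_eq (.add_assoc s t r)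
  zero_add f := by
    obtain ⟨s, rfl⟩ := cls_surj f
    exact cls_eq ((Eqv.add_comm _ _).trans (.add_zero s))
  add_zero f := by
    obtain ⟨s, rfl⟩ := cls_surj f
    exact cls_eq (.add_zero s)
  add_comm f g := by
    obtain ⟨s, rfl⟩ := cls_surj f; obtain ⟨t, rfl⟩ := cls_surj g
    exact cls_eq (.add_comm s t)
  neg_add_cancel f := by
    obtain ⟨s, rfl⟩ := cls_surj f
    exact cls_eq ((Eqv.add_comm _ _).trans (.add_neg s))
  nsmul := nsmulRec
  zsmul := zsmulRec

instance (a b : List P.Ob) : Module ℂ (P.Hom a b) :=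
  Module.ofMinimalAxioms
    (fun z f g => by
      obtain ⟨s, rfl⟩ := cls_surj f; obtain ⟨t, rfl⟩ := cls_surj g
      exact cls_eq (.smul_add z s t))
    (fun z w f => by
      obtain ⟨s, rfl⟩ := cls_surj f
      exact cls_eq (.add_smul z w s))
    (fun z w f => by
      obtain ⟨s, rfl⟩ := cls_surj f
      exact cls_eq (.mul_smul z w s))
    (fun f => by
      obtain ⟨s, rfl⟩ := cls_surj f
      exact cls_eq (.one_smul s))

instance : Category P.Cat where
  Hom a b := P.Hom a.word b.word
  id a := cls (.id a.word)
  comp := Quotient.map₂ Term.comp fun _ _ h _ _ h' => Eqv.comp h h'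
  id_comp f := by
    obtain ⟨s, rfl⟩ := cls_surj f
    exact cls_eq (.id_comp s)
  comp_id f := by
    obtain ⟨s, rfl⟩ := cls_surj f
    exact cls_eq (.comp_id s)
  assoc f g h := by
    obtain ⟨s, rfl⟩ := cls_surj f; obtain ⟨t, rfl⟩ := cls_surj g; obtain ⟨r, rfl⟩ := cls_surj h
    exact cls_eq (.comp_assoc s t r)

instance (a b : P.Cat) : AddCommGroup (a ⟶ b) := inferInstanceAs (AddCommGroup (P.Hom a.word b.word))
instance (a b : P.Cat) : Module ℂ (a ⟶ b) := inferInstanceAs (Module ℂ (P.Hom a.word b.word))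

/-- The morphism that a term represents, in the presented category. -/
def mor {a b : List P.Ob} (t : Term P.Gen a b) : (⟨a⟩ : P.Cat) ⟶ ⟨b⟩ := cls t

section

variable {a b c d x y : List P.Ob}

theorem mor_eq {s t : Term P.Gen a b} (h : P.Eqv s t) : mor s = mor t := cls_eq h

theorem mor_exact {s t : Term P.Gen a b} (h : mor s = mor t) : P.Eqv s t := exact h

theorem mor_surj (f : (⟨a⟩ : P.Cat) ⟶ ⟨b⟩) : ∃ t, mor t = f := cls_surj f

theorem mor_zero : mor (.zero : Term P.Gen a b) = 0 := rfl

theorem mor_add (s t : Term P.Gen a b) : mor (s.add t) = mor s + mor t := rfl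

theorem mor_smul (z : ℂ) (t : Term P.Gen a b) : mor (t.smul z) = z • mor t := rfl

theorem mor_comp (s : Term P.Gen a b) (t : Term P.Gen b c) :
    mor (s.comp t) = mor s ≫ mor t := rfl

theorem mor_id (a : List P.Ob) : mor (.id a) = 𝟙 (⟨a⟩ : P.Cat) := rfl

end

instance : Preadditive P.Cat where
  add_comp a b c f g h := by
    obtain ⟨s, rfl⟩ := mor_surj f; obtain ⟨t, rfl⟩ := mor_surj g; obtain ⟨r, rfl⟩ := mor_surj h
    exact mor_eq (.add_comp s t r)
  comp_add a b c f g h := by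
    obtain ⟨s, rfl⟩ := mor_surj f; obtain ⟨t, rfl⟩ := mor_surj g; obtain ⟨r, rfl⟩ := mor_surj h
    exact mor_eq (.comp_add s t r)

instance : Linear ℂ P.Cat where
  smul_comp a b c z f g := by
    obtain ⟨s, rfl⟩ := mor_surj f; obtain ⟨t, rfl⟩ := mor_surj g
    exact mor_eq (.smul_comp z s t)
  comp_smul a b c f z g := by
    obtain ⟨s, rfl⟩ := mor_surj f; obtain ⟨t, rfl⟩ := mor_surj g
    exact mor_eq (.comp_smul z s t)

/-! #### The parity grading -/

/-- The space of morphisms represented by a term of parity `p`. -/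
def parityHom (a b : List P.Ob) (p : ZMod 2) : Submodule ℂ ((⟨a⟩ : P.Cat) ⟶ ⟨b⟩) where
  carrier := {f | ∃ t : Term P.Gen a b, t.HasParity P.par p ∧ mor t = f}
  zero_mem' := ⟨.zero, .zero p, rfl⟩
  add_mem' := by
    rintro _ _ ⟨s, hs, rfl⟩ ⟨t, ht, rfl⟩
    exact ⟨s.add t, .add hs ht, rfl⟩
  smul_mem' := by
    rintro z _ ⟨t, ht, rfl⟩
    exact ⟨t.smul z, .smul z ht, rfl⟩

/-- The sign `(-1)^p`. -/
def sgn (p : ZMod 2) : ℂ := (-1) ^ p.val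

theorem sgn_zero : sgn 0 = 1 := by simp [sgn]

theorem sgn_one : sgn 1 = -1 := by
  have h : (1 : ZMod 2).val = 1 := rfl
  simp [sgn, h]

theorem eq_zero_or_one : ∀ p : ZMod 2, p = 0 ∨ p = 1 := by decide

theorem one_add_one : (1 + 1 : ZMod 2) = 0 := rfl

theorem sgn_add (p q : ZMod 2) : sgn (p + q) = sgn p * sgn q := by
  rcases eq_zero_or_one p with rfl | rfl <;> rcases eq_zero_or_one q with rfl | rfl <;>
    simp [sgn_zero, sgn_one, one_add_one]

/-- The tensor product of morphisms, as a bilinear map. -/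
def tens {a b c d x y : List P.Ob} (hx : x = a ++ c) (hy : y = b ++ d) :
    ((⟨a⟩ : P.Cat) ⟶ ⟨b⟩) →ₗ[ℂ] ((⟨c⟩ : P.Cat) ⟶ ⟨d⟩) →ₗ[ℂ] ((⟨x⟩ : P.Cat) ⟶ ⟨y⟩) :=
  LinearMap.mk₂ ℂ
    (Quotient.map₂ (fun s t => Term.tensor s t hx hy) fun _ _ h _ _ h' => Eqv.tensor h h' hx hy)
    (fun f f' g => by
      obtain ⟨s, rfl⟩ := mor_surj f; obtain ⟨s', rfl⟩ := mor_surj f'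
      obtain ⟨t, rfl⟩ := mor_surj g
      exact mor_eq (.add_tensor s s' t hx hy))
    (fun z f g => by
      obtain ⟨s, rfl⟩ := mor_surj f; obtain ⟨t, rfl⟩ := mor_surj g
      exact mor_eq (.smul_tensor z s t hx hy))
    (fun f g g' => by
      obtain ⟨s, rfl⟩ := mor_surj f; obtain ⟨t, rfl⟩ := mor_surj g
      obtain ⟨t', rfl⟩ := mor_surj g'
      exact mor_eq (.tensor_add s t t' hx hy))
    (fun z f g => by
      obtain ⟨s, rfl⟩ := mor_surj f; obtain ⟨t, rfl⟩ := mor_surj g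
      exact mor_eq (.tensor_smul z s t hx hy))

theorem mor_tensor {a b c d x y : List P.Ob} (s : Term P.Gen a b)
    (t : Term P.Gen c d) (hx : x = a ++ c) (hy : y = b ++ d) :
    mor (s.tensor t hx hy) = tens hx hy (mor s) (mor t) := rfl

/-- The parity involution on terms. -/
def bar : ∀ {a b : List P.Ob}, Term P.Gen a b → Term P.Gen a b
  | _, _, .id a => .id a
  | _, _, .gen g => (Term.gen g).smul (sgn (P.par _ _ g))
  | _, _, .comp s t => (bar s).comp (bar t)
  | _, _, .tensor s t hx hy => (bar s).tensor (bar t) hx hy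
  | _, _, .zero => .zero
  | _, _, .add s t => (bar s).add (bar t)
  | _, _, .smul z t => (bar t).smul z

theorem bar_hasParity {a b : List P.Ob} {t : Term P.Gen a b} {p : ZMod 2}
    (h : t.HasParity P.par p) : (bar t).HasParity P.par p := by
  induction h with
  | id a => exact .id a
  | gen g => exact .smul _ (.gen g)
  | comp _ _ h h' => exact .comp h h'
  | tensor _ _ hx hy h h' => exact .tensor h h' hx hy
  | zero p => exact .zero p
  | add _ _ h h' => exact .add h h'
  | smul z _ h => exact .smul z h

theorem mor_bar {a b : List P.Ob} {t : Term P.Gen a b} {p : ZMod 2}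
    (h : t.HasParity P.par p) : mor (bar t) = sgn p • mor t := by
  induction h with
  | id a => rw [sgn_zero, one_smul]; rfl
  | gen g => rfl
  | comp _ _ h h' =>
    rw [bar, mor_comp, mor_comp, h, h', sgn_add, Linear.smul_comp, Linear.comp_smul, smul_smul]
  | tensor _ _ hx hy h h' =>
    rw [bar, mor_tensor, mor_tensor, h, h', sgn_add, LinearMap.map_smul, LinearMap.map_smul,
      LinearMap.smul_apply, smul_smul, mul_comm]
  | zero p => exact (smul_zero (sgn p)).symm
  | add _ _ h h' => rw [bar, mor_add, mor_add, h, h', smul_add]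
  | smul z _ h => rw [bar, mor_smul, mor_smul, h, smul_smul, smul_smul, mul_comm]

theorem bar_eqv {a b : List P.Ob} {s t : Term P.Gen a b} (h : P.Eqv s t) :
    P.Eqv (bar s) (bar t) := by
  induction h with
  | @rel a b s t h =>
    obtain ⟨p, hs, ht⟩ := P.rel_parity h
    refine mor_exact ?_
    rw [mor_bar hs, mor_bar ht, mor_eq (.rel h)]
  | refl s => exact .refl _
  | symm _ h => exact h.symm
  | trans _ _ h h' => exact h.trans h'
  | comp _ _ h h' => exact .comp h h'
  | tensor _ _ hx hy h h' => exact .tensor h h' hx hy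
  | add _ _ h h' => exact .add h h'
  | smul z _ h => exact .smul z h
  | add_comm s t => exact .add_comm _ _
  | add_assoc s t r => exact .add_assoc _ _ _
  | add_zero s => exact .add_zero _
  | add_neg s => exact .add_neg _
  | one_smul s => exact .one_smul _
  | mul_smul z w s => exact .mul_smul _ _ _
  | smul_add z s t => exact .smul_add _ _ _
  | add_smul z w s => exact .add_smul _ _ _
  | add_comp s s' t => exact .add_comp _ _ _
  | comp_add s t t' => exact .comp_add _ _ _
  | smul_comp z s t => exact .smul_comp _ _ _
  | comp_smul z s t => exact .comp_smul _ _ _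
  | add_tensor s s' t hx hy => exact .add_tensor _ _ _ _ _
  | tensor_add s t t' hx hy => exact .tensor_add _ _ _ _ _
  | smul_tensor z s t hx hy => exact .smul_tensor _ _ _ _ _
  | tensor_smul z s t hx hy => exact .tensor_smul _ _ _ _ _
  | id_comp s => exact .id_comp _
  | comp_id s => exact .comp_id _
  | comp_assoc s t r => exact .comp_assoc _ _ _
  | tensor_id hx hx' => exact .tensor_id hx hx'
  | interchange s t s' t' ht' hs hx hy hz =>
    exact .interchange _ _ _ _ (bar_hasParity ht') (bar_hasParity hs) hx hy hz
  | tensor_assoc s t r h₁ h₂ h₃ h₄ h₅ h₆ h₇ h₈ =>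
    exact .tensor_assoc _ _ _ h₁ h₂ h₃ h₄ h₅ h₆ h₇ h₈
  | unit_tensor s ha hb => exact .unit_tensor _ ha hb
  | tensor_unit s ha hb => exact .tensor_unit _ ha hb

theorem comp_parityHom {a b c : List P.Ob} {f : (⟨a⟩ : P.Cat) ⟶ ⟨b⟩} {g : (⟨b⟩ : P.Cat) ⟶ ⟨c⟩}
    {p q : ZMod 2} (hf : f ∈ parityHom a b p) (hg : g ∈ parityHom b c q) :
    f ≫ g ∈ parityHom a c (p + q) := by
  obtain ⟨s, hs, rfl⟩ := hf; obtain ⟨t, ht, rfl⟩ := hg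
  exact ⟨s.comp t, .comp hs ht, rfl⟩

theorem tens_parityHom {a b c d x y : List P.Ob} {f : (⟨a⟩ : P.Cat) ⟶ ⟨b⟩}
    {g : (⟨c⟩ : P.Cat) ⟶ ⟨d⟩} {p q : ZMod 2} (hx : x = a ++ c) (hy : y = b ++ d)
    (hf : f ∈ parityHom a b p) (hg : g ∈ parityHom c d q) :
    tens hx hy f g ∈ parityHom x y (p + q) := by
  obtain ⟨s, hs, rfl⟩ := hf; obtain ⟨t, ht, rfl⟩ := hg
  exact ⟨s.tensor t hx hy, .tensor hs ht hx hy, rfl⟩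

theorem exists_parts {a b : List P.Ob} (t : Term P.Gen a b) :
    ∃ f ∈ parityHom a b 0, ∃ g ∈ parityHom a b 1, mor t = f + g := by
  have h11 := one_add_one
  induction t with
  | id a => exact ⟨mor (.id a), ⟨_, .id a, rfl⟩, 0, Submodule.zero_mem _, (add_zero _).symm⟩
  | @gen a b g =>
    have key : ∀ q : ZMod 2, P.par a b g = q → mor (.gen g) ∈ parityHom a b q :=
      fun q hq => ⟨_, hq ▸ .gen g, rfl⟩
    rcases eq_zero_or_one (P.par _ _ g) with h | h
    · exact ⟨_, key 0 h, 0, Submodule.zero_mem _, (add_zero _).symm⟩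
    · exact ⟨0, Submodule.zero_mem _, _, key 1 h, (zero_add _).symm⟩
  | @comp a b c s t hs ht =>
    obtain ⟨f, hf, g, hg, e⟩ := hs
    obtain ⟨f', hf', g', hg', e'⟩ := ht
    refine ⟨f ≫ f' + g ≫ g', Submodule.add_mem _ (comp_parityHom hf hf') ?_, f ≫ g' + g ≫ f',
      Submodule.add_mem _ (comp_parityHom hf hg') (comp_parityHom hg hf'), ?_⟩
    · exact h11 ▸ comp_parityHom hg hg'
    · rw [mor_comp, e, e', Preadditive.add_comp, Preadditive.comp_add, Preadditive.comp_add]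
      abel
  | @tensor a b c d x y s t hx hy hs ht =>
    obtain ⟨f, hf, g, hg, e⟩ := hs
    obtain ⟨f', hf', g', hg', e'⟩ := ht
    refine ⟨tens hx hy f f' + tens hx hy g g',
      Submodule.add_mem _ (tens_parityHom hx hy hf hf') ?_,
      tens hx hy f g' + tens hx hy g f',
      Submodule.add_mem _ (tens_parityHom hx hy hf hg') (tens_parityHom hx hy hg hf'), ?_⟩
    · exact h11 ▸ tens_parityHom hx hy hg hg'
    · rw [mor_tensor, e, e', LinearMap.map_add₂, map_add, map_add]
      abel
  | zero => exact ⟨0, Submodule.zero_mem _, 0, Submodule.zero_mem _, (add_zero _).symm⟩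
  | add s t hs ht =>
    obtain ⟨f, hf, g, hg, e⟩ := hs
    obtain ⟨f', hf', g', hg', e'⟩ := ht
    refine ⟨f + f', Submodule.add_mem _ hf hf', g + g', Submodule.add_mem _ hg hg', ?_⟩
    rw [mor_add, e, e']; abel
  | smul z t ht =>
    obtain ⟨f, hf, g, hg, e⟩ := ht
    refine ⟨z • f, Submodule.smul_mem _ _ hf, z • g, Submodule.smul_mem _ _ hg, ?_⟩
    rw [mor_smul, e, smul_add]

theorem parityHom_internal (a b : List P.Ob) :
    DirectSum.IsInternal (parityHom (P := P) a b) := by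
  have hu : (Set.univ : Set (ZMod 2)) = {0, 1} :=
    (Set.eq_univ_of_forall fun p => eq_zero_or_one p).symm
  refine (DirectSum.isInternal_submodule_iff_isCompl (parityHom a b) (i := 0) (j := 1)
    (by decide) hu).2 ⟨?_, ?_⟩
  · rw [Submodule.disjoint_def]
    rintro f ⟨s, hs, rfl⟩ ⟨t, ht, e⟩
    have h1 : mor (bar s) = mor (bar t) := mor_eq (bar_eqv (mor_exact e.symm))
    rw [mor_bar hs, mor_bar ht, e, sgn_zero, sgn_one, one_smul, neg_one_smul] at h1
    have h3 : (2 : ℂ) • mor s = 0 := by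
      rw [two_smul]; exact add_eq_zero_iff_eq_neg.2 h1
    exact (smul_eq_zero.1 h3).resolve_left two_ne_zero
  · rw [codisjoint_iff, eq_top_iff]
    intro f _
    obtain ⟨t, rfl⟩ := mor_surj f
    obtain ⟨f, hf, g, hg, e⟩ := exists_parts t
    rw [e]
    exact Submodule.add_mem_sup hf hg

instance : Supercategory P.Cat where
  parity a b := parityHom a.word b.word
  parity_internal a b := parityHom_internal a.word b.word
  id_parity a := ⟨_, .id a.word, rfl⟩
  comp_parity := comp_parityHom

/-! #### The monoidal structure -/

section

variable {a b c d e f ac bd ce df x y z x' y' a' b' c' : List P.Ob}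

theorem tens_id (hx hx' : x = a ++ c) :
    tens hx hx' (𝟙 (⟨a⟩ : P.Cat)) (𝟙 (⟨c⟩ : P.Cat)) = 𝟙 (⟨x⟩ : P.Cat) := mor_eq (.tensor_id hx hx')

theorem tens_comp (f : (⟨a⟩ : P.Cat) ⟶ ⟨b⟩) (g : (⟨a'⟩ : P.Cat) ⟶ ⟨b'⟩) (f' : (⟨b⟩ : P.Cat) ⟶ ⟨c⟩)
    (g' : (⟨b'⟩ : P.Cat) ⟶ ⟨c'⟩) {p q : ZMod 2} (hg' : g' ∈ parityHom b' c' p)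
    (hf : f ∈ parityHom a b q) (hx : x = a ++ a') (hy : y = b ++ b') (hz : z = c ++ c') :
    tens hx hy f g ≫ tens hy hz f' g' = koszul p q • tens hx hz (f ≫ f') (g ≫ g') := by
  obtain ⟨s, hs, rfl⟩ := hf; obtain ⟨t', ht', rfl⟩ := hg'
  obtain ⟨s', rfl⟩ := mor_surj f'; obtain ⟨t, rfl⟩ := mor_surj g
  exact mor_eq (.interchange s t s' t' ht' hs hx hy hz)

theorem tens_assoc (s : (⟨a⟩ : P.Cat) ⟶ ⟨b⟩) (t : (⟨c⟩ : P.Cat) ⟶ ⟨d⟩)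
    (r : (⟨e⟩ : P.Cat) ⟶ ⟨f⟩) (h₁ : ac = a ++ c) (h₂ : bd = b ++ d) (h₃ : x = ac ++ e)
    (h₄ : y = bd ++ f) (h₅ : ce = c ++ e) (h₆ : df = d ++ f) (h₇ : x = a ++ ce)
    (h₈ : y = b ++ df) : tens h₃ h₄ (tens h₁ h₂ s t) r = tens h₇ h₈ s (tens h₅ h₆ t r) := by
  obtain ⟨s, rfl⟩ := mor_surj s; obtain ⟨t, rfl⟩ := mor_surj t; obtain ⟨r, rfl⟩ := mor_surj r
  exact mor_eq (.tensor_assoc s t r h₁ h₂ h₃ h₄ h₅ h₆ h₇ h₈)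

theorem unit_tens (f : (⟨a⟩ : P.Cat) ⟶ ⟨b⟩) (ha : a = [] ++ a) (hb : b = [] ++ b) :
    tens ha hb (𝟙 (⟨[]⟩ : P.Cat)) f = f := by
  obtain ⟨s, rfl⟩ := mor_surj f
  exact mor_eq (.unit_tensor s ha hb)

theorem tens_unit (f : (⟨a⟩ : P.Cat) ⟶ ⟨b⟩) (ha : a = a ++ []) (hb : b = b ++ []) :
    tens ha hb f (𝟙 (⟨[]⟩ : P.Cat)) = f := by
  obtain ⟨s, rfl⟩ := mor_surj f
  exact mor_eq (.tensor_unit s ha hb)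

/-- The identity, read as an isomorphism between two equal words. -/
def castIso (h : a = b) : (⟨a⟩ : P.Cat) ≅ ⟨b⟩ := eqToIso (congrArg Cat.mk h)

theorem castIso_parity (h : a = b) : (castIso (P := P) h).hom ∈ parityHom a b 0 := by
  subst h; exact ⟨_, .id a, rfl⟩

theorem castIso_refl (h : a = a) : (castIso (P := P) h).hom = 𝟙 (⟨a⟩ : P.Cat) := rfl

theorem castIso_trans (h : a = b) (h' : b = c) :
    (castIso (P := P) h).hom ≫ (castIso h').hom = (castIso (h.trans h')).hom := by
  subst h h'; simp [castIso_refl]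

theorem tens_cast (f : (⟨a⟩ : P.Cat) ⟶ ⟨b⟩) (g : (⟨c⟩ : P.Cat) ⟶ ⟨d⟩) (hx : x = a ++ c)
    (hy : y = b ++ d) (hx' : x' = a ++ c) (hy' : y' = b ++ d) (ex : x = x') (ey : y = y') :
    tens hx hy f g ≫ (castIso ey).hom = (castIso ex).hom ≫ tens hx' hy' f g := by
  subst ex ey; simp [castIso_refl]

theorem tens_castIso_id (h : a = a') (hx : x = a ++ c) (hx' : x' = a' ++ c) (e : x = x') :
    tens hx hx' (castIso h).hom (𝟙 (⟨c⟩ : P.Cat)) = (castIso e).hom := by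
  subst h e; simp [castIso_refl, tens_id]

theorem tens_id_castIso (h : c = c') (hx : x = a ++ c) (hx' : x' = a ++ c') (e : x = x') :
    tens hx hx' (𝟙 (⟨a⟩ : P.Cat)) (castIso h).hom = (castIso e).hom := by
  subst h e; simp [castIso_refl, tens_id]

end

instance : MonoidalSupercategory P.Cat where
  tensorObj a b := ⟨a.word ++ b.word⟩
  tensorUnit := ⟨[]⟩
  tensorHom := tens rfl rfl
  tensorHom_parity := tens_parityHom rfl rfl
  tensorHom_id _ _ := tens_id _ _
  interchange f g f' g' _ _ hg' hf := tens_comp f g f' g' hg' hf _ _ _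
  associator a b c := castIso (List.append_assoc a.word b.word c.word)
  leftUnitor a := castIso (List.nil_append a.word)
  rightUnitor a := castIso (List.append_nil a.word)
  associator_parity _ _ _ := castIso_parity _
  leftUnitor_parity _ := castIso_parity _
  rightUnitor_parity _ := castIso_parity _
  associator_naturality f g h := by
    rw [tens_assoc f g h rfl rfl rfl rfl rfl rfl (List.append_assoc _ _ _)
      (List.append_assoc _ _ _)]
    exact tens_cast _ _ _ _ _ _ _ _
  leftUnitor_naturality f :=
    (tens_cast _ _ _ _ rfl rfl _ _).trans (congrArg _ (unit_tens f _ _))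
  rightUnitor_naturality {a b} f :=
    (tens_cast _ _ _ _ (List.append_nil a.word).symm (List.append_nil b.word).symm _ _).trans
      (congrArg _ (tens_unit f _ _))
  pentagon a b c d := by
    rw [tens_castIso_id, tens_id_castIso, castIso_trans, castIso_trans, castIso_trans] <;>
      simp
  triangle a b := by
    rw [tens_castIso_id, tens_id_castIso, castIso_trans]
    simp

end Presentation

end QWeb

namespace QWeb

/-! ### Morphisms of presentations -/

/-- Replace the generators in a term by generators over another set of objects. -/
def Term.map {Ob Ob' : Type} {Gen : List Ob → List Ob → Type}
    {Gen' : List Ob' → List Ob' → Type} (f : Ob → Ob')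
    (g : ∀ {a b : List Ob}, Gen a b → Gen' (a.map f) (b.map f)) :
    ∀ {a b : List Ob}, Term Gen a b → Term Gen' (a.map f) (b.map f)
  | _, _, .id a => .id (a.map f)
  | _, _, .gen x => .gen (g x)
  | _, _, .comp s t => (Term.map f g s).comp (Term.map f g t)
  | _, _, .tensor s t hx hy => (Term.map f g s).tensor (Term.map f g t)
      (by rw [hx, List.map_append]) (by rw [hy, List.map_append])
  | _, _, .zero => .zero
  | _, _, .add s t => (Term.map f g s).add (Term.map f g t)
  | _, _, .smul z t => (Term.map f g t).smul z

theorem Term.HasParity.map {Ob Ob' : Type} {Gen : List Ob → List Ob → Type}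
    {Gen' : List Ob' → List Ob' → Type} (f : Ob → Ob')
    (g : ∀ {a b : List Ob}, Gen a b → Gen' (a.map f) (b.map f))
    {par : ∀ a b : List Ob, Gen a b → ZMod 2} {par' : ∀ a b : List Ob', Gen' a b → ZMod 2}
    (hg : ∀ {a b : List Ob} (x : Gen a b), par' _ _ (g x) = par a b x) {a b : List Ob}
    {t : Term Gen a b} {p : ZMod 2} (h : t.HasParity par p) : (t.map f g).HasParity par' p := by
  induction h with
  | id a => exact .id _
  | gen x => exact hg x ▸ .gen (g x)
  | comp _ _ h h' => exact .comp h h'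
  | tensor _ _ hx hy h h' => exact .tensor h h' _ _
  | zero p => exact .zero p
  | add _ _ h h' => exact .add h h'
  | smul z _ h => exact .smul z h

/-- A map of generators that preserves parities and the defining relations. -/
structure Presentation.Map (P Q : Presentation) where
  ob : P.Ob → Q.Ob
  gen : ∀ {a b : List P.Ob}, P.Gen a b → Q.Gen (a.map ob) (b.map ob)
  gen_par : ∀ {a b : List P.Ob} (x : P.Gen a b), Q.par _ _ (gen x) = P.par a b x
  rel : ∀ {a b : List P.Ob} {s t : Term P.Gen a b}, P.Rel s t →
    Q.Eqv (s.map ob gen) (t.map ob gen)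

namespace Presentation.Map

variable {P Q : Presentation} (F : P.Map Q)

theorem eqv {a b : List P.Ob} {s t : Term P.Gen a b} (h : P.Eqv s t) :
    Q.Eqv (s.map F.ob F.gen) (t.map F.ob F.gen) := by
  induction h with
  | rel h => exact F.rel h
  | refl s => exact .refl _
  | symm _ h => exact h.symm
  | trans _ _ h h' => exact h.trans h'
  | comp _ _ h h' => exact .comp h h'
  | tensor _ _ hx hy h h' => exact .tensor h h' _ _
  | add _ _ h h' => exact .add h h'
  | smul z _ h => exact .smul z h
  | add_comm s t => exact .add_comm _ _
  | add_assoc s t r => exact .add_assoc _ _ _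
  | add_zero s => exact .add_zero _
  | add_neg s => exact .add_neg _
  | one_smul s => exact .one_smul _
  | mul_smul z w s => exact .mul_smul _ _ _
  | smul_add z s t => exact .smul_add _ _ _
  | add_smul z w s => exact .add_smul _ _ _
  | add_comp s s' t => exact .add_comp _ _ _
  | comp_add s t t' => exact .comp_add _ _ _
  | smul_comp z s t => exact .smul_comp _ _ _
  | comp_smul z s t => exact .comp_smul _ _ _
  | add_tensor s s' t hx hy => exact .add_tensor _ _ _ _ _
  | tensor_add s t t' hx hy => exact .tensor_add _ _ _ _ _
  | smul_tensor z s t hx hy => exact .smul_tensor _ _ _ _ _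
  | tensor_smul z s t hx hy => exact .tensor_smul _ _ _ _ _
  | id_comp s => exact .id_comp _
  | comp_id s => exact .comp_id _
  | comp_assoc s t r => exact .comp_assoc _ _ _
  | tensor_id hx hx' => exact .tensor_id _ _
  | interchange s t s' t' ht' hs hx hy hz =>
    exact .interchange _ _ _ _ (ht'.map F.ob F.gen F.gen_par) (hs.map F.ob F.gen F.gen_par) _ _ _
  | tensor_assoc s t r h₁ h₂ h₃ h₄ h₅ h₆ h₇ h₈ =>
    exact .tensor_assoc _ _ _ _ _ _ _ _ _ _ _
  | unit_tensor s ha hb => exact .unit_tensor _ _ _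
  | tensor_unit s ha hb =>
    exact .tensor_unit _ (List.append_nil _).symm (List.append_nil _).symm

/-- The effect on morphisms. -/
def onHom {a b : List P.Ob} : ((⟨a⟩ : P.Cat) ⟶ ⟨b⟩) →
    ((⟨a.map F.ob⟩ : Q.Cat) ⟶ ⟨b.map F.ob⟩) :=
  Quotient.map (Term.map F.ob F.gen) fun _ _ h => F.eqv h

theorem onHom_mor {a b : List P.Ob} (t : Term P.Gen a b) :
    F.onHom (mor t) = mor (t.map F.ob F.gen) := rfl

theorem onHom_tens {a b c d x y : List P.Ob} (f : (⟨a⟩ : P.Cat) ⟶ ⟨b⟩)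
    (g : (⟨c⟩ : P.Cat) ⟶ ⟨d⟩) (hx : x = a ++ c) (hy : y = b ++ d) :
    F.onHom (tens hx hy f g) = tens (by rw [hx, List.map_append]) (by rw [hy, List.map_append])
      (F.onHom f) (F.onHom g) := by
  obtain ⟨s, rfl⟩ := mor_surj f; obtain ⟨t, rfl⟩ := mor_surj g
  rfl

theorem onHom_castIso {a b : List P.Ob} (h : a = b) :
    F.onHom (castIso h).hom = (castIso (P := Q) (congrArg (List.map F.ob) h)).hom := by
  subst h; rfl

/-- The monoidal superfunctor given by a map of presentations. -/
def functor : MonoidalSuperfunctor P.Cat Q.Cat where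
  obj a := ⟨a.word.map F.ob⟩
  map f := F.onHom f
  map_id _ := rfl
  map_comp f g := by
    obtain ⟨s, rfl⟩ := mor_surj f; obtain ⟨t, rfl⟩ := mor_surj g
    rfl
  map_add f g := by
    obtain ⟨s, rfl⟩ := mor_surj f; obtain ⟨t, rfl⟩ := mor_surj g
    rfl
  map_smul z f := by
    obtain ⟨s, rfl⟩ := mor_surj f
    rfl
  map_parity h := by
    obtain ⟨s, hs, rfl⟩ := h
    exact ⟨_, hs.map F.ob F.gen F.gen_par, rfl⟩
  tensorIso a b := castIso List.map_append.symm
  unitIso := castIso rfl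
  tensorIso_parity _ _ := castIso_parity _
  unitIso_parity := castIso_parity _
  tensorIso_naturality f g :=
    (tens_cast _ _ _ _ List.map_append List.map_append _ _).trans
      (congrArg _ (F.onHom_tens f g rfl rfl).symm)
  associativity a b c := by
    have e₁ : (a.word.map F.ob ++ b.word.map F.ob) ++ c.word.map F.ob =
      (a.word ++ b.word).map F.ob ++ c.word.map F.ob := by simp
    have e₂ : a.word.map F.ob ++ (b.word.map F.ob ++ c.word.map F.ob) =
      a.word.map F.ob ++ (b.word ++ c.word).map F.ob := by simp
    refine (congrArg₂ _ (tens_castIso_id (P := Q) _ rfl rfl e₁) (congrArg₂ _ rfl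
      (F.onHom_castIso _))).trans ?_
    refine Eq.trans ?_ (congrArg₂ _ rfl (congrArg₂ _ (tens_id_castIso (P := Q) _ rfl rfl e₂)
      rfl)).symm
    exact ((congrArg _ (castIso_trans _ _)).trans (castIso_trans _ _)).trans
      ((congrArg _ (castIso_trans _ _)).trans (castIso_trans _ _)).symm
  left_unitality a := by
    refine Eq.symm ((congrArg₂ _ (tens_castIso_id _ _ _ rfl) (congrArg₂ _ rfl
      (F.onHom_castIso _))).trans ?_)
    exact (congrArg _ (castIso_trans _ _)).trans (castIso_trans _ _)
  right_unitality a := by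
    refine Eq.symm ((congrArg₂ _ (tens_id_castIso _ _ _ rfl) (congrArg₂ _ rfl
      (F.onHom_castIso _))).trans ?_)
    exact (congrArg _ (castIso_trans _ _)).trans (castIso_trans _ _)

end Presentation.Map

end QWeb

/-! ### Upward webs of type Q -/

namespace QWeb

/-- Composition of terms, the left factor being at the bottom. -/
scoped infixr:75 " ⨟ " => Term.comp

/-- The identity on the word `a`, to the left of `t`. -/
def Term.idLeft {Ob : Type} {Gen : List Ob → List Ob → Type} (a : List Ob) {b c x y : List Ob}
    (t : Term Gen b c)
    (hx : x = a ++ b := by simp) (hy : y = a ++ c := by simp) : Term Gen x y :=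
  Term.tensor (Term.id a) t hx hy

/-- The identity on the word `a`, to the right of `t`. -/
def Term.idRight {Ob : Type} {Gen : List Ob → List Ob → Type} {b c x y : List Ob}
    (t : Term Gen b c) (a : List Ob)
    (hx : x = b ++ a := by simp) (hy : y = c ++ a := by simp) : Term Gen x y :=
  Term.tensor t (Term.id a) hx hy

/-- The generating upward webs: dots, merges and splits. The generating object `k` is the upward
strand of thickness `k`. -/
inductive UpGen : List ℕ+ → List ℕ+ → Type
  | dot (k : ℕ+) : UpGen [k] [k]
  | merge (k l m : ℕ+) (h : k + l = m) : UpGen [k, l] [m]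
  | split (k l m : ℕ+) (h : k + l = m) : UpGen [m] [k, l]

/-- Dots are odd, merges and splits are even. -/
def UpGen.par : ∀ a b : List ℕ+, UpGen a b → ZMod 2
  | _, _, .dot _ => 1
  | _, _, .merge _ _ _ _ => 0
  | _, _, .split _ _ _ _ => 0

/-- The upward strand of thickness `k`; it is omitted if `k = 0`. -/
def up : ℕ → List ℕ+
  | 0 => []
  | k + 1 => [k.succPNat]

/-- The dot on a strand of thickness `k`, which is zero if `k = 0`. -/
def dt : ∀ k : ℕ, Term UpGen (up k) (up k)
  | 0 => 0
  | k + 1 => .gen (.dot k.succPNat)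

/-- The merge of strands of thickness `k` and `l`, with strands of thickness zero omitted. -/
def mrg : ∀ (k l : ℕ) {m : ℕ} (_ : k + l = m), Term UpGen (up k ++ up l) (up m)
  | 0, _, _, h => .ofEq (by simp [up, ← h])
  | _ + 1, 0, _, h => .ofEq (by simp [up, ← h])
  | k + 1, l + 1, m + 1, h => .gen (.merge k.succPNat l.succPNat m.succPNat
      (PNat.eq (by simpa using h)))

/-- The split into strands of thickness `k` and `l`, with strands of thickness zero omitted. -/
def spl : ∀ (k l : ℕ) {m : ℕ} (_ : k + l = m), Term UpGen (up m) (up k ++ up l)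
  | 0, _, _, h => .ofEq (by simp [up, ← h])
  | _ + 1, 0, _, h => .ofEq (by simp [up, ← h])
  | k + 1, l + 1, m + 1, h => .gen (.split k.succPNat l.succPNat m.succPNat
      (PNat.eq (by simpa using h)))

/-- The ladder `(k, l + 1) → (k + 1, l)` whose rung has thickness one and carries `ρ`. -/
def ladE (ρ : Term UpGen (up 1) (up 1)) (k l : ℕ) :
    Term UpGen (up k ++ up (l + 1)) (up (k + 1) ++ up l) :=
  Term.idLeft (up k) (spl 1 l (Nat.add_comm 1 l) ⨟ Term.idRight ρ (up l) rfl rfl) ⨟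
    (Term.idRight (mrg k 1 rfl) (up l) :
      Term UpGen (up k ++ (up 1 ++ up l)) (up (k + 1) ++ up l))

/-- The ladder `(k + 1, l) → (k, l + 1)` whose rung has thickness one and carries `ρ`. -/
def ladF (ρ : Term UpGen (up 1) (up 1)) (k l : ℕ) :
    Term UpGen (up (k + 1) ++ up l) (up k ++ up (l + 1)) :=
  Term.idRight (spl k 1 rfl ⨟ Term.idLeft (up k) ρ rfl rfl) (up l) ⨟
    (Term.idLeft (up k) (mrg 1 l (Nat.add_comm 1 l)) :
      Term UpGen ((up k ++ up 1) ++ up l) (up k ++ up (l + 1)))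

/-- A rung from left to right, then a rung from right to left. -/
def ladFE (ρ σ : Term UpGen (up 1) (up 1)) : ∀ k l : ℕ, Term UpGen (up k ++ up l) (up k ++ up l)
  | 0, _ => 0
  | k + 1, l => ladF ρ k l ⨟ ladE σ k l

/-- A rung from right to left, then a rung from left to right. -/
def ladEF (ρ σ : Term UpGen (up 1) (up 1)) : ∀ k l : ℕ, Term UpGen (up k ++ up l) (up k ++ up l)
  | _, 0 => 0
  | k, l + 1 => ladE ρ k l ⨟ ladF σ k l

/-- `(h, k, l + 1) → (h, k + 1, l) → (h + 1, k, l)`; the left rung carries `σ`, the right rung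
carries `τ`. -/
def ladE2E1 (σ τ : Term UpGen (up 1) (up 1)) (h k l : ℕ) :
    Term UpGen (up h ++ up k ++ up (l + 1)) (up (h + 1) ++ up k ++ up l) :=
  Term.idLeft (up h) (ladE τ k l) ⨟
    (Term.idRight (ladE σ h k) (up l) :
      Term UpGen (up h ++ (up (k + 1) ++ up l)) (up (h + 1) ++ up k ++ up l))

/-- `(h, k, l + 1) → (h + 1, k - 1, l + 1) → (h + 1, k, l)`; the left rung carries `σ`, the right
rung carries `τ`. -/
def ladE1E2 (σ τ : Term UpGen (up 1) (up 1)) : ∀ h k l : ℕ,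
    Term UpGen (up h ++ up k ++ up (l + 1)) (up (h + 1) ++ up k ++ up l)
  | _, 0, _ => 0
  | h, k + 1, l => Term.idRight (ladE σ h k) (up (l + 1)) ⨟
    (Term.idLeft (up (h + 1)) (ladE τ k l) :
      Term UpGen (up (h + 1) ++ up k ++ up (l + 1)) (up (h + 1) ++ up (k + 1) ++ up l))

/-- `(h + 1, k, l) → (h, k + 1, l) → (h, k, l + 1)`; the left rung carries `σ`, the right rung
carries `τ`. -/
def ladF1F2 (σ τ : Term UpGen (up 1) (up 1)) (h k l : ℕ) :
    Term UpGen (up (h + 1) ++ up k ++ up l) (up h ++ up k ++ up (l + 1)) :=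
  Term.idRight (ladF σ h k) (up l) ⨟
    (Term.idLeft (up h) (ladF τ k l) :
      Term UpGen (up h ++ up (k + 1) ++ up l) (up h ++ up k ++ up (l + 1)))

/-- `(h + 1, k, l) → (h + 1, k - 1, l + 1) → (h, k, l + 1)`; the left rung carries `σ`, the right
rung carries `τ`. -/
def ladF2F1 (σ τ : Term UpGen (up 1) (up 1)) : ∀ h k l : ℕ,
    Term UpGen (up (h + 1) ++ up k ++ up l) (up h ++ up k ++ up (l + 1))
  | _, 0, _ => 0
  | h, k + 1, l => Term.idLeft (up (h + 1)) (ladF τ k l) ⨟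
    (Term.idRight (ladF σ h k) (up (l + 1)) :
      Term UpGen (up (h + 1) ++ (up k ++ up (l + 1))) (up h ++ up (k + 1) ++ up (l + 1)))

/-- A plain rung. -/
abbrev plain : Term UpGen (up 1) (up 1) := .id (up 1)

/-- On two strands of thickness one: a merge followed by a split. -/
def dumbbell : Term UpGen (up 1 ++ up 1) (up 1 ++ up 1) := mrg 1 1 rfl ⨟ spl 1 1 rfl

/-- The defining relations between upward webs. -/
inductive UpRel : ∀ {a b : List ℕ+}, Term UpGen a b → Term UpGen a b → Prop
  | merge_assoc (h k l : ℕ) : UpRel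
      ((Term.idRight (mrg h k rfl) (up l) :
        Term UpGen (up h ++ up k ++ up l) (up (h + k) ++ up l)) ⨟ mrg (h + k) l rfl)
      ((Term.idLeft (up h) (mrg k l rfl) :
        Term UpGen (up h ++ up k ++ up l) (up h ++ up (k + l))) ⨟
          mrg h (k + l) (Nat.add_assoc h k l).symm)
  | split_assoc (h k l : ℕ) : UpRel
      (spl (h + k) l rfl ⨟ (Term.idRight (spl h k rfl) (up l) :
        Term UpGen (up (h + k) ++ up l) (up h ++ up k ++ up l)))
      (spl h (k + l) (Nat.add_assoc h k l).symm ⨟ (Term.idLeft (up h) (spl k l rfl) :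
        Term UpGen (up h ++ up (k + l)) (up h ++ up k ++ up l)))
  | digon (k l : ℕ) : UpRel (spl k l rfl ⨟ mrg k l rfl)
      (((k + l).choose l : ℂ) • Term.id (up (k + l)))
  | dot_dot (k : ℕ) : UpRel (dt k ⨟ dt k) ((k : ℂ) • Term.id (up k))
  | dot_merge (k l : ℕ) : UpRel (mrg k l rfl ⨟ dt (k + l))
      (Term.idRight (dt k) (up l) ⨟ mrg k l rfl + Term.idLeft (up k) (dt l) ⨟ mrg k l rfl)
  | dot_split (k l : ℕ) : UpRel (dt (k + l) ⨟ spl k l rfl)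
      (spl k l rfl ⨟ Term.idRight (dt k) (up l) + spl k l rfl ⨟ Term.idLeft (up k) (dt l))
  | dumbbell : UpRel dumbbell
      ((2 : ℂ) • Term.id (up 1 ++ up 1) +
        (dt 1).tens (dt 1) ⨟ dumbbell ⨟ (dt 1).tens (dt 1))
  | square_switch (k l : ℕ) : UpRel (ladFE plain plain k l - ladEF plain plain k l)
      (((k : ℂ) - (l : ℂ)) • Term.id (up k ++ up l))
  | square_switch_dot (k l : ℕ) : UpRel (ladFE plain (dt 1) k l - ladEF (dt 1) plain k l)
      (Term.idRight (dt k) (up l) - Term.idLeft (up k) (dt l))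
  | square_switch_dot' (k l : ℕ) : UpRel (ladFE (dt 1) plain k l - ladEF plain (dt 1) k l)
      (Term.idRight (dt k) (up l) - Term.idLeft (up k) (dt l))
  | double_rungs (h k l : ℕ) : UpRel
      (ladE2E1 plain plain h k l - ladE1E2 plain plain h k l)
      (ladE2E1 (dt 1) (dt 1) h k l + ladE1E2 (dt 1) (dt 1) h k l)
  | double_rungs_dot (h k l : ℕ) : UpRel
      (ladE2E1 plain (dt 1) h k l - ladE1E2 plain (dt 1) h k l)
      (ladE2E1 (dt 1) plain h k l - ladE1E2 (dt 1) plain h k l)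
  | double_rungs' (h k l : ℕ) : UpRel
      (ladF1F2 plain plain h k l - ladF2F1 plain plain h k l)
      (ladF1F2 (dt 1) (dt 1) h k l + ladF2F1 (dt 1) (dt 1) h k l)
  | double_rungs_dot' (h k l : ℕ) : UpRel
      (ladF1F2 plain (dt 1) h k l - ladF2F1 plain (dt 1) h k l)
      (ladF1F2 (dt 1) plain h k l - ladF2F1 (dt 1) plain h k l)

/-! #### The relations are homogeneous -/

section Homogeneity

variable {Ob : Type} {Gen : List Ob → List Ob → Type} {par : ∀ a b : List Ob, Gen a b → ZMod 2}
  {a b c d x y : List Ob} {p q : ZMod 2}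

theorem Term.HasParity.ofEq (h : a = b) : (Term.ofEq h : Term Gen a b).HasParity par 0 := by
  subst h; exact .id a

theorem Term.HasParity.cast {t : Term Gen a b} (h : t.HasParity par p) (e : p = q) : t.HasParity par q :=
  e ▸ h

theorem Term.HasParity.comp_even {s : Term Gen a b} {t : Term Gen b c} (hs : s.HasParity par p)
    (ht : t.HasParity par 0) : (s ⨟ t).HasParity par p := (hs.comp ht).cast (add_zero p)

theorem Term.HasParity.even_comp {s : Term Gen a b} {t : Term Gen b c} (hs : s.HasParity par 0)
    (ht : t.HasParity par p) : (s ⨟ t).HasParity par p := (hs.comp ht).cast (zero_add p)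

theorem Term.HasParity.idLeft {t : Term Gen b c} (ht : t.HasParity par p) (hx : x = a ++ b)
    (hy : y = a ++ c) : (Term.idLeft a t hx hy).HasParity par p :=
  (Term.HasParity.tensor (.id a) ht hx hy).cast (zero_add p)

theorem Term.HasParity.idRight {t : Term Gen b c} (ht : t.HasParity par p) (hx : x = b ++ a)
    (hy : y = c ++ a) : (Term.idRight t a hx hy).HasParity par p :=
  (Term.HasParity.tensor ht (.id a) hx hy).cast (add_zero p)

theorem Term.HasParity.sub {s t : Term Gen a b} (hs : s.HasParity par p) (ht : t.HasParity par p) :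
    (s - t).HasParity par p := hs.add (ht.smul (-1))

theorem dt_parity : ∀ k : ℕ, (dt k).HasParity UpGen.par 1
  | 0 => .zero 1
  | _ + 1 => .gen (UpGen.dot _)

theorem mrg_parity : ∀ (k l : ℕ) {m : ℕ} (h : k + l = m), (mrg k l h).HasParity UpGen.par 0
  | 0, _, _, _ => .ofEq _
  | _ + 1, 0, _, _ => .ofEq _
  | _ + 1, _ + 1, _ + 1, _ => .gen (UpGen.merge _ _ _ _)

theorem spl_parity : ∀ (k l : ℕ) {m : ℕ} (h : k + l = m), (spl k l h).HasParity UpGen.par 0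
  | 0, _, _, _ => .ofEq _
  | _ + 1, 0, _, _ => .ofEq _
  | _ + 1, _ + 1, _ + 1, _ => .gen (UpGen.split _ _ _ _)

variable {ρ σ τ : Term UpGen (up 1) (up 1)}

theorem ladE_parity (hρ : ρ.HasParity UpGen.par p) (k l : ℕ) : (ladE ρ k l).HasParity UpGen.par p :=
  .comp_even (.idLeft (.even_comp (spl_parity _ _ _) (.idRight hρ _ _)) _ _)
    (.idRight (mrg_parity _ _ _) _ _)

theorem ladF_parity (hρ : ρ.HasParity UpGen.par p) (k l : ℕ) : (ladF ρ k l).HasParity UpGen.par p :=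
  .comp_even (.idRight (.even_comp (spl_parity _ _ _) (.idLeft hρ _ _)) _ _)
    (.idLeft (mrg_parity _ _ _) _ _)

theorem ladFE_parity (hρ : ρ.HasParity UpGen.par p) (hσ : σ.HasParity UpGen.par q) :
    ∀ k l : ℕ, (ladFE ρ σ k l).HasParity UpGen.par (p + q)
  | 0, _ => .zero _
  | k + 1, l => .comp (ladF_parity hρ k l) (ladE_parity hσ k l)

theorem ladEF_parity (hρ : ρ.HasParity UpGen.par p) (hσ : σ.HasParity UpGen.par q) :
    ∀ k l : ℕ, (ladEF ρ σ k l).HasParity UpGen.par (p + q)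
  | _, 0 => .zero _
  | k, l + 1 => .comp (ladE_parity hρ k l) (ladF_parity hσ k l)

theorem ladE2E1_parity (hσ : σ.HasParity UpGen.par p) (hτ : τ.HasParity UpGen.par q) (h k l : ℕ) :
    (ladE2E1 σ τ h k l).HasParity UpGen.par (q + p) :=
  .comp (.idLeft (ladE_parity hτ k l) _ _) (.idRight (ladE_parity hσ h k) _ _)

theorem ladE1E2_parity (hσ : σ.HasParity UpGen.par p) (hτ : τ.HasParity UpGen.par q) :
    ∀ h k l : ℕ, (ladE1E2 σ τ h k l).HasParity UpGen.par (p + q)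
  | _, 0, _ => .zero _
  | h, k + 1, l => .comp (.idRight (ladE_parity hσ h k) _ _) (.idLeft (ladE_parity hτ k l) _ _)

theorem ladF1F2_parity (hσ : σ.HasParity UpGen.par p) (hτ : τ.HasParity UpGen.par q) (h k l : ℕ) :
    (ladF1F2 σ τ h k l).HasParity UpGen.par (p + q) :=
  .comp (.idRight (ladF_parity hσ h k) _ _) (.idLeft (ladF_parity hτ k l) _ _)

theorem ladF2F1_parity (hσ : σ.HasParity UpGen.par p) (hτ : τ.HasParity UpGen.par q) :
    ∀ h k l : ℕ, (ladF2F1 σ τ h k l).HasParity UpGen.par (q + p)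
  | _, 0, _ => .zero _
  | h, k + 1, l => .comp (.idLeft (ladF_parity hτ k l) _ _) (.idRight (ladF_parity hσ h k) _ _)

theorem dumbbell_parity : dumbbell.HasParity UpGen.par 0 :=
  .comp_even (mrg_parity _ _ _) (spl_parity _ _ _)

theorem UpRel.parity {a b : List ℕ+} {s t : Term UpGen a b} (h : UpRel s t) :
    ∃ p, s.HasParity UpGen.par p ∧ t.HasParity UpGen.par p := by
  have hp : plain.HasParity UpGen.par 0 := .id (up 1)
  have hd := dt_parity 1
  cases h with
  | merge_assoc h k l =>
    exact ⟨0, .comp_even (.idRight (mrg_parity _ _ _) _ _) (mrg_parity _ _ _),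
      .comp_even (.idLeft (mrg_parity _ _ _) _ _) (mrg_parity _ _ _)⟩
  | split_assoc h k l =>
    exact ⟨0, .comp_even (spl_parity _ _ _) (.idRight (spl_parity _ _ _) _ _),
      .comp_even (spl_parity _ _ _) (.idLeft (spl_parity _ _ _) _ _)⟩
  | digon k l => exact ⟨0, .comp_even (spl_parity _ _ _) (mrg_parity _ _ _), .smul _ (.id _)⟩
  | dot_dot k => exact ⟨0, .comp (dt_parity k) (dt_parity k), .smul _ (.id _)⟩
  | dot_merge k l =>
    exact ⟨1, .even_comp (mrg_parity _ _ _) (dt_parity _),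
      .add (.comp_even (.idRight (dt_parity k) _ _) (mrg_parity _ _ _))
        (.comp_even (.idLeft (dt_parity l) _ _) (mrg_parity _ _ _))⟩
  | dot_split k l =>
    exact ⟨1, .comp_even (dt_parity _) (spl_parity _ _ _),
      .add (.even_comp (spl_parity _ _ _) (.idRight (dt_parity k) _ _))
        (.even_comp (spl_parity _ _ _) (.idLeft (dt_parity l) _ _))⟩
  | dumbbell =>
    have hdd : ((dt 1).tens (dt 1)).HasParity UpGen.par 0 := .tensor hd hd _ _
    exact ⟨0, dumbbell_parity,
      .add (.smul _ (.id _)) (.even_comp hdd (.even_comp dumbbell_parity hdd))⟩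
  | square_switch k l =>
    exact ⟨0, .sub (ladFE_parity hp hp k l) (ladEF_parity hp hp k l), .smul _ (.id _)⟩
  | square_switch_dot k l =>
    exact ⟨1, .sub (ladFE_parity hp hd k l) (ladEF_parity hd hp k l),
      .sub (.idRight (dt_parity k) _ _) (.idLeft (dt_parity l) _ _)⟩
  | square_switch_dot' k l =>
    exact ⟨1, .sub (ladFE_parity hd hp k l) (ladEF_parity hp hd k l),
      .sub (.idRight (dt_parity k) _ _) (.idLeft (dt_parity l) _ _)⟩
  | double_rungs h k l =>
    exact ⟨0, .sub (ladE2E1_parity hp hp h k l) (ladE1E2_parity hp hp h k l),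
      .add (ladE2E1_parity hd hd h k l) (ladE1E2_parity hd hd h k l)⟩
  | double_rungs_dot h k l =>
    exact ⟨1, .sub (ladE2E1_parity hp hd h k l) (ladE1E2_parity hp hd h k l),
      .sub (ladE2E1_parity hd hp h k l) (ladE1E2_parity hd hp h k l)⟩
  | double_rungs' h k l =>
    exact ⟨0, .sub (ladF1F2_parity hp hp h k l) (ladF2F1_parity hp hp h k l),
      .add (ladF1F2_parity hd hd h k l) (ladF2F1_parity hd hd h k l)⟩
  | double_rungs_dot' h k l =>
    exact ⟨1, .sub (ladF1F2_parity hp hd h k l) (ladF2F1_parity hp hd h k l),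
      .sub (ladF1F2_parity hd hp h k l) (ladF2F1_parity hd hp h k l)⟩

end Homogeneity

/-- The presentation of the category of upward webs. -/
def upPres : Presentation where
  Ob := ℕ+
  Gen := UpGen
  par := UpGen.par
  Rel := UpRel
  rel_parity := UpRel.parity

/-- The monoidal supercategory of upward webs of type Q. -/
abbrev WebUp : Type := upPres.Cat

/-! #### Crossings of upward strands -/

/-- `k` upward strands of thickness one. -/
def ones : ℕ → List ℕ+
  | 0 => []
  | k + 1 => up 1 ++ ones k

/-- Split a strand of thickness `k` into `k` strands of thickness one. -/
def explode : ∀ k : ℕ, Term UpGen (up k) (ones k)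
  | 0 => .id []
  | k + 1 => spl 1 k (Nat.add_comm 1 k) ⨟ Term.idLeft (up 1) (explode k) rfl rfl

/-- Merge `k` strands of thickness one into a strand of thickness `k`. -/
def implode : ∀ k : ℕ, Term UpGen (ones k) (up k)
  | 0 => .id []
  | k + 1 => Term.idLeft (up 1) (implode k) rfl rfl ⨟ mrg 1 k (Nat.add_comm 1 k)

/-- The crossing of two upward strands of thickness one. -/
def thinCross : Term UpGen (up 1 ++ up 1) (up 1 ++ up 1) := dumbbell - .id (up 1 ++ up 1)

/-- One strand of thickness one crosses `l` strands of thickness one. -/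
def thinPass : ∀ l : ℕ, Term UpGen (up 1 ++ ones l) (ones l ++ up 1)
  | 0 => .ofEq (by simp [ones])
  | l + 1 => Term.idRight (x := up 1 ++ ones (l + 1)) thinCross (ones l) rfl rfl ⨟
      Term.idLeft (up 1) (thinPass l) rfl rfl

/-- `k` strands of thickness one cross `l` strands of thickness one. -/
def thinGrid : ∀ k l : ℕ, Term UpGen (ones k ++ ones l) (ones l ++ ones k)
  | 0, _ => .ofEq (by simp [ones])
  | k + 1, l => Term.idLeft (up 1) (thinGrid k l) rfl rfl ⨟
      Term.idRight (thinPass l) (ones k) rfl (by simp [ones])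

theorem up_coe (k : ℕ+) : up k = [k] := by
  obtain ⟨n, rfl⟩ : ∃ n : ℕ, k = n.succPNat := ⟨k.natPred, (PNat.succPNat_natPred k).symm⟩
  rfl

/-- The crossing of two upward strands of arbitrary thickness. -/
noncomputable def thickCross (k l : ℕ+) : Term UpGen [k, l] [l, k] :=
  (1 / ((Nat.factorial k : ℂ) * (Nat.factorial l : ℂ))) •
    (Term.tensor (explode k) (explode l) (by simp [up_coe]) rfl ⨟
      thinGrid k l ⨟ Term.tensor (implode l) (implode k) rfl (by simp [up_coe]))

/-- One strand crosses the strands in a word, given the crossings of pairs of strands. -/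
def passWord {Ob : Type} {Gen : List Ob → List Ob → Type}
    (X : ∀ x y : Ob, Term Gen [x, y] [y, x]) (x : Ob) :
    ∀ b : List Ob, Term Gen (x :: b) (b ++ [x])
  | [] => .id [x]
  | y :: b => Term.idRight (X x y) b rfl rfl ⨟ Term.idLeft [y] (passWord X x b) rfl rfl

/-- The strands in one word cross the strands in another word, given the crossings of pairs of
strands. -/
def crossWords {Ob : Type} {Gen : List Ob → List Ob → Type}
    (X : ∀ x y : Ob, Term Gen [x, y] [y, x]) :
    ∀ a b : List Ob, Term Gen (a ++ b) (b ++ a)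
  | [], b => .ofEq (List.append_nil b).symm
  | x :: a, b => Term.idLeft [x] (crossWords X a b) rfl rfl ⨟
      Term.idRight (x := [x] ++ (b ++ a)) (passWord X x b) a rfl (by simp)

open MonoidalSupercategory

/-- The braiding on upward webs. -/
noncomputable def upBraiding (a b : WebUp) : tensorObj a b ⟶ tensorObj b a :=
  Presentation.mor (P := upPres) (crossWords thickCross a.word b.word)

end QWeb

/-! ### Oriented webs of type Q -/

namespace QWeb

/-- The generating objects for oriented webs: upward and downward strands. -/
inductive OrOb : Type
  | up (k : ℕ+)
  | down (k : ℕ+)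

/-- The generating oriented webs: (upward) dots, merges and splits, (leftward) cups and caps, and
the rightward crossings, which are formal inverses of the leftward crossings. -/
inductive OrGen : List OrOb → List OrOb → Type
  | dot (k : ℕ+) : OrGen [.up k] [.up k]
  | merge (k l m : ℕ+) (h : k + l = m) : OrGen [.up k, .up l] [.up m]
  | split (k l m : ℕ+) (h : k + l = m) : OrGen [.up m] [.up k, .up l]
  | cup (k : ℕ+) : OrGen [] [.up k, .down k]
  | cap (k : ℕ+) : OrGen [.down k, .up k] []
  | rightCross (k l : ℕ+) : OrGen [.up k, .down l] [.down l, .up k]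

/-- Dots are odd, all other generators are even. -/
def OrGen.par : ∀ a b : List OrOb, OrGen a b → ZMod 2
  | _, _, .dot _ => 1
  | _, _, .merge _ _ _ _ => 0
  | _, _, .split _ _ _ _ => 0
  | _, _, .cup _ => 0
  | _, _, .cap _ => 0
  | _, _, .rightCross _ _ => 0

/-- The oriented generator of the same name. -/
def UpGen.toOr : ∀ {a b : List ℕ+}, UpGen a b → OrGen (a.map OrOb.up) (b.map OrOb.up)
  | _, _, .dot k => .dot k
  | _, _, .merge k l m h => .merge k l m h
  | _, _, .split k l m h => .split k l m h

theorem UpGen.toOr_par {a b : List ℕ+} (g : UpGen a b) :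
    OrGen.par _ _ g.toOr = UpGen.par a b g := by
  cases g <;> rfl

/-- An upward web, read as an oriented web. -/
def toOr {a b : List ℕ+} (t : Term UpGen a b) :
    Term OrGen (a.map OrOb.up) (b.map OrOb.up) := t.map OrOb.up UpGen.toOr

/-- The leftward cup. -/
def cup (k : ℕ+) : Term OrGen [] [.up k, .down k] := .gen (.cup k)

/-- The leftward cap. -/
def cap (k : ℕ+) : Term OrGen [.down k, .up k] [] := .gen (.cap k)

/-- The crossing of two upward strands. -/
noncomputable def upCross (k l : ℕ+) : Term OrGen [.up k, .up l] [.up l, .up k] :=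
  toOr (thickCross k l)

/-- The leftward crossing. -/
noncomputable def leftCross (k l : ℕ+) : Term OrGen [.down k, .up l] [.up l, .down k] :=
  (Term.idLeft [.down k, .up l] (cup k) rfl rfl :
      Term OrGen [.down k, .up l] [.down k, .up l, .up k, .down k]) ⨟
    (Term.idLeft [.down k] (Term.idRight (upCross l k) [.down k] rfl rfl) rfl rfl :
      Term OrGen [.down k, .up l, .up k, .down k] [.down k, .up k, .up l, .down k]) ⨟
    Term.idRight (cap k) [.up l, .down k] rfl rfl

/-- The rightward crossing. -/
def rightCross (k l : ℕ+) : Term OrGen [.up k, .down l] [.down l, .up k] :=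
  .gen (.rightCross k l)

/-- The crossing of two downward strands. -/
noncomputable def downCross (k l : ℕ+) : Term OrGen [.down k, .down l] [.down l, .down k] :=
  (Term.idLeft [.down k, .down l] (cup k) rfl rfl :
      Term OrGen [.down k, .down l] [.down k, .down l, .up k, .down k]) ⨟
    (Term.idLeft [.down k, .down l, .up k] (Term.idRight (cup l) [.down k] rfl rfl) rfl rfl :
      Term OrGen [.down k, .down l, .up k, .down k]
        [.down k, .down l, .up k, .up l, .down l, .down k]) ⨟
    (Term.idLeft [.down k, .down l] (Term.idRight (upCross k l) [.down l, .down k] rfl rfl)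
      rfl rfl : Term OrGen [.down k, .down l, .up k, .up l, .down l, .down k]
        [.down k, .down l, .up l, .up k, .down l, .down k]) ⨟
    (Term.idLeft [.down k] (Term.idRight (cap l) [.up k, .down l, .down k] rfl rfl) rfl rfl :
      Term OrGen [.down k, .down l, .up l, .up k, .down l, .down k]
        [.down k, .up k, .down l, .down k]) ⨟
    Term.idRight (cap k) [.down l, .down k] rfl rfl

/-- The crossing of two strands with arbitrary orientations. -/
noncomputable def orCross : ∀ x y : OrOb, Term OrGen [x, y] [y, x]
  | .up k, .up l => upCross k l
  | .down k, .up l => leftCross k l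
  | .up k, .down l => rightCross k l
  | .down k, .down l => downCross k l

/-- The defining relations between oriented webs. -/
inductive OrRel : ∀ {a b : List OrOb}, Term OrGen a b → Term OrGen a b → Prop
  | upward {a b : List ℕ+} {s t : Term UpGen a b} (h : UpRel s t) : OrRel (toOr s) (toOr t)
  | zigzag_up (k : ℕ+) : OrRel
      ((Term.idRight (cup k) [.up k] rfl rfl : Term OrGen [.up k] [.up k, .down k, .up k]) ⨟
        (Term.idLeft [.up k] (cap k) rfl rfl : Term OrGen [.up k, .down k, .up k] [.up k]))
      (.id [OrOb.up k])
  | zigzag_down (k : ℕ+) : OrRel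
      ((Term.idLeft [.down k] (cup k) rfl rfl : Term OrGen [.down k] [.down k, .up k, .down k]) ⨟
        Term.idRight (cap k) [.down k] rfl rfl) (.id [OrOb.down k])
  | left_right (k l : ℕ+) : OrRel (leftCross k l ⨟ rightCross l k) (.id [OrOb.down k, OrOb.up l])
  | right_left (k l : ℕ+) : OrRel (rightCross l k ⨟ leftCross k l) (.id [OrOb.up l, OrOb.down k])
  | delete_bubble (k : ℕ+) : OrRel
      (cup k ⨟ rightCross k k ⨟ (Term.idLeft [.down k] (.gen (.dot k)) rfl rfl :
        Term OrGen [.down k, .up k] [.down k, .up k]) ⨟ cap k) 0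

/-! #### The relations are homogeneous -/

theorem explode_parity : ∀ k : ℕ, (explode k).HasParity UpGen.par 0
  | 0 => .id _
  | k + 1 => .comp_even (spl_parity _ _ _) (.idLeft (explode_parity k) _ _)

theorem implode_parity : ∀ k : ℕ, (implode k).HasParity UpGen.par 0
  | 0 => .id _
  | k + 1 => .comp_even (.idLeft (implode_parity k) _ _) (mrg_parity _ _ _)

theorem thinCross_parity : thinCross.HasParity UpGen.par 0 := .sub dumbbell_parity (.id _)

theorem thinPass_parity : ∀ l : ℕ, (thinPass l).HasParity UpGen.par 0
  | 0 => .ofEq _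
  | l + 1 => .comp_even (.idRight thinCross_parity _ _) (.idLeft (thinPass_parity l) _ _)

theorem thinGrid_parity : ∀ k l : ℕ, (thinGrid k l).HasParity UpGen.par 0
  | 0, _ => .ofEq _
  | k + 1, l => .comp_even (.idLeft (thinGrid_parity k l) _ _) (.idRight (thinPass_parity l) _ _)

theorem thickCross_parity (k l : ℕ+) : (thickCross k l).HasParity UpGen.par 0 :=
  .smul _ (.comp_even (.tensor (explode_parity k) (explode_parity l) _ _)
    (.comp_even (thinGrid_parity k l) (.tensor (implode_parity l) (implode_parity k) _ _)))

theorem toOr_parity {a b : List ℕ+} {t : Term UpGen a b} {p : ZMod 2}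
    (h : t.HasParity UpGen.par p) : (toOr t).HasParity OrGen.par p :=
  h.map OrOb.up UpGen.toOr UpGen.toOr_par

theorem cup_parity (k : ℕ+) : (cup k).HasParity OrGen.par 0 := .gen _

theorem cap_parity (k : ℕ+) : (cap k).HasParity OrGen.par 0 := .gen _

theorem rightCross_parity (k l : ℕ+) : (rightCross k l).HasParity OrGen.par 0 := .gen _

theorem upCross_parity (k l : ℕ+) : (upCross k l).HasParity OrGen.par 0 :=
  toOr_parity (thickCross_parity k l)

theorem leftCross_parity (k l : ℕ+) : (leftCross k l).HasParity OrGen.par 0 :=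
  .comp_even (.idLeft (cup_parity k) _ _)
    (.comp_even (.idLeft (.idRight (upCross_parity l k) _ _) _ _) (.idRight (cap_parity k) _ _))

theorem OrRel.parity {a b : List OrOb} {s t : Term OrGen a b} (h : OrRel s t) :
    ∃ p, s.HasParity OrGen.par p ∧ t.HasParity OrGen.par p := by
  cases h with
  | upward h =>
    obtain ⟨p, hs, ht⟩ := h.parity
    exact ⟨p, toOr_parity hs, toOr_parity ht⟩
  | zigzag_up k =>
    exact ⟨0, .comp_even (.idRight (cup_parity k) _ _) (.idLeft (cap_parity k) _ _), .id _⟩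
  | zigzag_down k =>
    exact ⟨0, .comp_even (.idLeft (cup_parity k) _ _) (.idRight (cap_parity k) _ _), .id _⟩
  | left_right k l =>
    exact ⟨0, .comp_even (leftCross_parity k l) (rightCross_parity l k), .id _⟩
  | right_left k l =>
    exact ⟨0, .comp_even (rightCross_parity l k) (leftCross_parity k l), .id _⟩
  | delete_bubble k =>
    exact ⟨1, .even_comp (cup_parity k) (.even_comp (rightCross_parity k k)
      (.comp_even (.idLeft (.gen (OrGen.dot k)) _ _) (cap_parity k))), .zero 1⟩

/-- The presentation of the category of oriented webs. -/
def orPres : Presentation where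
  Ob := OrOb
  Gen := OrGen
  par := OrGen.par
  Rel := OrRel
  rel_parity := OrRel.parity

/-- The monoidal supercategory of oriented webs of type Q. -/
abbrev WebOr : Type := orPres.Cat

open MonoidalSupercategory

/-- The braiding on oriented webs. -/
noncomputable def orBraiding (a b : WebOr) : tensorObj a b ⟶ tensorObj b a :=
  Presentation.mor (P := orPres) (crossWords orCross a.word b.word)

/-- Generating upward webs go to oriented webs of the same name. -/
def thetaMap : upPres.Map orPres where
  ob := OrOb.up
  gen := UpGen.toOr
  gen_par := UpGen.toOr_par
  rel h := .rel (OrRel.upward h)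

/-- The evident monoidal superfunctor from upward webs to oriented webs, which sends objects and
morphisms to objects and morphisms of the same name. -/
def theta : MonoidalSuperfunctor WebUp WebOr := thetaMap.functor

/-- The object of the category of upward webs given by a word. -/
def upObj (a : List ℕ+) : WebUp := ⟨a⟩

/-- The object of the category of oriented webs given by a word. -/
def orObj (a : List OrOb) : WebOr := ⟨a⟩

/-- The morphism represented by a linear combination of upward webs. -/
def upMor {a b : List ℕ+} (t : Term UpGen a b) : upObj a ⟶ upObj b :=
  Presentation.mor (P := upPres) t

/-- The morphism represented by a linear combination of oriented webs. -/
def orMor {a b : List OrOb} (t : Term OrGen a b) : orObj a ⟶ orObj b :=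
  Presentation.mor (P := orPres) t

end QWeb

namespace QWeb

namespace Presentation

/-- Families of morphisms between all pairs of objects. -/
abbrev Fam (P : Presentation) : Type := ∀ w z : List P.Ob, (⟨w⟩ : P.Cat) ⟶ ⟨z⟩

/-- The linear endomorphisms of families of morphisms. A morphism `f : a ⟶ b` acts on families by
precomposition with `1_x ⊗ f ⊗ 1_c`, where `c` is arbitrary (see `op`). -/
def Ops (P : Presentation) : Type := Module.End ℂ (Fam P)

noncomputable instance (P : Presentation) : Ring (Ops P) :=
  inferInstanceAs (Ring (Module.End ℂ (Fam P)))

noncomputable instance (P : Presentation) : Algebra ℂ (Ops P) :=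
  inferInstanceAs (Algebra ℂ (Module.End ℂ (Fam P)))

/-- The action on families. -/
def Ops.ev {P : Presentation} (F : Ops P) (ψ : Fam P) : Fam P :=
  (show Fam P →ₗ[ℂ] Fam P from F) ψ

theorem Ops.ext {P : Presentation} {F G : Ops P} (h : ∀ ψ, F.ev ψ = G.ev ψ) : F = G :=
  LinearMap.ext h

theorem Ops.ev_mul {P : Presentation} (F G : Ops P) (ψ : Fam P) : (F * G).ev ψ = F.ev (G.ev ψ) :=
  rfl

theorem Ops.ev_smul {P : Presentation} (r : ℂ) (F : Ops P) (ψ : Fam P) (w z : List P.Ob) :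
    (r • F).ev ψ w z = r • F.ev ψ w z :=
  rfl

variable {P : Presentation} {a b c d x y z w X Y Z : List P.Ob}

/-- The morphism `1_x ⊗ f ⊗ 1_c`. -/
def mid (x : List P.Ob) (f : (⟨a⟩ : P.Cat) ⟶ ⟨b⟩) (c : List P.Ob) (hX : X = x ++ (a ++ c))
    (hY : Y = x ++ (b ++ c)) : (⟨X⟩ : P.Cat) ⟶ ⟨Y⟩ :=
  tens hX hY (𝟙 (⟨x⟩ : P.Cat)) (tens rfl rfl f (𝟙 (⟨c⟩ : P.Cat)))

theorem id_even (a : List P.Ob) : 𝟙 (⟨a⟩ : P.Cat) ∈ parityHom a a 0 := ⟨_, .id a, rfl⟩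

theorem koszul_zero_left (p : ZMod 2) : koszul 0 p = 1 := by simp [koszul]

theorem koszul_zero_right (p : ZMod 2) : koszul p 0 = 1 := by simp [koszul]

theorem koszul_comm (p q : ZMod 2) : koszul p q = koszul q p := by
  simp [koszul, mul_comm]

theorem koszul_mul_self (p q : ZMod 2) : koszul p q * koszul p q = 1 := by
  rw [koszul, ← mul_pow]; norm_num

theorem tens_comp_left_even (f : (⟨a⟩ : P.Cat) ⟶ ⟨b⟩) (g : (⟨x⟩ : P.Cat) ⟶ ⟨y⟩)
    (f' : (⟨b⟩ : P.Cat) ⟶ ⟨c⟩) (g' : (⟨y⟩ : P.Cat) ⟶ ⟨z⟩) (hf : f ∈ parityHom a b 0)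
    (hX : X = a ++ x) (hY : Y = b ++ y) (hZ : Z = c ++ z) :
    tens hX hY f g ≫ tens hY hZ f' g' = tens hX hZ (f ≫ f') (g ≫ g') := by
  obtain ⟨t', rfl⟩ := mor_surj g'
  obtain ⟨u, hu, v, hv, e⟩ := exists_parts t'
  rw [e, map_add, Preadditive.comp_add, tens_comp _ _ _ _ hu hf, tens_comp _ _ _ _ hv hf,
    koszul_zero_right, koszul_zero_right, one_smul, one_smul, Preadditive.comp_add, map_add]

theorem tens_comp_right_even (f : (⟨a⟩ : P.Cat) ⟶ ⟨b⟩) (g : (⟨x⟩ : P.Cat) ⟶ ⟨y⟩)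
    (f' : (⟨b⟩ : P.Cat) ⟶ ⟨c⟩) (g' : (⟨y⟩ : P.Cat) ⟶ ⟨z⟩) (hg : g' ∈ parityHom y z 0)
    (hX : X = a ++ x) (hY : Y = b ++ y) (hZ : Z = c ++ z) :
    tens hX hY f g ≫ tens hY hZ f' g' = tens hX hZ (f ≫ f') (g ≫ g') := by
  obtain ⟨t, rfl⟩ := mor_surj f
  obtain ⟨u, hu, v, hv, e⟩ := exists_parts t
  rw [e, LinearMap.map_add₂, Preadditive.add_comp, tens_comp _ _ _ _ hg hu,
    tens_comp _ _ _ _ hg hv, koszul_zero_left, koszul_zero_left, one_smul, one_smul,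
    Preadditive.add_comp, LinearMap.map_add₂]

theorem tens_inner {p q p' q' : List P.Ob} (e : (⟨x⟩ : P.Cat) ⟶ ⟨y⟩) (f : (⟨a⟩ : P.Cat) ⟶ ⟨b⟩)
    (g : (⟨c⟩ : P.Cat) ⟶ ⟨d⟩) (hp : p = a ++ c) (hq : q = b ++ d) (hp' : p' = a ++ c)
    (hq' : q' = b ++ d) (hX : X = x ++ p) (hY : Y = y ++ q) (hX' : X = x ++ p')
    (hY' : Y = y ++ q') :
    tens hX hY e (tens hp hq f g) = tens hX' hY' e (tens hp' hq' f g) := by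
  subst hp hq hp' hq'
  rfl

theorem mid_comp (f : (⟨a⟩ : P.Cat) ⟶ ⟨b⟩) (g : (⟨b⟩ : P.Cat) ⟶ ⟨d⟩) (hX : X = x ++ (a ++ c))
    (hY : Y = x ++ (b ++ c)) (hZ : Z = x ++ (d ++ c)) :
    mid x f c hX hY ≫ mid x g c hY hZ = mid x (f ≫ g) c hX hZ := by
  rw [mid, mid, mid, tens_comp_left_even _ _ _ _ (id_even x),
    tens_comp_right_even _ _ _ _ (id_even c), Category.id_comp, Category.id_comp]

open Classical in
/-- The action of a morphism, to the right of the word `x`, on one family. -/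
noncomputable def act (x : List P.Ob) (f : (⟨a⟩ : P.Cat) ⟶ ⟨b⟩) (ψ : Fam P) : Fam P :=
  fun w z => if h : ∃ c, w = x ++ (a ++ c) then mid x f h.choose h.choose_spec rfl ≫ ψ _ z else 0

/-- The action of a morphism, to the right of the word `x`. -/
noncomputable def op (x : List P.Ob) : ((⟨a⟩ : P.Cat) ⟶ ⟨b⟩) →ₗ[ℂ] Ops P where
  toFun f := LinearMap.mk (σ := RingHom.id ℂ) (AddHom.mk (act x f) (fun ψ ψ' => by
      funext w z
      by_cases h : ∃ c, w = x ++ (a ++ c)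
      · simp [act, h]
      · simp [act, h])) (fun r ψ => by
      funext w z
      by_cases h : ∃ c, w = x ++ (a ++ c)
      · simp [act, h]
      · simp [act, h])
  map_add' f f' := by
    refine Ops.ext fun ψ => ?_
    funext w z
    change act x (f + f') ψ w z = act x f ψ w z + act x f' ψ w z
    by_cases h : ∃ c, w = x ++ (a ++ c)
    · simp [act, h, mid, Preadditive.add_comp]
    · simp [act, h]
  map_smul' r f := by
    refine Ops.ext fun ψ => ?_
    funext w z
    change act x (r • f) ψ w z = r • act x f ψ w z
    by_cases h : ∃ c, w = x ++ (a ++ c)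
    · simp [act, h, mid]
    · simp [act, h]

variable {ψ : Fam P}

theorem op_apply (f : (⟨a⟩ : P.Cat) ⟶ ⟨b⟩) (hX : X = x ++ (a ++ c)) (hY : Y = x ++ (b ++ c)) :
    (op x f).ev ψ X z = mid x f c hX hY ≫ ψ Y z := by
  have h : ∃ c, X = x ++ (a ++ c) := ⟨c, hX⟩
  have e : h.choose = c := by
    have := h.choose_spec.symm.trans hX
    simpa using this
  have key : ∀ (c' : List P.Ob) (hX' : X = x ++ (a ++ c')), c' = c →
      mid x f c' hX' rfl ≫ ψ _ z = mid x f c hX hY ≫ ψ Y z := by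
    rintro c' hX' rfl
    subst hY
    rfl
  rw [← key _ h.choose_spec e]
  change act x f ψ X z = _
  rw [act, dif_pos h]

theorem op_apply_of_not (f : (⟨a⟩ : P.Cat) ⟶ ⟨b⟩) (h : ¬ ∃ c, X = x ++ (a ++ c)) :
    (op x f).ev ψ X z = 0 := by
  change act x f ψ X z = _
  rw [act, dif_neg h]

theorem op_comp (x : List P.Ob) (f : (⟨a⟩ : P.Cat) ⟶ ⟨b⟩) (g : (⟨b⟩ : P.Cat) ⟶ ⟨c⟩) :
    op x (f ≫ g) = op x f * op x g := by
  refine Ops.ext fun ψ => ?_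
  funext X z
  by_cases h : ∃ e, X = x ++ (a ++ e)
  · obtain ⟨e, rfl⟩ := h
    rw [Ops.ev_mul, op_apply _ rfl rfl, op_apply _ rfl rfl, op_apply _ rfl rfl,
      ← Category.assoc, mid_comp]
  · rw [Ops.ev_mul, op_apply_of_not _ h, op_apply_of_not _ h]

theorem op_tens (x : List P.Ob) (f : (⟨a⟩ : P.Cat) ⟶ ⟨b⟩) (g : (⟨c⟩ : P.Cat) ⟶ ⟨d⟩)
    (hX : X = a ++ c) (hY : Y = b ++ d) :
    op x (tens hX hY f g) = op (x ++ a) g * op x f := by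
  subst hX hY
  refine Ops.ext fun ψ => ?_
  funext X z
  by_cases h : ∃ e, X = x ++ ((a ++ c) ++ e)
  · obtain ⟨e, hX⟩ := h
    rw [Ops.ev_mul, op_apply _ hX rfl,
      op_apply (c := e) (Y := x ++ (a ++ (d ++ e))) g (by simp [hX]) (by simp),
      op_apply (c := d ++ e) (Y := x ++ ((b ++ d) ++ e)) f rfl (by simp), ← Category.assoc]
    congr 1
    simp only [mid]
    rw [← tens_id (P := P) (a := x) (c := a) rfl rfl,
      tens_assoc _ _ _ rfl rfl _ (by simp) rfl rfl (by simp [hX]) rfl,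
      tens_assoc f g (𝟙 (⟨e⟩ : P.Cat)) rfl rfl rfl rfl rfl rfl (by simp) (by simp),
      tens_comp_left_even _ _ _ _ (id_even x), tens_comp_left_even _ _ _ _ (id_even a)]
    · simp only [Category.id_comp, Category.comp_id]
      exact tens_inner _ _ _ _ _ _ _ _ _ _ _
  · rw [Ops.ev_mul, op_apply_of_not _ h, op_apply_of_not]
    rintro ⟨e, rfl⟩
    exact h ⟨e, by simp⟩

/-- The projection to the words with prefix `w`. -/
noncomputable def pre (w : List P.Ob) : Ops P := op w (𝟙 (⟨[]⟩ : P.Cat))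

theorem mid_id (hX : X = x ++ (a ++ c)) (hY : X = x ++ (a ++ c)) :
    mid x (𝟙 (⟨a⟩ : P.Cat)) c hX hY = 𝟙 _ := by
  rw [mid, tens_id, tens_id]

theorem op_id (x a : List P.Ob) : op x (𝟙 (⟨a⟩ : P.Cat)) = pre (x ++ a) := by
  refine Ops.ext fun ψ => ?_
  funext X z
  by_cases h : ∃ e, X = x ++ (a ++ e)
  · obtain ⟨e, hX⟩ := h
    have hX' : X = (x ++ a) ++ ([] ++ e) := by simp [hX]
    rw [pre, op_apply _ hX hX, op_apply _ hX' hX', mid_id, mid_id]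
  · rw [pre, op_apply_of_not _ h, op_apply_of_not]
    rintro ⟨e, rfl⟩
    exact h ⟨e, by simp⟩

theorem pre_append (x a : List P.Ob) : pre (x ++ a) = op x (𝟙 (⟨a⟩ : P.Cat)) := (op_id x a).symm

theorem pre_mul_op (x : List P.Ob) (f : (⟨a⟩ : P.Cat) ⟶ ⟨b⟩) : pre (x ++ a) * op x f = op x f := by
  rw [pre_append, ← op_comp, Category.id_comp]

theorem op_mul_pre (x : List P.Ob) (f : (⟨a⟩ : P.Cat) ⟶ ⟨b⟩) : op x f * pre (x ++ b) = op x f := by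
  rw [pre_append, ← op_comp, Category.comp_id]

/-- The superinterchange law. -/
theorem op_comm {p q : ZMod 2} (x y : List P.Ob) {f : (⟨a⟩ : P.Cat) ⟶ ⟨b⟩} {g : (⟨c⟩ : P.Cat) ⟶ ⟨d⟩}
    (hf : f ∈ parityHom a b q) (hg : g ∈ parityHom c d p) :
    op x f * op (x ++ (b ++ y)) g = koszul p q • (op (x ++ (a ++ y)) g * op x f) := by
  refine Ops.ext fun ψ => ?_
  funext X z
  by_cases h : ∃ e, X = x ++ (a ++ (y ++ (c ++ e)))
  · obtain ⟨e, hX⟩ := h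
    rw [Ops.ev_smul, Ops.ev_mul, Ops.ev_mul,
      op_apply (c := y ++ (c ++ e)) _ hX rfl,
      op_apply (c := e) (Y := x ++ (b ++ (y ++ (d ++ e)))) g (by simp) (by simp)]
    rw [op_apply (c := e) (Y := x ++ (a ++ (y ++ (d ++ e)))) g (by simp [hX]) (by simp),
      op_apply (c := y ++ (d ++ e)) f rfl rfl]
    rw [← Category.assoc, ← Category.assoc, ← Linear.smul_comp]
    congr 1
    have key : ∀ (u : List P.Ob) {A B : List P.Ob} (hA : A = x ++ (u ++ (y ++ (c ++ e))))
        (hB : B = x ++ (u ++ (y ++ (d ++ e)))) h1 h2,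
        mid (x ++ (u ++ y)) g e (X := A) (Y := B) h1 h2 =
          tens hA hB (𝟙 (⟨x⟩ : P.Cat)) (tens rfl rfl (𝟙 (⟨u⟩ : P.Cat))
            (tens rfl rfl (𝟙 (⟨y⟩ : P.Cat)) (tens rfl rfl g (𝟙 (⟨e⟩ : P.Cat))))) := by
      intro u A B hA hB h1 h2
      rw [mid, ← tens_id (P := P) (a := x) (c := u ++ y) rfl rfl,
        ← tens_id (P := P) (a := u) (c := y) rfl rfl,
        tens_assoc _ _ _ rfl rfl _ _ rfl rfl (by simp [hA]) (by simp [hB]),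
        tens_assoc (𝟙 (⟨u⟩ : P.Cat)) _ _ rfl rfl rfl rfl rfl rfl (by simp) (by simp)]
      exact tens_inner _ _ _ _ _ _ _ _ _ _ _
    rw [key b rfl rfl, key a hX rfl]
    have hg' : tens rfl rfl (𝟙 (⟨y⟩ : P.Cat)) (tens rfl rfl g (𝟙 (⟨e⟩ : P.Cat))) ∈
        parityHom (y ++ (c ++ e)) (y ++ (d ++ e)) p := by
      have h1 := tens_parityHom (P := P) rfl rfl hg (id_even e)
      have h2 := tens_parityHom (P := P) rfl rfl (id_even y) h1
      rwa [add_zero, zero_add] at h2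
    simp only [mid]
    rw [tens_comp_left_even _ _ _ _ (id_even x), tens_comp_left_even _ _ _ _ (id_even x),
      tens_comp _ _ _ _ hg' hf, tens_comp_left_even _ _ _ _ (id_even a)]
    simp only [Category.id_comp, Category.comp_id, map_smul]
  · rw [Ops.ev_smul, Ops.ev_mul, Ops.ev_mul, op_apply_of_not (a := c), smul_zero]
    · by_cases h' : ∃ e, X = x ++ (a ++ e)
      · obtain ⟨e, hX⟩ := h'
        rw [op_apply _ hX rfl, op_apply_of_not, Limits.comp_zero]
        rintro ⟨e', he⟩
        refine h ⟨e', ?_⟩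
        have : e = y ++ (c ++ e') := by simpa using he
        rw [hX, this]
      · rw [op_apply_of_not _ h']
    · rintro ⟨e, he⟩
      exact h ⟨e, by simpa using he⟩

theorem op_comm_right (x y : List P.Ob) (f : (⟨a⟩ : P.Cat) ⟶ ⟨b⟩)
    {g : (⟨c⟩ : P.Cat) ⟶ ⟨d⟩} (hg : g ∈ parityHom c d 0) :
    op x f * op (x ++ (b ++ y)) g = op (x ++ (a ++ y)) g * op x f := by
  obtain ⟨t, rfl⟩ := mor_surj f
  obtain ⟨u, hu, v, hv, e⟩ := exists_parts t
  rw [e, map_add, add_mul, op_comm _ _ hu hg, op_comm _ _ hv hg, koszul_zero_left,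
    koszul_zero_left, one_smul, one_smul, mul_add]

theorem op_comm_left (x y : List P.Ob) {f : (⟨a⟩ : P.Cat) ⟶ ⟨b⟩}
    (g : (⟨c⟩ : P.Cat) ⟶ ⟨d⟩) (hf : f ∈ parityHom a b 0) :
    op x f * op (x ++ (b ++ y)) g = op (x ++ (a ++ y)) g * op x f := by
  obtain ⟨t, rfl⟩ := mor_surj g
  obtain ⟨u, hu, v, hv, e⟩ := exists_parts t
  rw [e, map_add, mul_add, op_comm _ _ hf hu, op_comm _ _ hf hv, koszul_zero_right,
    koszul_zero_right, one_smul, one_smul, map_add, add_mul]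

theorem op_mul_pre_comm (x y : List P.Ob) (f : (⟨a⟩ : P.Cat) ⟶ ⟨b⟩) :
    op x f * pre (x ++ (b ++ y)) = pre (x ++ (a ++ y)) * op x f :=
  op_comm_right x y f (id_even [])

theorem pre_mul_op' (w y : List P.Ob) (f : (⟨a⟩ : P.Cat) ⟶ ⟨b⟩) :
    pre w * op (w ++ y) f = op (w ++ y) f := by
  refine Ops.ext fun ψ => ?_
  funext X z
  rw [Ops.ev_mul]
  by_cases h : ∃ e, X = w ++ ([] ++ e)
  · obtain ⟨e, hX⟩ := h
    rw [pre, op_apply _ hX hX, mid_id, Category.id_comp]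
  · rw [pre, op_apply_of_not _ h, op_apply_of_not]
    rintro ⟨e, rfl⟩
    exact h ⟨y ++ (a ++ e), by simp⟩

theorem op_mul_pre' (w y : List P.Ob) (f : (⟨a⟩ : P.Cat) ⟶ ⟨b⟩) :
    op (w ++ y) f * pre w = op (w ++ y) f := by
  refine Ops.ext fun ψ => ?_
  funext X z
  rw [Ops.ev_mul]
  by_cases h : ∃ e, X = (w ++ y) ++ (a ++ e)
  · obtain ⟨e, hX⟩ := h
    have hY : w ++ y ++ (b ++ e) = w ++ ([] ++ (y ++ (b ++ e))) := by simp
    rw [pre, op_apply _ hX rfl, op_apply _ hX rfl, op_apply _ hY hY, mid_id, Category.id_comp]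
  · rw [op_apply_of_not _ h, op_apply_of_not _ h]

theorem pre_mul_pre (w y : List P.Ob) : pre w * pre (w ++ y) = pre (P := P) (w ++ y) :=
  pre_mul_op' w y _

theorem pre_mul_pre' (w y : List P.Ob) : pre (w ++ y) * pre w = pre (P := P) (w ++ y) :=
  op_mul_pre' w y _

open Classical in
theorem op_injective {a' b' : List P.Ob} {f : (⟨a⟩ : P.Cat) ⟶ ⟨b⟩} {g : (⟨a'⟩ : P.Cat) ⟶ ⟨b'⟩}
    (ha : a = a') (hb : b = b') (h : op [] f = op [] g) :
    f ≫ (castIso hb).hom = (castIso ha).hom ≫ g := by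
  subst ha hb
  have h1 := congrFun (congrFun (congrArg (Ops.ev ·
    (fun w z => if e : w = z then (castIso e).hom else 0)) h) a) b
  have e1 : a = [] ++ (a ++ []) := by simp
  have e2 : b = [] ++ (b ++ []) := by simp
  rw [op_apply _ e1 e2, op_apply _ e1 e2, dif_pos rfl, castIso_refl, Category.comp_id,
    Category.comp_id] at h1
  have key : ∀ f : (⟨a⟩ : P.Cat) ⟶ ⟨b⟩, mid [] f [] e1 e2 = f := by
    intro f
    rw [mid, ← tens_assoc (𝟙 (⟨[]⟩ : P.Cat)) f _ (List.nil_append a).symm (List.nil_append b).symm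
      (List.append_nil a).symm (List.append_nil b).symm, unit_tens, tens_unit]
  rw [castIso_refl, castIso_refl, Category.comp_id, Category.id_comp, ← key f, ← key g, h1]

theorem op_inj {f g : (⟨a⟩ : P.Cat) ⟶ ⟨b⟩} (h : op [] f = op [] g) : f = g := by
  simpa [castIso_refl] using op_injective rfl rfl h

theorem op_castIso (x : List P.Ob) (h : a = b) : op x (castIso h).hom = pre (P := P) (x ++ a) := by
  subst h
  exact op_id x a

theorem op_castIso_inv (x : List P.Ob) (h : a = b) :
    op x (castIso h).inv = pre (P := P) (x ++ b) := by
  subst h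
  exact op_id x a

variable {P : Presentation} {a b c d x y z w v v' X Y Z : List P.Ob}

theorem pre_mul_op_of_prefix (f : (⟨a⟩ : P.Cat) ⟶ ⟨b⟩) (h : v <+: x ++ a) :
    pre v * op x f = op x f := by
  obtain ⟨t, h⟩ := h
  rw [← pre_mul_op x f, ← h, ← mul_assoc, pre_mul_pre]

theorem op_mul_pre_of_prefix (f : (⟨a⟩ : P.Cat) ⟶ ⟨b⟩) (h : v <+: x ++ b) :
    op x f * pre v = op x f := by
  obtain ⟨t, h⟩ := h
  rw [← op_mul_pre x f, ← h, mul_assoc, pre_mul_pre']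

theorem pre_mul_pre_of_prefix (h : v <+: w) : pre v * pre w = pre (P := P) w := by
  obtain ⟨t, rfl⟩ := h
  exact pre_mul_pre _ _

theorem pre_mul_pre_of_prefix' (h : v <+: w) : pre w * pre v = pre (P := P) w := by
  obtain ⟨t, rfl⟩ := h
  exact pre_mul_pre' _ _

theorem op_mul_pre_comm_of (f : (⟨a⟩ : P.Cat) ⟶ ⟨b⟩) (h : v = x ++ (b ++ y))
    (h' : v' = x ++ (a ++ y)) : op x f * pre v = pre v' * op x f := by
  subst h h'
  exact op_mul_pre_comm x y f

theorem op_slide_left {f : (⟨a⟩ : P.Cat) ⟶ ⟨b⟩} (g : (⟨c⟩ : P.Cat) ⟶ ⟨d⟩)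
    (hf : f ∈ parityHom a b 0) (y : List P.Ob) (h : v = x ++ (b ++ y))
    (h' : v' = x ++ (a ++ y)) : op x f * op v g = op v' g * op x f := by
  subst h h'
  exact op_comm_left x y g hf

theorem op_slide_right (f : (⟨a⟩ : P.Cat) ⟶ ⟨b⟩) {g : (⟨c⟩ : P.Cat) ⟶ ⟨d⟩}
    (hg : g ∈ parityHom c d 0) (y : List P.Ob) (h : v = x ++ (b ++ y))
    (h' : v' = x ++ (a ++ y)) : op x f * op v g = op v' g * op x f := by
  subst h h'
  exact op_comm_right x y f hg

theorem op_slide {p q : ZMod 2} {f : (⟨a⟩ : P.Cat) ⟶ ⟨b⟩} {g : (⟨c⟩ : P.Cat) ⟶ ⟨d⟩}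
    (hf : f ∈ parityHom a b q) (hg : g ∈ parityHom c d p) (y : List P.Ob)
    (h : v = x ++ (b ++ y)) (h' : v' = x ++ (a ++ y)) :
    op x f * op v g = koszul p q • (op v' g * op x f) := by
  subst h h'
  exact op_comm x y hf hg

/-! ### The operators of terms -/

theorem op_mor_comp (w : List P.Ob) (s : Term P.Gen a b) (t : Term P.Gen b c) :
    op w (mor (s.comp t)) = op w (mor s) * op w (mor t) := by
  rw [mor_comp, op_comp]

theorem op_mor_id (w : List P.Ob) : op w (mor (.id a : Term P.Gen a a)) = pre (w ++ a) := op_id w a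

theorem op_mor_tensor (w : List P.Ob) (s : Term P.Gen a b) (t : Term P.Gen c d)
    (hx : X = a ++ c) (hy : Y = b ++ d) :
    op w (mor (s.tensor t hx hy)) = op (w ++ a) (mor t) * op w (mor s) := by
  rw [mor_tensor, op_tens]

theorem op_mor_idLeft (w : List P.Ob) (t : Term P.Gen b c) (hx : x = a ++ b) (hy : y = a ++ c) :
    op w (mor (Term.idLeft a t hx hy)) = op (w ++ a) (mor t) := by
  rw [Term.idLeft, op_mor_tensor, op_mor_id, op_mul_pre_of_prefix _ ⟨c, rfl⟩]

theorem op_mor_idRight (w : List P.Ob) (t : Term P.Gen b c) (hx : x = b ++ a) (hy : y = c ++ a) :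
    op w (mor (Term.idRight t a hx hy)) = pre (w ++ (b ++ a)) * op w (mor t) := by
  rw [Term.idRight, op_mor_tensor, op_mor_id, List.append_assoc]

theorem op_mor_idRight' (w : List P.Ob) (t : Term P.Gen b c) (hx : x = b ++ a) (hy : y = c ++ a) :
    op w (mor (Term.idRight t a hx hy)) = op w (mor t) * pre (w ++ (c ++ a)) := by
  rw [op_mor_idRight, op_mul_pre_comm]

theorem op_mor_ofEq (w : List P.Ob) (h : a = b) :
    op w (mor (Term.ofEq h : Term P.Gen a b)) = pre (w ++ a) := by
  subst h
  exact op_mor_id w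

theorem op_mor_add (w : List P.Ob) (s t : Term P.Gen a b) :
    op w (mor (s + t)) = op w (mor s) + op w (mor t) :=
  (congrArg (op w) (mor_add s t)).trans (map_add (op w) _ _)

theorem op_mor_smul (w : List P.Ob) (r : ℂ) (t : Term P.Gen a b) :
    op w (mor (r • t)) = r • op w (mor t) :=
  (congrArg (op w) (mor_smul r t)).trans (map_smul (op w) _ _)

theorem op_mor_zero (w : List P.Ob) : op w (mor (0 : Term P.Gen a b)) = 0 := map_zero (op w)

theorem op_mor_sub (w : List P.Ob) (s t : Term P.Gen a b) :
    op w (mor (s - t)) = op w (mor s) - op w (mor t) := by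
  have h : mor (s - t) = mor s + (-1 : ℂ) • mor t := rfl
  rw [h, map_add, map_smul, sub_eq_add_neg]
  exact congrArg _ (neg_one_smul ℂ _)

theorem mor_even {t : Term P.Gen a b} (h : t.HasParity P.par 0) : mor t ∈ parityHom a b 0 :=
  ⟨t, h, rfl⟩

/-! ### Braidings from crossings of generating objects -/

variable (X : ∀ x y : P.Ob, Term P.Gen [x, y] [y, x])

/-- The operator of the crossing of the word `a` with the word `b`, to the right of `w`. -/
noncomputable def cr (w a b : List P.Ob) : Ops P := op w (mor (crossWords X a b))

theorem cr_nil_left (w b : List P.Ob) : cr X w [] b = pre (w ++ b) := by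
  rw [cr, crossWords, op_mor_ofEq, List.nil_append]

theorem op_passWord_nil (w : List P.Ob) (x : P.Ob) : op w (mor (passWord X x [])) = pre (w ++ [x]) :=
  op_mor_id w

theorem op_passWord_cons (w : List P.Ob) (x y : P.Ob) (b : List P.Ob) :
    op w (mor (passWord X x (y :: b))) = op w (mor (X x y)) * op (w ++ [y]) (mor (passWord X x b)) := by
  rw [passWord, op_mor_comp, op_mor_idRight', op_mor_idLeft, mul_assoc, pre_mul_op_of_prefix]
  exact ⟨[], by simp⟩

theorem cr_cons_left (w : List P.Ob) (x : P.Ob) (a b : List P.Ob) :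
    cr X w (x :: a) b = cr X (w ++ [x]) a b * op w (mor (passWord X x b)) := by
  rw [cr, crossWords, op_mor_comp, op_mor_idRight, op_mor_idLeft, ← mul_assoc, op_mul_pre_of_prefix]
  · rfl
  · exact ⟨[], by simp⟩

theorem pre_mul_cr (w a b : List P.Ob) (h : v <+: w ++ (a ++ b)) :
    pre v * cr X w a b = cr X w a b := pre_mul_op_of_prefix _ h

theorem cr_mul_pre (w a b : List P.Ob) (h : v <+: w ++ (b ++ a)) :
    cr X w a b * pre v = cr X w a b := op_mul_pre_of_prefix _ h

theorem cr_singleton (w : List P.Ob) (x : P.Ob) (b : List P.Ob) :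
    cr X w [x] b = op w (mor (passWord X x b)) := by
  rw [cr_cons_left, cr_nil_left, pre_mul_op_of_prefix]
  exact ⟨[], by simp⟩

theorem cr_nil_right (w a : List P.Ob) : cr X w a [] = pre (w ++ a) := by
  induction a generalizing w with
  | nil => rw [cr_nil_left]
  | cons x a ih =>
    rw [cr_cons_left, ih, op_passWord_nil, pre_mul_pre_of_prefix']
    · simp
    · exact ⟨a, by simp⟩

theorem cr_singleton_singleton (w : List P.Ob) (x y : P.Ob) :
    cr X w [x] [y] = op w (mor (X x y)) := by
  rw [cr_singleton, op_passWord_cons, op_passWord_nil, op_mul_pre_of_prefix]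
  exact ⟨[], by simp⟩

theorem cr_singleton_cons (w : List P.Ob) (x y : P.Ob) (b : List P.Ob) :
    cr X w [x] (y :: b) = op w (mor (X x y)) * cr X (w ++ [y]) [x] b := by
  rw [cr_singleton, cr_singleton, op_passWord_cons]

theorem cr_cons (w : List P.Ob) (x : P.Ob) (a b : List P.Ob) :
    cr X w (x :: a) b = cr X (w ++ [x]) a b * cr X w [x] b := by
  rw [cr_singleton, cr_cons_left]

theorem cr_append_left (w a b c : List P.Ob) :
    cr X w (a ++ b) c = cr X (w ++ a) b c * cr X w a c := by
  induction a generalizing w with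
  | nil =>
    rw [cr_nil_left, List.append_nil, List.nil_append, cr_mul_pre]
    exact ⟨b, by simp⟩
  | cons x a ih => rw [List.cons_append, cr_cons, ih, cr_cons X w x a c, mul_assoc]; simp

/-- All crossings are even. -/
def EvenCrossings : Prop := ∀ x y, (X x y).HasParity P.par 0

/-- The crossing of `y` with `x` is left inverse to the crossing of `x` with `y`. -/
def Symm (x y : P.Ob) : Prop :=
  ∀ w, op w (mor (X x y)) * op w (mor (X y x)) = pre (P := P) (w ++ [x, y])

variable {X}

theorem passWord_even (hX : EvenCrossings X) (x : P.Ob) (b : List P.Ob) : (passWord X x b).HasParity P.par 0 := by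
  induction b with
  | nil => exact .id _
  | cons y b ih => exact .comp_even (.idRight (hX x y) _ _) (.idLeft ih _ _)

theorem crossWords_even (hX : EvenCrossings X) (a b : List P.Ob) : (crossWords X a b).HasParity P.par 0 := by
  induction a with
  | nil => exact .ofEq _
  | cons x a ih => exact .comp_even (.idLeft ih _ _) (.idRight (passWord_even hX x b) _ _)

theorem op_cr (hX : EvenCrossings X) (f : (⟨c⟩ : P.Cat) ⟶ ⟨d⟩) (y : List P.Ob) (h : v = w ++ (d ++ y))
    (h' : v' = w ++ (c ++ y)) : op w f * cr X v a b = cr X v' a b * op w f :=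
  op_slide_right f (mor_even (crossWords_even hX a b)) y h h'

theorem cr_op (hX : EvenCrossings X) (f : (⟨c⟩ : P.Cat) ⟶ ⟨d⟩) (w y : List P.Ob) (h : v = w ++ (b ++ (a ++ y)))
    (h' : v' = w ++ (a ++ (b ++ y))) : cr X w a b * op v f = op v' f * cr X w a b :=
  op_slide_left f (mor_even (crossWords_even hX a b)) y (by simp [h]) (by simp [h'])

theorem cr_cr (hX : EvenCrossings X) (w a b c d y : List P.Ob) (h : v = w ++ (b ++ (a ++ y)))
    (h' : v' = w ++ (a ++ (b ++ y))) :
    cr X w a b * cr X v c d = cr X v' c d * cr X w a b :=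
  cr_op hX _ w y h h'

theorem cr_singleton_append (w : List P.Ob) (x : P.Ob) (b c : List P.Ob) :
    cr X w [x] (b ++ c) = cr X w [x] b * cr X (w ++ b) [x] c := by
  induction b generalizing w with
  | nil =>
    rw [cr_nil_right, List.append_nil, List.nil_append, pre_mul_cr]
    exact ⟨c, by simp⟩
  | cons y b ih =>
    rw [List.cons_append, cr_singleton_cons, cr_singleton_cons, ih, mul_assoc]
    simp

theorem cr_append_right (hX : EvenCrossings X) (w a b c : List P.Ob) :
    cr X w a (b ++ c) = cr X w a b * cr X (w ++ b) a c := by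
  induction a generalizing w with
  | nil =>
    rw [cr_nil_left, cr_nil_left, cr_nil_left, pre_mul_pre_of_prefix]
    · simp
    · exact ⟨c, by simp⟩
  | cons x a ih =>
    rw [cr_cons, ih, cr_singleton_append, cr_cons X w x a b, cr_cons X (w ++ b) x a c]
    rw [mul_assoc, mul_assoc, ← mul_assoc (cr X (w ++ [x] ++ b) a c),
      ← cr_cr hX (v := w ++ b ++ [x]) w [x] b a c []]
    · simp only [mul_assoc]
    · simp
    · simp

theorem cr_singleton_symm (w : List P.Ob) (x : P.Ob) (b : List P.Ob) (hs : ∀ y ∈ b, Symm X x y) :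
    cr X w [x] b * cr X w b [x] = pre (w ++ x :: b) := by
  induction b generalizing w with
  | nil => rw [cr_nil_right, cr_nil_left, pre_mul_pre_of_prefix]; exact List.prefix_rfl
  | cons y b ih =>
    rw [cr_singleton_cons, cr_cons X w y b, mul_assoc, ← mul_assoc (cr X (w ++ [y]) [x] b),
      ih _ fun z hz => hs z (.tail _ hz),
      cr_singleton_singleton, ← mul_assoc, op_mul_pre_comm_of (y := b) (v' := w ++ x :: y :: b),
      mul_assoc, hs y (.head _), pre_mul_pre_of_prefix']
    · exact ⟨b, by simp⟩
    · simp
    · simp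

theorem cr_symm (hX : EvenCrossings X) (w a b : List P.Ob) (hs : ∀ x ∈ a, ∀ y ∈ b, Symm X x y) :
    cr X w a b * cr X w b a = pre (w ++ (a ++ b)) := by
  induction a generalizing w with
  | nil => rw [cr_nil_right, cr_nil_left, List.nil_append, pre_mul_pre_of_prefix List.prefix_rfl]
  | cons x a ih =>
    rw [← List.singleton_append, cr_append_left, cr_append_right hX, mul_assoc,
      ← mul_assoc (cr X w [x] b), cr_singleton_symm _ _ _ (hs x (.head _)), ← mul_assoc, cr_mul_pre,
      ih _ fun z hz => hs z (.tail _ hz)]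
    · simp
    · exact ⟨a, by simp⟩

/-! ### Naturality -/

variable (X) in
/-- The strand `x` may be moved across `f`. -/
def Passes (x : P.Ob) (f : (⟨a⟩ : P.Cat) ⟶ ⟨b⟩) : Prop :=
  ∀ w : List P.Ob, op (w ++ [x]) f * cr X w [x] b = cr X w [x] a * op w f

variable {p : P.Ob}

theorem Passes.comp {f : (⟨a⟩ : P.Cat) ⟶ ⟨b⟩} {g : (⟨b⟩ : P.Cat) ⟶ ⟨c⟩} (hf : Passes X p f)
    (hg : Passes X p g) : Passes X p (f ≫ g) := fun w => by
  rw [op_comp, op_comp, mul_assoc, hg, ← mul_assoc, hf, mul_assoc]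

theorem Passes.add {f g : (⟨a⟩ : P.Cat) ⟶ ⟨b⟩} (hf : Passes X p f) (hg : Passes X p g) :
    Passes X p (f + g) := fun w => by
  rw [map_add, map_add, add_mul, mul_add, hf, hg]

theorem Passes.smul {f : (⟨a⟩ : P.Cat) ⟶ ⟨b⟩} (r : ℂ) (hf : Passes X p f) :
    Passes X p (r • f) := fun w => by
  rw [map_smul, map_smul, smul_mul_assoc, mul_smul_comm, hf]

theorem Passes.zero : Passes X p (0 : (⟨a⟩ : P.Cat) ⟶ ⟨b⟩) := fun w => by
  rw [map_zero, map_zero, zero_mul, mul_zero]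

theorem Passes.id (a : List P.Ob) : Passes X p (𝟙 (⟨a⟩ : P.Cat)) := fun w => by
  rw [op_id, op_id, pre_mul_cr, cr_mul_pre]
  · exact ⟨[p], by simp⟩
  · simp

theorem Passes.ofEq (h : a = b) : Passes X p (mor (.ofEq h : Term P.Gen a b)) := by
  subst h
  exact .id a

theorem Passes.tens (hX : EvenCrossings X) {f : (⟨a⟩ : P.Cat) ⟶ ⟨b⟩} {g : (⟨c⟩ : P.Cat) ⟶ ⟨d⟩}
    (hf : Passes X p f) (hg : Passes X p g) (hx : x = a ++ c) (hy : y = b ++ d) :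
    Passes X p (tens hx hy f g) := fun w => by
  subst hx hy
  have h1 := hg (w ++ a)
  have h2 := cr_op hX g (a := [p]) (b := a) (v := w ++ a ++ [p]) (v' := w ++ [p] ++ a) w []
    (by simp) (by simp)
  rw [op_tens, op_tens, cr_singleton_append, cr_singleton_append, mul_assoc,
    ← mul_assoc (op (w ++ [p]) f), hf, mul_assoc, op_cr hX f [] (v' := w ++ a) (by simp) (by simp),
    ← mul_assoc, ← h2, mul_assoc, ← mul_assoc (op _ g), h1]
  simp only [mul_assoc]

theorem passes_of_generators (hX : EvenCrossings X)
    (hg : ∀ {a b : List P.Ob} (g : P.Gen a b), Passes X p (mor (.gen g))) (t : Term P.Gen a b) :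
    Passes X p (mor t) := by
  induction t with
  | id a => exact .id a
  | gen g => exact hg g
  | comp s t hs ht => exact hs.comp ht
  | tensor s t hx hy hs ht => exact hs.tens hX ht hx hy
  | zero => exact .zero
  | add s t hs ht => exact hs.add ht
  | smul z t ht => exact ht.smul z

theorem op_mul_cr_of_passes {f : (⟨a⟩ : P.Cat) ⟶ ⟨b⟩} (w c : List P.Ob)
    (hf : ∀ x ∈ c, Passes X x f) (h : v = w ++ c) : op v f * cr X w c b = cr X w c a * op w f := by
  subst h
  induction c generalizing w with
  | nil =>
    rw [cr_nil_left, cr_nil_left, List.append_nil, pre_mul_op, op_mul_pre]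
  | cons x c ih =>
    have h := ih (w ++ [x]) fun y hy => hf y (.tail _ hy)
    simp only [List.append_assoc, List.singleton_append] at h
    rw [cr_cons X w x c b, ← mul_assoc, h, mul_assoc, hf x (.head _), ← mul_assoc, ← cr_cons]

theorem op_mul_cr_of_passes' (hX : EvenCrossings X) {f : (⟨a⟩ : P.Cat) ⟶ ⟨b⟩} (w c : List P.Ob)
    (hf : ∀ x ∈ c, Passes X x f) (ha : ∀ x ∈ a, ∀ y ∈ c, Symm X x y)
    (hb : ∀ x ∈ b, ∀ y ∈ c, Symm X y x) (h : v = w ++ c) :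
    op w f * cr X w b c = cr X w a c * op v f := by
  have h1 := op_mul_cr_of_passes w c hf h
  have h2 : cr X w a c * (op v f * cr X w c b) * cr X w b c = op w f * cr X w b c := by
    rw [h1, ← mul_assoc, cr_symm hX _ _ _ ha, ← op_mul_pre_comm, mul_assoc, pre_mul_cr]
    exact List.prefix_rfl
  rw [← h2, mul_assoc, mul_assoc, cr_symm hX _ _ _ fun x hx y hy => hb y hy x hx, h,
    op_mul_pre_of_prefix]
  simp

theorem isSymmetricBraiding_crossWords (hX : EvenCrossings X) (hs : ∀ x y, Symm X x y)
    (hg : ∀ (x : P.Ob) {a b : List P.Ob} (g : P.Gen a b), Passes X x (mor (.gen g))) :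
    IsSymmetricBraiding (C := P.Cat) fun a b => mor (crossWords X a.word b.word) where
  even a b := mor_even (crossWords_even hX _ _)
  symmetric a b := by
    refine op_inj ?_
    rw [op_comp]
    exact (cr_symm hX _ _ _ fun x _ y _ => hs x y).trans (op_id [] _).symm
  supernatural {a a' b b'} f g {p q} hf hg' := by
    obtain ⟨s, rfl⟩ := mor_surj f
    obtain ⟨t, rfl⟩ := mor_surj g
    have hs' := fun x => passes_of_generators hX (hg x) s
    have ht' := fun x => passes_of_generators hX (hg x) t
    refine op_inj ?_
    rw [op_comp, map_smul, op_comp]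
    change op [] (tens rfl rfl (mor s) (mor t)) * cr X [] a'.word b'.word =
      koszul p q • (cr X [] a.word b.word * op [] (tens rfl rfl (mor t) (mor s)))
    rw [op_tens, op_tens, mul_assoc, op_mul_cr_of_passes' hX [] b'.word (fun x _ => hs' x)
      (fun x _ y _ => hs x y) (fun x _ y _ => hs y x) rfl, ← mul_assoc,
      op_mul_cr_of_passes [] a.word (fun x _ => ht' x) rfl, mul_assoc,
      op_slide hg' hf [] (x := []) (by simp) rfl, mul_smul_comm]
    simp
  hexagon_forward a b c := by
    refine op_inj ?_
    change op [] ((castIso (P := P) _).hom ≫ _ ≫ (castIso (P := P) _).hom) =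
      op [] (tens rfl rfl _ _ ≫ (castIso (P := P) _).hom ≫ tens rfl rfl _ _)
    rw [op_comp, op_comp, op_comp, op_comp, op_castIso, op_castIso, op_castIso, op_tens, op_tens,
      op_id, op_id]
    change pre ((a.word ++ b.word) ++ c.word) * (cr X [] a.word (b.word ++ c.word) *
      pre ((b.word ++ c.word) ++ a.word)) = pre ((a.word ++ b.word) ++ c.word) *
      cr X [] a.word b.word * (pre ((b.word ++ a.word) ++ c.word) *
      (cr X b.word a.word c.word * pre b.word))
    rw [cr_mul_pre X b.word _ _ ⟨c.word ++ a.word, rfl⟩, pre_mul_cr X b.word _ _ (by simp),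
      cr_mul_pre X [] _ _ (by simp), cr_append_right hX, mul_assoc]
    rfl
  hexagon_reverse a b c := by
    refine op_inj ?_
    change op [] ((castIso (P := P) _).inv ≫ _ ≫ (castIso (P := P) _).inv) =
      op [] (tens rfl rfl _ _ ≫ (castIso (P := P) _).inv ≫ tens rfl rfl _ _)
    rw [op_comp, op_comp, op_comp, op_comp, op_castIso_inv, op_castIso_inv, op_castIso_inv, op_tens, op_tens,
      op_id, op_id]
    change pre (a.word ++ (b.word ++ c.word)) * (cr X [] (a.word ++ b.word) c.word *
      pre (c.word ++ (a.word ++ b.word))) = cr X a.word b.word c.word * pre a.word *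
      (pre (a.word ++ (c.word ++ b.word)) * (pre ((a.word ++ c.word) ++ b.word) *
      cr X [] a.word c.word))
    rw [cr_mul_pre X a.word _ _ ⟨c.word ++ b.word, rfl⟩, ← mul_assoc, pre_mul_cr X [] _ _ (by simp),
      cr_mul_pre X [] _ _ (by simp), cr_append_left, ← mul_assoc (pre _),
      pre_mul_pre_of_prefix (by simp), ← mul_assoc, cr_mul_pre X a.word _ _ (by simp)]
    rfl

end Presentation

open Presentation

set_option linter.unusedSectionVars false

/-! ### Operators of upward webs -/

/-- The presentation of upward webs, with transparent components. -/
abbrev upP : Presentation where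
  Ob := ℕ+
  Gen := UpGen
  par := UpGen.par
  Rel := UpRel
  rel_parity := UpRel.parity

section

variable {a b c d x y v w : List ℕ+}

/-- The operator of an upward web, to the right of the word `w`. -/
noncomputable def uo (w : List ℕ+) (t : Term UpGen a b) : Ops upP := op (P := upP) w (mor (P := upP) t)

/-- The projection to the words with prefix `w`. -/
noncomputable abbrev uI (w : List ℕ+) : Ops upP := pre (P := upP) w

theorem uo_rel (w : List ℕ+) {s t : Term UpGen a b} (h : UpRel s t) : uo w s = uo w t :=
  congrArg (fun f => op (P := upP) w f) (mor_eq (P := upP) (.rel h))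

theorem uo_comp (w : List ℕ+) (s : Term UpGen a b) (t : Term UpGen b c) :
    uo w (s ⨟ t) = uo w s * uo w t := op_mor_comp _ _ _

theorem uo_id (w a : List ℕ+) : uo w (.id a) = uI (w ++ a) := op_mor_id _

theorem uo_tensor (w : List ℕ+) (s : Term UpGen a b) (t : Term UpGen c d) (hx : x = a ++ c)
    (hy : y = b ++ d) : uo w (s.tensor t hx hy) = uo (w ++ a) t * uo w s :=
  op_mor_tensor _ _ _ _ _

theorem uo_tens (w : List ℕ+) (s : Term UpGen a b) (t : Term UpGen c d) :
    uo w (s.tens t) = uo (w ++ a) t * uo w s :=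
  op_mor_tensor _ _ _ _ _

theorem uo_idLeft (w : List ℕ+) (t : Term UpGen b c) (hx : x = a ++ b) (hy : y = a ++ c) :
    uo w (Term.idLeft a t hx hy) = uo (w ++ a) t := op_mor_idLeft _ _ _ _

theorem uo_idRight (w : List ℕ+) (t : Term UpGen b c) (hx : x = b ++ a) (hy : y = c ++ a) :
    uo w (Term.idRight t a hx hy) = uI (w ++ (b ++ a)) * uo w t := op_mor_idRight _ _ _ _

theorem uo_idRight' (w : List ℕ+) (t : Term UpGen b c) (hx : x = b ++ a) (hy : y = c ++ a) :
    uo w (Term.idRight t a hx hy) = uo w t * uI (w ++ (c ++ a)) := op_mor_idRight' _ _ _ _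

theorem uo_ofEq (w : List ℕ+) (h : a = b) : uo w (Term.ofEq h) = uI (w ++ a) := op_mor_ofEq _ h

theorem uo_add (w : List ℕ+) (s t : Term UpGen a b) : uo w (s + t) = uo w s + uo w t :=
  op_mor_add _ _ _

theorem uo_sub (w : List ℕ+) (s t : Term UpGen a b) : uo w (s - t) = uo w s - uo w t :=
  op_mor_sub _ _ _

theorem uo_smul (w : List ℕ+) (r : ℂ) (t : Term UpGen a b) : uo w (r • t) = r • uo w t :=
  op_mor_smul _ _ _

theorem uo_zero (w : List ℕ+) : uo w (0 : Term UpGen a b) = 0 := op_mor_zero (P := upP) _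

theorem uI_mul_uo (t : Term UpGen a b) (h : v <+: w ++ a) : uI v * uo w t = uo w t :=
  pre_mul_op_of_prefix _ h

theorem uo_mul_uI (t : Term UpGen a b) (h : v <+: w ++ b) : uo w t * uI v = uo w t :=
  op_mul_pre_of_prefix _ h

theorem uo_mul_uI_comm (t : Term UpGen a b) (y : List ℕ+) (h : v = w ++ (b ++ y))
    (h' : x = w ++ (a ++ y)) : uo w t * uI v = uI x * uo w t :=
  op_mul_pre_comm_of _ h h'

theorem uo_slide_left {s : Term UpGen a b} (t : Term UpGen c d) (hs : s.HasParity UpGen.par 0)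
    (y : List ℕ+) (h : v = w ++ (b ++ y)) (h' : x = w ++ (a ++ y)) :
    uo w s * uo v t = uo x t * uo w s := op_slide_left _ (mor_even (P := upP) hs) y h h'

theorem uo_slide_right (s : Term UpGen a b) {t : Term UpGen c d} (ht : t.HasParity UpGen.par 0)
    (y : List ℕ+) (h : v = w ++ (b ++ y)) (h' : x = w ++ (a ++ y)) :
    uo w s * uo v t = uo x t * uo w s := op_slide_right _ (mor_even (P := upP) ht) y h h'

theorem uo_slide_odd {s : Term UpGen a b} {t : Term UpGen c d} (hs : s.HasParity UpGen.par 1)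
    (ht : t.HasParity UpGen.par 1) (y : List ℕ+) (h : v = w ++ (b ++ y))
    (h' : x = w ++ (a ++ y)) : uo w s * uo v t = -(uo x t * uo w s) := by
  have h1 : koszul 1 1 = -1 := by
    have h : (1 : ZMod 2).val = 1 := rfl
    simp [koszul, h]
  refine (op_slide (P := upP) ⟨_, hs, rfl⟩ ⟨_, ht, rfl⟩ y h h').trans ?_
  rw [h1, neg_one_smul]
  rfl

theorem uo_mrg_assoc (w : List ℕ+) (i k l : ℕ) {m n r : ℕ} (h₁ : i + k = m) (h₂ : m + l = r)
    (h₃ : k + l = n) (h₄ : i + n = r) : uo w (mrg i k h₁) * uo w (mrg m l h₂) =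
    uo (w ++ up i) (mrg k l h₃) * uo w (mrg i n h₄) := by
  subst h₁ h₃ h₂
  have h := uo_rel w (UpRel.merge_assoc i k l)
  rwa [uo_comp, uo_comp, uo_idRight', uo_idLeft, mul_assoc, uI_mul_uo _ List.prefix_rfl] at h

theorem uo_spl_assoc (w : List ℕ+) (i k l : ℕ) {m n r : ℕ} (h₁ : i + k = m) (h₂ : m + l = r)
    (h₃ : k + l = n) (h₄ : i + n = r) : uo w (spl m l h₂) * uo w (spl i k h₁) =
    uo w (spl i n h₄) * uo (w ++ up i) (spl k l h₃) := by
  subst h₁ h₃ h₂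
  have h := uo_rel w (UpRel.split_assoc i k l)
  rwa [uo_comp, uo_comp, uo_idRight, uo_idLeft, ← mul_assoc, uo_mul_uI _ List.prefix_rfl] at h

theorem uo_digon (w : List ℕ+) (k l : ℕ) {m : ℕ} (h : k + l = m) :
    uo w (spl k l h) * uo w (mrg k l h) = (m.choose l : ℂ) • uI (w ++ up m) := by
  subst h
  have h := uo_rel w (UpRel.digon k l)
  rwa [uo_comp, uo_smul, uo_id] at h

theorem uo_mrg_zero_right (w : List ℕ+) (k : ℕ) (h : k + 0 = k) :
    uo w (mrg k 0 h) = uI (w ++ up k) := by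
  cases k with
  | zero => exact uo_ofEq w (a := up 0 ++ up 0) (b := up 0) rfl
  | succ k => exact (uo_ofEq w (a := up (k + 1) ++ up 0) (b := up (k + 1)) (List.append_nil _))

theorem uo_spl_zero_right (w : List ℕ+) (k : ℕ) (h : k + 0 = k) :
    uo w (spl k 0 h) = uI (w ++ up k) := by
  cases k with
  | zero => exact uo_ofEq w (a := up 0) (b := up 0 ++ up 0) rfl
  | succ k => exact uo_ofEq w (a := up (k + 1)) (b := up (k + 1) ++ up 0) (List.append_nil _).symm

theorem uo_mrg_zero_left (w : List ℕ+) (k : ℕ) (h : 0 + k = k) :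
    uo w (mrg 0 k h) = uI (w ++ up k) := by
  cases k <;> exact uo_ofEq w (a := up 0 ++ up _) (b := up _) rfl

theorem uo_spl_zero_left (w : List ℕ+) (k : ℕ) (h : 0 + k = k) :
    uo w (spl 0 k h) = uI (w ++ up k) := by
  cases k <;> exact uo_ofEq w (a := up _) (b := up 0 ++ up _) rfl

theorem uo_ladE (w : List ℕ+) (ρ : Term UpGen (up 1) (up 1)) (k l : ℕ) : uo w (ladE ρ k l) =
    uo (w ++ up k) (spl 1 l (Nat.add_comm 1 l)) * uo (w ++ up k) ρ * uo w (mrg k 1 rfl) := by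
  rw [ladE, uo_comp, uo_idLeft, uo_comp, uo_idRight, uo_idRight, ← mul_assoc (uo _ (spl _ _ _)),
    uo_mul_uI _ List.prefix_rfl, mul_assoc, ← mul_assoc (uo _ ρ),
    uo_mul_uI_comm ρ (up l) (x := w ++ up k ++ (up 1 ++ up l)), ← mul_assoc, ← mul_assoc,
    uo_mul_uI _ List.prefix_rfl]
  · simp
  · simp

theorem uo_ladF (w : List ℕ+) (ρ : Term UpGen (up 1) (up 1)) (k l : ℕ) : uo w (ladF ρ k l) =
    uo w (spl k 1 rfl) * uo (w ++ up k) ρ * uo (w ++ up k) (mrg 1 l (Nat.add_comm 1 l)) := by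
  rw [ladF, uo_comp, uo_idLeft, uo_idRight', uo_comp, uo_idLeft, mul_assoc, uI_mul_uo]
  simp

/-- The thin merge `↑₁ ↑ₗ → ↑ₗ₊₁`. -/
noncomputable def thinMerge (w : List ℕ+) (l : ℕ) : Ops upP := uo w (mrg 1 l (Nat.add_comm 1 l))

/-- The thin split `↑ₗ₊₁ → ↑₁ ↑ₗ`. -/
noncomputable def thinSplit (w : List ℕ+) (l : ℕ) : Ops upP := uo w (spl 1 l (Nat.add_comm 1 l))

/-- The thin crossing. -/
noncomputable def thinX (w : List ℕ+) : Ops upP := uo w thinCross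

theorem uo_dumbbell (w : List ℕ+) : uo w dumbbell = thinX w + uI (w ++ (up 1 ++ up 1)) := by
  rw [thinX, thinCross, uo_sub, uo_id, sub_add_cancel]

theorem uo_dumbbell' (w : List ℕ+) : uo w dumbbell = thinMerge w 1 * thinSplit w 1 := uo_comp _ _ _

theorem thinSplit_mul_thinMerge (w : List ℕ+) (l : ℕ) :
    thinSplit w l * thinMerge w l = ((l + 1 : ℕ) : ℂ) • uI (w ++ up (l + 1)) := by
  rw [thinSplit, thinMerge, uo_digon, Nat.choose_succ_self_right]

theorem up_zero : up 0 = [] := rfl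

theorem thinMerge_zero (w : List ℕ+) : thinMerge w 0 = uI (w ++ up 1) := uo_mrg_zero_right w 1 _

theorem thinSplit_zero (w : List ℕ+) : thinSplit w 0 = uI (w ++ up 1) := uo_spl_zero_right w 1 _

theorem uI_mul_uI (h : v <+: w) : uI v * uI w = uI w := pre_mul_pre_of_prefix h

theorem uI_mul_uI' (h : v <+: w) : uI w * uI v = uI w := pre_mul_pre_of_prefix' h

theorem uo_mul_thinX (w : List ℕ+) (t : Term UpGen a b) :
    uo (w ++ (up 1 ++ up 1)) t * thinX w = thinX w * uo (w ++ (up 1 ++ up 1)) t :=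
  (uo_slide_left t thinCross_parity [] (by simp) (by simp)).symm

theorem dumbbell_eq (w : List ℕ+) :
    uo w (mrg 1 1 rfl) * uo w (spl 1 1 rfl) = thinX w + uI (w ++ (up 1 ++ up 1)) := by
  rw [← uo_dumbbell, dumbbell, uo_comp]

theorem thinMerge_mul_thinSplit (w : List ℕ+) (l : ℕ) :
    thinMerge w (l + 1) * thinSplit w (l + 1) = uI (w ++ (up 1 ++ up (l + 1))) +
      thinSplit (w ++ up 1) l * thinX w * thinMerge (w ++ up 1) l := by
  have h := uo_rel w (UpRel.square_switch 1 (l + 1))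
  have e1 : uo w (spl 0 1 rfl) = uI (w ++ up 1) := uo_spl_zero_left w 1 _
  have e2 : uo w (mrg 0 1 rfl) = uI (w ++ up 1) := uo_mrg_zero_left w 1 _
  have e4 := thinSplit_mul_thinMerge (w ++ up 1) l
  have e5 : thinSplit (w ++ up 1) l * (thinX w + uI (w ++ (up 1 ++ up 1))) *
      thinMerge (w ++ up 1) l = thinSplit (w ++ up 1) l * thinX w * thinMerge (w ++ up 1) l +
      ((l + 1 : ℕ) : ℂ) • uI (w ++ (up 1 ++ up (l + 1))) := by
    rw [mul_add, add_mul, thinSplit, uo_mul_uI _ (by simp), ← thinSplit, e4, List.append_assoc]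
  rw [uo_sub, ladFE, ladEF, uo_comp, uo_comp, uo_ladE, uo_ladE, uo_ladF, uo_ladF, uo_smul, uo_id,
    e1, e2, uo_id, uo_id] at h
  simp only [up_zero, List.append_nil] at h
  rw [uI_mul_uI' List.prefix_rfl, uI_mul_uo _ (by simp), uo_mul_uI _ (by simp),
    uo_mul_uI _ (by simp), uo_mul_uI _ (by simp), uo_mul_uI _ (by simp), mul_assoc (uo (w ++ up 1) (spl 1 l _)), ← mul_assoc (uo w (mrg 1 1 _)), dumbbell_eq,
    ← mul_assoc (uo (w ++ up 1) (spl 1 l _))] at h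
  change thinMerge w (l + 1) * thinSplit w (l + 1) - thinSplit (w ++ up 1) l *
    (thinX w + uI (w ++ (up 1 ++ up 1))) * thinMerge (w ++ up 1) l = _ at h
  rw [e5, sub_eq_iff_eq_add] at h
  rw [h]
  push_cast
  module

theorem mrg_mul_spl_two_one (w : List ℕ+) (h : 2 + 1 = 3) :
    uo w (mrg 2 1 h) * uo w (spl 2 1 h) = uI (w ++ (up 2 ++ up 1)) +
      thinSplit w 1 * thinX (w ++ up 1) * thinMerge w 1 := by
  have e4 := thinSplit_mul_thinMerge w 1
  have e5 : thinSplit w 1 * (thinX (w ++ up 1) + uI (w ++ up 1 ++ (up 1 ++ up 1))) *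
      thinMerge w 1 = thinSplit w 1 * thinX (w ++ up 1) * thinMerge w 1 +
      (2 : ℂ) • uI (w ++ (up 2 ++ up 1)) := by
    rw [mul_add, add_mul]
    congr 1
    have := uo_mul_uI_comm (w := w) (spl 1 1 rfl) (up 1) (v := w ++ up 1 ++ (up 1 ++ up 1))
      (x := w ++ (up 2 ++ up 1)) (by simp) rfl
    rw [thinSplit, this, mul_assoc, ← thinSplit, e4, mul_smul_comm, uI_mul_uI' (by simp)]
    norm_num
  have h := uo_rel w (UpRel.square_switch 2 1)
  have e1 : uo (w ++ up 2) (spl 1 0 rfl) = uI (w ++ up 2 ++ up 1) := uo_spl_zero_right _ 1 _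
  have e2 : uo (w ++ up 2) (mrg 1 0 rfl) = uI (w ++ up 2 ++ up 1) := uo_mrg_zero_right _ 1 _
  rw [uo_sub, ladFE, ladEF, uo_comp, uo_comp, uo_ladE, uo_ladE, uo_ladF, uo_ladF, uo_smul, uo_id,
    uo_id, uo_id, e1, e2, uI_mul_uI List.prefix_rfl, uI_mul_uo _ (by simp), uo_mul_uI _ (by simp),
    uo_mul_uI _ (by simp), uo_mul_uI _ (by simp), uo_mul_uI _ (by simp),
    mul_assoc (uo w (spl 1 1 _)), ← mul_assoc (uo (w ++ up 1) (mrg 1 1 _)), dumbbell_eq,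
    ← mul_assoc (uo w (spl 1 1 _))] at h
  change thinSplit w 1 * (thinX (w ++ up 1) + uI (w ++ up 1 ++ (up 1 ++ up 1))) *
      thinMerge w 1 - uo w (mrg 2 1 _) * uo w (spl 2 1 _) = _ at h
  rw [e5, sub_eq_iff_eq_add] at h
  rw [eq_sub_of_add_eq' h.symm]
  push_cast
  module

theorem thinX_mul_uI (h : v <+: w ++ (up 1 ++ up 1)) : thinX w * uI v = thinX w := uo_mul_uI _ h

theorem uI_mul_thinX (h : v <+: w ++ (up 1 ++ up 1)) : uI v * thinX w = thinX w := uI_mul_uo _ h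

theorem thinX_mul_thinX (w : List ℕ+) : thinX w * thinX w = uI (w ++ (up 1 ++ up 1)) := by
  have h : uo w dumbbell * uo w dumbbell = (2 : ℂ) • uo w dumbbell := by
    have := thinSplit_mul_thinMerge w 1
    rw [uo_dumbbell', mul_assoc, ← mul_assoc (thinSplit w 1), this, smul_mul_assoc, mul_smul_comm,
      thinSplit, uI_mul_uo _ List.prefix_rfl]
    norm_num
  rw [uo_dumbbell, add_mul, mul_add, mul_add, thinX_mul_uI List.prefix_rfl,
    uI_mul_thinX List.prefix_rfl, uI_mul_uI List.prefix_rfl] at h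
  rw [add_assoc] at h
  rw [eq_sub_of_add_eq h]
  module

theorem braid_of_dumbbells {R : Type*} [Ring R] {s t i : R}
    (h1 : i * s = s) (h2 : s * i = s) (h3 : i * t = t) (h4 : t * i = t)
    (h : (s + i) + (s + i) * t * (s + i) = (t + i) + (t + i) * s * (t + i)) :
    s * t * s = t * s * t := by
  simp only [add_mul, mul_add, h1, h2, h3, h4, mul_assoc] at h ⊢
  have : s * (t * s) - t * (s * t) = 0 := by
    rw [← sub_eq_zero] at h
    rw [← h]
    abel
  exact sub_eq_zero.mp this

theorem thinX_braid (w : List ℕ+) :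
    thinX w * thinX (w ++ up 1) * thinX w = thinX (w ++ up 1) * thinX w * thinX (w ++ up 1) := by
  set J := uI (w ++ (up 1 ++ (up 1 ++ up 1))) with hJ
  have hc : thinX w * J = J * thinX w := uo_mul_uI_comm _ (up 1) (by simp) (by simp)
  have hJ2 : thinX (w ++ up 1) * J = thinX (w ++ up 1) := uo_mul_uI _ (by simp)
  have hJ3 : J * thinX (w ++ up 1) = thinX (w ++ up 1) := uI_mul_uo _ (by simp)
  have hJJ : J * J = J := uI_mul_uI List.prefix_rfl
  have hm : thinMerge w 1 * uo w (mrg 2 1 rfl) = thinMerge (w ++ up 1) 1 * thinMerge w 2 :=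
    uo_mrg_assoc w 1 1 1 _ _ _ _
  have hsp : uo w (spl 2 1 rfl) * thinSplit w 1 = thinSplit w 2 * thinSplit (w ++ up 1) 1 :=
    uo_spl_assoc w 1 1 1 _ _ _ _
  have h1 := mrg_mul_spl_two_one w rfl
  have h2 := thinMerge_mul_thinSplit w 1
  have h3 : thinMerge w 1 * (uo w (mrg 2 1 rfl) * uo w (spl 2 1 rfl)) * thinSplit w 1 =
      thinMerge (w ++ up 1) 1 * (thinMerge w 2 * thinSplit w 2) * thinSplit (w ++ up 1) 1 := by
    rw [← mul_assoc, hm, mul_assoc, hsp]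
    simp only [mul_assoc]
  have hd : thinMerge w 1 * thinSplit w 1 = thinX w + uI (w ++ (up 1 ++ up 1)) := dumbbell_eq w
  have hd' : thinMerge (w ++ up 1) 1 * thinSplit (w ++ up 1) 1 = thinX (w ++ up 1) + J := by
    have := dumbbell_eq (w ++ up 1)
    rwa [List.append_assoc w] at this
  have k1 : thinMerge w 1 * (uI (w ++ (up 2 ++ up 1)) + thinSplit w 1 * thinX (w ++ up 1) * thinMerge w 1)
      * thinSplit w 1 = (J * thinX w + J) + (J * thinX w + J) * thinX (w ++ up 1) * (J * thinX w + J) := by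
    have a1 : thinMerge w 1 * uI (w ++ (up 2 ++ up 1)) = J * thinMerge w 1 :=
      uo_mul_uI_comm _ (up 1) (by simp) rfl
    have a2 : (thinX w + uI (w ++ (up 1 ++ up 1))) * J = J * thinX w + J := by
      rw [add_mul, hc, uI_mul_uI (by simp)]
    have a3 : J * (thinX w + uI (w ++ (up 1 ++ up 1))) = J * thinX w + J := by
      rw [mul_add, uI_mul_uI' (by simp)]
    rw [mul_add, add_mul, a1, mul_assoc, hd, a3]
    congr 1
    rw [mul_assoc, mul_assoc, hd, ← mul_assoc, ← mul_assoc, hd, ← hJ3, ← hJ2,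
      ← mul_assoc, ← mul_assoc, a2, mul_assoc _ J, a3, hJ2, hJ3]
  have k2 : thinMerge (w ++ up 1) 1 * (uI (w ++ (up 1 ++ up (1 + 1))) +
      thinSplit (w ++ up 1) 1 * thinX w * thinMerge (w ++ up 1) 1) * thinSplit (w ++ up 1) 1 =
      (thinX (w ++ up 1) + J) + (thinX (w ++ up 1) + J) * (J * thinX w) * (thinX (w ++ up 1) + J) := by
    have a1 : thinMerge (w ++ up 1) 1 * uI (w ++ (up 1 ++ up (1 + 1))) = thinMerge (w ++ up 1) 1 :=
      uo_mul_uI _ (by simp)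
    have a2 : (thinX (w ++ up 1) + J) * J = thinX (w ++ up 1) + J := by rw [add_mul, hJ2, hJJ]
    rw [mul_add, add_mul, a1, hd', ← mul_assoc _ J, a2]
    congr 1
    rw [← hd']
    simp only [mul_assoc]
  rw [h1, h2, k1, k2] at h3
  have h4 := braid_of_dumbbells (s := J * thinX w) (t := thinX (w ++ up 1)) (i := J)
    (by rw [← mul_assoc, hJJ]) (by rw [← hc, mul_assoc, hJJ]) hJ3 hJ2 h3
  have k3 : thinX w * thinX (w ++ up 1) * thinX w =
      (thinX w * J) * thinX (w ++ up 1) * (J * thinX w) := by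
    rw [mul_assoc _ J, hJ3, ← mul_assoc _ J, mul_assoc _ _ J, hJ2]
  rw [k3, hc, h4, ← mul_assoc, hJ2]

/-! ### Dots and thin crossings -/

theorem dot_slide_of_anticommute {R : Type*} [Ring R] [Algebra ℂ R] {a b s i : R}
    (ai : a * i = a) (bi : b * i = b) (is : i * s = s)
    (aa : a * a = i) (bb : b * b = i) (ab : a * b = -(b * a))
    (hs : s = b * a * s * (b * a)) (hc : (a + b) * s = s * (a + b)) :
    a * s = s * b := by
  have hD : b * a * (b * a) = -i := by
    rw [mul_assoc, ← mul_assoc a, ab, neg_mul, mul_assoc, aa, mul_neg, bi, bb]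
  have h1 : b * a * s = -(s * (b * a)) := by
    calc b * a * s = b * a * (b * a) * s * (b * a) := by
          conv_lhs => rw [hs]
          simp only [mul_assoc]
      _ = _ := by rw [hD, neg_mul, neg_mul, is]
  have h2 : a - b = (a + b) * (b * a) := by
    rw [add_mul, ← mul_assoc, ab, neg_mul, mul_assoc, aa, bi, ← mul_assoc, bb]
    have : i * a = a := by rw [← aa, mul_assoc, aa, ai]
    rw [this]
    abel
  have h3 : (a - b) * s = -(s * (a - b)) := by
    rw [h2, mul_assoc, h1, mul_neg, ← mul_assoc, hc, mul_assoc]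
  have h4 : (2 : ℂ) • (a * s) = (2 : ℂ) • (s * b) := by
    have h5 : (a + b) * s + (a - b) * s = s * (a + b) + -(s * (a - b)) := by rw [hc, h3]
    have h6 : a * s + a * s = s * b + s * b := by
      simp only [add_mul, sub_mul, mul_add, mul_sub] at h5
      have h7 : a * s + a * s = a * s + b * s + (a * s - b * s) := by abel
      rw [h7, h5]
      abel
    rw [two_smul, two_smul, h6]
  have h5 := congrArg ((2 : ℂ)⁻¹ • ·) h4
  simpa using h5

/-- The thin dot. -/
noncomputable def thinD (w : List ℕ+) : Ops upP := uo w (dt 1)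

theorem thinD_mul_thinD (w : List ℕ+) : thinD w * thinD w = uI (w ++ up 1) := by
  have h := uo_rel w (UpRel.dot_dot 1)
  rw [uo_comp, uo_smul, uo_id, Nat.cast_one, one_smul] at h
  exact h

theorem thinD_mul_thinX (w : List ℕ+) : thinD w * thinX w = thinX w * thinD (w ++ up 1) := by
  set J := uI (w ++ (up 1 ++ up 1)) with hJ
  have hc : thinD w * J = J * thinD w := uo_mul_uI_comm (dt 1) (up 1) (by simp) (by simp)
  have hb : thinD (w ++ up 1) * J = thinD (w ++ up 1) := uo_mul_uI _ (by simp)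
  have hb' : J * thinD (w ++ up 1) = thinD (w ++ up 1) := uI_mul_uo _ (by simp)
  have hX : J * thinX w = thinX w := uI_mul_thinX List.prefix_rfl
  have hX' : thinX w * J = thinX w := thinX_mul_uI List.prefix_rfl
  have hJJ : J * J = J := uI_mul_uI List.prefix_rfl
  have hab : thinD w * thinD (w ++ up 1) = -(thinD (w ++ up 1) * thinD w) :=
    uo_slide_odd (dt_parity 1) (dt_parity 1) [] (by simp) (by simp)
  have hD : thinD (w ++ up 1) * (J * thinD w) = thinD (w ++ up 1) * thinD w := by
    rw [← mul_assoc, hb]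
  have hDD : thinD (w ++ up 1) * thinD w * (thinD (w ++ up 1) * thinD w) = -J := by
    rw [mul_assoc, ← mul_assoc (thinD w), hab, neg_mul, mul_assoc, thinD_mul_thinD, mul_neg,
      ← mul_assoc, thinD_mul_thinD, uI_mul_uI' (by simp), List.append_assoc]
  have key := dot_slide_of_anticommute (a := J * thinD w) (b := thinD (w ++ up 1)) (s := thinX w)
    (i := J) (by rw [← hc, mul_assoc, hJJ]) hb hX
    (by rw [mul_assoc, ← mul_assoc (thinD w), hc, mul_assoc, thinD_mul_thinD,
          uI_mul_uI' (by simp), hJJ])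
    (by rw [thinD_mul_thinD, List.append_assoc])
    (by rw [hD, mul_assoc J, hab, mul_neg, ← mul_assoc, hb']) ?_ ?_
  · rw [← hX, ← mul_assoc, hc, key, hX]
  · rw [hD]
    have h := uo_rel w UpRel.dumbbell
    rw [uo_add, uo_comp, uo_comp, uo_tens, uo_smul, uo_id, uo_dumbbell] at h
    change thinX w + J = (2 : ℂ) • J + thinD (w ++ up 1) * thinD w * ((thinX w + J) *
      (thinD (w ++ up 1) * thinD w)) at h
    rw [add_mul, mul_add, ← mul_assoc J, hb', hDD] at h
    rw [mul_assoc]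
    refine (eq_sub_of_add_eq h).trans ?_
    module
  · have h1 := uo_rel w (UpRel.dot_merge 1 1)
    have h2 := uo_rel w (UpRel.dot_split 1 1)
    rw [uo_comp, uo_add, uo_comp, uo_comp, uo_idRight, uo_idLeft] at h1
    rw [uo_comp, uo_add, uo_comp, uo_comp, uo_idRight', uo_idLeft] at h2
    change uo w (mrg 1 1 rfl) * uo w (dt 2) = J * thinD w * uo w (mrg 1 1 rfl) +
      thinD (w ++ up 1) * uo w (mrg 1 1 rfl) at h1
    change uo w (dt 2) * uo w (spl 1 1 rfl) = uo w (spl 1 1 rfl) * (thinD w * J) +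
      uo w (spl 1 1 rfl) * thinD (w ++ up 1) at h2
    rw [← add_mul] at h1
    rw [← mul_add, hc] at h2
    have h3 : (J * thinD w + thinD (w ++ up 1)) * (thinX w + J) =
        (thinX w + J) * (J * thinD w + thinD (w ++ up 1)) := by
      rw [← dumbbell_eq, ← mul_assoc, ← h1, mul_assoc, h2, mul_assoc]
    have h4 : (J * thinD w + thinD (w ++ up 1)) * J = J * (J * thinD w + thinD (w ++ up 1)) := by
      rw [add_mul, mul_add, hb, hb', mul_assoc, hc]
    rw [mul_add, add_mul _ J, h4] at h3
    exact add_right_cancel h3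

theorem thinD_mul_thinX' (w : List ℕ+) : thinD (w ++ up 1) * thinX w = thinX w * thinD w := by
  have hc : thinD w * uI (w ++ (up 1 ++ up 1)) = uI (w ++ (up 1 ++ up 1)) * thinD w :=
    uo_mul_uI_comm (dt 1) (up 1) (by simp) (by simp)
  have h : thinX w * (thinD w * thinX w) * thinX w =
      thinX w * (thinX w * thinD (w ++ up 1)) * thinX w := by rw [thinD_mul_thinX]
  have hb' : uI (w ++ (up 1 ++ up 1)) * thinD (w ++ up 1) = thinD (w ++ up 1) :=
    uI_mul_uo _ (by simp)
  rw [mul_assoc, mul_assoc, thinX_mul_thinX, ← mul_assoc (thinX w) (thinX w), thinX_mul_thinX,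
    hc, ← mul_assoc, thinX_mul_uI List.prefix_rfl, hb'] at h
  exact h.symm

/-! ### Explosions and implosions -/

/-- The operator of an explosion. -/
noncomputable def ex (w : List ℕ+) (k : ℕ) : Ops upP := uo w (explode k)

/-- The operator of an implosion. -/
noncomputable def im (w : List ℕ+) (k : ℕ) : Ops upP := uo w (implode k)

theorem ex_zero (w : List ℕ+) : ex w 0 = uI w := by
  refine (uo_id w []).trans ?_
  rw [List.append_nil]

theorem im_zero (w : List ℕ+) : im w 0 = uI w := by
  refine (uo_id w []).trans ?_
  rw [List.append_nil]

theorem ex_succ (w : List ℕ+) (k : ℕ) : ex w (k + 1) = thinSplit w k * ex (w ++ up 1) k := by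
  rw [ex, explode, uo_comp]
  exact congrArg _ (uo_idLeft w (a := up 1) (explode k) rfl rfl)

theorem im_succ (w : List ℕ+) (k : ℕ) : im w (k + 1) = im (w ++ up 1) k * thinMerge w k := by
  rw [im, implode, uo_comp]
  exact congrArg (· * _) (uo_idLeft w (a := up 1) (implode k) rfl rfl)

theorem ex_one (w : List ℕ+) : ex w 1 = uI (w ++ up 1) := by
  rw [ex_succ, thinSplit_zero, ex_zero, uI_mul_uI List.prefix_rfl]

theorem im_one (w : List ℕ+) : im w 1 = uI (w ++ up 1) := by
  rw [im_succ, thinMerge_zero, im_zero, uI_mul_uI List.prefix_rfl]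

theorem ex_mul_im (w : List ℕ+) (k : ℕ) :
    ex w k * im w k = (k.factorial : ℂ) • uI (w ++ up k) := by
  induction k generalizing w with
  | zero => rw [ex_zero, im_zero, uI_mul_uI List.prefix_rfl, up_zero, List.append_nil]; simp
  | succ k ih =>
    rw [ex_succ, im_succ, mul_assoc, ← mul_assoc (ex _ k), ih, smul_mul_assoc, mul_smul_comm,
      thinMerge, uI_mul_uo _ (by simp), ← thinMerge, thinSplit_mul_thinMerge, smul_smul]
    simp [Nat.factorial_succ, mul_comm]

theorem ex_mul_uI (w : List ℕ+) (k : ℕ) (h : v <+: w ++ ones k) : ex w k * uI v = ex w k :=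
  uo_mul_uI _ h

theorem uI_mul_ex (w : List ℕ+) (k : ℕ) (h : v <+: w ++ up k) : uI v * ex w k = ex w k :=
  uI_mul_uo _ h

theorem im_mul_uI (w : List ℕ+) (k : ℕ) (h : v <+: w ++ up k) : im w k * uI v = im w k :=
  uo_mul_uI _ h

theorem uI_mul_im (w : List ℕ+) (k : ℕ) (h : v <+: w ++ ones k) : uI v * im w k = im w k :=
  uI_mul_uo _ h

/-- An implosion followed by an explosion. -/
noncomputable def sym (w : List ℕ+) (k : ℕ) : Ops upP := im w k * ex w k

theorem sym_mul_im (w : List ℕ+) (k : ℕ) : sym w k * im w k = (k.factorial : ℂ) • im w k := by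
  rw [sym, mul_assoc, ex_mul_im, mul_smul_comm, im_mul_uI _ _ List.prefix_rfl]

theorem ex_mul_sym (w : List ℕ+) (k : ℕ) : ex w k * sym w k = (k.factorial : ℂ) • ex w k := by
  rw [sym, ← mul_assoc, ex_mul_im, smul_mul_assoc, uI_mul_ex _ _ List.prefix_rfl]

theorem fac_smul_inj {k : ℕ} {F G : Ops upP} (h : (k.factorial : ℂ) • F = (k.factorial : ℂ) • G) :
    F = G := by
  have hk : (k.factorial : ℂ) ≠ 0 := Nat.cast_ne_zero.mpr k.factorial_ne_zero
  simpa [smul_smul, hk] using congrArg ((k.factorial : ℂ)⁻¹ • ·) h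

theorem sym_succ_succ (w : List ℕ+) (k : ℕ) : sym w (k + 2) = sym (w ++ up 1) (k + 1) +
    (1 / (k.factorial : ℂ) ^ 2) • (sym (w ++ up 1) (k + 1) * thinX w *
      sym (w ++ up 1 ++ up 1) k * sym (w ++ up 1) (k + 1)) := by
  have hk : (k.factorial : ℂ) ≠ 0 := Nat.cast_ne_zero.mpr k.factorial_ne_zero
  have h1 : im (w ++ up 1) (k + 1) * thinSplit (w ++ up 1) k =
      (1 / (k.factorial : ℂ)) • (sym (w ++ up 1) (k + 1) * im (w ++ up 1 ++ up 1) k) := by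
    rw [sym, ex_succ, mul_assoc, mul_assoc, ex_mul_im, mul_smul_comm, mul_smul_comm, smul_smul,
      one_div_mul_cancel hk, one_smul, thinSplit, uo_mul_uI _ (by simp)]
  have h2 : thinMerge (w ++ up 1) k * ex (w ++ up 1) (k + 1) =
      (1 / (k.factorial : ℂ)) • (ex (w ++ up 1 ++ up 1) k * sym (w ++ up 1) (k + 1)) := by
    rw [sym, im_succ, ← mul_assoc, ← mul_assoc, ex_mul_im, smul_mul_assoc, smul_mul_assoc, smul_smul,
      one_div_mul_cancel hk, one_smul, thinMerge, uI_mul_uo _ (by simp)]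
  have h3 : im (w ++ up 1 ++ up 1) k * thinX w = thinX w * im (w ++ up 1 ++ up 1) k := by
    rw [List.append_assoc]
    exact uo_mul_thinX w _
  rw [sym, ex_succ w, im_succ w, mul_assoc, ← mul_assoc (thinMerge w _), thinMerge_mul_thinSplit,
    add_mul, mul_add, uI_mul_ex _ _ (by simp), ← sym]
  congr 1
  rw [mul_assoc, h2, ← mul_assoc, ← mul_assoc, h1, smul_mul_assoc, mul_assoc _ _ (thinX w), h3,
    mul_smul_comm, smul_mul_assoc, smul_smul]
  have h4 : sym (w ++ up 1 ++ up 1) k = im (w ++ up 1 ++ up 1) k * ex (w ++ up 1 ++ up 1) k := rfl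
  rw [one_div_mul_one_div, ← sq, h4]
  simp only [mul_assoc]

/-! ### Thin crossings and thick crossings -/

/-- The operator of `thinPass`. -/
noncomputable def tp (w : List ℕ+) (l : ℕ) : Ops upP := uo w (thinPass l)

theorem tp_zero (w : List ℕ+) : tp w 0 = uI (w ++ up 1) :=
  uo_ofEq w (a := up 1 ++ ones 0) (b := ones 0 ++ up 1) rfl

theorem tp_succ (w : List ℕ+) (l : ℕ) : tp w (l + 1) = thinX w * tp (w ++ up 1) l := by
  rw [tp, thinPass, uo_comp]
  refine (congrArg₂ (· * ·) (uo_idRight' w (a := ones l) thinCross rfl rfl)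
    (uo_idLeft w (a := up 1) (thinPass l) rfl rfl)).trans ?_
  rw [mul_assoc, uI_mul_uo _ (by simp)]
  rfl

/-- The operator of `thinGrid`. -/
noncomputable def tg (w : List ℕ+) (k l : ℕ) : Ops upP := uo w (thinGrid k l)

theorem tg_zero (w : List ℕ+) (l : ℕ) : tg w 0 l = uI (w ++ ones l) :=
  uo_ofEq w (a := ones 0 ++ ones l) (b := ones l ++ ones 0) (List.append_nil _).symm

theorem tg_succ (w : List ℕ+) (k l : ℕ) : tg w (k + 1) l = tg (w ++ up 1) k l * tp w l := by
  rw [tg, thinGrid, uo_comp]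
  refine (congrArg₂ (· * ·) (uo_idLeft w (a := up 1) (thinGrid k l) rfl rfl)
    (uo_idRight w (a := ones k) (x := up 1 ++ (ones l ++ ones k))
      (y := ones l ++ (up 1 ++ ones k)) (thinPass l) (by simp) (by simp))).trans ?_
  rw [← mul_assoc, uo_mul_uI _ (by simp)]
  rfl

theorem uo_thickCross (w : List ℕ+) (k l : ℕ) :
    uo w (thickCross k.succPNat l.succPNat) =
      (1 / (((k + 1).factorial : ℂ) * ((l + 1).factorial : ℂ))) •
        (ex (w ++ up (k + 1)) (l + 1) * ex w (k + 1) * (tg w (k + 1) (l + 1) *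
          (im (w ++ ones (l + 1)) (k + 1) * im w (l + 1)))) := by
  rw [thickCross, uo_smul, uo_comp, uo_comp]
  refine congrArg _ (congrArg₂ (· * ·) (uo_tensor w (explode (k + 1)) (explode (l + 1)) _ _)
    (congrArg _ (uo_tensor w (implode (l + 1)) (implode (k + 1)) _ _)))

theorem uo_thickCross_one_one (w : List ℕ+) :
    uo w (thickCross (Nat.succPNat 0) (Nat.succPNat 0)) = thinX w := by
  rw [uo_thickCross, zero_add, ex_one, ex_one, im_one, im_one, tg_succ, tp_succ, tp_zero, tg_zero]
  change _ • (uI (w ++ up 1 ++ up 1) * uI (w ++ up 1) * (uI (w ++ up 1 ++ up 1) *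
    (thinX w * uI (w ++ up 1 ++ up 1)) * (uI (w ++ up 1 ++ up 1) * uI (w ++ up 1)))) = _
  rw [uI_mul_uI' (by simp), thinX_mul_uI (by simp), uI_mul_thinX (by simp), thinX_mul_uI (by simp),
    uI_mul_thinX (by simp)]
  simp

theorem thickCross_even : EvenCrossings (P := upP) thickCross := thickCross_parity

/-- The operator of the crossing of upward words. -/
noncomputable abbrev uc (w a b : List ℕ+) : Ops upP := cr (P := upP) thickCross w a b

theorem uc_one_one (w : List ℕ+) : uc w (up 1) (up 1) = thinX w :=
  (cr_singleton_singleton (P := upP) thickCross w (Nat.succPNat 0) (Nat.succPNat 0)).trans (uo_thickCross_one_one w)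

theorem uc_up_one (w : List ℕ+) (l : ℕ) : uc w (up 1) (ones l) = tp w l := by
  induction l generalizing w with
  | zero => rw [tp_zero]; exact cr_nil_right _ _ _
  | succ l ih =>
    rw [tp_succ, ← ih, ← uc_one_one]
    exact cr_singleton_append (P := upP) (X := thickCross) w (Nat.succPNat 0) (up 1) (ones l)

theorem uc_ones (w : List ℕ+) (k l : ℕ) : uc w (ones k) (ones l) = tg w k l := by
  induction k generalizing w with
  | zero => rw [tg_zero]; exact cr_nil_left _ _ _
  | succ k ih =>
    rw [tg_succ, ← ih, ← uc_up_one]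
    exact cr_append_left (P := upP) thickCross w (up 1) (ones k) (ones l)

theorem symm_one_one : Symm (P := upP) (X := thickCross) (Nat.succPNat 0) (Nat.succPNat 0) := by
  intro w
  change uo w (thickCross _ _) * uo w (thickCross _ _) = _
  rw [uo_thickCross_one_one, thinX_mul_thinX]
  rfl

theorem mem_ones {x : ℕ+} {k : ℕ} (h : x ∈ ones k) : x = Nat.succPNat 0 := by
  induction k with
  | zero => exact absurd h List.not_mem_nil
  | succ k ih =>
    rcases List.mem_cons.mp (show x ∈ Nat.succPNat 0 :: ones k from h) with h | h
    · exact h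
    · exact ih h

/-- A strand of thickness one may be moved across a web. -/
def ThinPasses (t : Term UpGen a b) : Prop :=
  Passes (P := upP) thickCross (Nat.succPNat 0) (mor (P := upP) t)

theorem thinPasses_iff (t : Term UpGen a b) :
    ThinPasses t ↔ ∀ w, uo (w ++ up 1) t * uc w (up 1) b = uc w (up 1) a * uo w t := Iff.rfl

theorem thinPasses_dt_one : ThinPasses (dt 1) := by
  rw [thinPasses_iff]
  intro w
  rw [uc_one_one]
  exact thinD_mul_thinX' w

theorem thinPasses_thinCross : ThinPasses thinCross := by
  rw [thinPasses_iff]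
  intro w
  have : uc w (up 1) (up 1 ++ up 1) = thinX w * thinX (w ++ up 1) := by
    rw [← uc_one_one, ← uc_one_one]
    exact cr_append_right (P := upP) thickCross_even _ _ _ _
  rw [this, ← mul_assoc]
  exact (thinX_braid w).symm

theorem ThinPasses.congr {s t : Term UpGen a b} (h : ∀ w, uo w s = uo w t) (ht : ThinPasses t) :
    ThinPasses s := by
  rw [thinPasses_iff] at *
  simpa only [h] using ht

theorem ThinPasses.comp {s : Term UpGen a b} {t : Term UpGen b c} (hs : ThinPasses s)
    (ht : ThinPasses t) : ThinPasses (s ⨟ t) := Passes.comp (P := upP) hs ht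

theorem ThinPasses.add {s t : Term UpGen a b} (hs : ThinPasses s)
    (ht : ThinPasses t) : ThinPasses (s + t) := Passes.add (P := upP) hs ht

theorem ThinPasses.smul {t : Term UpGen a b} (r : ℂ) (ht : ThinPasses t) : ThinPasses (r • t) :=
  Passes.smul (P := upP) r ht

theorem ThinPasses.id (a : List ℕ+) : ThinPasses (.id a) := Passes.id (P := upP) a

theorem ThinPasses.zero : ThinPasses (0 : Term UpGen a b) := Passes.zero (P := upP)

theorem ThinPasses.ofEq (h : a = b) : ThinPasses (.ofEq h) := Passes.ofEq (P := upP) h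

theorem ThinPasses.tensor {s : Term UpGen a b} {t : Term UpGen c d} (hs : ThinPasses s)
    (ht : ThinPasses t) (hx : x = a ++ c) (hy : y = b ++ d) : ThinPasses (s.tensor t hx hy) :=
  Passes.tens (P := upP) thickCross_even hs ht hx hy

theorem ThinPasses.idLeft {t : Term UpGen b c} (ht : ThinPasses t) (hx : x = a ++ b)
    (hy : y = a ++ c) : ThinPasses (Term.idLeft a t hx hy) := .tensor (.id a) ht hx hy

theorem ThinPasses.idRight {t : Term UpGen b c} (ht : ThinPasses t) (hx : x = b ++ a)
    (hy : y = c ++ a) : ThinPasses (Term.idRight t a hx hy) := .tensor ht (.id a) hx hy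

/-- An implosion followed by an explosion. -/
def symTerm (k : ℕ) : Term UpGen (ones k) (ones k) := implode k ⨟ explode k

theorem uo_symTerm (w : List ℕ+) (k : ℕ) : uo w (symTerm k) = sym w k := uo_comp _ _ _

theorem thinPasses_symTerm : ∀ k : ℕ, ThinPasses (symTerm k)
  | 0 => .congr (t := .id []) (fun w => by
      rw [uo_symTerm, sym, ex_zero, im_zero, uI_mul_uI List.prefix_rfl]
      exact ((uo_id w []).trans (by rw [List.append_nil])).symm) (.id [])
  | 1 => .congr (t := .id (up 1)) (fun w => by
      rw [uo_symTerm, sym, ex_one, im_one, uI_mul_uI List.prefix_rfl]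
      exact (uo_id w (up 1)).symm) (.id (up 1))
  | k + 2 => by
    have h1 : ThinPasses (Term.idLeft (up 1) (symTerm (k + 1)) rfl rfl :
        Term UpGen (ones (k + 2)) (ones (k + 2))) := (thinPasses_symTerm (k + 1)).idLeft _ _
    have h2 : ThinPasses (Term.idRight thinCross (ones k) rfl rfl :
        Term UpGen (ones (k + 2)) (ones (k + 2))) := thinPasses_thinCross.idRight _ _
    have h3 : ThinPasses (Term.idLeft (up 1 ++ up 1) (symTerm k) rfl rfl :
        Term UpGen (ones (k + 2)) (ones (k + 2))) := (thinPasses_symTerm k).idLeft _ _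
    refine .congr (fun w => ?_) (h1.add ((h1.comp (h2.comp (h3.comp h1))).smul
      (1 / (k.factorial : ℂ) ^ 2)))
    have e1 : uo w (Term.idLeft (up 1) (symTerm (k + 1)) rfl rfl :
        Term UpGen (ones (k + 2)) (ones (k + 2))) = sym (w ++ up 1) (k + 1) :=
      (uo_idLeft _ _ _ _).trans (uo_symTerm _ _)
    have e2 : uo w (Term.idRight thinCross (ones k) rfl rfl :
        Term UpGen (ones (k + 2)) (ones (k + 2))) = uI (w ++ ones (k + 2)) * thinX w :=
      uo_idRight w (a := ones k) thinCross _ _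
    have e3 : uo w (Term.idLeft (up 1 ++ up 1) (symTerm k) rfl rfl :
        Term UpGen (ones (k + 2)) (ones (k + 2))) = sym (w ++ up 1 ++ up 1) k :=
      (uo_idLeft w (symTerm k) _ _).trans ((uo_symTerm _ _).trans (by rw [List.append_assoc]))
    rw [uo_symTerm, uo_add, uo_smul, uo_comp, uo_comp, uo_comp, e1, e2, e3, sym_succ_succ,
      ← mul_assoc, ← mul_assoc, ← mul_assoc, sym, mul_assoc _ (ex _ _) (uI _), ex_mul_uI]
    rw [List.append_assoc]
    exact List.prefix_rfl

theorem sym_mul_uc (w : List ℕ+) (k l : ℕ) :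
    sym (w ++ ones l) k * uc w (ones l) (ones k) = uc w (ones l) (ones k) * sym w k := by
  rw [← uo_symTerm, ← uo_symTerm]
  refine op_mul_cr_of_passes (P := upP) w (ones l) (fun x hx => ?_) rfl
  rw [mem_ones hx]
  exact thinPasses_symTerm k

theorem sym_mul_uc' (w : List ℕ+) (k l : ℕ) :
    sym w k * uc w (ones k) (ones l) = uc w (ones k) (ones l) * sym (w ++ ones l) k := by
  rw [← uo_symTerm, ← uo_symTerm]
  refine op_mul_cr_of_passes' (P := upP) thickCross_even w (ones l) (fun x hx => ?_) (fun x hx y hy => ?_)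
    (fun x hx y hy => ?_) rfl
  · rw [mem_ones hx]
    exact thinPasses_symTerm k
  · rw [mem_ones hx, mem_ones hy]
    exact symm_one_one
  · rw [mem_ones hx, mem_ones hy]
    exact symm_one_one

theorem uc_ones_symm (w : List ℕ+) (k l : ℕ) :
    uc w (ones k) (ones l) * uc w (ones l) (ones k) = uI (w ++ (ones k ++ ones l)) := by
  refine cr_symm (P := upP) thickCross_even w _ _ fun x hx y hy => ?_
  rw [mem_ones hx, mem_ones hy]
  exact symm_one_one

theorem uo_thickCross' (w : List ℕ+) (k l : ℕ) :
    uo w (thickCross k.succPNat l.succPNat) =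
      (1 / (((k + 1).factorial : ℂ) * ((l + 1).factorial : ℂ))) •
        (ex (w ++ up (k + 1)) (l + 1) * ex w (k + 1) * (uc w (ones (k + 1)) (ones (l + 1)) *
          (im (w ++ ones (l + 1)) (k + 1) * im w (l + 1)))) := by
  rw [uo_thickCross, uc_ones]

theorem ex_slide_uo (w : List ℕ+) (k : ℕ) (t : Term UpGen a b) :
    ex w k * uo (w ++ ones k) t = uo (w ++ up k) t * ex w k :=
  uo_slide_left t (explode_parity k) [] (by simp) (by simp)

theorem im_slide_uo (w : List ℕ+) (k : ℕ) (t : Term UpGen a b) :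
    im w k * uo (w ++ up k) t = uo (w ++ ones k) t * im w k :=
  uo_slide_left t (implode_parity k) [] (by simp) (by simp)

theorem uo_slide_ex (w : List ℕ+) (k : ℕ) (t : Term UpGen a b) :
    uo w t * ex (w ++ b) k = ex (w ++ a) k * uo w t :=
  uo_slide_right t (explode_parity k) [] (by simp) (by simp)

theorem uo_slide_im (w : List ℕ+) (k : ℕ) (t : Term UpGen a b) :
    uo w t * im (w ++ b) k = im (w ++ a) k * uo w t :=
  uo_slide_right t (implode_parity k) [] (by simp) (by simp)

theorem ex_ex (w : List ℕ+) (k l : ℕ) :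
    ex w k * ex (w ++ ones k) l = ex (w ++ up k) l * ex w k := ex_slide_uo w k (explode l)

theorem im_im (w : List ℕ+) (k l : ℕ) :
    im w k * im (w ++ up k) l = im (w ++ ones k) l * im w k := im_slide_uo w k (implode l)

theorem ex_im (w : List ℕ+) (k l : ℕ) :
    ex w k * im (w ++ ones k) l = im (w ++ up k) l * ex w k := ex_slide_uo w k (implode l)

theorem im_ex (w : List ℕ+) (k l : ℕ) :
    im w k * ex (w ++ up k) l = ex (w ++ ones k) l * im w k := im_slide_uo w k (explode l)

theorem thickCross_symm (k l : ℕ+) : Symm (P := upP) (X := thickCross) k l := by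
  intro w
  rw [← PNat.succPNat_natPred k, ← PNat.succPNat_natPred l]
  generalize k.natPred = k, l.natPred = l
  change uo w (thickCross _ _) * uo w (thickCross _ _) = uI (w ++ (up (k + 1) ++ up (l + 1)))
  rw [uo_thickCross', uo_thickCross']
  have hk : ((k + 1).factorial : ℂ) ≠ 0 := Nat.cast_ne_zero.mpr (Nat.factorial_ne_zero _)
  have hl : ((l + 1).factorial : ℂ) ≠ 0 := Nat.cast_ne_zero.mpr (Nat.factorial_ne_zero _)
  generalize k + 1 = k at *
  generalize l + 1 = l at *
  have h1 : ∀ F, im w l * (ex (w ++ up l) k * F) = ex (w ++ ones l) k * (im w l * F) := by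
    intro F; rw [← mul_assoc, im_ex, mul_assoc]
  have h2 : ∀ F, im (w ++ ones l) k * (ex (w ++ ones l) k * F) = sym (w ++ ones l) k * F := by
    intro F; rw [← mul_assoc]; rfl
  have h3 : ∀ F, im w l * (ex w l * F) = sym w l * F := by intro F; rw [← mul_assoc]; rfl
  have h4 : ∀ F, uc w (ones k) (ones l) * (sym (w ++ ones l) k * F) =
      sym w k * (uc w (ones k) (ones l) * F) := by
    intro F; rw [← mul_assoc, ← sym_mul_uc', mul_assoc]
  have h5 : ∀ F, uc w (ones k) (ones l) * (sym w l * F) =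
      sym (w ++ ones k) l * (uc w (ones k) (ones l) * F) := by
    intro F; rw [← mul_assoc, ← sym_mul_uc, mul_assoc]
  have h6 : ∀ F, uc w (ones k) (ones l) * (uc w (ones l) (ones k) * F) =
      uI (w ++ (ones k ++ ones l)) * F := by
    intro F; rw [← mul_assoc, uc_ones_symm]
  have h7 : ∀ F, ex w k * (sym w k * F) = (k.factorial : ℂ) • (ex w k * F) := by
    intro F; rw [← mul_assoc, ex_mul_sym, smul_mul_assoc]
  have h8 : ∀ F, sym (w ++ ones k) l * (im (w ++ ones k) l * F) =
      (l.factorial : ℂ) • (im (w ++ ones k) l * F) := by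
    intro F; rw [← mul_assoc, sym_mul_im, smul_mul_assoc]
  have h9 : ∀ F, uI (w ++ (ones k ++ ones l)) * (im (w ++ ones k) l * F) = im (w ++ ones k) l * F := by
    intro F; rw [← mul_assoc, uI_mul_im _ _ (by simp)]
  have h10 : ∀ F, ex w k * (im (w ++ ones k) l * F) = im (w ++ up k) l * (ex w k * F) := by
    intro F; rw [← mul_assoc, ex_im, mul_assoc]
  have h11 : ∀ F, ex (w ++ up k) l * (im (w ++ up k) l * F) =
      (l.factorial : ℂ) • (uI (w ++ (up k ++ up l)) * F) := by
    intro F; rw [← mul_assoc, ex_mul_im, smul_mul_assoc, List.append_assoc]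
  simp only [mul_assoc, smul_mul_assoc, mul_smul_comm, h1, h2, h3, h4, h5, h6, h7, h8, h9, h10, h11,
    ex_mul_im, smul_smul]
  rw [uI_mul_uI' (by simp)]
  convert one_smul ℂ _
  field_simp

theorem uc_one_up (w : List ℕ+) (l : ℕ) : uc w (up 1) (up l) =
    (1 / (l.factorial : ℂ)) • (ex (w ++ up 1) l * (uc w (up 1) (ones l) * im w l)) := by
  cases l with
  | zero =>
    rw [ex_zero, im_zero]
    change uc w (up 1) [] = (1 / ((0).factorial : ℂ)) • (_ * (uc w (up 1) [] * uI w))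
    rw [cr_mul_pre (P := upP) _ _ _ _ (by simp), pre_mul_cr (P := upP) _ _ _ _ (by simp)]
    simp
  | succ l =>
    have h := (cr_singleton_singleton (P := upP) thickCross w (Nat.succPNat 0)
      (Nat.succPNat l)).trans (uo_thickCross' w 0 l)
    refine h.trans ?_
    have h1 : im (w ++ ones (l + 1)) 1 * im w (l + 1) = im w (l + 1) * uI (w ++ up (l + 1) ++ up 1) := by
      rw [← im_im, im_one]
    have h2 : ex (w ++ up 1) (l + 1) * ex w 1 = ex (w ++ up 1) (l + 1) := by
      rw [ex_one, ex_mul_uI _ _ (by simp)]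
    rw [zero_add, h1, h2]
    have h3 : im w (l + 1) * uI (w ++ up (l + 1) ++ up 1) =
        uI (w ++ (ones (l + 1) ++ up 1)) * im w (l + 1) :=
      uo_mul_uI_comm _ (up 1) (by simp) rfl
    rw [h3, ← mul_assoc (uc _ _ _)]
    have h4 : uc w (ones 1) (ones (l + 1)) * uI (w ++ (ones (l + 1) ++ up 1)) = uc w (up 1) (ones (l + 1)) :=
      cr_mul_pre (P := upP) _ _ _ _ List.prefix_rfl
    rw [h4]
    simp

theorem uc_ones_up (w : List ℕ+) (k l : ℕ) : uc w (ones k) (up l) =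
    (1 / (l.factorial : ℂ)) • (ex (w ++ ones k) l * (uc w (ones k) (ones l) * im w l)) := by
  have hl : (l.factorial : ℂ) ≠ 0 := Nat.cast_ne_zero.mpr (Nat.factorial_ne_zero _)
  induction k generalizing w with
  | zero =>
    have h1 : uc w (ones 0) (up l) = uI (w ++ up l) := cr_nil_left (P := upP) _ _ _
    have h2 : uc w (ones 0) (ones l) = uI (w ++ ones l) := cr_nil_left (P := upP) _ _ _
    have h3 : w ++ ones 0 = w := List.append_nil w
    rw [h1, h2, h3, uI_mul_im _ _ List.prefix_rfl, ex_mul_im, smul_smul, one_div_mul_cancel hl, one_smul]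
  | succ k ih =>
    have h1 : ∀ b, uc w (ones (k + 1)) b = uc (w ++ up 1) (ones k) b * uc w (up 1) b :=
      fun b => cr_append_left (P := upP) thickCross w (up 1) (ones k) b
    have h2 : sym (w ++ up 1) l * uc w (up 1) (ones l) = uc w (up 1) (ones l) * sym w l :=
      sym_mul_uc w l 1
    have h3 : im (w ++ up 1) l * (ex (w ++ up 1) l * (uc w (up 1) (ones l) * im w l)) =
        (l.factorial : ℂ) • (uc w (up 1) (ones l) * im w l) := by
      rw [← mul_assoc, ← mul_assoc, ← sym, h2, mul_assoc, sym_mul_im, mul_smul_comm]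
    have h4 : w ++ up 1 ++ ones k = w ++ ones (k + 1) := List.append_assoc _ _ _
    rw [h1, h1, ih, uc_one_up, smul_mul_assoc, mul_smul_comm, mul_assoc, mul_assoc, h3, h4,
      mul_smul_comm, mul_smul_comm, smul_smul, smul_smul, mul_assoc, one_div_mul_cancel hl, mul_one, mul_assoc]

theorem thinPasses_implode (k : ℕ) : ThinPasses (implode k) := by
  rw [thinPasses_iff]
  intro w
  refine fac_smul_inj (k := k) ?_
  have hk : (k.factorial : ℂ) ≠ 0 := Nat.cast_ne_zero.mpr (Nat.factorial_ne_zero _)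
  have h2 : sym (w ++ up 1) k * uc w (up 1) (ones k) = uc w (up 1) (ones k) * sym w k :=
    sym_mul_uc w k 1
  rw [uc_one_up, mul_smul_comm, smul_smul, mul_one_div_cancel hk, one_smul, ← mul_assoc,
    ← mul_assoc]
  change sym (w ++ up 1) k * _ * im w k = _
  rw [h2, mul_assoc, sym_mul_im, mul_smul_comm]
  rfl

theorem thinPasses_explode (k : ℕ) : ThinPasses (explode k) := by
  rw [thinPasses_iff]
  intro w
  refine fac_smul_inj (k := k) ?_
  have hk : (k.factorial : ℂ) ≠ 0 := Nat.cast_ne_zero.mpr (Nat.factorial_ne_zero _)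
  have h2 : sym (w ++ up 1) k * uc w (up 1) (ones k) = uc w (up 1) (ones k) * sym w k :=
    sym_mul_uc w k 1
  rw [uc_one_up, smul_mul_assoc, smul_smul, mul_one_div_cancel hk, one_smul, mul_assoc, mul_assoc]
  change _ = _ * (_ * sym w k)
  rw [← h2, ← mul_assoc, ex_mul_sym, smul_mul_assoc]
  rfl

/-! ### Thick strands in terms of thin strands -/

theorem im_mul_mrg (w : List ℕ+) (k l : ℕ) {m : ℕ} (h : k + l = m) :
    im (w ++ ones k) l * im w k * uo w (mrg k l h) = im w m := by
  induction k generalizing w m with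
  | zero =>
    obtain rfl : l = m := by omega
    have h3 : w ++ ones 0 = w := List.append_nil w
    rw [uo_mrg_zero_left, im_zero, h3, im_mul_uI _ _ (by simp), im_mul_uI _ _ (by simp)]
  | succ k ih =>
    obtain ⟨m, rfl⟩ : ∃ m', m = m' + 1 := ⟨k + l, by omega⟩
    have h4 : w ++ up 1 ++ ones k = w ++ ones (k + 1) := List.append_assoc _ _ _
    have h5 := uo_mrg_assoc w 1 k l (Nat.add_comm 1 k) h (by omega) (Nat.add_comm 1 m)
    rw [im_succ, im_succ, mul_assoc, mul_assoc, thinMerge, h5, ← h4, ← mul_assoc, ← mul_assoc, ih]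
    rfl

theorem spl_mul_ex (w : List ℕ+) (k l : ℕ) {m : ℕ} (h : k + l = m) :
    uo w (spl k l h) * (ex (w ++ up k) l * ex w k) = ex w m := by
  induction k generalizing w m with
  | zero =>
    obtain rfl : l = m := by omega
    have h3 : w ++ up 0 = w := List.append_nil w
    rw [uo_spl_zero_left, ex_zero, h3, ex_mul_uI _ _ (by simp), uI_mul_ex _ _ (by simp)]
  | succ k ih =>
    obtain ⟨m, rfl⟩ : ∃ m', m = m' + 1 := ⟨k + l, by omega⟩
    have h5 := uo_spl_assoc w 1 k l (Nat.add_comm 1 k) h (by omega) (Nat.add_comm 1 m)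
    have h6 : thinSplit w k * ex (w ++ up 1 ++ up k) l = ex (w ++ up (k + 1)) l * thinSplit w k := by
      rw [List.append_assoc]
      exact uo_slide_ex w l _
    rw [ex_succ, ex_succ, ← mul_assoc (ex _ l), ← h6, ← mul_assoc, ← mul_assoc]
    change uo w _ * uo w (spl 1 k _) * _ * _ = _
    rw [h5, mul_assoc, mul_assoc, ih]
    rfl

theorem ones_add {k l m : ℕ} (h : k + l = m) : ones k ++ ones l = ones m := by
  subst h
  induction k with
  | zero => rw [zero_add]; rfl
  | succ k ih => rw [Nat.add_right_comm, ones, ones, List.append_assoc, ih]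

theorem uo_mrg (w : List ℕ+) (k l : ℕ) {m : ℕ} (h : k + l = m) :
    ((k.factorial : ℂ) * (l.factorial : ℂ)) • uo w (mrg k l h) =
      ex (w ++ up k) l * ex w k * im w m := by
  have h10 : ∀ F, ex w k * (im (w ++ ones k) l * F) = im (w ++ up k) l * (ex w k * F) := by
    intro F; rw [← mul_assoc, ex_im, mul_assoc]
  have h11 : ∀ F, ex (w ++ up k) l * (im (w ++ up k) l * F) =
      (l.factorial : ℂ) • (uI (w ++ (up k ++ up l)) * F) := by
    intro F; rw [← mul_assoc, ex_mul_im, smul_mul_assoc, List.append_assoc]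
  have h12 : ∀ F, ex w k * (im w k * F) = (k.factorial : ℂ) • (uI (w ++ up k) * F) := by
    intro F; rw [← mul_assoc, ex_mul_im, smul_mul_assoc]
  have h13 : uI (w ++ (up k ++ up l)) * (uI (w ++ up k) * uo w (mrg k l h)) = uo w (mrg k l h) := by
    rw [uI_mul_uo _ (by simp), uI_mul_uo _ List.prefix_rfl]
  rw [← im_mul_mrg w k l h]
  simp only [mul_assoc, h10, h11, h12, mul_smul_comm, smul_smul, h13]

theorem uo_spl (w : List ℕ+) (k l : ℕ) {m : ℕ} (h : k + l = m) :
    ((k.factorial : ℂ) * (l.factorial : ℂ)) • uo w (spl k l h) =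
      ex w m * (im (w ++ ones k) l * im w k) := by
  have h10 : ∀ F, ex w k * (im (w ++ ones k) l * F) = im (w ++ up k) l * (ex w k * F) := by
    intro F; rw [← mul_assoc, ex_im, mul_assoc]
  have h11 : ∀ F, ex (w ++ up k) l * (im (w ++ up k) l * F) =
      (l.factorial : ℂ) • (uI (w ++ (up k ++ up l)) * F) := by
    intro F; rw [← mul_assoc, ex_mul_im, smul_mul_assoc, List.append_assoc]
  have h13 : uo w (spl k l h) * (uI (w ++ (up k ++ up l)) * uI (w ++ up k)) = uo w (spl k l h) := by
    rw [uI_mul_uI' (by simp), uo_mul_uI _ List.prefix_rfl]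
  rw [← spl_mul_ex w k l h]
  simp only [mul_assoc, h10, h11, ex_mul_im, mul_smul_comm, smul_smul, h13]

/-- The sum of the dots on `k` thin strands. -/
def sumDots : ∀ k : ℕ, Term UpGen (ones k) (ones k)
  | 0 => 0
  | k + 1 => Term.idRight (dt 1) (ones k) rfl rfl + Term.idLeft (up 1) (sumDots k) rfl rfl

theorem uo_sumDots_succ (w : List ℕ+) (k : ℕ) : uo w (sumDots (k + 1)) =
    uI (w ++ (up 1 ++ ones k)) * thinD w + uo (w ++ up 1) (sumDots k) := by
  refine (uo_add (a := up 1 ++ ones k) (b := up 1 ++ ones k) w _ _).trans ?_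
  exact congrArg₂ (· + ·) (uo_idRight w (a := ones k) (dt 1) rfl rfl)
    (uo_idLeft w (a := up 1) (sumDots k) rfl rfl)

theorem uo_dot_merge (w : List ℕ+) (k l : ℕ) {m : ℕ} (h : k + l = m) :
    uo w (mrg k l h) * uo w (dt m) =
      (uo w (dt k) * uI (w ++ (up k ++ up l)) + uo (w ++ up k) (dt l)) * uo w (mrg k l h) := by
  subst h
  have h := uo_rel w (UpRel.dot_merge k l)
  rwa [uo_comp, uo_add, uo_comp, uo_comp, uo_idRight', uo_idLeft, ← add_mul] at h

theorem im_mul_dt (w : List ℕ+) (k : ℕ) :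
    im w k * uo w (dt k) = uo w (sumDots k) * im w k := by
  induction k generalizing w with
  | zero =>
    have h1 : uo w (dt 0) = 0 := uo_zero (a := up 0) (b := up 0) w
    have h2 : uo w (sumDots 0) = 0 := uo_zero (a := ones 0) (b := ones 0) w
    rw [h1, h2, mul_zero, zero_mul]
  | succ k ih =>
    have h1 : thinMerge w k * uo w (dt (k + 1)) = (thinD w * uI (w ++ (up 1 ++ up k)) +
        uo (w ++ up 1) (dt k)) * thinMerge w k := uo_dot_merge w 1 k _
    have h2 : thinD w * im (w ++ up 1) k = im (w ++ up 1) k * thinD w := uo_slide_im w k (dt 1)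
    have h3 : uI (w ++ (up 1 ++ ones k)) * thinD w = thinD w * uI (w ++ (up 1 ++ ones k)) :=
      (uo_mul_uI_comm (dt 1) (ones k) rfl rfl).symm
    rw [im_succ, mul_assoc, h1, uo_sumDots_succ, ← mul_assoc, ← mul_assoc, mul_add, add_mul,
      add_mul, add_mul, ih, ← mul_assoc, ← h2, h3, mul_assoc _ (uI _) (im _ _), uI_mul_im _ _ (by simp),
      mul_assoc (thinD w), im_mul_uI _ _ (by simp)]

theorem uo_dt (w : List ℕ+) (k : ℕ) :
    (k.factorial : ℂ) • uo w (dt k) = ex w k * (uo w (sumDots k) * im w k) := by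
  rw [← im_mul_dt, ← mul_assoc, ex_mul_im, smul_mul_assoc, uI_mul_uo _ List.prefix_rfl]

end

section

variable {a b c d x y v w : List ℕ+}

/-! ### The braiding on upward webs -/

theorem thinPasses_sumDots : ∀ k : ℕ, ThinPasses (sumDots k)
  | 0 => .zero
  | k + 1 => .add (thinPasses_dt_one.idRight (a := ones k) rfl rfl)
      ((thinPasses_sumDots k).idLeft (a := up 1) rfl rfl)

theorem thinPasses_dt (k : ℕ) : ThinPasses (dt k) := by
  refine .congr (fun w => ?_) (((thinPasses_explode k).comp ((thinPasses_sumDots k).comp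
    (thinPasses_implode k))).smul (1 / (k.factorial : ℂ)))
  refine fac_smul_inj (k := k) ?_
  have hk : (k.factorial : ℂ) ≠ 0 := Nat.cast_ne_zero.mpr (Nat.factorial_ne_zero _)
  rw [uo_dt, uo_smul, smul_smul, mul_one_div_cancel hk, one_smul, uo_comp, uo_comp]
  rfl

theorem thinPasses_mrg (k l : ℕ) {m : ℕ} (h : k + l = m) : ThinPasses (mrg k l h) := by
  refine .congr (fun w => ?_) ((((thinPasses_explode k).tensor (thinPasses_explode l) rfl rfl).comp
    ((ThinPasses.ofEq (ones_add h)).comp (thinPasses_implode m))).smul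
      (1 / ((k.factorial : ℂ) * (l.factorial : ℂ))))
  have hk : (k.factorial : ℂ) ≠ 0 := Nat.cast_ne_zero.mpr (Nat.factorial_ne_zero _)
  have hl : (l.factorial : ℂ) ≠ 0 := Nat.cast_ne_zero.mpr (Nat.factorial_ne_zero _)
  rw [uo_smul, uo_comp, uo_comp, uo_ofEq, uo_tensor, ones_add h, uI_mul_uo _ List.prefix_rfl]
  change _ = _ • (ex (w ++ up k) l * ex w k * im w m)
  rw [← uo_mrg w k l h, smul_smul]
  convert (one_smul ℂ _).symm
  field_simp

theorem thinPasses_spl (k l : ℕ) {m : ℕ} (h : k + l = m) : ThinPasses (spl k l h) := by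
  refine .congr (fun w => ?_) (((thinPasses_explode m).comp ((ThinPasses.ofEq (ones_add h).symm).comp
    ((thinPasses_implode k).tensor (thinPasses_implode l) rfl rfl))).smul
      (1 / ((k.factorial : ℂ) * (l.factorial : ℂ))))
  have hk : (k.factorial : ℂ) ≠ 0 := Nat.cast_ne_zero.mpr (Nat.factorial_ne_zero _)
  have hl : (l.factorial : ℂ) ≠ 0 := Nat.cast_ne_zero.mpr (Nat.factorial_ne_zero _)
  rw [uo_smul, uo_comp, uo_comp, uo_ofEq, uo_tensor, ← mul_assoc, uo_mul_uI _ List.prefix_rfl]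
  change _ = _ • (ex w m * (im (w ++ ones k) l * im w k))
  rw [← uo_spl w k l h, smul_smul]
  convert (one_smul ℂ _).symm
  field_simp

theorem thinPasses_gen (g : UpGen a b) : ThinPasses (.gen g) := by
  cases g with
  | dot k =>
    obtain ⟨k, rfl⟩ : ∃ n : ℕ, k = n.succPNat := ⟨k.natPred, (PNat.succPNat_natPred k).symm⟩
    exact thinPasses_dt (k + 1)
  | merge k l m h =>
    obtain ⟨k, rfl⟩ : ∃ n : ℕ, k = n.succPNat := ⟨k.natPred, (PNat.succPNat_natPred k).symm⟩
    obtain ⟨l, rfl⟩ : ∃ n : ℕ, l = n.succPNat := ⟨l.natPred, (PNat.succPNat_natPred l).symm⟩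
    obtain ⟨m, rfl⟩ : ∃ n : ℕ, m = n.succPNat := ⟨m.natPred, (PNat.succPNat_natPred m).symm⟩
    exact thinPasses_mrg (k + 1) (l + 1) (m := m + 1) (by simpa using congrArg PNat.val h)
  | split k l m h =>
    obtain ⟨k, rfl⟩ : ∃ n : ℕ, k = n.succPNat := ⟨k.natPred, (PNat.succPNat_natPred k).symm⟩
    obtain ⟨l, rfl⟩ : ∃ n : ℕ, l = n.succPNat := ⟨l.natPred, (PNat.succPNat_natPred l).symm⟩
    obtain ⟨m, rfl⟩ : ∃ n : ℕ, m = n.succPNat := ⟨m.natPred, (PNat.succPNat_natPred m).symm⟩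
    exact thinPasses_spl (k + 1) (l + 1) (m := m + 1) (by simpa using congrArg PNat.val h)

theorem thinPasses (t : Term UpGen a b) : ThinPasses t :=
  passes_of_generators (P := upP) thickCross_even thinPasses_gen t

theorem uo_mul_uc_ones (w : List ℕ+) (k : ℕ) (t : Term UpGen a b) :
    uo (w ++ ones k) t * uc w (ones k) b = uc w (ones k) a * uo w t := by
  refine op_mul_cr_of_passes (P := upP) w (ones k) (fun x hx => ?_) rfl
  rw [mem_ones hx]
  exact thinPasses t

theorem sym_mul_uc_up (w : List ℕ+) (k l : ℕ) :
    sym w k * uc w (ones k) (up l) = uc w (ones k) (up l) * sym (w ++ up l) k := by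
  rw [uc_ones_up, mul_smul_comm, smul_mul_assoc]
  congr 1
  have h1 : sym w k * ex (w ++ ones k) l = ex (w ++ ones k) l * sym w k := by
    rw [← uo_symTerm]
    exact uo_slide_ex w l _
  have h2 : im w l * sym (w ++ up l) k = sym (w ++ ones l) k * im w l := by
    rw [← uo_symTerm, ← uo_symTerm]
    exact im_slide_uo w l _
  rw [← mul_assoc, h1, mul_assoc, ← mul_assoc (sym w k), sym_mul_uc', mul_assoc, mul_assoc,
    mul_assoc, h2]

theorem uc_up_up (w : List ℕ+) (k l : ℕ) : uc w (up k) (up (l + 1)) =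
    (1 / (k.factorial : ℂ)) • (ex w k * (uc w (ones k) (up (l + 1)) * im (w ++ up (l + 1)) k)) := by
  cases k with
  | zero =>
    rw [ex_zero, im_zero]
    change uc w [] _ = (1 / ((0).factorial : ℂ)) • (_ * (uc w [] _ * uI _))
    rw [cr_mul_pre (P := upP) _ _ _ _ (by simp), pre_mul_cr (P := upP) _ _ _ _ (by simp)]
    simp
  | succ k =>
    have h := (cr_singleton_singleton (P := upP) thickCross w (Nat.succPNat k)
      (Nat.succPNat l)).trans (uo_thickCross' w k l)
    refine h.trans ?_
    rw [uc_ones_up, ← im_im, ← ex_ex]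
    simp only [smul_mul_assoc, mul_smul_comm, smul_smul, mul_assoc]
    congr 1
    field_simp

theorem uc_up (w : List ℕ+) (k : ℕ) (b : List ℕ+) : uc w (up k) b =
    (1 / (k.factorial : ℂ)) • (ex w k * (uc w (ones k) b * im (w ++ b) k)) := by
  have hk : (k.factorial : ℂ) ≠ 0 := Nat.cast_ne_zero.mpr (Nat.factorial_ne_zero _)
  induction b generalizing w with
  | nil =>
    have h1 : uc w (up k) [] = uI (w ++ up k) := cr_nil_right (P := upP) _ _ _
    have h2 : uc w (ones k) [] = uI (w ++ ones k) := cr_nil_right (P := upP) _ _ _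
    rw [h1, h2, List.append_nil, uI_mul_im _ _ List.prefix_rfl, ex_mul_im, smul_smul,
      one_div_mul_cancel hk, one_smul]
  | cons y b ih =>
    obtain ⟨l, rfl⟩ : ∃ n : ℕ, y = n.succPNat := ⟨y.natPred, (PNat.succPNat_natPred y).symm⟩
    have h : ∀ a, uc w a (l.succPNat :: b) = uc w a (up (l + 1)) * uc (w ++ up (l + 1)) a b :=
      fun a => cr_append_right (P := upP) thickCross_even w a (up (l + 1)) b
    have h3 : w ++ up (l + 1) ++ b = w ++ (l.succPNat :: b) := List.append_assoc _ _ _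
    have h4 : ∀ F, im (w ++ up (l + 1)) k * (ex (w ++ up (l + 1)) k * F) = sym (w ++ up (l + 1)) k * F := by
      intro F; rw [← mul_assoc]; rfl
    have h5 : ∀ F, uc w (ones k) (up (l + 1)) * (sym (w ++ up (l + 1)) k * F) =
        sym w k * (uc w (ones k) (up (l + 1)) * F) := by
      intro F; rw [← mul_assoc, ← sym_mul_uc_up, mul_assoc]
    have h6 : ∀ F, ex w k * (sym w k * F) = (k.factorial : ℂ) • (ex w k * F) := by
      intro F; rw [← mul_assoc, ex_mul_sym, smul_mul_assoc]
    rw [h, h, uc_up_up, ih, h3]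
    simp only [smul_mul_assoc, mul_smul_comm, smul_smul, mul_assoc, h4, h5, h6]
    congr 1
    field_simp

theorem passes_thickCross (k : ℕ+) (t : Term UpGen a b) :
    Passes (P := upP) thickCross k (mor (P := upP) t) := by
  obtain ⟨k, rfl⟩ : ∃ n : ℕ, k = n.succPNat := ⟨k.natPred, (PNat.succPNat_natPred k).symm⟩
  intro w
  change uo (w ++ up (k + 1)) t * uc w (up (k + 1)) b = uc w (up (k + 1)) a * uo w t
  rw [uc_up, uc_up, mul_smul_comm, smul_mul_assoc, ← mul_assoc, ← ex_slide_uo, mul_assoc,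
    ← mul_assoc (uo _ _), uo_mul_uc_ones, mul_assoc, uo_slide_im, mul_assoc, mul_assoc]

theorem isSymmetricBraiding_upBraiding : IsSymmetricBraiding upBraiding :=
  isSymmetricBraiding_crossWords (P := upP) thickCross_even thickCross_symm
    fun x _ _ g => passes_thickCross x (.gen g)

end

/-! ### Operators of oriented webs -/

/-- The presentation of oriented webs, with transparent components. -/
abbrev orP : Presentation where
  Ob := OrOb
  Gen := OrGen
  par := OrGen.par
  Rel := OrRel
  rel_parity := OrRel.parity

section

variable {a b c d x y v w : List OrOb}

/-- The operator of an oriented web, to the right of the word `w`. -/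
noncomputable def oo (w : List OrOb) (t : Term OrGen a b) : Ops orP :=
  op (P := orP) w (mor (P := orP) t)

/-- The projection to the words with prefix `w`. -/
noncomputable abbrev oI (w : List OrOb) : Ops orP := pre (P := orP) w

theorem oo_rel (w : List OrOb) {s t : Term OrGen a b} (h : OrRel s t) : oo w s = oo w t :=
  congrArg (fun f => op (P := orP) w f) (mor_eq (P := orP) (.rel h))

theorem oo_comp (w : List OrOb) (s : Term OrGen a b) (t : Term OrGen b c) :
    oo w (s ⨟ t) = oo w s * oo w t := op_mor_comp _ _ _

theorem oo_id (w a : List OrOb) : oo w (.id a) = oI (w ++ a) := op_mor_id _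

theorem oo_tensor (w : List OrOb) (s : Term OrGen a b) (t : Term OrGen c d) (hx : x = a ++ c)
    (hy : y = b ++ d) : oo w (s.tensor t hx hy) = oo (w ++ a) t * oo w s :=
  op_mor_tensor _ _ _ _ _

theorem oo_idLeft (w : List OrOb) (t : Term OrGen b c) (hx : x = a ++ b) (hy : y = a ++ c) :
    oo w (Term.idLeft a t hx hy) = oo (w ++ a) t := op_mor_idLeft _ _ _ _

theorem oo_idRight (w : List OrOb) (t : Term OrGen b c) (hx : x = b ++ a) (hy : y = c ++ a) :
    oo w (Term.idRight t a hx hy) = oI (w ++ (b ++ a)) * oo w t := op_mor_idRight _ _ _ _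

theorem oo_idRight' (w : List OrOb) (t : Term OrGen b c) (hx : x = b ++ a) (hy : y = c ++ a) :
    oo w (Term.idRight t a hx hy) = oo w t * oI (w ++ (c ++ a)) := op_mor_idRight' _ _ _ _

theorem oo_ofEq (w : List OrOb) (h : a = b) : oo w (Term.ofEq h) = oI (w ++ a) := op_mor_ofEq _ h

theorem oo_add (w : List OrOb) (s t : Term OrGen a b) : oo w (s + t) = oo w s + oo w t :=
  op_mor_add _ _ _

theorem oo_smul (w : List OrOb) (r : ℂ) (t : Term OrGen a b) : oo w (r • t) = r • oo w t :=
  op_mor_smul _ _ _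

theorem oo_zero (w : List OrOb) : oo w (0 : Term OrGen a b) = 0 := op_mor_zero (P := orP) _

theorem oI_mul_oo (t : Term OrGen a b) (h : v <+: w ++ a) : oI v * oo w t = oo w t :=
  pre_mul_op_of_prefix _ h

theorem oo_mul_oI (t : Term OrGen a b) (h : v <+: w ++ b) : oo w t * oI v = oo w t :=
  op_mul_pre_of_prefix _ h

theorem oI_mul_oI (h : v <+: w) : oI v * oI w = oI w := pre_mul_pre_of_prefix h

theorem oI_mul_oI' (h : v <+: w) : oI w * oI v = oI w := pre_mul_pre_of_prefix' h

theorem oo_mul_oI_comm (t : Term OrGen a b) (y : List OrOb) (h : v = w ++ (b ++ y))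
    (h' : x = w ++ (a ++ y)) : oo w t * oI v = oI x * oo w t :=
  op_mul_pre_comm_of _ h h'

theorem oo_slide_left {s : Term OrGen a b} (t : Term OrGen c d) (hs : s.HasParity OrGen.par 0)
    (y : List OrOb) (h : v = w ++ (b ++ y)) (h' : x = w ++ (a ++ y)) :
    oo w s * oo v t = oo x t * oo w s := op_slide_left _ (mor_even (P := orP) hs) y h h'

theorem oo_slide_right (s : Term OrGen a b) {t : Term OrGen c d} (ht : t.HasParity OrGen.par 0)
    (y : List OrOb) (h : v = w ++ (b ++ y)) (h' : x = w ++ (a ++ y)) :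
    oo w s * oo v t = oo x t * oo w s := op_slide_right _ (mor_even (P := orP) ht) y h h'

theorem oo_slide_odd {s : Term OrGen a b} {t : Term OrGen c d} (hs : s.HasParity OrGen.par 1)
    (ht : t.HasParity OrGen.par 1) (y : List OrOb) (h : v = w ++ (b ++ y))
    (h' : x = w ++ (a ++ y)) : oo w s * oo v t = -(oo x t * oo w s) := by
  have h1 : koszul 1 1 = -1 := by
    have h : (1 : ZMod 2).val = 1 := rfl
    simp [koszul, h]
  refine (op_slide (P := orP) ⟨_, hs, rfl⟩ ⟨_, ht, rfl⟩ y h h').trans ?_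
  rw [h1, neg_one_smul]
  rfl

theorem oo_inj {s t : Term OrGen a b} (h : oo [] s = oo [] t) : orMor s = orMor t :=
  op_inj (P := orP) h

theorem oo_toOr_congr {a b : List ℕ+} {s t : Term UpGen a b} (h : uo [] s = uo [] t)
    (w : List OrOb) : oo w (toOr s) = oo w (toOr t) := by
  have h1 : mor (P := upP) s = mor (P := upP) t := op_inj (P := upP) h
  have h2 : mor (P := orP) (toOr s) = mor (P := orP) (toOr t) := congrArg thetaMap.onHom h1
  exact congrArg (fun f => op (P := orP) w f) h2

theorem toOr_comp {a b c : List ℕ+} (s : Term UpGen a b) (t : Term UpGen b c) :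
    toOr (s ⨟ t) = toOr s ⨟ toOr t := rfl

theorem oo_toOr_tensor (w : List OrOb) {a b c d x y : List ℕ+} (s : Term UpGen a b)
    (t : Term UpGen c d) (hx : x = a ++ c) (hy : y = b ++ d) :
    oo w (toOr (s.tensor t hx hy)) = oo (w ++ a.map .up) (toOr t) * oo w (toOr s) := oo_tensor _ _ _ _ _

theorem oo_toOr_id (w : List OrOb) (a : List ℕ+) :
    oo w (toOr (.id a)) = oI (w ++ a.map .up) := oo_id _ _

theorem oo_toOr_ofEq (w : List OrOb) {a b : List ℕ+} (h : a = b) :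
    oo w (toOr (.ofEq h)) = oI (w ++ a.map .up) := by
  subst h
  exact oo_toOr_id w a

theorem oo_toOr_idLeft (w : List OrOb) {a b c x y : List ℕ+} (t : Term UpGen b c) (hx : x = a ++ b)
    (hy : y = a ++ c) : oo w (toOr (Term.idLeft a t hx hy)) = oo (w ++ a.map .up) (toOr t) := by
  rw [Term.idLeft, oo_toOr_tensor, oo_toOr_id, oo_mul_oI _ (by simp)]

theorem oo_toOr_idRight (w : List OrOb) {a b c x y : List ℕ+} (t : Term UpGen b c) (hx : x = b ++ a)
    (hy : y = c ++ a) :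
    oo w (toOr (Term.idRight t a hx hy)) = oI (w ++ (b.map .up ++ a.map .up)) * oo w (toOr t) := by
  rw [Term.idRight, oo_toOr_tensor, oo_toOr_id, List.append_assoc]

theorem oo_toOr_idRight' (w : List OrOb) {a b c x y : List ℕ+} (t : Term UpGen b c) (hx : x = b ++ a)
    (hy : y = c ++ a) :
    oo w (toOr (Term.idRight t a hx hy)) = oo w (toOr t) * oI (w ++ (c.map .up ++ a.map .up)) := by
  rw [oo_toOr_idRight, oo_mul_oI_comm _ _ rfl rfl]

/-! ### Crossings of oriented words -/

/-- The operator of the crossing of oriented words. -/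
noncomputable abbrev oc (w a b : List OrOb) : Ops orP := cr (P := orP) orCross w a b

theorem downCross_parity (k l : ℕ+) : (downCross k l).HasParity OrGen.par 0 :=
  .comp_even (.idLeft (cup_parity k) _ _) (.comp_even (.idLeft (.idRight (cup_parity l) _ _) _ _)
    (.comp_even (.idLeft (.idRight (upCross_parity k l) _ _) _ _)
      (.comp_even (.idLeft (.idRight (cap_parity l) _ _) _ _) (.idRight (cap_parity k) _ _))))

theorem orCross_even : EvenCrossings (P := orP) orCross
  | .up k, .up l => upCross_parity k l
  | .down k, .up l => leftCross_parity k l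
  | .up k, .down l => rightCross_parity k l
  | .down k, .down l => downCross_parity k l

theorem oc_single (w : List OrOb) (x y : OrOb) : oc w [x] [y] = oo w (orCross x y) :=
  cr_singleton_singleton (P := orP) _ _ _ _

theorem oc_cons (w : List OrOb) (x : OrOb) (a b : List OrOb) :
    oc w (x :: a) b = oc (w ++ [x]) a b * oc w [x] b := cr_cons (P := orP) _ _ _ _ _

theorem oc_single_cons (w : List OrOb) (x y : OrOb) (b : List OrOb) :
    oc w [x] (y :: b) = oo w (orCross x y) * oc (w ++ [y]) [x] b :=
  cr_singleton_cons (P := orP) _ _ _ _ _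

theorem oc_append_left (w a b c : List OrOb) : oc w (a ++ b) c = oc (w ++ a) b c * oc w a c :=
  cr_append_left (P := orP) _ _ _ _ _

theorem oc_append_right (w a b c : List OrOb) : oc w a (b ++ c) = oc w a b * oc (w ++ b) a c :=
  cr_append_right (P := orP) orCross_even _ _ _ _

theorem oc_nil_left (w b : List OrOb) : oc w [] b = oI (w ++ b) := cr_nil_left (P := orP) _ _ _

theorem oc_nil_right (w a : List OrOb) : oc w a [] = oI (w ++ a) := cr_nil_right (P := orP) _ _ _

theorem oI_mul_oc (w a b : List OrOb) (h : v <+: w ++ (a ++ b)) : oI v * oc w a b = oc w a b :=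
  pre_mul_cr (P := orP) _ _ _ _ h

theorem oc_mul_oI (w a b : List OrOb) (h : v <+: w ++ (b ++ a)) : oc w a b * oI v = oc w a b :=
  cr_mul_pre (P := orP) _ _ _ _ h

theorem oo_slide_oc {s : Term OrGen a b} (hs : s.HasParity OrGen.par 0) (c d y : List OrOb)
    (h : v = w ++ (b ++ y)) (h' : x = w ++ (a ++ y)) :
    oo w s * oc v c d = oc x c d * oo w s :=
  oo_slide_left (crossWords orCross c d) hs y h h'

theorem oo_toOr_passWord (w : List OrOb) (l : ℕ+) (b : List ℕ+) :
    oo w (toOr (passWord thickCross l b)) = oc w [OrOb.up l] (b.map .up) := by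
  induction b generalizing w with
  | nil =>
    rw [List.map_nil, oc_nil_right]
    exact oo_toOr_id w [l]
  | cons y b ih =>
    rw [passWord, toOr_comp, oo_comp, oo_toOr_idRight', oo_toOr_idLeft, ih, mul_assoc,
      oI_mul_oc _ _ _ (by simp)]
    exact (oc_single_cons w (.up l) (.up y) (b.map .up)).symm

theorem oo_toOr_crossWords (w : List OrOb) (a b : List ℕ+) :
    oo w (toOr (crossWords thickCross a b)) = oc w (a.map .up) (b.map .up) := by
  induction a generalizing w with
  | nil =>
    rw [List.map_nil, oc_nil_left, crossWords, oo_toOr_ofEq]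
    rfl
  | cons x a ih =>
    rw [crossWords, toOr_comp, oo_comp, oo_toOr_idRight, oo_toOr_idLeft, ih, oo_toOr_passWord,
      ← mul_assoc, oc_mul_oI _ _ _ (by simp)]
    exact (oc_cons w (.up x) (a.map .up) (b.map .up)).symm

theorem onHom_crossWords (a b : List ℕ+) (h1 : (a ++ b).map OrOb.up = a.map .up ++ b.map .up)
    (h2 : (b ++ a).map OrOb.up = b.map .up ++ a.map .up) :
    (castIso (P := orP) h1.symm).hom ≫ mor (P := orP) (toOr (crossWords thickCross a b)) =
      mor (P := orP) (crossWords orCross (a.map .up) (b.map .up)) ≫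
        (castIso (P := orP) h2.symm).hom := by
  refine op_inj (P := orP) ?_
  rw [op_comp, op_comp, op_castIso, op_castIso]
  change oI _ * oo [] _ = oc [] _ _ * oI _
  rw [oo_toOr_crossWords, oI_mul_oc _ _ _ (by simp), oc_mul_oI _ _ _ (by simp)]

theorem preservesBraiding_theta : theta.PreservesBraiding upBraiding orBraiding :=
  fun a b => onHom_crossWords a.word b.word List.map_append List.map_append

/-! ### Zigzags and inverses of crossings -/

theorem cup_mul_cap (w : List OrOb) (k : ℕ+) :
    oo w (cup k) * oo (w ++ [OrOb.up k]) (cap k) = oI (w ++ [OrOb.up k]) := by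
  have h := oo_rel w (OrRel.zigzag_up k)
  rwa [oo_comp, oo_idRight', oo_idLeft, oo_id, mul_assoc, oI_mul_oo _ (by simp)] at h

theorem cup_mul_cap' (w : List OrOb) (k : ℕ+) :
    oo (w ++ [OrOb.down k]) (cup k) * oo w (cap k) = oI (w ++ [OrOb.down k]) := by
  have h := oo_rel w (OrRel.zigzag_down k)
  rwa [oo_comp, oo_idRight, oo_idLeft, oo_id, ← mul_assoc, oo_mul_oI _ (by simp)] at h

theorem oo_leftCross (w : List OrOb) (k l : ℕ+) : oo w (leftCross k l) =
    oo (w ++ [OrOb.down k, OrOb.up l]) (cup k) * oo (w ++ [OrOb.down k]) (upCross l k) * oo w (cap k) := by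
  rw [leftCross, oo_comp, oo_comp, oo_idLeft, oo_idLeft, oo_idRight', oo_idRight,
    mul_assoc (oo _ (upCross l k)), ← mul_assoc (oI _) (oI _), oI_mul_oI (by simp),
    ← mul_assoc (oo _ (upCross l k)),
    oo_mul_oI_comm (upCross l k) [OrOb.down k] (x := w ++ [OrOb.down k, OrOb.up l, OrOb.up k, OrOb.down k]) (by simp)
      (by simp), ← mul_assoc, ← mul_assoc, oo_mul_oI _ (by simp)]

theorem symm_down_up (k l : ℕ+) : Symm (P := orP) (X := orCross) (.down k) (.up l) := by
  intro w
  have h := oo_rel w (OrRel.left_right k l)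
  rw [oo_comp, oo_id] at h
  exact h

theorem symm_up_down (k l : ℕ+) : Symm (P := orP) (X := orCross) (.up l) (.down k) := by
  intro w
  have h := oo_rel w (OrRel.right_left k l)
  rw [oo_comp, oo_id] at h
  exact h

theorem symm_up_up (k l : ℕ+) : Symm (P := orP) (X := orCross) (.up k) (.up l) := by
  intro w
  have h := oo_toOr_congr (s := thickCross k l ⨟ thickCross l k) (t := .id [k, l]) (by
    rw [uo_comp, uo_id]
    exact thickCross_symm k l []) w
  rw [toOr_comp, oo_comp, oo_toOr_id] at h
  exact h

/-- A strand of the type `x` may be moved across a web. -/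
def OrPasses (x : OrOb) (t : Term OrGen a b) : Prop :=
  Passes (P := orP) orCross x (mor (P := orP) t)

theorem orPasses_iff (p : OrOb) (t : Term OrGen a b) :
    OrPasses p t ↔ ∀ w, oo (w ++ [p]) t * oc w [p] b = oc w [p] a * oo w t := Iff.rfl

theorem orPasses_up_toOr (l : ℕ+) {a b : List ℕ+} (t : Term UpGen a b) :
    OrPasses (.up l) (toOr t) := by
  rw [orPasses_iff]
  intro w
  have h := oo_toOr_congr (s := Term.idLeft [l] t rfl rfl ⨟ crossWords thickCross [l] b)
    (t := crossWords thickCross [l] a ⨟ Term.idRight t [l] rfl rfl) (by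
      rw [uo_comp, uo_comp, uo_idLeft, uo_idRight, ← mul_assoc]
      change uo ([] ++ [l]) t * uc [] [l] b = uc [] [l] a * uI _ * uo [] t
      rw [cr_mul_pre (P := upP) _ _ _ _ (by simp)]
      exact passes_thickCross l t []) w
  rw [toOr_comp, toOr_comp, oo_comp, oo_comp, oo_toOr_idLeft, oo_toOr_idRight, oo_toOr_crossWords,
    oo_toOr_crossWords, ← mul_assoc, oc_mul_oI _ _ _ (by simp)] at h
  exact h

theorem orPasses_up_cup (k l : ℕ+) : OrPasses (.up l) (cup k) := by
  rw [orPasses_iff]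
  intro w
  have h1 : oo w (cup k) * oo (w ++ [OrOb.up k]) (leftCross k l) =
      oo (w ++ [OrOb.up l]) (cup k) * oo w (upCross l k) := by
    have e1 := oo_slide_left (w := w) (v := w ++ [OrOb.up k] ++ [OrOb.down k, OrOb.up l]) (x := w ++ [OrOb.up l])
      (cup k) (cup_parity k) [OrOb.up l] (by simp) (by simp)
    have e2 := oo_slide_left (w := w) (v := w ++ [OrOb.up k] ++ [OrOb.down k]) (x := w)
      (upCross l k) (cup_parity k) [] (by simp) (by simp)
    have e3 : oo w (upCross l k) * oI (w ++ [OrOb.up k]) = oo w (upCross l k) := oo_mul_oI _ (by simp)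
    rw [oo_leftCross, ← mul_assoc, ← mul_assoc, e1, mul_assoc _ (oo w _), e2, mul_assoc, mul_assoc,
      cup_mul_cap, e3]
  have h2 : oo (w ++ [OrOb.up k]) (leftCross k l) * oo (w ++ [OrOb.up k]) (rightCross l k) =
      oI (w ++ [OrOb.up k] ++ [OrOb.down k, OrOb.up l]) := symm_down_up k l _
  rw [oc_single_cons, oc_single]
  change oo _ _ * (oo w (upCross l k) * oo _ (rightCross l k)) = _
  rw [← mul_assoc, ← h1, mul_assoc, h2, oc_nil_right]
  exact oo_mul_oI_comm _ [OrOb.up l] (by simp) (by simp)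

theorem orPasses_up_cap (k l : ℕ+) : OrPasses (.up l) (cap k) := by
  rw [orPasses_iff]
  intro w
  have h1 : oo w (leftCross k l) * oo (w ++ [OrOb.up l]) (cap k) =
      oo (w ++ [OrOb.down k]) (upCross l k) * oo w (cap k) := by
    have e1 := oo_slide_left (w := w) (v := w ++ [OrOb.up l]) (x := w ++ [OrOb.down k] ++ [OrOb.up k, OrOb.up l])
      (cap k) (cap_parity k) [OrOb.up l] (by simp) (by simp)
    have e2 := oo_slide_right (w := w ++ [OrOb.down k]) (v := w ++ [OrOb.down k] ++ [OrOb.up k, OrOb.up l])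
      (x := w ++ [OrOb.down k, OrOb.up l] ++ [OrOb.up k])
      (upCross l k) (cap_parity k) [] (by simp) (by simp)
    have e3 : oI (w ++ [OrOb.down k, OrOb.up l] ++ [OrOb.up k]) * oo (w ++ [OrOb.down k]) (upCross l k) =
      oo (w ++ [OrOb.down k]) (upCross l k) := oI_mul_oo _ (by simp)
    rw [oo_leftCross, mul_assoc, e1, ← mul_assoc, mul_assoc _ (oo _ (upCross l k)), e2, ← mul_assoc,
      cup_mul_cap, e3]
  have h2 : oo w (rightCross l k) * oo w (leftCross k l) = oI (w ++ [OrOb.up l, OrOb.down k]) :=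
    symm_up_down k l _
  rw [oc_single_cons, oc_single, oc_nil_right]
  change _ = oo w (rightCross l k) * oo (w ++ [OrOb.down k]) (upCross l k) * _
  rw [mul_assoc, ← h1, ← mul_assoc, h2, oo_mul_oI _ (by simp), oI_mul_oo _ (by simp)]

theorem OrPasses.comp {s : Term OrGen a b} {t : Term OrGen b c} {p : OrOb} (hs : OrPasses p s)
    (ht : OrPasses p t) : OrPasses p (s ⨟ t) := Passes.comp (P := orP) hs ht

theorem OrPasses.tensor_left {t : Term OrGen b c} {p : OrOb} (ht : OrPasses p t) (a : List OrOb)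
    {hx : x = a ++ b} {hy : y = a ++ c} : OrPasses p (Term.idLeft a t hx hy) :=
  Passes.tens (P := orP) orCross_even (Passes.id (P := orP) a) ht hx hy

theorem OrPasses.tensor_right {t : Term OrGen b c} {p : OrOb} (ht : OrPasses p t) (a : List OrOb)
    {hx : x = b ++ a} {hy : y = c ++ a} : OrPasses p (Term.idRight t a hx hy) :=
  Passes.tens (P := orP) orCross_even ht (Passes.id (P := orP) a) hx hy

theorem OrPasses.inv {s : Term OrGen a b} {t : Term OrGen b a} {p : OrOb} (h : OrPasses p s)
    (hst : ∀ w, oo w s * oo w t = oI (w ++ a)) (hts : ∀ w, oo w t * oo w s = oI (w ++ b)) :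
    OrPasses p t := by
  rw [orPasses_iff] at *
  intro w
  have h1 : oc w [p] a * (oo w s * oo w t) = oc w [p] a := by
    rw [hst, oc_mul_oI _ _ _ (by simp)]
  rw [← h1, ← mul_assoc (oc w [p] a), ← h, ← mul_assoc, ← mul_assoc, hts, oI_mul_oc _ _ _ (by simp)]

theorem orPasses_up (l : ℕ+) (t : Term OrGen a b) : OrPasses (.up l) t := by
  refine passes_of_generators (P := orP) orCross_even (fun g => ?_) t
  change OrPasses _ _
  cases g with
  | dot k => exact orPasses_up_toOr l (.gen (.dot k))
  | merge j k m h => exact orPasses_up_toOr l (.gen (.merge j k m h))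
  | split j k m h => exact orPasses_up_toOr l (.gen (.split j k m h))
  | cup k => exact orPasses_up_cup k l
  | cap k => exact orPasses_up_cap k l
  | rightCross j k =>
    have h : OrPasses (.up l) (leftCross k j) :=
      ((orPasses_up_cup k l).tensor_left [OrOb.down k, OrOb.up j]).comp
        ((((orPasses_up_toOr l (thickCross j k)).tensor_right [OrOb.down k]).tensor_left [OrOb.down k]).comp
        ((orPasses_up_cap k l).tensor_right [OrOb.up j, OrOb.down k]))
    exact h.inv (symm_down_up k j) (symm_up_down k j)

/-! ### Crossings with downward strands -/

theorem symm_up_any (l : ℕ+) (x : OrOb) : Symm (P := orP) (X := orCross) (.up l) x :=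
  match x with
  | .up k => symm_up_up l k
  | .down k => symm_up_down k l

theorem symm_any_up (l : ℕ+) (x : OrOb) : Symm (P := orP) (X := orCross) x (.up l) :=
  match x with
  | .up k => symm_up_up k l
  | .down k => symm_down_up k l

theorem oo_mul_oc_up (w : List OrOb) (l : ℕ+) (t : Term OrGen a b) :
    oo w t * oc w b [OrOb.up l] = oc w a [OrOb.up l] * oo (w ++ [OrOb.up l]) t := by
  refine op_mul_cr_of_passes' (P := orP) orCross_even w [OrOb.up l] (fun x hx => ?_) (fun x _ y hy => ?_)
    (fun x _ y hy => ?_) rfl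
  · rw [List.mem_singleton.mp hx]
    exact orPasses_up l t
  · rw [List.mem_singleton.mp hy]
    exact symm_any_up l x
  · rw [List.mem_singleton.mp hy]
    exact symm_up_any l x

theorem move_prefixes {R : Type*} [Monoid R] {C B B' X X' E P J₁ J₂ J₃ J₄ K L : R}
    (e1 : E * J₁ = K * E) (e2 : X * K = J₃ * X) (e3 : B * J₄ = L * B) (e4 : C * L = C)
    (e5 : J₂ = J₁) (e6 : J₄ = J₃) (e7 : J₁ * J₁ = J₁) (e7' : J₃ * J₃ = J₃) (e8 : B' = B)
    (e9 : X' = X) :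
    C * (B * J₄ * (J₃ * X * (E * J₁ * (J₂ * P)))) = C * (B' * X' * E) * P := by
  subst e8 e9 e6 e5
  calc _ = C * (B' * (J₄ * J₄) * X') * (E * (J₂ * J₂)) * P := by simp only [mul_assoc]
    _ = C * (B' * (J₄ * X')) * K * E * P := by rw [e7, e7', e1]; simp only [mul_assoc]
    _ = C * ((B' * J₄) * X' * K) * E * P := by simp only [mul_assoc]
    _ = C * (B' * J₄ * J₄ * X') * E * P := by rw [mul_assoc _ X', e2]; simp only [mul_assoc]
    _ = (C * L) * B' * X' * E * P := by
      rw [mul_assoc B', e7', e3]; simp only [mul_assoc]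
    _ = _ := by rw [e4]; simp only [mul_assoc]

theorem move_cup_cross_cap {R : Type*} [Monoid R] {u X E A₁ A₂ A₃ A₄ C₁ C₂ C₃ C₄ P₁ P₂ P₃ I : R}
    (e1 : E * A₁ = A₂ * E) (e2 : E * C₁ = C₂ * E) (e3 : E * P₁ = P₂ * E)
    (e4 : X * A₂ = A₃ * X) (e5 : X * C₂ = C₃ * X) (e6 : X * P₂ = P₃ * X)
    (e7 : u * A₃ = A₄ * u) (e8 : u * C₃ = C₄ * u) (e9 : u * P₃ = I) (e10 : I * X = X) :
    u * X * E * (A₁ * (C₁ * P₁)) = A₄ * (C₄ * X * E) := by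
  calc _ = u * X * (E * A₁) * C₁ * P₁ := by simp only [mul_assoc]
    _ = u * (X * A₂) * (E * C₁) * P₁ := by rw [e1]; simp only [mul_assoc]
    _ = (u * A₃) * (X * C₂) * (E * P₁) := by rw [e4, e2]; simp only [mul_assoc]
    _ = A₄ * (u * C₃) * (X * P₂) * E := by rw [e7, e5, e3]; simp only [mul_assoc]
    _ = A₄ * C₄ * ((u * P₃) * X) * E := by rw [e8, e6]; simp only [mul_assoc]
    _ = _ := by rw [e9, e10]; simp only [mul_assoc]

theorem oo_downCross (w : List OrOb) (k l : ℕ+) : oo w (downCross k l) =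
    oo (w ++ [OrOb.down k, OrOb.down l]) (cup k) * oo (w ++ [OrOb.down k]) (leftCross l k) * oo w (cap k) := by
  rw [downCross, oo_comp, oo_comp, oo_comp, oo_comp, oo_idLeft, oo_idLeft, oo_idLeft, oo_idLeft,
    oo_idRight', oo_idRight, oo_idRight', oo_idRight, oo_leftCross]
  have e1 : oo (w ++ [OrOb.down k]) (cap l) * oI (w ++ [OrOb.down k] ++ ([] ++ [OrOb.up k, OrOb.down l, OrOb.down k])) =
      oI (w ++ [OrOb.down k, OrOb.down l, OrOb.up l, OrOb.up k, OrOb.down l, OrOb.down k]) * oo (w ++ [OrOb.down k]) (cap l) :=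
    oo_mul_oI_comm _ [OrOb.up k, OrOb.down l, OrOb.down k] (by simp) (by simp)
  have e2 : oo (w ++ [OrOb.down k, OrOb.down l]) (upCross k l) * oI (w ++ [OrOb.down k, OrOb.down l, OrOb.up l, OrOb.up k, OrOb.down l, OrOb.down k]) =
      oI (w ++ [OrOb.down k, OrOb.down l] ++ ([OrOb.up k, OrOb.up l] ++ [OrOb.down l, OrOb.down k])) * oo (w ++ [OrOb.down k, OrOb.down l]) (upCross k l) :=
    oo_mul_oI_comm _ [OrOb.down l, OrOb.down k] (by simp) (by simp)
  have e3 : oo (w ++ [OrOb.down k, OrOb.down l, OrOb.up k]) (cup l) * oI (w ++ [OrOb.down k, OrOb.down l, OrOb.up k] ++ ([OrOb.up l, OrOb.down l] ++ [OrOb.down k])) =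
      oI (w ++ [OrOb.down k, OrOb.down l, OrOb.up k, OrOb.down k]) * oo (w ++ [OrOb.down k, OrOb.down l, OrOb.up k]) (cup l) := oo_mul_oI_comm _ [OrOb.down k] (by simp) (by simp)
  have e4 : oo (w ++ [OrOb.down k, OrOb.down l]) (cup k) * oI (w ++ [OrOb.down k, OrOb.down l, OrOb.up k, OrOb.down k]) =
      oo (w ++ [OrOb.down k, OrOb.down l]) (cup k) := oo_mul_oI _ (by simp)
  have e5 : oI (w ++ ([OrOb.down k, OrOb.up k] ++ [OrOb.down l, OrOb.down k])) =
      oI (w ++ [OrOb.down k] ++ ([] ++ [OrOb.up k, OrOb.down l, OrOb.down k])) := by simp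
  have e6 : oI (w ++ [OrOb.down k, OrOb.down l, OrOb.up k] ++ ([OrOb.up l, OrOb.down l] ++ [OrOb.down k])) =
      oI (w ++ [OrOb.down k, OrOb.down l] ++ ([OrOb.up k, OrOb.up l] ++ [OrOb.down l, OrOb.down k])) := by simp
  have e7 : ∀ v, oI v * oI v = oI v := fun v => oI_mul_oI List.prefix_rfl
  have e8 : oo (w ++ [OrOb.down k] ++ [OrOb.down l, OrOb.up k]) (cup l) = oo (w ++ [OrOb.down k, OrOb.down l, OrOb.up k]) (cup l) := by
    simp only [List.append_assoc]
    rfl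
  have e9 : oo (w ++ [OrOb.down k] ++ [OrOb.down l]) (upCross k l) = oo (w ++ [OrOb.down k, OrOb.down l]) (upCross k l) := by
    simp only [List.append_assoc]
    rfl
  exact move_prefixes e1 e2 e3 e4 e5 e6 (e7 _) (e7 _) e8 e9

theorem oc_down (w : List OrOb) (l : ℕ+) (a : List OrOb) : oc w [OrOb.down l] a =
    oo (w ++ ([OrOb.down l] ++ a)) (cup l) * (oc (w ++ [OrOb.down l]) a [OrOb.up l] * oo w (cap l)) := by
  induction a generalizing w with
  | nil =>
    have h : oo w (cap l) = oI (w ++ [OrOb.down l, OrOb.up l]) * oo w (cap l) := (oI_mul_oo _ (by simp)).symm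
    have h1 := cup_mul_cap' w l
    rw [oc_nil_right, oc_nil_left, oI_mul_oo _ (by simp), List.append_nil, h1]
  | cons y a ih =>
    have h0 : oo w (orCross (.down l) y) = oo (w ++ [OrOb.down l, y]) (cup l) *
        oo (w ++ [OrOb.down l]) (orCross y (.up l)) * oo w (cap l) := by
      cases y with
      | up k => exact oo_leftCross w l k
      | down k => exact oo_downCross w l k
    have e1 : oo w (cap l) * oo (w ++ [y] ++ ([OrOb.down l] ++ a)) (cup l) =
        oo (w ++ [OrOb.down l, OrOb.up l, y, OrOb.down l] ++ a) (cup l) * oo w (cap l) :=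
      oo_slide_left _ (cap_parity l) ([y, OrOb.down l] ++ a) (by simp) (by simp)
    have e2 : oo w (cap l) * oc (w ++ [y] ++ [OrOb.down l]) a [OrOb.up l] =
        oc (w ++ [OrOb.down l, OrOb.up l, y, OrOb.down l]) a [OrOb.up l] * oo w (cap l) :=
      oo_slide_oc (cap_parity l) a [OrOb.up l] [y, OrOb.down l] (by simp) (by simp)
    have e3 : oo w (cap l) * oo (w ++ [y]) (cap l) =
        oo (w ++ [OrOb.down l, OrOb.up l, y]) (cap l) * oo w (cap l) :=
      oo_slide_left _ (cap_parity l) [y] (by simp) (by simp)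
    have hX := orCross_even y (.up l)
    have e4 : oo (w ++ [OrOb.down l]) (orCross y (.up l)) *
        oo (w ++ [OrOb.down l, OrOb.up l, y, OrOb.down l] ++ a) (cup l) =
        oo (w ++ [OrOb.down l, y, OrOb.up l, OrOb.down l] ++ a) (cup l) *
          oo (w ++ [OrOb.down l]) (orCross y (.up l)) :=
      oo_slide_left _ hX ([OrOb.down l] ++ a) (by simp) (by simp)
    have e5 : oo (w ++ [OrOb.down l]) (orCross y (.up l)) *
        oc (w ++ [OrOb.down l, OrOb.up l, y, OrOb.down l]) a [OrOb.up l] =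
        oc (w ++ [OrOb.down l, y, OrOb.up l, OrOb.down l]) a [OrOb.up l] *
          oo (w ++ [OrOb.down l]) (orCross y (.up l)) :=
      oo_slide_oc hX a [OrOb.up l] [OrOb.down l] (by simp) (by simp)
    have e6 : oo (w ++ [OrOb.down l]) (orCross y (.up l)) * oo (w ++ [OrOb.down l, OrOb.up l, y]) (cap l) =
        oo (w ++ [OrOb.down l, y, OrOb.up l]) (cap l) * oo (w ++ [OrOb.down l]) (orCross y (.up l)) :=
      oo_slide_left _ hX [] (by simp) (by simp)
    have e7 : oo (w ++ [OrOb.down l, y]) (cup l) * oo (w ++ [OrOb.down l, y, OrOb.up l, OrOb.down l] ++ a) (cup l) =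
        oo (w ++ ([OrOb.down l] ++ (y :: a))) (cup l) * oo (w ++ [OrOb.down l, y]) (cup l) :=
      oo_slide_left _ (cup_parity l) a (by simp) (by simp)
    have e8 : oo (w ++ [OrOb.down l, y]) (cup l) * oc (w ++ [OrOb.down l, y, OrOb.up l, OrOb.down l]) a [OrOb.up l] =
        oc (w ++ [OrOb.down l, y]) a [OrOb.up l] * oo (w ++ [OrOb.down l, y]) (cup l) :=
      oo_slide_oc (cup_parity l) a [OrOb.up l] [] (by simp) (by simp)
    have e9 : oo (w ++ [OrOb.down l, y]) (cup l) * oo (w ++ [OrOb.down l, y, OrOb.up l]) (cap l) =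
        oI (w ++ [OrOb.down l, y, OrOb.up l]) := by
      have := cup_mul_cap (w ++ [OrOb.down l, y]) l
      simpa using this
    have e10 : oI (w ++ [OrOb.down l, y, OrOb.up l]) * oo (w ++ [OrOb.down l]) (orCross y (.up l)) =
        oo (w ++ [OrOb.down l]) (orCross y (.up l)) := oI_mul_oo _ (by simp)
    have h1 : oc (w ++ [OrOb.down l]) (y :: a) [OrOb.up l] =
        oc (w ++ [OrOb.down l, y]) a [OrOb.up l] * oo (w ++ [OrOb.down l]) (orCross y (.up l)) := by
      rw [oc_cons, oc_single, List.append_assoc]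
      rfl
    rw [oc_single_cons, h0, ih, h1]
    exact move_cup_cross_cap e1 e2 e3 e4 e5 e6 e7 e8 e9 e10

theorem orPasses_down (l : ℕ+) (t : Term OrGen a b) : OrPasses (.down l) t := by
  rw [orPasses_iff]
  intro w
  have e1 : oo (w ++ [OrOb.down l]) t * oo (w ++ ([OrOb.down l] ++ b)) (cup l) =
      oo (w ++ ([OrOb.down l] ++ a)) (cup l) * oo (w ++ [OrOb.down l]) t :=
    oo_slide_right _ (cup_parity l) [] (by simp) (by simp)
  have e2 : oo (w ++ [OrOb.down l] ++ [OrOb.up l]) t * oo w (cap l) = oo w (cap l) * oo w t :=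
    (oo_slide_left _ (cap_parity l) [] (by simp) (by simp)).symm
  rw [oc_down, oc_down, ← mul_assoc, e1, mul_assoc, ← mul_assoc (oo _ t), oo_mul_oc_up, mul_assoc,
    e2]
  simp only [mul_assoc]

theorem orPasses (p : OrOb) (t : Term OrGen a b) : OrPasses p t :=
  match p with
  | .up l => orPasses_up l t
  | .down l => orPasses_down l t

theorem symm_down_down (k l : ℕ+) : Symm (P := orP) (X := orCross) (.down k) (.down l) := by
  intro w
  change oo w (downCross k l) * oo w (downCross l k) = oI _
  have e1 : oo w (downCross k l) * oo (w ++ [OrOb.down l, OrOb.down k]) (cup l) =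
      oo (w ++ [OrOb.down k, OrOb.down l]) (cup l) * oo w (downCross k l) :=
    oo_slide_left _ (downCross_parity k l) [] (by simp) (by simp)
  have e2 := (orPasses_iff _ _).mp (orPasses_down k (cap l)) w
  rw [oc_nil_right, oc_single_cons, oc_single] at e2
  change _ = oo w (downCross k l) * oo (w ++ [OrOb.down l]) (leftCross k l) * _ at e2
  have e3 := cup_mul_cap' (w ++ [OrOb.down k]) l
  rw [List.append_assoc] at e3
  rw [oo_downCross w l k, ← mul_assoc, ← mul_assoc, e1, mul_assoc, mul_assoc, ← mul_assoc (oo w _), ← e2,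
    ← mul_assoc]
  change oo (w ++ ([OrOb.down k] ++ [OrOb.down l])) (cup l) * _ * _ = _
  rw [e3, oI_mul_oI' (by simp)]
  rfl

theorem symm_orCross : ∀ x y : OrOb, Symm (P := orP) (X := orCross) x y
  | .up k, y => symm_up_any k y
  | x, .up l => symm_any_up l x
  | .down k, .down l => symm_down_down k l

theorem isSymmetricBraiding_orBraiding : IsSymmetricBraiding orBraiding :=
  isSymmetricBraiding_crossWords (P := orP) orCross_even symm_orCross
    fun x _ _ g => orPasses x (.gen g)

theorem oo_mul_oc (w c : List OrOb) (t : Term OrGen a b) :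
    oo (w ++ c) t * oc w c b = oc w c a * oo w t :=
  op_mul_cr_of_passes (P := orP) w c (fun p _ => orPasses p t) rfl

theorem oo_mul_oc' (w c : List OrOb) (t : Term OrGen a b) :
    oo w t * oc w b c = oc w a c * oo (w ++ c) t :=
  op_mul_cr_of_passes' (P := orP) orCross_even w c (fun p _ => orPasses p t)
    (fun x _ y _ => symm_orCross x y) (fun x _ y _ => symm_orCross y x) rfl

theorem oc_symm (w a b : List OrOb) : oc w a b * oc w b a = oI (w ++ (a ++ b)) :=
  cr_symm (P := orP) orCross_even w a b fun x _ y _ => symm_orCross x y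

end

section

variable {a b c d x y v w : List ℕ+}

/-! ### Webs on thin strands -/

/-- Families of operators, indexed by the word to the left. -/
abbrev UpFam : Type := List ℕ+ → Ops upP

/-- The family, to the right of one more thin strand. -/
noncomputable def sh (F : UpFam) : UpFam := fun w => F (w ++ up 1)

theorem sh_mul (F G : UpFam) : sh (F * G) = sh F * sh G := rfl
theorem sh_add (F G : UpFam) : sh (F + G) = sh F + sh G := rfl
theorem sh_smul (r : ℂ) (F : UpFam) : sh (r • F) = r • sh F := rfl
theorem sh_zero : sh 0 = 0 := rfl

/-- The identity of `n` thin strands. -/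
noncomputable def thinI (n : ℕ) : UpFam := fun w => uI (w ++ ones n)

theorem sh_thinI (n : ℕ) : sh (thinI n) = thinI (n + 1) := by
  funext w
  change uI (w ++ up 1 ++ ones n) = uI (w ++ (up 1 ++ ones n))
  rw [List.append_assoc]

/-- The span of the webs between `n` thin strands of parity `p`, in terms of the webs between one
strand less. -/
noncomputable def Mk : ℕ → ZMod 2 → Submodule ℂ UpFam
  | 0, p => Submodule.span ℂ {F | p = 0 ∧ F = thinI 0}
  | n + 1, p => Submodule.span ℂ
      ({F | ∃ z ∈ Mk n p, F = sh z} ∪ {F | ∃ q, ∃ z ∈ Mk n q, q + 1 = p ∧ F = sh z * thinD} ∪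
        {F | n ≠ 0 ∧ ∃ q r, ∃ y ∈ Mk n q, ∃ z ∈ Mk n r, q + r = p ∧ F = sh y * thinX * sh z})

variable {n : ℕ} {p q r : ZMod 2} {F G y z : UpFam}

/-- Membership in `Mk n p`. -/
def IsMk (n : ℕ) (p : ZMod 2) (F : UpFam) : Prop := F ∈ Mk n p

theorem IsMk.cast (h : IsMk n p F) (e : p = q) : IsMk n q F := e ▸ h

theorem IsMk.plain (h : IsMk n p z) : IsMk (n + 1) p (sh z) :=
  Submodule.subset_span (.inl (.inl ⟨z, h, rfl⟩))

theorem IsMk.dot (h : IsMk n p z) : IsMk (n + 1) (p + 1) (sh z * thinD) :=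
  Submodule.subset_span (.inl (.inr ⟨p, z, h, rfl, rfl⟩))

theorem IsMk.cross (hn : n ≠ 0) (hy : IsMk n p y) (hz : IsMk n q z) :
    IsMk (n + 1) (p + q) (sh y * thinX * sh z) :=
  Submodule.subset_span (.inr ⟨hn, p, q, y, hy, z, hz, rfl, rfl⟩)

theorem IsMk.induction {motive : UpFam → Prop} (hF : IsMk (n + 1) p F)
    (plain : ∀ z, IsMk n p z → motive (sh z))
    (dot : ∀ q, ∀ z, IsMk n q z → q + 1 = p → motive (sh z * thinD))
    (cross : n ≠ 0 → ∀ q r, ∀ y, IsMk n q y → ∀ z, IsMk n r z → q + r = p →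
      motive (sh y * thinX * sh z))
    (zero : motive 0) (add : ∀ F G, motive F → motive G → motive (F + G))
    (smul : ∀ (c : ℂ) F, motive F → motive (c • F)) : motive F := by
  rw [IsMk, Mk] at hF
  induction hF using Submodule.span_induction with
  | mem F h =>
    rcases h with (⟨z, hz, rfl⟩ | ⟨q, z, hz, e, rfl⟩) | ⟨hn, q, r, y, hy, z, hz, e, rfl⟩
    · exact plain z hz
    · exact dot q z hz e
    · exact cross hn q r y hy z hz e
  | zero => exact zero
  | add F G _ _ h h' => exact add F G h h'
  | smul c F _ h => exact smul c F h

theorem IsMk.one (n : ℕ) : IsMk n 0 (thinI n) := by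
  induction n with
  | zero => exact Submodule.subset_span ⟨rfl, rfl⟩
  | succ n ih => rw [← sh_thinI]; exact ih.plain

theorem IsMk.exists_term (h : IsMk n p F) :
    ∃ t : Term UpGen (ones n) (ones n), t.HasParity UpGen.par p ∧ F = fun w => uo w t := by
  induction n generalizing F p with
  | zero =>
    rw [IsMk, Mk] at h
    induction h using Submodule.span_induction with
    | mem F h =>
      obtain ⟨rfl, rfl⟩ := h
      exact ⟨.id [], .id _, funext fun w => (uo_id w []).symm⟩
    | zero => exact ⟨0, .zero _, funext fun w => (uo_zero w).symm⟩
    | add F G _ _ h h' =>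
      obtain ⟨s, hs, rfl⟩ := h
      obtain ⟨t, ht, rfl⟩ := h'
      exact ⟨s + t, hs.add ht, funext fun w => (uo_add w s t).symm⟩
    | smul c F _ h =>
      obtain ⟨s, hs, rfl⟩ := h
      exact ⟨c • s, hs.smul c, funext fun w => (uo_smul w c s).symm⟩
  | succ n ih =>
    refine IsMk.induction (motive := fun F => ∃ t : Term UpGen (ones (n + 1)) (ones (n + 1)),
      t.HasParity UpGen.par p ∧ F = fun w => uo w t) h (fun z hz => ?_) (fun q z hz e => ?_) (fun hn q r y hy z hz e => ?_)
      ⟨0, .zero _, funext fun w => (uo_zero w).symm⟩ ?_ ?_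
    · obtain ⟨t, ht, rfl⟩ := ih hz
      exact ⟨Term.idLeft (up 1) t rfl rfl, ht.idLeft _ _, funext fun w =>
        (uo_idLeft w (a := up 1) t rfl rfl).symm⟩
    · obtain ⟨t, ht, rfl⟩ := ih hz
      refine ⟨(dt 1).tens t, .cast (.tensor (dt_parity 1) ht _ _) ?_, funext fun w =>
        (uo_tens w (dt 1) t).symm⟩
      rw [← e, add_comm]
    · obtain ⟨n, rfl⟩ := Nat.exists_eq_succ_of_ne_zero hn
      obtain ⟨s, hs, rfl⟩ := ih hy
      obtain ⟨t, ht, rfl⟩ := ih hz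
      have hX : (Term.idRight thinCross (ones n) rfl rfl :
        Term UpGen (up 1 ++ ones (n + 1)) (up 1 ++ ones (n + 1))).HasParity UpGen.par 0 :=
          thinCross_parity.idRight _ _
      refine ⟨Term.idLeft (up 1) s rfl rfl ⨟ Term.idRight thinCross (ones n) rfl rfl ⨟
        Term.idLeft (up 1) t rfl rfl, .cast (.comp (hs.idLeft _ _) (.comp hX (ht.idLeft _ _))) ?_, ?_⟩
      · rw [← e, zero_add]
      · funext w
        have e1 : uo w (Term.idRight thinCross (ones n) rfl rfl :
            Term UpGen (up 1 ++ ones (n + 1)) (up 1 ++ ones (n + 1))) =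
            uI (w ++ (up 1 ++ up 1 ++ ones n)) * thinX w := uo_idRight w (a := ones n) thinCross rfl rfl
        have e2 : uo w (Term.idLeft (up 1) s rfl rfl) = uo (w ++ up 1) s :=
          uo_idLeft w (a := up 1) s rfl rfl
        have e3 : uo w (Term.idLeft (up 1) t rfl rfl) = uo (w ++ up 1) t :=
          uo_idLeft w (a := up 1) t rfl rfl
        have e4 : uo (w ++ up 1) s * uI (w ++ (up 1 ++ up 1 ++ ones n)) = uo (w ++ up 1) s :=
          uo_mul_uI _ ⟨[], by simp [ones]⟩
        refine Eq.symm ((uo_comp w _ _).trans ?_)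
        refine (congrArg₂ (· * ·) e2 (uo_comp w _ _)).trans ?_
        refine (congrArg (fun u => uo (w ++ up 1) s * u) (congrArg₂ (· * ·) e1 e3)).trans ?_
        change _ = uo (w ++ up 1) s * thinX w * uo (w ++ up 1) t
        rw [mul_assoc (uI _), ← mul_assoc, e4, mul_assoc]
    · rintro F G ⟨s, hs, rfl⟩ ⟨t, ht, rfl⟩
      exact ⟨s + t, hs.add ht, funext fun w => (uo_add w s t).symm⟩
    · rintro c F ⟨s, hs, rfl⟩
      exact ⟨c • s, hs.smul c, funext fun w => (uo_smul w c s).symm⟩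

theorem IsMk.mul_thinI (h : IsMk n p F) : F * thinI n = F := by
  obtain ⟨t, -, rfl⟩ := h.exists_term
  exact funext fun w => uo_mul_uI t List.prefix_rfl

theorem IsMk.thinI_mul (h : IsMk n p F) : thinI n * F = F := by
  obtain ⟨t, -, rfl⟩ := h.exists_term
  exact funext fun w => uI_mul_uo t List.prefix_rfl

theorem IsMk.mul_thinI_of_le (h : IsMk n p F) {m : ℕ} (hm : m ≤ n) : F * thinI m = F := by
  obtain ⟨t, -, rfl⟩ := h.exists_term
  refine funext fun w => uo_mul_uI t ?_
  obtain ⟨k, rfl⟩ := Nat.exists_eq_add_of_le hm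
  exact ⟨ones k, by rw [← ones_add rfl, List.append_assoc]⟩

/-- The sign in exchanging a dot with a web of the given parity. -/
noncomputable def dsign (p : ZMod 2) : ℂ := koszul p 1

theorem IsMk.thinD_mul_sh (h : IsMk n p F) : thinD * sh F = dsign p • (sh F * thinD) := by
  obtain ⟨t, ht, rfl⟩ := h.exists_term
  exact funext fun w => op_slide (P := upP) ⟨_, dt_parity 1, rfl⟩ ⟨_, ht, rfl⟩ [] (by simp) (by simp)

theorem IsMk.sh_sh_mul_thinX (h : IsMk n p F) : sh (sh F) * thinX = thinX * sh (sh F) := by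
  obtain ⟨t, ht, rfl⟩ := h.exists_term
  refine funext fun w => ?_
  change uo (w ++ up 1 ++ up 1) t * thinX w = thinX w * uo (w ++ up 1 ++ up 1) t
  rw [List.append_assoc]
  exact uo_mul_thinX w t

theorem fam_D_mul_D : thinD * thinD = thinI 1 := funext fun w => thinD_mul_thinD w
theorem fam_X_mul_X : thinX * thinX = thinI 2 := funext fun w => thinX_mul_thinX w
theorem fam_D_mul_X : thinD * thinX = thinX * sh thinD := funext fun w => thinD_mul_thinX w
theorem fam_shD_mul_X : sh thinD * thinX = thinX * thinD := funext fun w => thinD_mul_thinX' w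
theorem fam_braid : thinX * sh thinX * thinX = sh thinX * thinX * sh thinX :=
  funext fun w => thinX_braid w

theorem IsMk.dot_one (n : ℕ) : IsMk (n + 1) 1 (thinD * thinI (n + 1)) := by
  have h := (IsMk.one n).dot
  rw [sh_thinI, zero_add] at h
  have h2 := (IsMk.one n).thinD_mul_sh
  rw [sh_thinI] at h2
  have h3 : dsign 0 = 1 := koszul_zero_left 1
  rwa [h2, h3, one_smul]

theorem IsMk.cross_one (n : ℕ) : IsMk (n + 2) 0 (thinI (n + 2) * thinX) := by
  have h := IsMk.cross n.succ_ne_zero (IsMk.one (n + 1)) (IsMk.one (n + 1))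
  have h2 := (IsMk.one n).sh_sh_mul_thinX
  rw [sh_thinI, sh_thinI] at h2
  rw [sh_thinI, h2, mul_assoc, (IsMk.one (n + 2)).mul_thinI, ← h2] at h
  exact h

theorem IsMk.zero (n : ℕ) (p : ZMod 2) : IsMk n p 0 := Submodule.zero_mem _
theorem IsMk.add (h : IsMk n p F) (h' : IsMk n p G) : IsMk n p (F + G) := Submodule.add_mem _ h h'
theorem IsMk.smul (c : ℂ) (h : IsMk n p F) : IsMk n p (c • F) := Submodule.smul_mem _ c h

theorem thinX_mul_thinI (n : ℕ) : thinX * thinI (n + 2) = thinI (n + 2) * thinX := by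
  have h2 := (IsMk.one n).sh_sh_mul_thinX
  rw [sh_thinI, sh_thinI] at h2
  exact h2.symm

theorem thinD_mul_thinI (n : ℕ) : thinD * thinI (n + 1) = thinI (n + 1) * thinD := by
  have h2 := (IsMk.one n).thinD_mul_sh
  rw [sh_thinI] at h2
  have h3 : dsign 0 = 1 := koszul_zero_left 1
  rw [h2, h3, one_smul]

theorem IsMk.mul_thinD (h : IsMk (n + 1) p F)
    (hm : ∀ {p q F G}, IsMk (n + 1) p F → IsMk (n + 1) q G → IsMk (n + 1) (p + q) (F * G)) :
    IsMk (n + 1) (p + 1) (F * thinD) := by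
  rw [← h.mul_thinI, mul_assoc, ← thinD_mul_thinI]
  exact hm h (.dot_one n)

theorem IsMk.thinD_mul (h : IsMk (n + 1) p F)
    (hm : ∀ {p q F G}, IsMk (n + 1) p F → IsMk (n + 1) q G → IsMk (n + 1) (p + q) (F * G)) :
    IsMk (n + 1) (p + 1) (thinD * F) := by
  rw [← h.thinI_mul, ← mul_assoc]
  exact (hm (.dot_one n) h).cast (add_comm _ _)

theorem IsMk.mul_thinX (h : IsMk (n + 2) p F)
    (hm : ∀ {p q F G}, IsMk (n + 2) p F → IsMk (n + 2) q G → IsMk (n + 2) (p + q) (F * G)) :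
    IsMk (n + 2) p (F * thinX) := by
  rw [← h.mul_thinI, mul_assoc]
  exact (hm h (.cross_one n)).cast (add_zero p)

theorem IsMk.thinX_mul (h : IsMk (n + 2) p F)
    (hm : ∀ {p q F G}, IsMk (n + 2) p F → IsMk (n + 2) q G → IsMk (n + 2) (p + q) (F * G)) :
    IsMk (n + 2) p (thinX * F) := by
  rw [← h.thinI_mul, ← mul_assoc, thinX_mul_thinI]
  exact (hm (.cross_one n) h).cast (zero_add p)

theorem sh_mul_thinI_one (h : IsMk n p F) : sh F * thinI 1 = sh F :=
  h.plain.mul_thinI_of_le (by omega)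

theorem IsMk.cross_mul_cross {u : UpFam} (hn : n ≠ 0)
    (hm : ∀ {p q F G}, IsMk n p F → IsMk n q G → IsMk n (p + q) (F * G))
    (hy : IsMk n p y) (hu : IsMk n q u) (hz : IsMk n r z) :
    IsMk (n + 1) (p + q + r) (sh y * thinX * sh u * thinX * sh z) := by
  obtain ⟨n, rfl⟩ := Nat.exists_eq_succ_of_ne_zero hn
  rw [Nat.succ_eq_add_one] at *
  refine IsMk.induction (motive := fun u => IsMk (n + 1 + 1) (p + q + r)
    (sh y * thinX * sh u * thinX * sh z)) hu (fun v hv => ?_) (fun p' v hv e => ?_) (fun hn' p' q' a ha b hb e => ?_) ?_ ?_ ?_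
  · have e1 : sh y * thinX * sh (sh v) * thinX * sh z = sh (y * sh v * z) := by
      rw [mul_assoc (sh y), ← hv.sh_sh_mul_thinX, mul_assoc, mul_assoc, mul_assoc, ← mul_assoc thinX,
        fam_X_mul_X, ← mul_assoc (sh (sh v)), hv.plain.plain.mul_thinI_of_le (by omega)]
      simp only [sh_mul, mul_assoc]
    rw [e1]
    exact (hm (hm hy hv.plain) hz).plain
  · have e1 : sh y * thinX * sh (sh v * thinD) * thinX * sh z =
        dsign r • (sh (y * sh v * z) * thinD) := by
      have h2 : thinX * sh (sh v * thinD) * thinX = sh (sh v) * thinD := by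
        rw [sh_mul, ← mul_assoc, ← hv.sh_sh_mul_thinX, mul_assoc, mul_assoc, fam_shD_mul_X,
          ← mul_assoc thinX, fam_X_mul_X, ← mul_assoc, hv.plain.plain.mul_thinI_of_le (by omega)]
      rw [mul_assoc (sh y), mul_assoc (sh y), h2, mul_assoc, mul_assoc, hz.thinD_mul_sh]
      simp only [sh_mul, mul_assoc, mul_smul_comm]
    rw [e1]
    subst e
    exact ((hm (hm hy hv.plain) hz).dot.smul _).cast (by ring)
  · obtain ⟨n, rfl⟩ := Nat.exists_eq_succ_of_ne_zero hn'
    rw [Nat.succ_eq_add_one] at *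
    have e1 : sh y * thinX * sh (sh a * thinX * sh b) * thinX * sh z =
        sh (y * (sh a * thinX)) * thinX * sh (thinX * sh b * z) := by
      have h3 : ∀ F : UpFam, thinX * (sh thinX * (thinX * F)) = sh thinX * (thinX * (sh thinX * F)) :=
        fun F => by rw [← mul_assoc, ← mul_assoc, fam_braid, mul_assoc, mul_assoc]
      simp only [sh_mul, mul_assoc]
      rw [← mul_assoc (sh (sh b)), hb.sh_sh_mul_thinX, ← mul_assoc thinX, ← ha.sh_sh_mul_thinX]
      simp only [mul_assoc]
      rw [h3]
    rw [e1]
    subst e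
    exact (IsMk.cross (Nat.succ_ne_zero _) (hm hy (ha.plain.mul_thinX hm)) (hm (hb.plain.thinX_mul hm) hz)).cast
      (by ring)
  · rw [sh_zero, mul_zero, zero_mul, zero_mul]; exact .zero _ _
  · intro F G hF hG
    rw [sh_add, mul_add, add_mul, add_mul]
    exact hF.add hG
  · intro c F hF
    rw [sh_smul, mul_smul_comm, smul_mul_assoc, smul_mul_assoc]
    exact hF.smul c

theorem two_odd (a b : ZMod 2) : a + b = a + 1 + (b + 1) := by decide +revert

theorem IsMk.mul : ∀ {n : ℕ} {p q : ZMod 2} {F G : UpFam}, IsMk n p F → IsMk n q G →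
    IsMk n (p + q) (F * G) := by
  intro n
  induction n with
  | zero =>
    intro p q F G hF hG
    have hF' := hF
    rw [IsMk, Mk] at hF
    induction hF using Submodule.span_induction with
    | mem F h =>
      obtain ⟨rfl, rfl⟩ := h
      rw [hG.thinI_mul, zero_add]
      exact hG
    | zero => rw [zero_mul]; exact .zero _ _
    | add F F' h1 h2 h h' => rw [add_mul]; exact (h h1).add (h' h2)
    | smul c F h1 h => rw [smul_mul_assoc]; exact (h h1).smul c
  | succ n hm =>
    intro p q F G hF hG
    refine IsMk.induction (motive := fun F => IsMk (n + 1) (p + q) (F * G)) hF (fun z hz => ?_) (fun p' z hz e => ?_) (fun hn p' q' y hy z hz e => ?_) ?_ ?_ ?_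
    · refine IsMk.induction (motive := fun G => IsMk (n + 1) (p + q) (sh z * G)) hG (fun z' hz' => ?_) (fun p'' z' hz' e' => ?_)
        (fun hn' p'' q'' y' hy' z' hz' e' => ?_) ?_ ?_ ?_
      · exact (hm hz hz').plain
      · rw [← mul_assoc, ← sh_mul]
        subst e'
        exact (hm hz hz').dot.cast (by ring)
      · rw [← mul_assoc, ← mul_assoc, ← sh_mul]
        subst e'
        exact (IsMk.cross hn' (hm hz hy') hz').cast (by ring)
      · rw [mul_zero]; exact .zero _ _
      · intro A B hA hB; rw [mul_add]; exact hA.add hB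
      · intro c A hA; rw [mul_smul_comm]; exact hA.smul c
    · subst e
      refine IsMk.induction (motive := fun G => IsMk (n + 1) (p' + 1 + q) (sh z * thinD * G)) hG (fun z' hz' => ?_) (fun p'' z' hz' e' => ?_)
        (fun hn' p'' q'' y' hy' z' hz' e' => ?_) ?_ ?_ ?_
      · rw [mul_assoc, hz'.thinD_mul_sh, mul_smul_comm, ← mul_assoc, ← sh_mul]
        exact ((hm hz hz').dot.smul _).cast (by ring)
      · rw [← mul_assoc, mul_assoc (sh z), hz'.thinD_mul_sh, mul_smul_comm, smul_mul_assoc, mul_assoc, mul_assoc,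
          fam_D_mul_D, sh_mul_thinI_one hz', ← sh_mul]
        subst e'
        exact ((hm hz hz').plain.smul _).cast (two_odd _ _)
      · rw [← mul_assoc, ← mul_assoc, mul_assoc (sh z), hy'.thinD_mul_sh, mul_smul_comm,
          smul_mul_assoc, smul_mul_assoc]
        have h3 : sh z * (sh y' * thinD) * thinX * sh z' = sh (z * y') * thinX * sh (thinD * z') := by
          simp only [sh_mul, mul_assoc]
          rw [← mul_assoc thinD thinX, fam_D_mul_X, mul_assoc]
        rw [h3]
        obtain ⟨n, rfl⟩ := Nat.exists_eq_succ_of_ne_zero hn'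
        rw [Nat.succ_eq_add_one] at *
        subst e'
        exact ((IsMk.cross (Nat.succ_ne_zero _) (hm hz hy') (hz'.thinD_mul hm)).smul _).cast (by ring)
      · rw [mul_zero]; exact .zero _ _
      · intro A B hA hB; rw [mul_add]; exact hA.add hB
      · intro c A hA; rw [mul_smul_comm]; exact hA.smul c
    · subst e
      refine IsMk.induction (motive := fun G => IsMk (n + 1) (p' + q' + q)
        (sh y * thinX * sh z * G)) hG (fun z' hz' => ?_) (fun p'' z' hz' e' => ?_)
        (fun hn' p'' q'' y' hy' z' hz' e' => ?_) ?_ ?_ ?_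
      · rw [mul_assoc, ← sh_mul]
        exact (IsMk.cross hn hy (hm hz hz')).cast (by ring)
      · have h0 := (hm hz hz').thinD_mul_sh
        have h1 : dsign (q' + p'') * dsign (q' + p'') = 1 := koszul_mul_self _ _
        have h2 : sh (z * z') * thinD = dsign (q' + p'') • (thinD * sh (z * z')) := by
          rw [h0, smul_smul, h1, one_smul]
        rw [← mul_assoc, mul_assoc (sh y * thinX), ← sh_mul, mul_assoc, h2, mul_smul_comm,
          ← mul_assoc, mul_assoc (sh y), ← fam_shD_mul_X, ← mul_assoc, ← sh_mul]
        obtain ⟨n, rfl⟩ := Nat.exists_eq_succ_of_ne_zero hn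
        rw [Nat.succ_eq_add_one] at *
        subst e'
        exact ((IsMk.cross (Nat.succ_ne_zero _) (hy.mul_thinD hm) (hm hz hz')).smul _).cast (by ring)
      · have h0 := IsMk.cross_mul_cross hn hm hy (hm hz hy') hz'
        rw [sh_mul] at h0
        simp only [← mul_assoc] at h0 ⊢
        subst e'
        exact h0.cast (by ring)
      · rw [mul_zero]; exact .zero _ _
      · intro A B hA hB; rw [mul_add]; exact hA.add hB
      · intro c A hA; rw [mul_smul_comm]; exact hA.smul c
    · rw [zero_mul]; exact .zero _ _
    · intro A B hA hB; rw [add_mul]; exact hA.add hB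
    · intro c A hA; rw [smul_mul_assoc]; exact hA.smul c

end

section

variable {a b c d x y v w : List ℕ+} {n m : ℕ} {p q r : ZMod 2} {F G z : UpFam}

/-! ### Closure properties of webs on thin strands -/

/-- The family, to the right of `n` more thin strands. -/
noncomputable def shn (n : ℕ) (F : UpFam) : UpFam := fun w => F (w ++ ones n)

theorem shn_zero (F : UpFam) : shn 0 F = F := by
  funext w
  rw [shn, ones, List.append_nil]

theorem shn_succ (n : ℕ) (F : UpFam) : shn (n + 1) F = sh (shn n F) := by
  funext w
  rw [shn, ones, ← List.append_assoc]
  rfl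

theorem shn_thinI (n m : ℕ) : shn n (thinI m) = thinI (n + m) := by
  funext w
  change uI (w ++ ones n ++ ones m) = uI (w ++ ones (n + m))
  rw [List.append_assoc, ones_add rfl]

theorem IsMk.congr (h : IsMk n p F) (e : ∀ w, F w = G w) : IsMk n p G := (funext e : F = G) ▸ h

theorem IsMk.cast_nat (h : IsMk n p F) (e : n = m) : IsMk m p F := e ▸ h

theorem IsMk.tensor (hF : IsMk n p F) (hG : IsMk m q G) : IsMk (n + m) (p + q) (shn n G * F) := by
  induction n generalizing F G p q with
  | zero =>
    rw [IsMk, Mk] at hF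
    induction hF using Submodule.span_induction with
    | mem F h =>
      obtain ⟨rfl, rfl⟩ := h
      rw [shn_zero, hG.mul_thinI_of_le (Nat.zero_le m)]
      exact (hG.cast (zero_add q).symm).cast_nat (Nat.zero_add m).symm
    | zero => rw [mul_zero]; exact .zero _ _
    | add F F' _ _ h h' => rw [mul_add]; exact h.add h'
    | smul c F _ h => rw [mul_smul_comm]; exact h.smul c
  | succ n ih =>
    have hn : n + 1 + m = n + m + 1 := Nat.add_right_comm n 1 m
    refine .cast_nat ?_ hn.symm
    rw [shn_succ]
    refine IsMk.induction (motive := fun F => IsMk (n + m + 1) (p + q) (sh (shn n G) * F)) hF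
      (fun z hz => ?_) (fun p' z hz e => ?_) (fun hn p' q' y hy z hz e => ?_) ?_ ?_ ?_
    · exact (ih hz hG).plain
    · rw [← mul_assoc, ← sh_mul]
      subst e
      exact (ih hz hG).dot.cast (by ring)
    · obtain ⟨n, rfl⟩ := Nat.exists_eq_succ_of_ne_zero hn
      rw [Nat.succ_eq_add_one] at *
      have e1 : thinX * thinI (n + m + 2) = thinI (n + m + 2) * thinX := thinX_mul_thinI _
      have e2 : n + m + 2 = n + 1 + m + 1 := by omega
      have h1 := ih hy hG
      have h2 := ih hz (.one m)
      rw [shn_thinI] at h2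
      have e3 : sh (shn (n + 1) G) * (sh y * thinX * sh z) =
          sh (shn (n + 1) G * y) * thinX * sh (thinI (n + 1 + m) * z) := by
        have e4 := h1.plain.mul_thinI
        rw [sh_mul] at e4
        have e5 : sh (shn (n + 1) G) * sh y * thinX * (thinI (n + 1 + m + 1) * sh z) =
            sh (shn (n + 1) G) * sh y * thinI (n + 1 + m + 1) * thinX * sh z := by
          rw [← e2, mul_assoc _ (thinI _) thinX, ← e1]
          simp only [mul_assoc]
        rw [sh_mul, sh_mul, sh_thinI, e5, e4]
        simp only [mul_assoc]
      rw [e3]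
      subst e
      exact (IsMk.cross (by omega) h1 h2).cast (by ring)
    · rw [mul_zero]; exact .zero _ _
    · intro A B hA hB; rw [mul_add]; exact hA.add hB
    · intro c A hA; rw [mul_smul_comm]; exact hA.smul c

theorem isMk_sym : ∀ k : ℕ, IsMk k 0 fun w => sym w k
  | 0 => by
    convert IsMk.one 0 using 1
    funext w
    rw [sym, im_zero, ex_zero, uI_mul_uI List.prefix_rfl]
    exact congrArg uI (List.append_nil w).symm
  | 1 => by
    convert IsMk.one 1 using 1
    funext w
    rw [sym, im_one, ex_one, uI_mul_uI List.prefix_rfl]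
    rfl
  | k + 2 => by
    have h1 := isMk_sym (k + 1)
    have h0 := isMk_sym k
    have h := h1.plain.add ((IsMk.cross k.succ_ne_zero h1 ((h0.plain).mul h1)).smul
      (1 / (k.factorial : ℂ) ^ 2))
    convert h using 1
    funext w
    rw [sym_succ_succ, mul_assoc]
    rfl

theorem isMk_sumDots : ∀ k : ℕ, IsMk k 1 fun w => uo w (sumDots k)
  | 0 => by
    convert IsMk.zero 0 1 using 1
    exact funext fun w => uo_zero w
  | k + 1 => by
    have h := (IsMk.dot_one k).add (isMk_sumDots k).plain
    rw [thinD_mul_thinI] at h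
    convert h using 1
    exact funext fun w => uo_sumDots_succ w k

theorem IsMk.im_slide (h : IsMk n p F) (w : List ℕ+) (k : ℕ) :
    im w k * F (w ++ up k) = F (w ++ ones k) * im w k := by
  obtain ⟨t, -, rfl⟩ := h.exists_term
  exact im_slide_uo w k t

/-! ### Explosions of words -/

/-- The number of thin strands in the explosion of a word. -/
def sz : List ℕ+ → ℕ
  | [] => 0
  | k :: a => k + sz a

theorem sz_append (a b : List ℕ+) : sz (a ++ b) = sz a + sz b := by
  induction a with
  | nil => exact (Nat.zero_add _).symm
  | cons k a ih => rw [List.cons_append, sz, ih, sz, Nat.add_assoc]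

theorem ones_sz_nil : [] = ones (sz []) := rfl

theorem ones_sz_cons (k : ℕ+) (a : List ℕ+) : ones (sz (k :: a)) = ones k ++ ones (sz a) :=
  (ones_add rfl).symm

theorem cons_eq_up (k : ℕ+) (a : List ℕ+) : k :: a = up k ++ a := by
  rw [up_coe]
  rfl

/-- The explosion of all strands of a word. -/
def exWord : ∀ a : List ℕ+, Term UpGen a (ones (sz a))
  | [] => .ofEq ones_sz_nil
  | k :: a => Term.tensor (explode k) (exWord a) (cons_eq_up k a) (ones_sz_cons k a)

/-- The implosion of the strands of a word. -/
def imWord : ∀ a : List ℕ+, Term UpGen (ones (sz a)) a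
  | [] => .ofEq ones_sz_nil.symm
  | k :: a => Term.tensor (implode k) (imWord a) (ones_sz_cons k a) (cons_eq_up k a)

theorem exWord_parity : ∀ a : List ℕ+, (exWord a).HasParity UpGen.par 0
  | [] => .ofEq _
  | k :: a => .tensor (explode_parity k) (exWord_parity a) _ _

theorem imWord_parity : ∀ a : List ℕ+, (imWord a).HasParity UpGen.par 0
  | [] => .ofEq _
  | k :: a => .tensor (implode_parity k) (imWord_parity a) _ _

theorem uo_exWord_nil (w : List ℕ+) : uo w (exWord []) = uI w := by
  rw [exWord, uo_ofEq, List.append_nil]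

theorem uo_imWord_nil (w : List ℕ+) : uo w (imWord []) = uI w := by
  rw [imWord, uo_ofEq, ← ones_sz_nil, List.append_nil]

theorem uo_exWord_cons (w : List ℕ+) (k : ℕ+) (a : List ℕ+) :
    uo w (exWord (k :: a)) = uo (w ++ [k]) (exWord a) * ex w k := by
  have h : w ++ up k = w ++ [k] := by rw [up_coe]
  rw [exWord, uo_tensor, h]
  rfl

theorem uo_imWord_cons (w : List ℕ+) (k : ℕ+) (a : List ℕ+) :
    uo w (imWord (k :: a)) = im w k * uo (w ++ [k]) (imWord a) := by
  rw [imWord, uo_tensor, ← up_coe]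
  exact (im_slide_uo w k (imWord a)).symm

theorem uo_exWord_single (w : List ℕ+) (k : ℕ+) : uo w (exWord [k]) = ex w k := by
  rw [uo_exWord_cons, uo_exWord_nil]
  exact uI_mul_ex w k (by rw [up_coe])

theorem uo_imWord_single (w : List ℕ+) (k : ℕ+) : uo w (imWord [k]) = im w k := by
  rw [uo_imWord_cons, uo_imWord_nil]
  exact im_mul_uI w k (by rw [up_coe])

theorem uo_exWord_mul_uI (w b : List ℕ+) : uo w (exWord b) * uI w = uo w (exWord b) :=
  uo_mul_uI _ (List.prefix_append _ _)

theorem uo_exWord_append (w a b : List ℕ+) :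
    uo w (exWord (a ++ b)) = uo (w ++ a) (exWord b) * uo w (exWord a) := by
  induction a generalizing w with
  | nil =>
    rw [uo_exWord_nil, List.append_nil]
    exact (uo_exWord_mul_uI w b).symm
  | cons k a ih =>
    rw [List.cons_append, uo_exWord_cons, uo_exWord_cons, ih, mul_assoc, List.append_assoc]
    rfl

theorem uo_imWord_append (w a b : List ℕ+) :
    uo w (imWord (a ++ b)) = uo w (imWord a) * uo (w ++ a) (imWord b) := by
  induction a generalizing w with
  | nil =>
    rw [uo_imWord_nil, List.append_nil]
    exact (uI_mul_uo _ (List.prefix_append _ _)).symm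
  | cons k a ih =>
    rw [List.cons_append, uo_imWord_cons, uo_imWord_cons, ih, mul_assoc, List.append_assoc]
    rfl

/-- The product of the factorials of the thicknesses in a word. -/
def facWord : List ℕ+ → ℂ
  | [] => 1
  | k :: a => (k : ℕ).factorial * facWord a

theorem facWord_ne_zero : ∀ a : List ℕ+, facWord a ≠ 0
  | [] => one_ne_zero
  | k :: a => mul_ne_zero (Nat.cast_ne_zero.mpr (Nat.factorial_ne_zero k)) (facWord_ne_zero a)

theorem exWord_mul_imWord (w a : List ℕ+) :
    uo w (exWord a) * uo w (imWord a) = facWord a • uI (w ++ a) := by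
  induction a generalizing w with
  | nil => rw [uo_exWord_nil, uo_imWord_nil, facWord, one_smul, uI_mul_uI List.prefix_rfl, List.append_nil]
  | cons k a ih =>
    rw [uo_exWord_cons, uo_imWord_cons, mul_assoc, ← mul_assoc (ex w k), ex_mul_im, smul_mul_assoc,
      up_coe, uI_mul_uo _ (by simp), mul_smul_comm, ih, smul_smul, facWord, List.append_assoc]
    rfl

/-- The conjugate of a web by explosions and implosions. -/
noncomputable def conj (t : Term UpGen a b) : UpFam :=
  fun w => uo w (imWord a) * uo w t * uo w (exWord b)

theorem conj_id (a : List ℕ+) : IsMk (sz a) 0 (conj (.id a)) := by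
  induction a with
  | nil =>
    refine (IsMk.one 0).congr fun w => ?_
    rw [conj, uo_imWord_nil, uo_exWord_nil, uo_id, List.append_nil, uI_mul_uI List.prefix_rfl,
      uI_mul_uI List.prefix_rfl]
    exact congrArg uI (List.append_nil w)
  | cons k a ih =>
    refine ((isMk_sym k).tensor ih).congr fun w => ?_
    have h := ih.im_slide w k
    rw [up_coe] at h
    change conj (.id a) (w ++ ones k) * sym w k = _
    rw [sym, ← mul_assoc, ← h, conj, conj, uo_imWord_cons, uo_exWord_cons, uo_id, uo_id, List.append_assoc]
    simp only [mul_assoc]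
    rfl

theorem uo_eq_conj (w : List ℕ+) (t : Term UpGen a b) :
    (facWord a * facWord b) • uo w t = uo w (exWord a) * conj t w * uo w (imWord b) := by
  have h : uo w (exWord a) * conj t w * uo w (imWord b) = (uo w (exWord a) * uo w (imWord a)) *
      uo w t * (uo w (exWord b) * uo w (imWord b)) := by
    simp only [conj, mul_assoc]
  rw [h, exWord_mul_imWord, exWord_mul_imWord, smul_mul_assoc, uI_mul_uo t List.prefix_rfl,
    mul_smul_comm, smul_mul_assoc, uo_mul_uI t List.prefix_rfl, smul_smul, mul_comm]

theorem conj_comp (s : Term UpGen a b) (t : Term UpGen b c) :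
    conj s * conj t = facWord b • conj (s ⨟ t) := by
  funext w
  change conj s w * conj t w = facWord b • conj (s ⨟ t) w
  have h : conj s w * conj t w = uo w (imWord a) * uo w s * (uo w (exWord b) * uo w (imWord b)) *
    uo w t * uo w (exWord c) := by
    simp only [conj, mul_assoc]
  rw [h, exWord_mul_imWord, mul_smul_comm, smul_mul_assoc, smul_mul_assoc, mul_assoc _ (uo w s),
    uo_mul_uI s List.prefix_rfl, conj, uo_comp]
  simp only [mul_assoc]

/-- A homogeneous web explodes to a web on thin strands, and it vanishes if the thicknesses of its
source and target do not match. -/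
structure IsMackey (t : Term UpGen a b) (p : ZMod 2) : Prop where
  isMk : sz a = sz b → IsMk (sz a) p (conj t)
  zero : sz a ≠ sz b → ∀ w, uo w t = 0

theorem conj_tensor (w : List ℕ+) (s : Term UpGen a b) (t : Term UpGen c d) (hx : x = a ++ c)
    (hy : y = b ++ d) (ht : IsMk (sz c) q (conj t)) :
    conj (s.tensor t hx hy) w = shn (sz a) (conj t) w * conj s w := by
  subst hx hy
  obtain ⟨t', -, ht'⟩ := ht.exists_term
  have e1 : uo w s * uo (w ++ b) (exWord d) = uo (w ++ a) (exWord d) * uo w s :=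
    uo_slide_right s (exWord_parity d) [] (by simp) (by simp)
  have e2 : uo w (imWord a) * uo (w ++ a) t' = uo (w ++ ones (sz a)) t' * uo w (imWord a) :=
    uo_slide_left t' (imWord_parity a) [] (by simp) (by simp)
  have e3 : uo (w ++ a) (imWord c) * uo (w ++ a) t * uo (w ++ a) (exWord d) = uo (w ++ a) t' :=
    congrFun ht' (w ++ a)
  have e4 : shn (sz a) (conj t) w = uo (w ++ ones (sz a)) t' := congrFun ht' (w ++ ones (sz a))
  rw [e4, conj, conj, uo_imWord_append, uo_exWord_append, uo_tensor, ← mul_assoc (uo _ t' ), ← mul_assoc (uo _ t' ), ← e2, ← e3]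
  have h2 : uo w (imWord a) * uo (w ++ a) (imWord c) * (uo (w ++ a) t * uo w s) *
      (uo (w ++ b) (exWord d) * uo w (exWord b)) = uo w (imWord a) * uo (w ++ a) (imWord c) *
      (uo (w ++ a) t * (uo w s * uo (w ++ b) (exWord d))) * uo w (exWord b) := by
    simp only [mul_assoc]
  rw [h2, e1]
  simp only [mul_assoc]

theorem conj_gen_dot (k : ℕ+) : IsMk (sz [k]) 1 (conj (.gen (.dot k))) := by
  have h := ((isMk_sumDots k).mul (isMk_sym k)).cast (add_zero _)
  refine .cast_nat (.congr h fun w => Eq.symm ?_) (Nat.add_zero (k : ℕ)).symm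
  obtain ⟨k, rfl⟩ : ∃ j : ℕ, k = j.succPNat := ⟨k.natPred, (PNat.succPNat_natPred k).symm⟩
  rw [conj, uo_imWord_single, uo_exWord_single]
  change im w (k + 1) * uo w (dt (k + 1)) * ex w (k + 1) = uo w (sumDots (k + 1)) * sym w (k + 1)
  rw [im_mul_dt, sym, mul_assoc]

theorem conj_gen_merge (j k m : ℕ+) (h : j + k = m) :
    IsMk (sz [j, k]) 0 (conj (.gen (.merge j k m h))) := by
  have h' : (j : ℕ) + k = m := by rw [← h]; rfl
  refine .cast_nat (.congr (isMk_sym m) fun w => Eq.symm ?_)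
    (h'.symm.trans (by simp [sz]) : (m : ℕ) = sz [j, k])
  obtain ⟨j, rfl⟩ : ∃ i : ℕ, j = i.succPNat := ⟨j.natPred, (PNat.succPNat_natPred j).symm⟩
  obtain ⟨k, rfl⟩ : ∃ i : ℕ, k = i.succPNat := ⟨k.natPred, (PNat.succPNat_natPred k).symm⟩
  obtain ⟨m, rfl⟩ : ∃ i : ℕ, m = i.succPNat := ⟨m.natPred, (PNat.succPNat_natPred m).symm⟩
  rw [conj, uo_exWord_single, uo_imWord_cons, uo_imWord_single]
  have h' : j + 1 + (k + 1) = m + 1 := h'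
  change im w (j + 1) * im (w ++ up (j + 1)) (k + 1) * uo w (mrg (j + 1) (k + 1) h') * ex w (m + 1) = sym w (m + 1)
  rw [im_im, im_mul_mrg]
  rfl

theorem conj_gen_split (j k m : ℕ+) (h : j + k = m) :
    IsMk (sz [m]) 0 (conj (.gen (.split j k m h))) := by
  have h' : (j : ℕ) + k = m := by rw [← h]; rfl
  refine .cast_nat (.congr (isMk_sym m) fun w => Eq.symm ?_) (Nat.add_zero (m : ℕ)).symm
  obtain ⟨j, rfl⟩ : ∃ i : ℕ, j = i.succPNat := ⟨j.natPred, (PNat.succPNat_natPred j).symm⟩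
  obtain ⟨k, rfl⟩ : ∃ i : ℕ, k = i.succPNat := ⟨k.natPred, (PNat.succPNat_natPred k).symm⟩
  obtain ⟨m, rfl⟩ : ∃ i : ℕ, m = i.succPNat := ⟨m.natPred, (PNat.succPNat_natPred m).symm⟩
  rw [conj, uo_imWord_single, uo_exWord_cons, uo_exWord_single]
  have h' : j + 1 + (k + 1) = m + 1 := h'
  change im w (m + 1) * uo w (spl (j + 1) (k + 1) h') * (ex (w ++ up (j + 1)) (k + 1) * ex w (j + 1)) = sym w (m + 1)
  rw [mul_assoc, spl_mul_ex]
  rfl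

theorem conj_zero : conj (0 : Term UpGen a b) = 0 := by
  funext w
  rw [conj, uo_zero, mul_zero, zero_mul]
  rfl

theorem conj_add (s t : Term UpGen a b) : conj (s + t) = conj s + conj t := by
  funext w
  change _ = conj s w + conj t w
  rw [conj, uo_add, mul_add, add_mul]
  rfl

theorem conj_smul (c : ℂ) (t : Term UpGen a b) : conj (c • t) = c • conj t := by
  funext w
  change _ = c • conj t w
  rw [conj, uo_smul, mul_smul_comm, smul_mul_assoc]
  rfl

theorem conj_eq_zero {t : Term UpGen a b} (h : ∀ w, uo w t = 0) : conj t = 0 := by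
  funext w
  rw [conj, h, mul_zero, zero_mul]
  rfl

theorem isMackey {t : Term UpGen a b} {p : ZMod 2} (h : t.HasParity UpGen.par p) : IsMackey t p := by
  induction h with
  | id a => exact ⟨fun _ => conj_id a, fun h => absurd rfl h⟩
  | @gen a b g =>
    cases g with
    | dot k => exact ⟨fun _ => conj_gen_dot k, fun h => absurd rfl h⟩
    | merge j k m h =>
      exact ⟨fun _ => conj_gen_merge j k m h, fun h' => absurd (by subst h; simp [sz]) h'⟩
    | split j k m h =>
      exact ⟨fun _ => conj_gen_split j k m h, fun h' => absurd (by subst h; simp [sz]) h'⟩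
  | @comp a b c s t p q hs ht ihs iht =>
    by_cases hab : sz a = sz b
    · by_cases hbc : sz b = sz c
      · refine ⟨fun _ => ?_, fun h => absurd (hab.trans hbc) h⟩
        have h := ((ihs.isMk hab).mul ((iht.isMk hbc).cast_nat hab.symm)).smul (facWord b)⁻¹
        rwa [conj_comp, smul_smul, inv_mul_cancel₀ (facWord_ne_zero b), one_smul] at h
      · have h0 : ∀ w, uo w (s ⨟ t) = 0 := fun w => by rw [uo_comp, iht.zero hbc, mul_zero]
        exact ⟨fun _ => (conj_eq_zero h0).symm ▸ .zero _ _, fun _ => h0⟩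
    · have h0 : ∀ w, uo w (s ⨟ t) = 0 := fun w => by rw [uo_comp, ihs.zero hab, zero_mul]
      exact ⟨fun _ => (conj_eq_zero h0).symm ▸ .zero _ _, fun _ => h0⟩
  | @tensor a b c d x y s t p q hs ht hx hy ihs iht =>
    by_cases hab : sz a = sz b
    · by_cases hcd : sz c = sz d
      · refine ⟨fun _ => ?_, fun h => absurd ?_ h⟩
        · have h := (ihs.isMk hab).tensor (iht.isMk hcd)
          have e : sz a + sz c = sz x := by rw [hx, sz_append]
          exact (h.congr fun w => (conj_tensor w s t hx hy (iht.isMk hcd)).symm).cast_nat e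
        · rw [hx, hy, sz_append, sz_append, hab, hcd]
      · have h0 : ∀ w, uo w (s.tensor t hx hy) = 0 := fun w => by
          rw [uo_tensor, iht.zero hcd, zero_mul]
        exact ⟨fun _ => (conj_eq_zero h0).symm ▸ .zero _ _, fun _ => h0⟩
    · have h0 : ∀ w, uo w (s.tensor t hx hy) = 0 := fun w => by
        rw [uo_tensor, ihs.zero hab, mul_zero]
      exact ⟨fun _ => (conj_eq_zero h0).symm ▸ .zero _ _, fun _ => h0⟩
  | zero p => exact ⟨fun _ => conj_zero.symm ▸ .zero _ _, fun _ => uo_zero⟩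
  | @add a b s t p hs ht ihs iht =>
    exact ⟨fun h => (conj_add s t).symm ▸ (ihs.isMk h).add (iht.isMk h), fun h w =>
      (uo_add w s t).trans (by rw [ihs.zero h, iht.zero h, add_zero])⟩
  | @smul a b t p c ht iht =>
    exact ⟨fun h => (conj_smul c t).symm ▸ (iht.isMk h).smul c, fun h w =>
      (uo_smul w c t).trans (by rw [iht.zero h, smul_zero])⟩

/-! ### A normal form -/

/-- The web that moves the first strand to the position `j`. -/
noncomputable def cyc : ℕ → UpFam
  | 0 => fun w => uI w
  | j + 1 => sh (cyc j) * thinX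

/-- A linear combination of permutations of the last strand and webs on the other strands. -/
def IsNF (n : ℕ) (p : ZMod 2) (F : UpFam) : Prop :=
  ∃ z z' : ℕ → UpFam, (∀ j, IsMk n p (z j)) ∧ (∀ j, IsMk n (p + 1) (z' j)) ∧
    F = ∑ j ∈ Finset.range (n + 1), cyc j * (sh (z j) + sh (z' j) * thinD)

theorem IsNF.zero (n : ℕ) (p : ZMod 2) : IsNF n p 0 :=
  ⟨0, 0, fun _ => .zero _ _, fun _ => .zero _ _, (Finset.sum_eq_zero fun j _ => by
    change cyc j * (sh 0 + sh 0 * thinD) = 0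
    rw [sh_zero, zero_mul, add_zero, mul_zero]).symm⟩

theorem IsNF.add (hF : IsNF n p F) (hG : IsNF n p G) : IsNF n p (F + G) := by
  obtain ⟨z, z', hz, hz', rfl⟩ := hF
  obtain ⟨y, y', hy, hy', rfl⟩ := hG
  refine ⟨z + y, z' + y', fun j => (hz j).add (hy j), fun j => (hz' j).add (hy' j), ?_⟩
  rw [← Finset.sum_add_distrib]
  refine Finset.sum_congr rfl fun j _ => ?_
  change _ = cyc j * (sh (z j + y j) + sh (z' j + y' j) * thinD)
  rw [sh_add, sh_add]
  noncomm_ring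

theorem IsNF.smul (c : ℂ) (hF : IsNF n p F) : IsNF n p (c • F) := by
  obtain ⟨z, z', hz, hz', rfl⟩ := hF
  refine ⟨c • z, c • z', fun j => (hz j).smul c, fun j => (hz' j).smul c, ?_⟩
  rw [Finset.smul_sum]
  refine Finset.sum_congr rfl fun j _ => ?_
  change _ = cyc j * (sh (c • z j) + sh (c • z' j) * thinD)
  rw [sh_smul, sh_smul, smul_mul_assoc, ← smul_add, mul_smul_comm]

theorem cyc_succ (j : ℕ) : cyc (j + 1) = sh (cyc j) * thinX := rfl

theorem cyc_zero_mul (h : IsMk n p F) : cyc 0 * F = F := by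
  obtain ⟨t, -, rfl⟩ := h.exists_term
  exact funext fun w => uI_mul_uo t (List.prefix_append _ _)

theorem IsNF.of_cyc (hn : n ≤ m) {z z' : UpFam} (hz : IsMk m p z) (hz' : IsMk m (p + 1) z') :
    IsNF m p (cyc n * (sh z + sh z' * thinD)) := by
  refine ⟨Pi.single n z, Pi.single n z', fun j => ?_, fun j => ?_, ?_⟩
  · by_cases h : j = n
    · subst h
      rwa [Pi.single_eq_same]
    · rw [Pi.single_eq_of_ne h]
      exact .zero _ _
  · by_cases h : j = n
    · subst h
      rwa [Pi.single_eq_same]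
    · rw [Pi.single_eq_of_ne h]
      exact .zero _ _
  · rw [Finset.sum_eq_single n]
    · rw [Pi.single_eq_same, Pi.single_eq_same]
    · intro j _ h
      rw [Pi.single_eq_of_ne h, Pi.single_eq_of_ne h, sh_zero, zero_mul, add_zero, mul_zero]
    · intro h
      exact absurd (Finset.mem_range.mpr (Nat.lt_succ_of_le hn)) h

theorem IsNF.sum {ι : Type*} {s : Finset ι} {f : ι → UpFam} (h : ∀ i ∈ s, IsNF n p (f i)) :
    IsNF n p (∑ i ∈ s, f i) := by
  classical
  induction s using Finset.induction_on with
  | empty => rw [Finset.sum_empty]; exact .zero _ _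
  | insert i s hi ih =>
    rw [Finset.sum_insert hi]
    exact (h i (Finset.mem_insert_self i s)).add (ih fun j hj => h j (Finset.mem_insert_of_mem hj))

theorem sh_sum {ι : Type*} (s : Finset ι) (f : ι → UpFam) : sh (∑ i ∈ s, f i) = ∑ i ∈ s, sh (f i) := by
  funext w
  change (∑ i ∈ s, f i) (w ++ up 1) = _
  rw [Finset.sum_apply, Finset.sum_apply]
  rfl

theorem IsMk.isNF (h : IsMk (n + 1) p F) : IsNF n p F := by
  induction n generalizing p F with
  | zero =>
    refine IsMk.induction (motive := IsNF 0 p) h (fun z hz => ?_) (fun q z hz e => ?_)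
      (fun hn => absurd rfl hn) (.zero _ _) (fun F G => .add) fun c F => .smul c
    · have h1 := IsNF.of_cyc (Nat.zero_le 0) hz (.zero _ _)
      rwa [sh_zero, zero_mul, add_zero, cyc_zero_mul hz.plain] at h1
    · have e' : q = p + 1 := by rw [← e, add_assoc, one_add_one, add_zero]
      have h1 := IsNF.of_cyc (Nat.zero_le 0) (.zero _ p) (hz.cast e')
      rwa [sh_zero, zero_add, cyc_zero_mul hz.dot] at h1
  | succ n ih =>
    refine IsMk.induction (motive := IsNF (n + 1) p) h (fun z hz => ?_) (fun q z hz e => ?_)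
      (fun hn q r y hy z hz e => ?_) (.zero _ _) (fun F G => .add) fun c F => .smul c
    · have h1 := IsNF.of_cyc (Nat.zero_le (n + 1)) hz (.zero _ _)
      rwa [sh_zero, zero_mul, add_zero, cyc_zero_mul hz.plain] at h1
    · have e' : q = p + 1 := by rw [← e, add_assoc, one_add_one, add_zero]
      have h1 := IsNF.of_cyc (Nat.zero_le (n + 1)) (.zero _ p) (hz.cast e')
      rwa [sh_zero, zero_add, cyc_zero_mul hz.dot] at h1
    · obtain ⟨u, u', hu, hu', rfl⟩ := ih hy
      rw [sh_sum, Finset.sum_mul, Finset.sum_mul]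
      refine IsNF.sum fun j hj => ?_
      have hj : j + 1 ≤ n + 1 := by
        have := Finset.mem_range.mp hj
        omega
      have e1 : sh (cyc j * (sh (u j) + sh (u' j) * thinD)) * thinX * sh z =
          cyc (j + 1) * (sh (sh (u j) * z) + sh (dsign r • (sh (u' j) * z)) * thinD) := by
        have h1 := (hu j).sh_sh_mul_thinX
        have h2 := (hu' j).sh_sh_mul_thinX
        have h3 : sh (sh (u' j)) * sh thinD * thinX * sh z =
            thinX * (dsign r • (sh (sh (u' j) * z) * thinD)) := by
          rw [mul_assoc (sh _) (sh thinD), fam_shD_mul_X, ← mul_assoc, h2, mul_assoc, mul_assoc,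
            hz.thinD_mul_sh, mul_smul_comm, sh_mul, mul_assoc]
        rw [cyc_succ, sh_mul, sh_add, sh_mul, mul_assoc (sh (cyc j)), mul_assoc (sh (cyc j)), add_mul,
          add_mul, h3, h1, mul_assoc thinX, ← sh_mul, ← mul_add, sh_smul, smul_mul_assoc, mul_assoc]
      rw [e1]
      subst e
      refine IsNF.of_cyc hj ((hu j).plain.mul hz) ((((hu' j).plain.mul hz).smul _).cast ?_)
      ring

end

section

variable {a b c d x y v w : List OrOb}

/-- The upward word with the given thicknesses. -/
abbrev ups (a : List ℕ+) : List OrOb := a.map OrOb.up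

/-! ### Duals and mates -/

/-- A dual of a word, with its leftward cup and cap. -/
structure Dual (x x' : List OrOb) where
  cup : Term OrGen [] (x ++ x')
  cap : Term OrGen (x' ++ x) []
  cup_parity : cup.HasParity OrGen.par 0
  cap_parity : cap.HasParity OrGen.par 0
  zigzag' : ∀ w, oo (w ++ x') cup * oo w cap = oI (w ++ x')
  zigzag : ∀ w, oo w cup * oo (w ++ x) cap = oI (w ++ x)

/-- The dual of one upward strand. -/
def Dual.single (k : ℕ+) : Dual [OrOb.up k] [OrOb.down k] where
  cup := QWeb.cup k
  cap := QWeb.cap k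
  cup_parity := QWeb.cup_parity k
  cap_parity := QWeb.cap_parity k
  zigzag w := cup_mul_cap w k
  zigzag' w := cup_mul_cap' w k

namespace Dual

variable {x' y' : List OrOb} (D : Dual x x') (E : Dual y y')

theorem oo_mul_cap (s : Term OrGen a b) :
    oo w s * oo (w ++ b) D.cap = oo (w ++ a) D.cap * oo w s :=
  oo_slide_right s D.cap_parity [] (by simp) (by simp)

theorem oo_mul_cup (s : Term OrGen a b) :
    oo w s * oo (w ++ b) D.cup = oo (w ++ a) D.cup * oo w s :=
  oo_slide_right s D.cup_parity [] (by simp) (by simp)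

theorem cup_mul_oo (w : List OrOb) (s : Term OrGen a b) (v : List OrOb) :
    oo w D.cup * oo (w ++ (x ++ x' ++ v)) s = oo (w ++ v) s * oo w D.cup :=
  oo_slide_left s D.cup_parity v rfl rfl

theorem cap_mul_oo (w : List OrOb) (s : Term OrGen a b) (v : List OrOb) :
    oo w D.cap * oo (w ++ v) s = oo (w ++ (x' ++ x ++ v)) s * oo w D.cap :=
  oo_slide_left s D.cap_parity v rfl rfl

/-- The dual of the concatenation of two words. -/
def append : Dual (x ++ y) (y' ++ x') where
  cup := D.cup ⨟ (Term.idLeft x (Term.idRight E.cup x' rfl rfl) rfl (by simp) :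
    Term OrGen (x ++ x') (x ++ y ++ (y' ++ x')))
  cap := (Term.idLeft y' (Term.idRight D.cap y rfl rfl) (by simp) rfl :
    Term OrGen (y' ++ x' ++ (x ++ y)) (y' ++ y)) ⨟ E.cap
  cup_parity := .comp_even D.cup_parity (.idLeft (.idRight E.cup_parity _ _) _ _)
  cap_parity := .comp_even (.idLeft (.idRight D.cap_parity _ _) _ _) E.cap_parity
  zigzag w := by
    have e1 : oo w D.cup * oI (w ++ x ++ ([] ++ x')) = oo w D.cup := oo_mul_oI _ (by simp)
    have e2 : oI (w ++ (x ++ y) ++ y' ++ ([] ++ y)) * oo (w ++ (x ++ y)) E.cap = oo (w ++ (x ++ y)) E.cap :=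
      oI_mul_oo _ (by simp)
    have e3 := D.oo_mul_cap (w := w ++ x) E.cup
    have e4 := D.zigzag w
    have e5 := E.zigzag (w ++ x)
    rw [oo_comp, oo_comp, oo_idLeft, oo_idLeft, oo_idRight, oo_idRight', mul_assoc (oo _ D.cap), e2,
      ← mul_assoc (oo w D.cup), e1, mul_assoc, ← mul_assoc (oo _ E.cup)]
    have e6 : w ++ (x ++ y) ++ y' = w ++ x ++ (y ++ y') := by simp
    rw [e6, e3, List.append_nil, mul_assoc, ← List.append_assoc w x y, e5, ← mul_assoc, e4,
      oI_mul_oI (by simp)]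
  zigzag' w := by
    have e1 : oo (w ++ (y' ++ x')) D.cup * oI (w ++ (y' ++ x') ++ x ++ ([] ++ x')) =
      oo (w ++ (y' ++ x')) D.cup := oo_mul_oI _ (by simp)
    have e2 : oI (w ++ y' ++ ([] ++ y)) * oo w E.cap = oo w E.cap :=
      oI_mul_oo _ (by simp)
    have e3 := D.cap_mul_oo (w ++ y') E.cup []
    have e4 := D.zigzag' (w ++ y')
    have e5 := E.zigzag' w
    rw [oo_comp, oo_comp, oo_idLeft, oo_idLeft, oo_idRight, oo_idRight', mul_assoc (oo _ D.cap), e2,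
      ← mul_assoc (oo _ D.cup), e1, mul_assoc, ← mul_assoc (oo _ E.cup)]
    have e6 : w ++ (y' ++ x') ++ x = w ++ y' ++ (x' ++ x ++ []) := by simp
    rw [e6, ← e3, List.append_nil, mul_assoc, e5, ← mul_assoc, ← List.append_assoc w y' x', e4,
      oI_mul_oI' (by simp)]

/-- The rightward cap. -/
noncomputable def rcap : Term OrGen (x ++ x') [] := crossWords orCross x x' ⨟ D.cap

theorem oo_rcap (w : List OrOb) : oo w D.rcap = oc w x x' * oo w D.cap := oo_comp _ _ _

theorem rcap_parity : D.rcap.HasParity OrGen.par 0 :=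
  .comp_even (crossWords_even (P := orP) orCross_even _ _) D.cap_parity

theorem rcap_mul_oo (w : List OrOb) (s : Term OrGen a b) (v : List OrOb) :
    oo w D.rcap * oo (w ++ v) s = oo (w ++ (x ++ x' ++ v)) s * oo w D.rcap :=
  oo_slide_left s D.rcap_parity v rfl rfl

theorem oo_mul_rcap (s : Term OrGen a b) :
    oo w s * oo (w ++ b) D.rcap = oo (w ++ a) D.rcap * oo w s :=
  oo_slide_right s D.rcap_parity [] (by simp) (by simp)

theorem rcap_append (w c : List OrOb) :
    oo (w ++ c) D.rcap = oc w c (x ++ x') * oo w D.rcap := by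
  have h := oo_mul_oc w c D.rcap
  rw [oc_nil_right, oo_mul_oI _ (by simp)] at h
  exact h

theorem cap_append (w c : List OrOb) :
    oo (w ++ c) D.cap = oc w c (x' ++ x) * oo w D.cap := by
  have h := oo_mul_oc w c D.cap
  rw [oc_nil_right, oo_mul_oI _ (by simp)] at h
  exact h

theorem cup_append (w c : List OrOb) : oo (w ++ c) D.cup = oo w D.cup * oc w (x ++ x') c := by
  have h := oo_mul_oc' w c D.cup
  rw [oc_nil_left, oI_mul_oo _ (by simp)] at h
  exact h.symm

theorem oo_append_cup (w : List OrOb) :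
    oo w (D.append E).cup = oo w D.cup * oo (w ++ x) E.cup := by
  have e1 : oo w D.cup * oI (w ++ x ++ ([] ++ x')) = oo w D.cup := oo_mul_oI _ (by simp)
  rw [append, oo_comp, oo_idLeft, oo_idRight, ← mul_assoc, e1]

theorem oo_append_cap (w : List OrOb) :
    oo w (D.append E).cap = oo (w ++ y') D.cap * oo w E.cap := by
  have e2 : oI (w ++ y' ++ ([] ++ y)) * oo w E.cap = oo w E.cap := oI_mul_oo _ (by simp)
  rw [append, oo_comp, oo_idLeft, oo_idRight', mul_assoc, e2]

theorem oo_append_rcap (w : List OrOb) :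
    oo w (D.append E).rcap = oo (w ++ x) E.rcap * oo w D.rcap := by
  have e1 : oc (w ++ x ++ y') y x' * oc w x y' = oc w x y' * oc (w ++ y' ++ x) y x' := by
    have h := oo_slide_left (w := w) (v := w ++ y' ++ x) (x := w ++ x ++ y') (s := crossWords orCross x y')
      (crossWords orCross y x') (crossWords_even (P := orP) orCross_even _ _) [] (by simp) (by simp)
    exact h.symm
  have e2 : oc (w ++ y' ++ x) y x' * oo (w ++ y') D.rcap =
      oc (w ++ y') x y * oo (w ++ y' ++ y) D.rcap := by
    rw [D.rcap_append (w ++ y') y, oc_append_right, ← mul_assoc, ← mul_assoc, oc_symm, oI_mul_oc _ _ _ (by simp)]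
  have e3 : oo (w ++ y' ++ y) D.rcap * oo w E.cap = oo w E.cap * oo w D.rcap := by
    have h := E.cap_mul_oo w D.rcap []
    rw [List.append_nil, List.append_nil, ← List.append_assoc] at h
    exact h.symm
  rw [oo_rcap, oo_append_cap, oc_append_left, oc_append_right, oc_append_right]
  calc _ = oc (w ++ x) y y' * (oc (w ++ x ++ y') y x' * oc w x y') * (oc (w ++ y') x x' *
        oo (w ++ y') D.cap) * oo w E.cap := by simp only [mul_assoc]
    _ = oc (w ++ x) y y' * oc w x y' * (oc (w ++ y' ++ x) y x' * oo (w ++ y') D.rcap) *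
        oo w E.cap := by rw [e1, ← oo_rcap]; simp only [mul_assoc]
    _ = oc (w ++ x) y y' * (oc w x y' * oc (w ++ y') x y) * (oo (w ++ y' ++ y) D.rcap * oo w E.cap) := by
      rw [e2]; simp only [mul_assoc]
    _ = oc (w ++ x) y y' * (oc w x (y' ++ y) * oo w E.cap) * oo w D.rcap := by
      rw [e3, ← oc_append_right]; simp only [mul_assoc]
    _ = _ := by rw [← cap_append, ← oo_rcap]

/-- The mate of a web. -/
def mate (t : Term OrGen x y) : Term OrGen y' x' :=
  (Term.idLeft y' D.cup (by simp) rfl : Term OrGen y' (y' ++ (x ++ x'))) ⨟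
    (Term.idLeft y' (Term.idRight t x' rfl rfl) rfl rfl : Term OrGen (y' ++ (x ++ x')) (y' ++ (y ++ x'))) ⨟
    Term.idRight E.cap x' (by simp) rfl

theorem mate_parity {t : Term OrGen x y} {p : ZMod 2} (h : t.HasParity OrGen.par p) :
    (mate D E t).HasParity OrGen.par p :=
  .even_comp (.idLeft D.cup_parity _ _) (.comp_even (.idLeft (.idRight h _ _) _ _)
    (.idRight E.cap_parity _ _))

theorem oo_mate (w : List OrOb) (t : Term OrGen x y) :
    oo w (mate D E t) = oo (w ++ y') D.cup * oo (w ++ y') t * oo w E.cap := by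
  have e1 : oo (w ++ y') D.cup * oI (w ++ y' ++ (x ++ x')) = oo (w ++ y') D.cup :=
    oo_mul_oI _ (by simp)
  have e3 : oo (w ++ y') t * oI (w ++ (y' ++ y ++ x')) = oI (w ++ y' ++ (x ++ x')) * oo (w ++ y') t :=
    oo_mul_oI_comm _ x' (by simp) (by simp)
  rw [mate, oo_comp, oo_comp, oo_idLeft, oo_idLeft, oo_idRight, oo_idRight]
  calc _ = oo (w ++ y') D.cup * oI (w ++ y' ++ (x ++ x')) *
        (oo (w ++ y') t * oI (w ++ (y' ++ y ++ x'))) * oo w E.cap := by simp only [mul_assoc]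
    _ = oo (w ++ y') D.cup * oI (w ++ y' ++ (x ++ x')) * oI (w ++ y' ++ (x ++ x')) *
        oo (w ++ y') t * oo w E.cap := by rw [e3]; simp only [mul_assoc]
    _ = _ := by rw [e1, e1]

theorem cup_mul_mate (w : List OrOb) (t : Term OrGen x y) :
    oo w E.cup * oo (w ++ y) (mate D E t) = oo w D.cup * oo w t := by
  have e1 : oo w E.cup * oo (w ++ y ++ y') D.cup = oo w D.cup * oo w E.cup := by
    have h := E.cup_mul_oo w D.cup []
    rwa [List.append_nil, List.append_nil, ← List.append_assoc] at h
  have e2 : oo w E.cup * oo (w ++ y ++ y') t = oo w t * oo w E.cup := by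
    have h := E.cup_mul_oo w t []
    rwa [List.append_nil, List.append_nil, ← List.append_assoc] at h
  rw [oo_mate, ← mul_assoc, ← mul_assoc, e1, mul_assoc (oo w D.cup), e2, mul_assoc, mul_assoc, E.zigzag,
    oo_mul_oI t List.prefix_rfl]

theorem mate_mul_cap (w : List OrOb) (t : Term OrGen x y) :
    oo w (mate D E t) * oo w D.cap = oo (w ++ y') t * oo w E.cap := by
  have e1 : oo w E.cap * oo w D.cap = oo (w ++ y' ++ y) D.cap * oo w E.cap := by
    have h := E.cap_mul_oo w D.cap []
    rwa [List.append_nil, List.append_nil, ← List.append_assoc] at h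
  have e2 := D.oo_mul_cap (w := w ++ y') t
  rw [oo_mate, mul_assoc, e1, ← mul_assoc, mul_assoc (oo _ D.cup), e2, ← mul_assoc, D.zigzag,
    oI_mul_oo t List.prefix_rfl]

theorem oo_mul_rcap' (w : List OrOb) (t : Term OrGen x y) :
    oo w t * oo w E.rcap = oo (w ++ x) (mate D E t) * oo w D.rcap := by
  rw [oo_rcap, oo_rcap, ← mul_assoc, ← mul_assoc, oo_mul_oc', oo_mul_oc, mul_assoc, mul_assoc,
    mate_mul_cap]

end Dual

theorem bubble_dot (w : List OrOb) (k : ℕ+) :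
    oo w (cup k) * oo w (.gen (.dot k)) * oo w (Dual.single k).rcap = 0 := by
  have h := oo_rel w (OrRel.delete_bubble k)
  have h2 := oo_mul_oc' w [OrOb.down k] (Term.gen (.dot k) : Term OrGen [OrOb.up k] [OrOb.up k])
  rw [oo_comp, oo_comp, oo_comp, oo_idLeft, oo_zero] at h
  rw [Dual.oo_rcap, mul_assoc, ← mul_assoc (oo w (.gen _)), h2, mul_assoc, oc_single]
  exact h

theorem bubble (w : List OrOb) :
    oo w (cup (Nat.succPNat 0)) * oo w (Dual.single (Nat.succPNat 0)).rcap = 0 := by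
  set k := Nat.succPNat 0 with hk
  set D := Dual.single k
  set δ : Term OrGen [OrOb.up k] [OrOb.up k] := .gen (.dot k) with hδ
  have hp : δ.HasParity OrGen.par 1 := .gen _
  have h0 : oo w δ * oo w δ = oI (w ++ [OrOb.up k]) := by
    have h := oo_toOr_congr (s := dt 1 ⨟ dt 1) (t := .id (up 1)) (by
      rw [uo_comp, uo_id]
      exact thinD_mul_thinD []) w
    rw [toOr_comp, oo_comp, oo_toOr_id] at h
    exact h
  have h1 : oo w δ * oo w D.rcap = oo (w ++ [OrOb.up k]) (D.mate D δ) * oo w D.rcap :=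
    D.oo_mul_rcap' D w δ
  have h2 : oo w D.cup * oo (w ++ [OrOb.up k]) (D.mate D δ) = oo w D.cup * oo w δ :=
    D.cup_mul_mate D w δ
  have h3 : oo w δ * oo (w ++ [OrOb.up k]) (D.mate D δ) =
      -(oo (w ++ [OrOb.up k]) (D.mate D δ) * oo w δ) :=
    oo_slide_odd hp (D.mate_parity D hp) [] (by simp) (by simp)
  have h4 : oo w D.cup * oo w D.rcap = -(oo w D.cup * oo w D.rcap) := by
    have h5 : oo w D.rcap = oo w δ * (oo w δ * oo w D.rcap) := by
      rw [← mul_assoc, h0, oI_mul_oo _ (by simp)]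
    have h6 : oo w D.cup * (oo w δ * (oo (w ++ [OrOb.up k]) (D.mate D δ) * oo w D.rcap)) =
        -(oo w D.cup * (oo w δ * (oo w δ * oo w D.rcap))) := by
      rw [← mul_assoc (oo w δ), h3, neg_mul, mul_neg, ← mul_assoc, ← mul_assoc, h2]
      simp only [mul_assoc]
    conv_lhs => rw [h5, h1, h6, ← h5]
  have h7 : (2 : ℂ) • (oo w D.cup * oo w D.rcap) = 0 := by
    rw [two_smul]
    exact eq_neg_iff_add_eq_zero.mp h4
  exact (smul_eq_zero.mp h7).resolve_left two_ne_zero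

theorem right_curl (w : List OrOb) (k : ℕ+) :
    oo (w ++ [OrOb.up k]) (cup k) * oc w [OrOb.up k] [OrOb.up k] * oo (w ++ [OrOb.up k]) (Dual.single k).rcap =
      oI (w ++ [OrOb.up k]) := by
  have h := oo_mul_oc w [OrOb.up k] (cup k)
  rw [oc_nil_right, oc_single_cons, ← oc_single] at h
  have h2 : oo w (cup k) * oo (w ++ [OrOb.up k]) (Dual.single k).cap = oI (w ++ [OrOb.up k]) :=
    cup_mul_cap w k
  rw [Dual.oo_rcap, ← mul_assoc, mul_assoc (oo (w ++ [OrOb.up k]) (cup k)), h, mul_assoc, h2,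
    oI_mul_oI List.prefix_rfl]

theorem left_curl (w : List OrOb) (k : ℕ+) :
    oo (w ++ [OrOb.up k]) (cup k) * oc (w ++ [OrOb.up k]) [OrOb.up k] [OrOb.down k] *
      oo w (Dual.single k).rcap = oI (w ++ [OrOb.up k]) := by
  have h1 := oo_mul_oc w [OrOb.up k] (cup k ⨟ rightCross k k)
  have h2 : ∀ v, oo v (cup k ⨟ rightCross k k) = oo v (cup k) * oc v [OrOb.up k] [OrOb.down k] :=
    fun v => by rw [oo_comp, oc_single]; rfl
  have h3 : oc w [OrOb.up k] [OrOb.down k, OrOb.up k] * oc (w ++ [OrOb.down k]) [OrOb.up k] [OrOb.up k] =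
      oc w [OrOb.up k] [OrOb.down k] * oI (w ++ [OrOb.down k, OrOb.up k, OrOb.up k]) := by
    rw [oc_single_cons, ← oc_single, mul_assoc, oc_symm]
    simp
  have h4 : oo (w ++ [OrOb.up k]) (Dual.single k).cap =
      oc w [OrOb.up k] [OrOb.down k, OrOb.up k] * oo w (Dual.single k).cap :=
    (Dual.single k).cap_append w [OrOb.up k]
  have h10 : oo w (cup k) * oo (w ++ [OrOb.up k]) (Dual.single k).cap = oI (w ++ [OrOb.up k]) :=
    cup_mul_cap w k
  rw [oc_single_cons, ← oc_single] at h4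
  have h6 : oo w (Dual.single k).cap * oI (w ++ [OrOb.up k]) = oI (w ++ [OrOb.down k, OrOb.up k, OrOb.up k]) *
      oo w (Dual.single k).cap := oo_mul_oI_comm _ [OrOb.up k] rfl rfl
  have h7 : oc w [OrOb.up k] [OrOb.down k] * oo w (Dual.single k).cap * oI (w ++ [OrOb.up k]) =
      oc w [OrOb.up k] [OrOb.down k, OrOb.up k] *
        (oc (w ++ [OrOb.down k]) [OrOb.up k] [OrOb.up k] * oo w (Dual.single k).cap) := by
    rw [mul_assoc, h6, ← mul_assoc, ← h3, mul_assoc]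
  have h8 : oo (w ++ [OrOb.up k]) (cup k) * oc (w ++ [OrOb.up k]) [OrOb.up k] [OrOb.down k] *
      (oo w (Dual.single k).rcap * oI (w ++ [OrOb.up k])) = oI (w ++ [OrOb.up k]) := by
    rw [Dual.oo_rcap, h7, ← mul_assoc, ← h2, h1, h2, oc_nil_right, mul_assoc, mul_assoc,
      ← mul_assoc (oc _ _ _), ← h4, h10, oI_mul_oI List.prefix_rfl]
  have h9 : oo w (Dual.single k).rcap * oI (w ++ [OrOb.up k]) =
      oI (w ++ [OrOb.up k, OrOb.down k, OrOb.up k]) * oo w (Dual.single k).rcap :=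
    oo_mul_oI_comm _ [OrOb.up k] rfl rfl
  rwa [h9, mul_assoc, ← mul_assoc (oc _ _ _), oc_mul_oI _ _ _ (by simp), ← mul_assoc] at h8

end

section

variable {a b c d x y v w : List OrOb} {n : ℕ} {p : ZMod 2} {F : UpFam}

/-! ### Traces of upward webs -/

/-- An upward strand of thickness one. -/
abbrev tU : List OrOb := [OrOb.up (Nat.succPNat 0)]

/-- A downward strand of thickness one. -/
abbrev tD : List OrOb := [OrOb.down (Nat.succPNat 0)]

/-- The dual of a strand of thickness one. -/
abbrev tDual : Dual tU tD := Dual.single (Nat.succPNat 0)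

theorem oo_toOr_thinCross (w : List OrOb) : oo w (toOr thinCross) = oc w tU tU := by
  rw [oc_single]
  exact (oo_toOr_congr (s := thickCross (Nat.succPNat 0) (Nat.succPNat 0)) (t := thinCross)
    (uo_thickCross_one_one []) w).symm

/-- The trace of the first strand of a web on thin strands, drawn on its right. -/
noncomputable def leftTrace (n : ℕ) (w : List OrOb) (G : Ops orP) : Ops orP :=
  oo w tDual.cup * oc (w ++ tU) tD (ups (ones n)) * G *
    oc (w ++ tU) (ups (ones n)) tD * oo w tDual.rcap

theorem cup_oc_slide (w : List OrOb) (z : Term OrGen a b) :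
    oo w tDual.cup * oc (w ++ tU) tD a * oo (w ++ tU) z =
      oo w z * (oo w tDual.cup * oc (w ++ tU) tD b) := by
  have h1 := oo_mul_oc (w ++ tU) tD z
  have h2 := tDual.cup_mul_oo w z []
  rw [List.append_nil, List.append_nil, ← List.append_assoc] at h2
  rw [mul_assoc, ← h1, ← mul_assoc, h2, mul_assoc]

theorem slide_oc_rcap (w : List OrOb) (z : Term OrGen a b) :
    oo (w ++ tU) z * (oc (w ++ tU) b tD * oo w tDual.rcap) =
      oc (w ++ tU) a tD * oo w tDual.rcap * oo w z := by
  have h1 := oo_mul_oc' (w ++ tU) tD z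
  have h2 := tDual.rcap_mul_oo w z []
  rw [List.append_nil, List.append_nil, ← List.append_assoc] at h2
  rw [← mul_assoc, h1, mul_assoc, mul_assoc, h2]

theorem trace_of_commuting (w c : List OrOb) {G : Ops orP}
    (hG : oc (w ++ tU) tD c * G = G * oc (w ++ tU) tD c) :
    oo w tDual.cup * oc (w ++ tU) tD c * G * (oc (w ++ tU) c tD * oo w tDual.rcap) =
      oo w tDual.cup * G * oo w tDual.rcap * oI (w ++ c) := by
  have h1 : oI (w ++ tU ++ (tD ++ c)) * oo w tDual.rcap = oo w tDual.rcap * oI (w ++ c) :=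
    (oo_mul_oI_comm _ c rfl (by simp)).symm
  calc _ = oo w tDual.cup * (oc (w ++ tU) tD c * G) * (oc (w ++ tU) c tD * oo w tDual.rcap) := by
        simp only [mul_assoc]
    _ = oo w tDual.cup * G * (oc (w ++ tU) tD c * oc (w ++ tU) c tD) * oo w tDual.rcap := by
        rw [hG]; simp only [mul_assoc]
    _ = _ := by rw [oc_symm, mul_assoc, h1]; simp only [mul_assoc]

theorem leftTrace_add (n : ℕ) (w : List OrOb) (G G' : Ops orP) :
    leftTrace n w (G + G') = leftTrace n w G + leftTrace n w G' := by
  simp only [leftTrace, mul_add, add_mul]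

theorem leftTrace_smul (n : ℕ) (w : List OrOb) (r : ℂ) (G : Ops orP) :
    leftTrace n w (r • G) = r • leftTrace n w G := by
  simp only [leftTrace, mul_smul_comm, smul_mul_assoc]

theorem leftTrace_plain (w : List OrOb) (z : Term UpGen (ones n) (ones n)) :
    leftTrace n w (oo (w ++ tU) (toOr z)) = 0 := by
  have h2 := trace_of_commuting w (ups (ones n)) (G := 1) (by rw [one_mul, mul_one])
  have h3 : oo w tDual.cup * oo w tDual.rcap = 0 := bubble w
  rw [mul_one, mul_one, h3, zero_mul] at h2
  rw [leftTrace, cup_oc_slide, mul_assoc, mul_assoc, h2, mul_zero]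

theorem leftTrace_dot (w : List OrOb) (z : Term UpGen (ones n) (ones n)) :
    leftTrace n w (oo (w ++ tU) (toOr z) * oo w (toOr (dt 1))) = 0 := by
  have h1 : oc (w ++ tU) tD (ups (ones n)) * oo w (toOr (dt 1)) =
      oo w (toOr (dt 1)) * oc (w ++ tU) tD (ups (ones n)) :=
    (oo_slide_right (v := w ++ tU) (toOr (dt 1)) (crossWords_even (P := orP) orCross_even _ _) []
      (by rw [List.append_nil]; rfl) (by rw [List.append_nil]; rfl)).symm
  have h2 := trace_of_commuting w (ups (ones n)) h1
  have h3 : oo w tDual.cup * oo w (toOr (dt 1)) * oo w tDual.rcap = 0 := bubble_dot w _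
  rw [h3, zero_mul] at h2
  rw [leftTrace, ← mul_assoc, cup_oc_slide]
  simp only [mul_assoc] at h2 ⊢
  rw [h2, mul_zero]

theorem leftTrace_cross (w : List OrOb) (y z : Term UpGen (ones (n + 1)) (ones (n + 1))) :
    leftTrace (n + 1) w (oo (w ++ tU) (toOr y) * oc w tU tU * oo (w ++ tU) (toOr z)) =
      oo w (toOr y) * oo w (toOr z) := by
  have hc : ups (ones (n + 1)) = tU ++ ups (ones n) := rfl
  have e1 : oc (w ++ tU) tD (ups (ones (n + 1))) = oc (w ++ tU) tD tU * oc (w ++ tU ++ tU) tD (ups (ones n)) := by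
    rw [hc, oc_append_right]
  have e2 : oc (w ++ tU) (ups (ones (n + 1))) tD = oc (w ++ tU ++ tU) (ups (ones n)) tD * oc (w ++ tU) tU tD := by
    rw [hc, oc_append_left]
  have e3 : oc (w ++ tU ++ tU) tD (ups (ones n)) * oc w tU tU =
      oc w tU tU * oc (w ++ tU ++ tU) tD (ups (ones n)) :=
    (oo_slide_oc (w := w) (v := w ++ tU ++ tU) (crossWords_even (P := orP) orCross_even tU tU) tD
      (ups (ones n)) [] (by simp) (by simp)).symm
  have e5 : oo w tDual.cup * oc (w ++ tU) tD tU * oc w tU tU = oo (w ++ tU) tDual.cup := by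
    rw [tDual.cup_append, oc_append_left, mul_assoc]
  have e6 : oI (w ++ tU ++ tU ++ (tD ++ ups (ones n))) * (oc (w ++ tU) tU tD * oo w tDual.rcap) =
      oc (w ++ tU) tU tD * oo w tDual.rcap * oI (w ++ (tU ++ ups (ones n))) := by
    have k1 : oo w tDual.rcap * oI (w ++ (tU ++ ups (ones n))) =
      oI (w ++ tU ++ (tD ++ tU ++ ups (ones n))) * oo w tDual.rcap :=
      oo_mul_oI_comm _ (tU ++ ups (ones n)) rfl (by simp)
    have k2 : oc (w ++ tU) tU tD * oI (w ++ tU ++ (tD ++ tU ++ ups (ones n))) =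
        oI (w ++ tU ++ tU ++ (tD ++ ups (ones n))) * oc (w ++ tU) tU tD :=
      oo_mul_oI_comm (crossWords orCross tU tD) (ups (ones n)) (by simp) (by simp)
    rw [← mul_assoc, ← k2, mul_assoc, ← k1, mul_assoc]
  have e7 : oo (w ++ tU) tDual.cup * oc (w ++ tU) tU tD * oo w tDual.rcap = oI (w ++ tU) :=
    left_curl w _
  have e8 : oo w tDual.cup * oc (w ++ tU) tD (ups (ones (n + 1))) * oc w tU tU *
      (oc (w ++ tU) (ups (ones (n + 1))) tD * oo w tDual.rcap) = oI (w ++ (tU ++ ups (ones n))) := by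
    calc _ = oo w tDual.cup * oc (w ++ tU) tD tU * (oc (w ++ tU ++ tU) tD (ups (ones n)) * oc w tU tU) *
          oc (w ++ tU ++ tU) (ups (ones n)) tD * (oc (w ++ tU) tU tD * oo w tDual.rcap) := by
          rw [e1, e2]; simp only [mul_assoc]
      _ = oo w tDual.cup * oc (w ++ tU) tD tU * oc w tU tU * (oc (w ++ tU ++ tU) tD (ups (ones n)) *
          oc (w ++ tU ++ tU) (ups (ones n)) tD) * (oc (w ++ tU) tU tD * oo w tDual.rcap) := by
          rw [e3]; simp only [mul_assoc]
      _ = oo (w ++ tU) tDual.cup * oc (w ++ tU) tU tD * oo w tDual.rcap *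
          oI (w ++ (tU ++ ups (ones n))) := by
          rw [e5, oc_symm, mul_assoc, e6]; simp only [mul_assoc]
      _ = _ := by rw [e7, oI_mul_oI (by simp)]
  rw [leftTrace]
  calc _ = (oo w tDual.cup * oc (w ++ tU) tD (ups (ones (n + 1))) * oo (w ++ tU) (toOr y)) *
        oc w tU tU * (oo (w ++ tU) (toOr z) * (oc (w ++ tU) (ups (ones (n + 1))) tD *
        oo w tDual.rcap)) := by simp only [mul_assoc]
    _ = oo w (toOr y) * (oo w tDual.cup * oc (w ++ tU) tD (ups (ones (n + 1))) * oc w tU tU *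
      (oc (w ++ tU) (ups (ones (n + 1))) tD * oo w tDual.rcap)) * oo w (toOr z) := by
        rw [cup_oc_slide, slide_oc_rcap]; simp only [mul_assoc]
    _ = _ := by
        rw [e8, oo_mul_oI _ ⟨[], by rw [List.append_nil]; rfl⟩]

theorem ones_succ (n : ℕ) : ones (n + 1) = up 1 ++ ones n := rfl

theorem ones_succ_succ (n : ℕ) : ones (n + 2) = up 1 ++ up 1 ++ ones n := rfl

theorem oo_crossing (w : List OrOb) (y z : Term UpGen (ones (n + 1)) (ones (n + 1))) :
    oo w (toOr (Term.idLeft (up 1) y (ones_succ _) (ones_succ _) ⨟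
      Term.idRight thinCross (ones n) (ones_succ_succ _) (ones_succ_succ _) ⨟
      Term.idLeft (up 1) z (ones_succ _) (ones_succ _))) =
      oo (w ++ tU) (toOr y) * oc w tU tU * oo (w ++ tU) (toOr z) := by
  have e4 : oo (w ++ tU) (toOr y) * oI (w ++ (tU ++ tU ++ ups (ones n))) = oo (w ++ tU) (toOr y) :=
    oo_mul_oI _ ⟨[], by simp [ones]; rfl⟩
  rw [toOr_comp, toOr_comp, oo_comp, oo_comp, oo_toOr_idLeft, oo_toOr_idLeft, oo_toOr_idRight,
    oo_toOr_thinCross]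
  change oo (w ++ tU) (toOr y) * (oI (w ++ (tU ++ tU ++ ups (ones n))) * _ * oo (w ++ tU) (toOr z)) = _
  rw [mul_assoc (oI _), ← mul_assoc, e4, mul_assoc]

theorem uo_crossing (w : List ℕ+) (y z : Term UpGen (ones (n + 1)) (ones (n + 1))) :
    uo w (Term.idLeft (up 1) y (ones_succ _) (ones_succ _) ⨟
      Term.idRight thinCross (ones n) (ones_succ_succ _) (ones_succ_succ _) ⨟
      Term.idLeft (up 1) z (ones_succ _) (ones_succ _)) =
      uo (w ++ up 1) y * thinX w * uo (w ++ up 1) z := by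
  have e4 : uo (w ++ up 1) y * uI (w ++ (up 1 ++ up 1 ++ ones n)) = uo (w ++ up 1) y :=
    uo_mul_uI _ ⟨[], by simp [ones]⟩
  rw [uo_comp, uo_comp, uo_idLeft, uo_idLeft, uo_idRight, mul_assoc (uI _), ← mul_assoc, e4, mul_assoc]
  rfl

/-- A web on thin strands with an upward trace. -/
def HasLeftTrace (n : ℕ) (F : UpFam) : Prop :=
  ∃ s : Term UpGen (ones (n + 1)) (ones (n + 1)), ∃ t : Term UpGen (ones n) (ones n),
    (F = fun w => uo w s) ∧ ∀ w, leftTrace n w (oo w (toOr s)) = oo w (toOr t)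

theorem IsMk.hasLeftTrace (hF : IsMk (n + 1) p F) : HasLeftTrace n F := by
  have h0 : ∀ w, oo w (toOr (0 : Term UpGen (ones n) (ones n))) = 0 := fun w => oo_zero w
  refine IsMk.induction (motive := HasLeftTrace n) hF (fun z hz => ?_) (fun q z hz e => ?_)
      (fun hn q r y hy z hz e => ?_) ?_ ?_ ?_
  · obtain ⟨z, -, rfl⟩ := hz.exists_term
    refine ⟨Term.idLeft (up 1) z (ones_succ _) (ones_succ _), 0, funext fun w => ?_, fun w => ?_⟩
    · rw [uo_idLeft]
      rfl
    · rw [oo_toOr_idLeft, h0]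
      exact leftTrace_plain w z
  · obtain ⟨z, -, rfl⟩ := hz.exists_term
    refine ⟨Term.tensor (dt 1) z (ones_succ _) (ones_succ _), 0, funext fun w => ?_, fun w => ?_⟩
    · rw [uo_tensor]
      rfl
    · rw [oo_toOr_tensor, h0]
      exact leftTrace_dot w z
  · obtain ⟨n, rfl⟩ := Nat.exists_eq_succ_of_ne_zero hn
    obtain ⟨y, -, rfl⟩ := hy.exists_term
    obtain ⟨z, -, rfl⟩ := hz.exists_term
    refine ⟨_, y ⨟ z, funext fun w => (uo_crossing w y z).symm, fun w => ?_⟩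
    exact (congrArg (leftTrace (n + 1) w) (oo_crossing w y z)).trans
      ((leftTrace_cross w y z).trans (by rw [toOr_comp, oo_comp]))
  · refine ⟨0, 0, funext fun w => (uo_zero w).symm, fun w => ?_⟩
    have h : oo w (toOr (0 : Term UpGen (ones (n + 1)) (ones (n + 1)))) = 0 := oo_zero w
    rw [h, h0, leftTrace, mul_zero, zero_mul, zero_mul]
  · rintro F G ⟨s, t, rfl, h⟩ ⟨s', t', rfl, h'⟩
    refine ⟨s + s', t + t', funext fun w => (uo_add w s s').symm, fun w => ?_⟩
    have e1 : oo w (toOr (s + s')) = oo w (toOr s) + oo w (toOr s') := oo_add w _ _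
    have e2 : oo w (toOr (t + t')) = oo w (toOr t) + oo w (toOr t') := oo_add w _ _
    rw [e1, e2, leftTrace_add, h, h']
  · rintro c F ⟨s, t, rfl, h⟩
    refine ⟨c • s, c • t, funext fun w => (uo_smul w c s).symm, fun w => ?_⟩
    have e1 : oo w (toOr (c • s)) = c • oo w (toOr s) := oo_smul w _ _
    have e2 : oo w (toOr (c • t)) = c • oo w (toOr t) := oo_smul w _ _
    rw [e1, e2, leftTrace_smul, h]

end

section

variable {a b c d P Q : List ℕ+} {n : ℕ} {p : ZMod 2}

/-! ### Traces of strands of arbitrary thickness -/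

theorem exists_homogeneous (t : Term UpGen a b) : ∃ s s' : Term UpGen a b,
    s.HasParity UpGen.par 0 ∧ s'.HasParity UpGen.par 1 ∧ ∀ w, uo w t = uo w (s + s') := by
  obtain ⟨f, ⟨s, hs, rfl⟩, g, ⟨s', hs', rfl⟩, e⟩ := exists_parts (P := upP) t
  exact ⟨s, s', hs, hs', fun w => congrArg (fun f => op (P := upP) w f) e⟩

theorem sz_ones : ∀ n : ℕ, sz (ones n) = n
  | 0 => rfl
  | n + 1 => by
    have h : sz (ones (n + 1)) = 1 + sz (ones n) := rfl
    rw [h, sz_ones n, Nat.add_comm]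

theorem uo_exWord_ones (w : List ℕ+) (n : ℕ) : uo w (exWord (ones n)) = uI (w ++ ones n) := by
  induction n generalizing w with
  | zero => exact (uo_exWord_nil w).trans (congrArg uI (List.append_nil w).symm)
  | succ n ih =>
    refine (uo_exWord_cons w _ (ones n)).trans ?_
    rw [ih]
    refine (congrArg (_ * ·) (ex_one w)).trans ?_
    refine (uI_mul_uI' (v := w ++ up 1) (List.prefix_append _ _)).trans ?_
    rw [List.append_assoc]
    rfl

theorem uo_imWord_ones (w : List ℕ+) (n : ℕ) : uo w (imWord (ones n)) = uI (w ++ ones n) := by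
  induction n generalizing w with
  | zero => exact (uo_imWord_nil w).trans (congrArg uI (List.append_nil w).symm)
  | succ n ih =>
    refine (uo_imWord_cons w _ (ones n)).trans ?_
    rw [ih]
    refine (congrArg (· * _) (im_one w)).trans ?_
    refine (uI_mul_uI (List.prefix_append _ _)).trans ?_
    rw [List.append_assoc]
    rfl

theorem isMk_uo {t : Term UpGen (ones n) (ones n)} (h : t.HasParity UpGen.par p) :
    IsMk n p fun w => uo w t := by
  refine (((isMackey h).isMk rfl).cast_nat (sz_ones n)).congr fun w => ?_
  rw [conj, uo_exWord_ones, uo_imWord_ones, uI_mul_uo t List.prefix_rfl, uo_mul_uI t List.prefix_rfl]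

/-- The trace of the last strand of a web. -/
noncomputable def rightTrace (k : ℕ+) (P Q : List ℕ+) (F : Ops orP) : Ops orP :=
  oo (ups P) (cup k) * F * oo (ups Q) (Dual.single k).rcap

theorem rightTrace_add (k : ℕ+) (P Q : List ℕ+) (F G : Ops orP) :
    rightTrace k P Q (F + G) = rightTrace k P Q F + rightTrace k P Q G := by
  simp only [rightTrace, mul_add, add_mul]

theorem rightTrace_smul (k : ℕ+) (P Q : List ℕ+) (r : ℂ) (F : Ops orP) :
    rightTrace k P Q (r • F) = r • rightTrace k P Q F := by
  simp only [rightTrace, mul_smul_comm, smul_mul_assoc]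

theorem rightTrace_ones (F : Ops orP) : rightTrace (Nat.succPNat 0) (ones n) (ones n) F =
    leftTrace n [] (oc [] tU (ups (ones n)) * F * oc [] (ups (ones n)) tU) := by
  have e1 := tDual.cup_append [] (ups (ones n))
  have e2 := tDual.rcap_append [] (ups (ones n))
  rw [oc_append_left] at e1
  rw [oc_append_right] at e2
  rw [List.nil_append] at e1 e2
  change oo (ups (ones n)) tDual.cup * F * oo (ups (ones n)) tDual.rcap = _
  rw [e1, e2, leftTrace]
  simp only [List.nil_append, mul_assoc]

theorem exists_rightTrace_ones {t : Term UpGen (ones (n + 1)) (ones (n + 1))}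
    (ht : t.HasParity UpGen.par p) : ∃ s : Term UpGen (ones n) (ones n),
    rightTrace (Nat.succPNat 0) (ones n) (ones n) (oo [] (toOr t)) = oo [] (toOr s) := by
  have hl : ones (n + 1) = ones n ++ [Nat.succPNat 0] := (ones_add (k := n) (l := 1) rfl).symm
  set g : Term UpGen (ones (n + 1)) (ones (n + 1)) :=
    crossWords thickCross [Nat.succPNat 0] (ones n) ⨟ Term.ofEq hl.symm ⨟ t ⨟ Term.ofEq hl ⨟
      crossWords thickCross (ones n) [Nat.succPNat 0]
  have hX := fun a b => crossWords_even (P := upP) (X := thickCross) (fun x y => thickCross_parity x y) a b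
  have hg : g.HasParity UpGen.par p := .even_comp (hX _ _) (.even_comp (.ofEq _)
    (.comp_even ht (.comp_even (.ofEq _) (hX _ _))))
  have hgo : oo [] (toOr g) = oc [] tU (ups (ones n)) * oo [] (toOr t) * oc [] (ups (ones n)) tU := by
    have e1 : oo [] (toOr (crossWords thickCross [Nat.succPNat 0] (ones n))) = oc [] tU (ups (ones n)) :=
      oo_toOr_crossWords _ _ _
    have e2 : oo [] (toOr (crossWords thickCross (ones n) [Nat.succPNat 0])) = oc [] (ups (ones n)) tU :=
      oo_toOr_crossWords _ _ _
    have e3 : ups (ones (n + 1)) = ups (ones n) ++ tU := by rw [hl]; exact List.map_append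
    have e4 : oo [] (toOr g) = oo [] (toOr (crossWords thickCross [Nat.succPNat 0] (ones n))) *
      oo [] (toOr (Term.ofEq hl.symm ⨟ t ⨟ Term.ofEq hl ⨟
        crossWords thickCross (ones n) [Nat.succPNat 0])) := oo_comp [] _ _
    rw [e4, toOr_comp, toOr_comp, toOr_comp, oo_comp, oo_comp, oo_comp, oo_toOr_ofEq,
      oo_toOr_ofEq, e1, e2]
    rw [oI_mul_oc _ _ _ ⟨[], by rw [List.append_nil]; exact congrArg _ e3⟩, ← mul_assoc (oI _),
      oI_mul_oo _ ⟨[], by rw [← hl, List.append_nil]⟩, mul_assoc]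
  obtain ⟨s, t', e, h⟩ := (isMk_uo hg).hasLeftTrace
  refine ⟨t', ?_⟩
  rw [rightTrace_ones, ← hgo, ← h, oo_toOr_congr (congrFun e [])]

theorem exists_rightTrace_one_of_parity {t : Term UpGen (P ++ [Nat.succPNat 0]) (Q ++ [Nat.succPNat 0])}
    (ht : t.HasParity UpGen.par p) : ∃ s : Term UpGen P Q,
    rightTrace (Nat.succPNat 0) P Q (oo [] (toOr t)) = oo [] (toOr s) := by
  have hs : ∀ R : List ℕ+, sz (R ++ [Nat.succPNat 0]) = sz R + 1 := fun R => by
    rw [sz_append]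
    rfl
  have hl : ∀ m, ones (m + 1) = ones m ++ [Nat.succPNat 0] := fun m => (ones_add (k := m) (l := 1) rfl).symm
  by_cases h : sz P = sz Q
  · obtain ⟨g, hg, e⟩ := ((((isMackey ht).isMk (by rw [hs, hs, h])).cast_nat (hs P))).exists_term
    obtain ⟨s, hs'⟩ := exists_rightTrace_ones hg
    have hc : facWord (P ++ [Nat.succPNat 0]) * facWord (Q ++ [Nat.succPNat 0]) ≠ 0 :=
      mul_ne_zero (facWord_ne_zero _) (facWord_ne_zero _)
    have e1 := uo_eq_conj [] t
    rw [congrFun e []] at e1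
    set c := facWord (P ++ [Nat.succPNat 0]) * facWord (Q ++ [Nat.succPNat 0]) with hcdef
    have i1 : uo [] (exWord (P ++ [Nat.succPNat 0])) =
        uI (P ++ [Nat.succPNat 0]) * uo [] (exWord P) := by
      rw [uo_exWord_append, uo_exWord_single]
      exact congrArg (· * _) (ex_one P)
    have i2 : uo [] (imWord (Q ++ [Nat.succPNat 0])) =
        uo [] (imWord Q) * uI (Q ++ [Nat.succPNat 0]) := by
      rw [uo_imWord_append, uo_imWord_single]
      exact congrArg (_ * ·) (im_one Q)
    have e2 : uo [] (c • t) = uo [] (Term.idRight (exWord P) [Nat.succPNat 0] rfl (hl _) ⨟ g ⨟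
        Term.idRight (imWord Q) [Nat.succPNat 0] (by rw [h]; exact hl _) rfl) := by
      rw [uo_smul, e1, uo_comp, uo_comp, uo_idRight, uo_idRight', i1, i2, mul_assoc]
      rfl
    refine ⟨(1 / c) • (exWord P ⨟ s ⨟ Term.ofEq (by rw [h]) ⨟ imWord Q), ?_⟩
    have e3 : oo [] (toOr (c • t)) = _ := oo_toOr_congr e2 []
    have e4 : oo [] (toOr (c • t)) = c • oo [] (toOr t) := oo_smul _ _ _
    have e5 : oo [] (toOr t) = (1 / c) • oo [] (toOr (c • t)) := by
      rw [e4, smul_smul, one_div, inv_mul_cancel₀ hc, one_smul]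
    have e6 : ∀ f : Term UpGen P Q, oo [] (toOr ((1 / c) • f)) = (1 / c) • oo [] (toOr f) :=
      fun f => oo_smul _ _ _
    rw [e6, e5, rightTrace_smul, e3]
    congr 1
    rw [toOr_comp, toOr_comp, toOr_comp, toOr_comp, toOr_comp, oo_comp, oo_comp, oo_comp, oo_comp,
      oo_comp, ← hs', oo_toOr_ofEq, oo_toOr_idRight', oo_toOr_idRight, rightTrace, rightTrace]
    have k1 := tDual.oo_mul_cup (w := []) (toOr (exWord P))
    have k2 := tDual.oo_mul_rcap (w := []) (toOr (imWord Q))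
    rw [List.nil_append, List.nil_append] at k1 k2
    have k6 : oo [] (toOr (imWord Q)) * oo (ups Q) tDual.rcap =
        oo (ups (ones (sz P))) tDual.rcap * oo [] (toOr (imWord Q)) := by
      rw [h]
      exact k2
    have k3 : oI (ups (ones (sz P)) ++ ups [Nat.succPNat 0]) * oo [] (toOr g) = oo [] (toOr g) :=
      oI_mul_oo _ ⟨[], by rw [hl, List.map_append]; simp⟩
    have k4 : oo [] (toOr g) * oI (ups (ones (sz Q)) ++ ups [Nat.succPNat 0]) = oo [] (toOr g) :=
      oo_mul_oI _ ⟨[], by rw [hl, List.map_append, h]; simp⟩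
    have k5 : oI (ups (ones (sz P))) * oo [] (toOr (imWord Q)) = oo [] (toOr (imWord Q)) :=
      oI_mul_oo _ ⟨[], by rw [h]; simp⟩
    rw [List.nil_append, List.nil_append, List.nil_append, k5, mul_assoc (oo [] (toOr (exWord P))),
      ← mul_assoc (oI _), k3, ← mul_assoc (oo [] (toOr g)), k4]
    calc _ = (oo (ups P) tDual.cup * oo [] (toOr (exWord P))) * oo [] (toOr g) *
          (oo [] (toOr (imWord Q)) * oo (ups Q) tDual.rcap) := by simp only [mul_assoc]; rfl
      _ = _ := by rw [← k1, k6]; simp only [mul_assoc]; rfl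
  · refine ⟨0, ?_⟩
    have e : oo [] (toOr t) = oo [] (toOr (0 : Term UpGen _ _)) := oo_toOr_congr
      (((isMackey ht).zero (by rw [hs, hs]; omega) []).trans (uo_zero _).symm) []
    have e2 : oo [] (toOr (0 : Term UpGen (P ++ [Nat.succPNat 0]) (Q ++ [Nat.succPNat 0]))) = 0 := oo_zero []
    have e3 : oo [] (toOr (0 : Term UpGen P Q)) = 0 := oo_zero []
    rw [e, e2, e3, rightTrace, mul_zero, zero_mul]

theorem exists_rightTrace_one (t : Term UpGen (P ++ [Nat.succPNat 0]) (Q ++ [Nat.succPNat 0])) :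
    ∃ s : Term UpGen P Q,
      rightTrace (Nat.succPNat 0) P Q (oo [] (toOr t)) = oo [] (toOr s) := by
  obtain ⟨f, g, hf, hg, e⟩ := exists_homogeneous t
  obtain ⟨s, hs⟩ := exists_rightTrace_one_of_parity hf
  obtain ⟨s', hs'⟩ := exists_rightTrace_one_of_parity hg
  refine ⟨s + s', ?_⟩
  have e1 : oo [] (toOr (f + g)) = oo [] (toOr f) + oo [] (toOr g) := oo_add _ _ _
  have e2 : oo [] (toOr (s + s')) = oo [] (toOr s) + oo [] (toOr s') := oo_add _ _ _
  rw [oo_toOr_congr (e []), e1, e2, rightTrace_add, hs, hs']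

/-- Traces are cyclic. -/
theorem cup_mul_mul_rcap {x x' y y' u v a b : List OrOb} (D : Dual x x') (E : Dual y y')
    (s : Term OrGen x y) (f : Term OrGen a b) (ha : a = u ++ y) (hb : b = v ++ x)
    (hs : s.HasParity OrGen.par 0) :
    oo u E.cup * oo [] f * (oo v s * oo v E.rcap) = oo u D.cup * (oo u s * oo [] f) * oo v D.rcap := by
  subst ha hb
  have h : oo [] f * oo (v ++ x) (D.mate E s) = oo (u ++ y) (D.mate E s) * oo [] f :=
    oo_slide_right f (D.mate_parity E hs) [] (by simp) (by simp)
  rw [D.oo_mul_rcap' E, ← mul_assoc, mul_assoc (oo u E.cup), h, ← mul_assoc, D.cup_mul_mate]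
  simp only [mul_assoc]

theorem exists_rightTrace (k : ℕ) (P Q : List ℕ+)
    (t : Term UpGen (P ++ [k.succPNat]) (Q ++ [k.succPNat])) :
    ∃ s : Term UpGen P Q, rightTrace k.succPNat P Q (oo [] (toOr t)) = oo [] (toOr s) := by
  induction k generalizing P Q with
  | zero => exact exists_rightTrace_one t
  | succ k ih =>
    generalize hj : k.succPNat = j at ih
    generalize hm' : (k + 1).succPNat = m at t ⊢
    have hm : Nat.succPNat 0 + j = m := by
      subst hj hm'
      exact PNat.eq (Nat.add_comm 1 (k + 1))
    set D : Dual [OrOb.up (Nat.succPNat 0), OrOb.up j] ([OrOb.down j] ++ tD) :=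
      tDual.append (Dual.single j)
    set E : Dual [OrOb.up m] [OrOb.down m] := Dual.single m
    set s : Term UpGen [Nat.succPNat 0, j] [m] := .gen (.merge (Nat.succPNat 0) j m hm)
    set q : Term UpGen [m] [Nat.succPNat 0, j] := .gen (.split (Nat.succPNat 0) j m hm)
    have hsp : (toOr s).HasParity OrGen.par 0 := .gen _
    have hdig : ∀ w : List ℕ+, uo w (q ⨟ s) = uo w (((k : ℂ) + 2) • .id [m]) := fun w => by
      have h := uo_digon w 1 (k + 1) (m := k + 2) (by omega)
      subst hj hm'
      rw [uo_comp, uo_smul, uo_id]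
      refine Eq.trans h ?_
      have h3 : (k + 2).choose (k + 1) = k + 2 := Nat.choose_succ_self_right (k + 1)
      rw [h3]
      push_cast
      rfl
    obtain ⟨g, hg⟩ := ih (P ++ [Nat.succPNat 0]) (Q ++ [Nat.succPNat 0])
      (Term.idLeft P s (by simp) rfl ⨟ t ⨟ Term.idLeft Q q rfl (by simp))
    obtain ⟨f, hf⟩ := exists_rightTrace_one g
    have hk : (k : ℂ) + 2 ≠ 0 := by
      have h : ((k + 2 : ℕ) : ℂ) ≠ 0 := Nat.cast_ne_zero.mpr (by omega)
      push_cast at h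
      exact h
    refine ⟨(1 / ((k : ℂ) + 2)) • f, ?_⟩
    have e1 : oo [] (toOr t) = (1 / ((k : ℂ) + 2)) • (oo [] (toOr t) * oo (ups Q) (toOr q) * oo (ups Q) (toOr s)) := by
      have h1 : oo (ups Q) (toOr q) * oo (ups Q) (toOr s) =
          ((k : ℂ) + 2) • oI (ups Q ++ [OrOb.up m]) := by
        rw [← oo_comp, ← toOr_comp, oo_toOr_congr (hdig [])]
        refine (oo_smul _ _ _).trans ?_
        exact congrArg _ (oo_id _ _)
      rw [mul_assoc, h1, mul_smul_comm, smul_smul, one_div, inv_mul_cancel₀ hk, one_smul,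
        oo_mul_oI _ ⟨[], by simp⟩]
    have e2 : oo [] (toOr ((1 / ((k : ℂ) + 2)) • f)) = (1 / ((k : ℂ) + 2)) • oo [] (toOr f) := oo_smul _ _ _
    rw [e2, e1, rightTrace_smul, ← hf, ← hg]
    congr 1
    have e3 := cup_mul_mul_rcap (u := ups P) (v := ups Q) D E (toOr s)
      (toOr (t ⨟ Term.idLeft Q q rfl rfl)) (by simp) (by simp) hsp
    rw [toOr_comp, oo_comp, oo_toOr_idLeft] at e3
    rw [rightTrace, rightTrace, rightTrace, toOr_comp, toOr_comp, oo_comp, oo_comp, oo_toOr_idLeft,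
      oo_toOr_idLeft]
    have e4 := tDual.oo_append_cup (Dual.single j) (ups P)
    have e5 := tDual.oo_append_rcap (Dual.single j) (ups Q)
    have e6 : ∀ R : List ℕ+, ups (R ++ [Nat.succPNat 0]) = ups R ++ tU := fun R => List.map_append
    have e7 : ∀ R, oo R (cup j) = oo R (Dual.single j).cup := fun R => rfl
    have e8 : ∀ R, oo R (cup m) = oo R E.cup := fun R => rfl
    have e9 : ∀ R, oo R (cup (Nat.succPNat 0)) = oo R tDual.cup := fun R => rfl
    rw [e6, e6, e7, e8, e9, List.nil_append, List.nil_append]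
    rw [List.nil_append] at e3
    refine Eq.trans ?_ (e3.trans ?_)
    · simp only [mul_assoc]
      rfl
    · refine (congrArg₂ (fun A B => A * (oo (ups P) (toOr s) * (oo [] (toOr t) * oo (ups Q) (toOr q))) * B) e4 e5).trans ?_
      simp only [mul_assoc]

end

section

variable {x y w l r : List OrOb} {a b c d s u v : List ℕ+}

/-! ### Bending downward strands -/

/-- The upward strands in a word. -/
def upPart : List OrOb → List ℕ+
  | [] => []
  | OrOb.up k :: x => k :: upPart x
  | OrOb.down _ :: x => upPart x

/-- The downward strands in a word, in reversed order. -/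
def downPart : List OrOb → List ℕ+
  | [] => []
  | OrOb.up _ :: x => downPart x
  | OrOb.down k :: x => downPart x ++ [k]

theorem upPart_append (x y : List OrOb) : upPart (x ++ y) = upPart x ++ upPart y := by
  induction x with
  | nil => rfl
  | cons k x ih => cases k <;> simp [upPart, ih]

theorem downPart_append (x y : List OrOb) : downPart (x ++ y) = downPart y ++ downPart x := by
  induction x with
  | nil => simp [downPart]
  | cons k x ih => cases k <;> simp [downPart, ih]

theorem upPart_ups (a : List ℕ+) : upPart (ups a) = a := by
  induction a with
  | nil => rfl
  | cons k a ih => exact congrArg (k :: ·) ih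

theorem downPart_ups (a : List ℕ+) : downPart (ups a) = [] := by
  induction a with
  | nil => rfl
  | cons k a ih => exact ih

/-- Connect the downward strands of a word to upward strands on its right, in the presence of
the upward strands `v`. -/
noncomputable def bendTerm (v : List ℕ+) :
    ∀ x : List OrOb, Term OrGen (x ++ ups (v ++ downPart x)) (ups (upPart x ++ v))
  | [] => .ofEq (by simp [upPart, downPart])
  | OrOb.up k :: x => Term.idLeft [OrOb.up k] (bendTerm v x) rfl rfl
  | OrOb.down k :: x =>
      (Term.idLeft [OrOb.down k] (Term.idRight (bendTerm v x) [OrOb.up k] rfl rfl)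
        (by simp [downPart]) rfl :
        Term OrGen (OrOb.down k :: x ++ ups (v ++ downPart (OrOb.down k :: x)))
          ([OrOb.down k] ++ (ups (upPart x ++ v) ++ [OrOb.up k]))) ⨟
      (Term.idLeft [OrOb.down k] (crossWords orCross (ups (upPart x ++ v)) [OrOb.up k]) rfl rfl :
        Term OrGen ([OrOb.down k] ++ (ups (upPart x ++ v) ++ [OrOb.up k]))
          ([OrOb.down k] ++ ([OrOb.up k] ++ ups (upPart x ++ v)))) ⨟
      Term.idRight (cap k) (ups (upPart x ++ v)) rfl rfl

theorem bendTerm_parity (v : List ℕ+) : ∀ x, (bendTerm v x).HasParity OrGen.par 0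
  | [] => .ofEq _
  | OrOb.up _ :: x => .idLeft (bendTerm_parity v x) _ _
  | OrOb.down k :: x => .comp_even (.idLeft (.idRight (bendTerm_parity v x) _ _) _ _)
      (.comp_even (.idLeft (crossWords_even (P := orP) orCross_even _ _) _ _) (.idRight (cap_parity k) _ _))

/-- The operator of `bendTerm`. -/
noncomputable def bend (w : List OrOb) (x : List OrOb) (v : List ℕ+) : Ops orP := oo w (bendTerm v x)

theorem bend_nil (w : List OrOb) (v : List ℕ+) : bend w [] v = oI (w ++ ups v) := by
  refine Eq.trans (oo_ofEq w _) ?_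
  simp [downPart]

theorem bend_up (w : List OrOb) (k : ℕ+) (x : List OrOb) (v : List ℕ+) :
    bend w (OrOb.up k :: x) v = bend (w ++ [OrOb.up k]) x v := oo_idLeft _ _ _ _

theorem bend_down (w : List OrOb) (k : ℕ+) (x : List OrOb) (v : List ℕ+) :
    bend w (OrOb.down k :: x) v = bend (w ++ [OrOb.down k]) x v *
      oc (w ++ [OrOb.down k]) (ups (upPart x ++ v)) [OrOb.up k] * oo w (cap k) := by
  have e1 : oI (w ++ ([OrOb.down k, OrOb.up k] ++ ups (upPart x ++ v))) * oo w (cap k) =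
    oo w (cap k) * oI (w ++ ups (upPart x ++ v)) := (oo_mul_oI_comm _ _ rfl rfl).symm
  have e2 : oo (w ++ [OrOb.down k]) (bendTerm v x) *
      oI (w ++ [OrOb.down k] ++ (ups (upPart x ++ v) ++ [OrOb.up k])) *
      oc (w ++ [OrOb.down k]) (ups (upPart x ++ v)) [OrOb.up k] =
      oo (w ++ [OrOb.down k]) (bendTerm v x) *
      oc (w ++ [OrOb.down k]) (ups (upPart x ++ v)) [OrOb.up k] := by
    rw [mul_assoc, oI_mul_oc _ _ _ List.prefix_rfl]
  have e3 : oc (w ++ [OrOb.down k]) (ups (upPart x ++ v)) [OrOb.up k] *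
      oI (w ++ ([OrOb.down k, OrOb.up k] ++ ups (upPart x ++ v))) =
      oc (w ++ [OrOb.down k]) (ups (upPart x ++ v)) [OrOb.up k] := oc_mul_oI _ _ _ (by simp)
  refine Eq.trans ((oo_comp _ _ _).trans (congrArg₂ (· * ·) ((oo_idLeft _ _ _ _).trans
    (oo_idRight' _ _ _ _)) ((oo_comp _ _ _).trans (congrArg₂ (· * ·) (oo_idLeft _ _ _ _)
    (oo_idRight _ _ _ _))))) ?_
  change oo (w ++ [OrOb.down k]) (bendTerm v x) *
      oI (w ++ [OrOb.down k] ++ (ups (upPart x ++ v) ++ [OrOb.up k])) *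
      (oc (w ++ [OrOb.down k]) (ups (upPart x ++ v)) [OrOb.up k] *
      (oI (w ++ ([OrOb.down k, OrOb.up k] ++ ups (upPart x ++ v))) * oo w (cap k))) = _
  rw [← mul_assoc (oc _ _ _), e3, ← mul_assoc, e2]
  rfl

theorem bend_ups (w : List OrOb) (a v : List ℕ+) : bend w (ups a) v = oI (w ++ ups (a ++ v)) := by
  induction a generalizing w with
  | nil => exact bend_nil w v
  | cons k a ih =>
    refine (bend_up w k (ups a) v).trans ((ih _).trans ?_)
    simp

theorem bend_append (w x y : List OrOb) (v : List ℕ+) :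
    bend w (x ++ y) v = bend (w ++ x) y v * bend w x (upPart y ++ v) := by
  induction x generalizing w with
  | nil =>
    rw [bend_nil, List.append_nil, List.nil_append]
    exact (oo_mul_oI _ List.prefix_rfl).symm
  | cons k x ih =>
    cases k with
    | up k => rw [List.cons_append, bend_up, bend_up, ih, List.append_assoc]; rfl
    | down k =>
      rw [List.cons_append, bend_down, bend_down, ih, upPart_append, List.append_assoc,
        List.append_assoc]
      simp only [mul_assoc]
      rfl

theorem oo_mul_bend (w : List OrOb) {p q : List OrOb} (t : Term OrGen p q) (z x : List OrOb) (v : List ℕ+) :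
    oo w t * bend (w ++ (q ++ z)) x v = bend (w ++ (p ++ z)) x v * oo w t :=
  oo_slide_right t (bendTerm_parity v x) z rfl rfl

theorem bend_natural (w x : List OrOb) (t : Term OrGen (ups v) (ups u)) :
    bend w x v * oo (w ++ ups (upPart x)) t = oo (w ++ x) t * bend w x u := by
  induction x generalizing w with
  | nil =>
    rw [bend_nil, bend_nil, oI_mul_oo _ (by simp [upPart]), oo_mul_oI _ (by simp)]
    simp [upPart]
  | cons k x ih =>
    cases k with
    | up k =>
      have h := ih (w ++ [OrOb.up k])
      rw [List.append_assoc, List.append_assoc] at h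
      rw [bend_up, bend_up]
      exact h
    | down k =>
      have h := ih (w ++ [OrOb.down k])
      rw [bend_down, bend_down]
      have e1 : oo w (cap k) * oo (w ++ ups (upPart x)) t =
        oo (w ++ ([OrOb.down k, OrOb.up k] ++ ups (upPart x))) t * oo w (cap k) :=
        (Dual.single k).cap_mul_oo w t _
      have e2 : oc (w ++ [OrOb.down k]) (ups (upPart x)) [OrOb.up k] *
          oo (w ++ ([OrOb.down k, OrOb.up k] ++ ups (upPart x))) t =
          oo (w ++ [OrOb.down k] ++ ups (upPart x) ++ [OrOb.up k]) t *
          oc (w ++ [OrOb.down k]) (ups (upPart x)) [OrOb.up k] :=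
        oo_slide_left t (crossWords_even (P := orP) orCross_even _ _) [] (by simp) (by simp)
      have e3 := oo_mul_oc' (w ++ [OrOb.down k] ++ ups (upPart x)) [OrOb.up k] t
      have e4 : ∀ z, oc (w ++ [OrOb.down k]) (ups (upPart x ++ z)) [OrOb.up k] =
          oc (w ++ [OrOb.down k] ++ ups (upPart x)) (ups z) [OrOb.up k] *
            oc (w ++ [OrOb.down k]) (ups (upPart x)) [OrOb.up k] := fun z => by
        rw [ups, List.map_append, oc_append_left]
      have e5 : w ++ OrOb.down k :: x = w ++ [OrOb.down k] ++ x := by simp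
      rw [e4, e4, e5, upPart]
      calc _ = bend (w ++ [OrOb.down k]) x v * (oc (w ++ [OrOb.down k] ++ ups (upPart x)) (ups v) [OrOb.up k] *
            (oc (w ++ [OrOb.down k]) (ups (upPart x)) [OrOb.up k] * (oo w (cap k) * oo (w ++ ups (upPart x)) t))) := by
            simp only [mul_assoc]
        _ = bend (w ++ [OrOb.down k]) x v * ((oc (w ++ [OrOb.down k] ++ ups (upPart x)) (ups v) [OrOb.up k] *
            oo (w ++ [OrOb.down k] ++ ups (upPart x) ++ [OrOb.up k]) t) *
            (oc (w ++ [OrOb.down k]) (ups (upPart x)) [OrOb.up k] * oo w (cap k))) := by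
            rw [e1, ← mul_assoc (oc _ (ups (upPart x)) _), e2]; simp only [mul_assoc]
        _ = (bend (w ++ [OrOb.down k]) x v * oo (w ++ [OrOb.down k] ++ ups (upPart x)) t) *
            (oc (w ++ [OrOb.down k] ++ ups (upPart x)) (ups u) [OrOb.up k] *
            (oc (w ++ [OrOb.down k]) (ups (upPart x)) [OrOb.up k] * oo w (cap k))) := by
            rw [← e3]; simp only [mul_assoc]
        _ = _ := by rw [h]; simp only [mul_assoc]

theorem bend_append_single (w x : List OrOb) (v : List ℕ+) (m : ℕ+) :
    bend w x (v ++ [m]) = oc (w ++ x ++ ups v) [OrOb.up m] (ups (downPart x)) * bend w x v := by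
  induction x generalizing w with
  | nil =>
    change _ = oc _ _ [] * _
    rw [bend_nil, bend_nil, oc_nil_right, oI_mul_oI' (by simp)]
    simp
  | cons k x ih =>
    cases k with
    | up k =>
      rw [bend_up, bend_up, ih, List.append_assoc w]
      rfl
    | down k =>
      have e1 : oc (w ++ OrOb.down k :: x ++ ups v) [OrOb.up m] (ups (downPart (OrOb.down k :: x))) =
          oc (w ++ [OrOb.down k] ++ x ++ ups v) [OrOb.up m] (ups (downPart x)) *
          oc (w ++ [OrOb.down k] ++ x ++ ups v ++ ups (downPart x)) [OrOb.up m] [OrOb.up k] := by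
        rw [← oc_append_right]
        simp [downPart]
      have e2 : oc (w ++ [OrOb.down k]) (ups (upPart x ++ (v ++ [m]))) [OrOb.up k] =
          oc (w ++ [OrOb.down k] ++ ups (upPart x ++ v)) [OrOb.up m] [OrOb.up k] *
          oc (w ++ [OrOb.down k]) (ups (upPart x ++ v)) [OrOb.up k] := by
        rw [← oc_append_left]
        simp
      have e3 : bend (w ++ [OrOb.down k]) x v *
          oc (w ++ [OrOb.down k] ++ ups (upPart x ++ v)) [OrOb.up m] [OrOb.up k] =
          oc (w ++ [OrOb.down k] ++ x ++ ups v ++ ups (downPart x)) [OrOb.up m] [OrOb.up k] *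
          bend (w ++ [OrOb.down k]) x v :=
        oo_slide_left _ (bendTerm_parity v x) [] (by simp) (by simp)
      rw [bend_down, bend_down, ih, e1, e2]
      calc _ = oc (w ++ [OrOb.down k] ++ x ++ ups v) [OrOb.up m] (ups (downPart x)) *
            (bend (w ++ [OrOb.down k]) x v *
            oc (w ++ [OrOb.down k] ++ ups (upPart x ++ v)) [OrOb.up m] [OrOb.up k]) *
            oc (w ++ [OrOb.down k]) (ups (upPart x ++ v)) [OrOb.up k] * oo w (cap k) := by
            simp only [mul_assoc]
        _ = _ := by rw [e3]; simp only [mul_assoc]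

/-- The operator of an upward web. -/
def IsUp (s u : List ℕ+) (F : Ops orP) : Prop := ∃ g : Term UpGen s u, F = oo [] (toOr g)

theorem IsUp.cast {s' u' : List ℕ+} {F : Ops orP} (h : IsUp s u F) (hs : s = s') (hu : u = u') :
    IsUp s' u' F := hs ▸ hu ▸ h

theorem IsUp.mul_oo {F : Ops orP} (h : IsUp s (c ++ (a ++ d)) F) (t : Term UpGen a b) :
    IsUp s (c ++ (b ++ d)) (F * oo (ups c) (toOr t)) := by
  obtain ⟨g, rfl⟩ := h
  refine ⟨g ⨟ Term.idLeft c (Term.idRight t d rfl rfl) rfl rfl, ?_⟩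
  rw [toOr_comp, oo_comp, oo_toOr_idLeft, oo_toOr_idRight, ← mul_assoc]
  congr 1
  exact (oo_mul_oI _ ⟨[], by simp⟩).symm

theorem IsUp.oo_mul {F : Ops orP} (h : IsUp (c ++ (b ++ d)) u F) (t : Term UpGen a b) :
    IsUp (c ++ (a ++ d)) u (oo (ups c) (toOr t) * F) := by
  obtain ⟨g, rfl⟩ := h
  refine ⟨Term.idLeft c (Term.idRight t d rfl rfl) rfl rfl ⨟ g, ?_⟩
  rw [toOr_comp, oo_comp, oo_toOr_idLeft, oo_toOr_idRight', mul_assoc]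
  congr 1
  exact (oI_mul_oo _ ⟨[], by simp⟩).symm

theorem IsUp.tensor_id {F : Ops orP} (h : IsUp s u F) (c : List ℕ+) :
    IsUp (s ++ c) (u ++ c) (oI (ups (s ++ c)) * F) := by
  obtain ⟨g, rfl⟩ := h
  refine ⟨Term.idRight g c rfl rfl, ?_⟩
  rw [oo_toOr_idRight]
  simp

theorem IsUp.rightTrace {F : Ops orP} {k : ℕ+} (h : IsUp (s ++ [k]) (u ++ [k]) F) :
    IsUp s u (rightTrace k s u F) := by
  obtain ⟨g, rfl⟩ := h
  obtain ⟨n, rfl⟩ : ∃ n : ℕ, k = n.succPNat := ⟨k.natPred, (PNat.succPNat_natPred k).symm⟩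
  exact exists_rightTrace n s u g

theorem IsUp.zero : IsUp s u 0 := ⟨0, (oo_zero _).symm⟩

theorem IsUp.add {F G : Ops orP} (h : IsUp s u F) (h' : IsUp s u G) : IsUp s u (F + G) := by
  obtain ⟨f, rfl⟩ := h
  obtain ⟨g, rfl⟩ := h'
  exact ⟨f + g, (oo_add _ _ _).symm⟩

theorem IsUp.smul {F : Ops orP} (z : ℂ) (h : IsUp s u F) : IsUp s u (z • F) := by
  obtain ⟨f, rfl⟩ := h
  exact ⟨z • f, (oo_smul _ _ _).symm⟩

/-- A trace of one strand can be moved past other strands. -/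
theorem trace_past (w w' c : List OrOb) (m : ℕ+) (G : Ops orP)
    (hG : oc (w ++ [OrOb.up m]) [OrOb.down m] c * G = G * oc (w' ++ [OrOb.up m]) [OrOb.down m] c) :
    oo (w ++ c) (cup m) * oc w c [OrOb.up m] * G * oc w' [OrOb.up m] c * oo (w' ++ c) (Dual.single m).rcap =
      oo w (cup m) * G * oo w' (Dual.single m).rcap * oI (w' ++ c) := by
  set D := Dual.single m
  have e1 : oo (w ++ c) (cup m) = oo w (cup m) * (oc (w ++ [OrOb.up m]) [OrOb.down m] c *
      oc w [OrOb.up m] c) := by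
    have h := D.cup_append w c
    rw [oc_append_left] at h
    exact h
  have e2 : oo (w' ++ c) D.rcap = oc w' c [OrOb.up m] * (oc (w' ++ [OrOb.up m]) c [OrOb.down m] *
      oo w' D.rcap) := by
    rw [D.rcap_append, oc_append_right, mul_assoc]
  have e3 : ∀ v, oc (v ++ [OrOb.up m]) [OrOb.down m] c * (oc v [OrOb.up m] c * oc v c [OrOb.up m]) =
      oc (v ++ [OrOb.up m]) [OrOb.down m] c := fun v => by
    rw [oc_symm, oc_mul_oI _ _ _ (by simp)]
  have e4 : oI (w' ++ [OrOb.up m] ++ ([OrOb.down m] ++ c)) * oo w' D.rcap = oo w' D.rcap * oI (w' ++ c) :=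
    (oo_mul_oI_comm _ _ rfl (by simp)).symm
  calc _ = oo w (cup m) * (oc (w ++ [OrOb.up m]) [OrOb.down m] c *
        (oc w [OrOb.up m] c * oc w c [OrOb.up m])) * G * (oc w' [OrOb.up m] c * oc w' c [OrOb.up m]) *
        (oc (w' ++ [OrOb.up m]) c [OrOb.down m] * oo w' D.rcap) := by
        rw [e1, e2]; simp only [mul_assoc]
    _ = oo w (cup m) * (oc (w ++ [OrOb.up m]) [OrOb.down m] c * G) * (oc w' [OrOb.up m] c *
        oc w' c [OrOb.up m]) * (oc (w' ++ [OrOb.up m]) c [OrOb.down m] * oo w' D.rcap) := by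
        rw [e3]; simp only [mul_assoc]
    _ = oo w (cup m) * G * (oc (w' ++ [OrOb.up m]) [OrOb.down m] c * (oc w' [OrOb.up m] c *
        oc w' c [OrOb.up m])) * (oc (w' ++ [OrOb.up m]) c [OrOb.down m] * oo w' D.rcap) := by
        rw [hG]; simp only [mul_assoc]
    _ = oo w (cup m) * G * (oc (w' ++ [OrOb.up m]) [OrOb.down m] c *
        oc (w' ++ [OrOb.up m]) c [OrOb.down m]) * oo w' D.rcap := by
        rw [e3]; simp only [mul_assoc]
    _ = _ := by rw [oc_symm, mul_assoc, e4]; simp only [mul_assoc]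

/-- An oriented web whose bent form is upward. -/
structure Good (a : List ℕ+) (y : List OrOb) (F : Ops orP) : Prop where
  exists_term : ∃ f : Term OrGen (ups a) y, F = oo [] f
  isUp : IsUp (a ++ downPart y) (upPart y) (F * bend [] y [])

theorem Good.exists_term_mul {F : Ops orP} (h : Good a (l ++ (x ++ r)) F) (t : Term OrGen x y) :
    ∃ f : Term OrGen (ups a) (l ++ (y ++ r)), F * oo l t = oo [] f := by
  obtain ⟨f, rfl⟩ := h.exists_term
  refine ⟨f ⨟ Term.idLeft l (Term.idRight t r rfl rfl) rfl rfl, ?_⟩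
  rw [oo_comp, oo_idLeft, oo_idRight, ← mul_assoc]
  exact congrArg (· * _) (oo_mul_oI f ⟨[], by simp⟩).symm

theorem bend_middle (l y r : List OrOb) : bend [] (l ++ (y ++ r)) [] =
    bend (l ++ y) r [] * (bend l y (upPart r) * bend [] l (upPart y ++ upPart r)) := by
  rw [bend_append, bend_append, upPart_append, List.append_nil, List.append_nil, mul_assoc]
  rfl

theorem oo_mul_bend_middle (l r : List OrOb) (t : Term OrGen x y) : oo l t * bend [] (l ++ (y ++ r)) [] =
    bend (l ++ x) r [] * (oo l t * bend l y (upPart r) * bend [] l (upPart y ++ upPart r)) := by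
  have h := oo_mul_bend l t [] r []
  rw [List.append_nil, List.append_nil] at h
  rw [bend_middle, ← mul_assoc, h]
  simp only [mul_assoc]

/-- A web that does not change bent forms. -/
theorem Good.of_bend_eq {F : Ops orP} (h : Good a (l ++ (x ++ r)) F) (t : Term OrGen x y)
    (hd : downPart x = downPart y) (hu : upPart x = upPart y)
    (ht : ∀ v, oo l t * bend l y v = bend l x v) : Good a (l ++ (y ++ r)) (F * oo l t) := by
  refine ⟨h.exists_term_mul t, ?_⟩
  have h2 := h.isUp
  rw [bend_middle] at h2
  rw [mul_assoc, oo_mul_bend_middle, ht, ← hu]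
  refine h2.cast ?_ ?_
  · simp only [downPart_append, hd]
  · simp only [upPart_append, hu]

theorem Good.mul_toOr {F : Ops orP} {p q : List ℕ+} (h : Good a (l ++ (ups p ++ r)) F) (t : Term UpGen p q) :
    Good a (l ++ (ups q ++ r)) (F * oo l (toOr t)) := by
  refine ⟨h.exists_term_mul _, ?_⟩
  have h2 := h.isUp
  rw [bend_middle, bend_ups, upPart_ups] at h2
  rw [mul_assoc, oo_mul_bend_middle, bend_ups, upPart_ups, oo_mul_oI_comm (x := l ++ ups (p ++ upPart r)) _ (ups (upPart r)) (by simp) (by simp)]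
  have e := bend_natural (v := p ++ upPart r) (u := q ++ upPart r) [] l
    (toOr (Term.idRight t (upPart r) rfl rfl))
  have k1 : bend [] l (p ++ upPart r) * oI ([] ++ ups (upPart l) ++ (ups p ++ ups (upPart r))) =
      bend [] l (p ++ upPart r) := oo_mul_oI _ (by simp)
  have k2 : oI ([] ++ l ++ (ups q ++ ups (upPart r))) * bend [] l (q ++ upPart r) =
      bend [] l (q ++ upPart r) := oI_mul_oo _ (by simp)
  have e1 : bend [] l (p ++ upPart r) * oo (ups (upPart l)) (toOr t) = oo l (toOr t) * bend [] l (q ++ upPart r) := by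
    refine Eq.trans ?_ (e.trans ?_)
    · rw [oo_toOr_idRight, ← mul_assoc, k1, List.nil_append]
    · rw [oo_toOr_idRight', mul_assoc, k2, List.nil_append]
  have h3 := IsUp.mul_oo (c := upPart l) (d := upPart r) (h2.cast rfl (by simp [upPart_append, upPart_ups])) t
  rw [mul_assoc (oI _), ← e1]
  refine IsUp.cast ?_ (s := a ++ downPart (l ++ (ups p ++ r))) (u := upPart l ++ (q ++ upPart r)) ?_ ?_
  · simpa only [mul_assoc] using h3
  · simp only [downPart_append, downPart_ups]
  · simp only [upPart_append, upPart_ups]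

theorem bend_down_up (l : List OrOb) (k m : ℕ+) (v : List ℕ+) : bend l [OrOb.down m, OrOb.up k] v =
    oc (l ++ [OrOb.down m]) (ups (k :: v)) [OrOb.up m] * oo l (cap m) := by
  rw [bend_down, bend_up, bend_nil]
  refine congrArg (· * _) (oI_mul_oc _ _ _ ⟨[OrOb.up m], by simp [upPart]⟩)

theorem bend_up_down (l : List OrOb) (k m : ℕ+) (v : List ℕ+) : bend l [OrOb.up k, OrOb.down m] v =
    oc (l ++ [OrOb.up k, OrOb.down m]) (ups v) [OrOb.up m] * oo (l ++ [OrOb.up k]) (cap m) := by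
  have h : l ++ [OrOb.up k] ++ [OrOb.down m] = l ++ [OrOb.up k, OrOb.down m] := by simp
  rw [bend_up, bend_down, bend_nil, h]
  exact congrArg (· * _) (oI_mul_oc _ _ _ ⟨[OrOb.up m], List.append_assoc _ _ _⟩)

theorem Good.mul_rightCross {F : Ops orP} (k m : ℕ+) (h : Good a (l ++ ([OrOb.up k, OrOb.down m] ++ r)) F) :
    Good a (l ++ ([OrOb.down m, OrOb.up k] ++ r)) (F * oo l (rightCross k m)) := by
  refine h.of_bend_eq _ rfl rfl fun v => ?_
  have e1 : bend l [OrOb.down m, OrOb.up k] v =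
      oc (l ++ [OrOb.down m]) (ups (k :: v)) [OrOb.up m] * oo l (cap m) := bend_down_up l k m v
  have e2 : bend l [OrOb.up k, OrOb.down m] v =
      oc (l ++ [OrOb.up k, OrOb.down m]) (ups v) [OrOb.up m] * oo (l ++ [OrOb.up k]) (cap m) :=
    bend_up_down l k m v
  have e3 := (Dual.single m).cap_append l [OrOb.up k]
  rw [oc_append_right] at e3
  have e4 : oc (l ++ [OrOb.down m]) (ups (k :: v)) [OrOb.up m] =
      oc (l ++ [OrOb.down m, OrOb.up k]) (ups v) [OrOb.up m] *
        oc (l ++ [OrOb.down m]) [OrOb.up k] [OrOb.up m] := by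
    have h := oc_append_left (l ++ [OrOb.down m]) [OrOb.up k] (ups v) [OrOb.up m]
    rw [List.append_assoc] at h
    exact h
  have e5 : oo l (rightCross k m) * oc (l ++ [OrOb.down m, OrOb.up k]) (ups v) [OrOb.up m] =
      oc (l ++ [OrOb.up k, OrOb.down m]) (ups v) [OrOb.up m] * oo l (rightCross k m) :=
    oo_slide_oc (rightCross_parity k m) _ _ [] (by simp) (by simp)
  have e6 : oo l (rightCross k m) = oc l [OrOb.up k] [OrOb.down m] := (oc_single _ _ _).symm
  rw [e1, e2, e4, ← mul_assoc, ← mul_assoc, e5, mul_assoc, mul_assoc, e6]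
  refine congrArg (_ * ·) ?_
  rw [← mul_assoc]
  exact e3.symm

theorem Good.mul_cup {F : Ops orP} (k : ℕ+) (h : Good a (l ++ ([] ++ r)) F) :
    Good a (l ++ ([OrOb.up k, OrOb.down k] ++ r)) (F * oo l (cup k)) := by
  refine ⟨h.exists_term_mul _, ?_⟩
  obtain ⟨f, hf⟩ := h.exists_term
  have h2 := h.isUp
  have e0 : oI (l ++ ups (upPart r)) * bend [] l (upPart [] ++ upPart r) = bend [] l (upPart r) :=
    oI_mul_oo _ (by simp [upPart])
  rw [bend_middle, bend_nil, List.append_nil, e0] at h2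
  rw [mul_assoc, oo_mul_bend_middle, List.append_nil, bend_up_down]
  set v := upPart r with hv
  set X : Term UpGen (v ++ [k]) ([k] ++ v) := crossWords thickCross v [k]
  set Y : Term UpGen ([k] ++ downPart l) (downPart l ++ [k]) := crossWords thickCross [k] (downPart l)
  have e1 : oo l (cup k) * oc (l ++ [OrOb.up k, OrOb.down k]) (ups v) [OrOb.up k] =
      oc l (ups v) [OrOb.up k] * oo l (cup k) :=
    oo_slide_oc (cup_parity k) _ _ [] (by simp) (by simp)
  have e2 : oc l (ups v) [OrOb.up k] * oI (l ++ [OrOb.up k]) = oc l (ups v) [OrOb.up k] :=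
    oc_mul_oI _ _ _ (by simp)
  have e3 : oc l (ups v) [OrOb.up k] = oo l (toOr X) := (oo_toOr_crossWords l v [k]).symm
  have e4 : bend [] l (v ++ [k]) * oo (ups (upPart l)) (toOr X) = oo l (toOr X) * bend [] l ([k] ++ v) :=
    bend_natural [] l (toOr X)
  have e5 : bend [] l (v ++ [k]) = oo (l ++ ups v) (toOr Y) * bend [] l v := by
    have e := oo_toOr_crossWords (l ++ ups v) [k] (downPart l)
    rw [bend_append_single]
    exact congrArg (· * _) e.symm
  have hY : (toOr Y).HasParity OrGen.par 0 :=
    toOr_parity (crossWords_even (P := upP) (X := thickCross) (fun x y => thickCross_parity x y) _ _)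
  have e6 : bend l r [] * oo (l ++ ups v) (toOr Y) = oo (l ++ (r ++ ups (downPart r))) (toOr Y) * bend l r [] :=
    oo_slide_left _ (bendTerm_parity [] r) [] (by simp [v]) (by simp)
  have e7 : F * oo (l ++ (r ++ ups (downPart r))) (toOr Y) = oo (ups (a ++ downPart r)) (toOr Y) * F := by
    rw [hf]
    exact oo_slide_right f hY (ups (downPart r)) (by simp) (by simp)
  have e8 : oo l (cup k) * oo (l ++ [OrOb.up k]) (cap k) = oI (l ++ [OrOb.up k]) := cup_mul_cap l k
  have h3 := IsUp.mul_oo (c := upPart l) (d := []) ((h2.tensor_id [k]).cast rfl (by simp [upPart_append, v])) X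
  have h4 := IsUp.oo_mul (c := a ++ downPart r) (d := []) (h3.cast (by simp [downPart_append]) rfl) Y
  have e11 : oo (ups (a ++ downPart r)) (toOr Y) * oI (ups (a ++ downPart (l ++ ([] ++ r)) ++ [k])) =
      oo (ups (a ++ downPart r)) (toOr Y) := oo_mul_oI _ ⟨[], by simp [downPart_append]⟩
  refine IsUp.cast ?_ (s := a ++ downPart r ++ ([k] ++ downPart l ++ [])) (u := upPart l ++ ([k] ++ v ++ [])) ?_ ?_
  · refine Eq.subst (motive := IsUp _ _) ?_ h4
    have e9 : bend [] l (upPart [OrOb.up k, OrOb.down k] ++ v) = bend [] l ([k] ++ v) := rfl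
    rw [e9]
    calc _ = (oo (ups (a ++ downPart r)) (toOr Y) * oI (ups (a ++ downPart (l ++ ([] ++ r)) ++ [k]))) *
          F * bend l r [] * bend [] l v * oo (ups (upPart l)) (toOr X) := by
          simp only [mul_assoc]
      _ = (oo (ups (a ++ downPart r)) (toOr Y) * F) * bend l r [] * bend [] l v * oo (ups (upPart l)) (toOr X) := by
          rw [e11]
      _ = F * (bend l r [] * oo (l ++ ups v) (toOr Y)) * bend [] l v * oo (ups (upPart l)) (toOr X) := by
          rw [← e7, e6]; simp only [mul_assoc]
      _ = F * bend l r [] * ((oo (l ++ ups v) (toOr Y) * bend [] l v) * oo (ups (upPart l)) (toOr X)) := by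
          simp only [mul_assoc]
      _ = F * bend l r [] * (oc l (ups v) [OrOb.up k] * oI (l ++ [OrOb.up k]) * bend [] l ([k] ++ v)) := by
          rw [← e5, e4, e2, e3]
      _ = _ := by rw [← e8, ← mul_assoc (oc _ _ _), ← e1]; simp only [mul_assoc]
  · simp [downPart_append, downPart]
  · simp [upPart_append, upPart, v]

theorem trace_down_up (l : List OrOb) (m : ℕ+) (v : List ℕ+) :
    oo (l ++ [OrOb.down m, OrOb.up m] ++ ups v) (cup m) * (oc (l ++ [OrOb.down m]) (ups (m :: v)) [OrOb.up m] *
      oo l (cap m) * oc l [OrOb.up m] (ups v)) * oo (l ++ ups v) (Dual.single m).rcap =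
      oo l (cap m) * oI (l ++ ups v) := by
  have e1 : oc (l ++ [OrOb.down m]) (ups (m :: v)) [OrOb.up m] =
      oc (l ++ [OrOb.down m, OrOb.up m]) (ups v) [OrOb.up m] *
        oc (l ++ [OrOb.down m]) [OrOb.up m] [OrOb.up m] := by
    have h := oc_append_left (l ++ [OrOb.down m]) [OrOb.up m] (ups v) [OrOb.up m]
    rw [List.append_assoc] at h
    exact h
  have s1 : oc (l ++ [OrOb.down m, OrOb.up m] ++ [OrOb.up m]) [OrOb.down m] (ups v) *
      oc (l ++ [OrOb.down m]) [OrOb.up m] [OrOb.up m] =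
      oc (l ++ [OrOb.down m]) [OrOb.up m] [OrOb.up m] *
        oc (l ++ [OrOb.down m, OrOb.up m] ++ [OrOb.up m]) [OrOb.down m] (ups v) :=
    (oo_slide_oc (crossWords_even (P := orP) orCross_even _ _) _ _ [] (by simp) (by simp)).symm
  have s2 : oc (l ++ [OrOb.down m, OrOb.up m] ++ [OrOb.up m]) [OrOb.down m] (ups v) * oo l (cap m) =
      oo l (cap m) * oc (l ++ [OrOb.up m]) [OrOb.down m] (ups v) :=
    (oo_slide_oc (cap_parity m) _ _ [OrOb.up m] (by simp) (by simp)).symm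
  have h := trace_past (l ++ [OrOb.down m, OrOb.up m]) l (ups v) m
    (oc (l ++ [OrOb.down m]) [OrOb.up m] [OrOb.up m] * oo l (cap m))
    (by rw [← mul_assoc, s1, mul_assoc, s2, mul_assoc])
  have s3 : oo l (cap m) * oo l (Dual.single m).rcap =
      oo (l ++ [OrOb.down m, OrOb.up m]) (Dual.single m).rcap * oo l (cap m) := by
    have h := (Dual.single m).cap_mul_oo l (Dual.single m).rcap []
    rw [List.append_nil, List.append_nil] at h
    exact h
  have s4 := right_curl (l ++ [OrOb.down m]) m
  rw [List.append_assoc] at s4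
  rw [e1]
  refine Eq.trans ?_ (h.trans ?_)
  · simp only [mul_assoc]
  · rw [← mul_assoc (oo _ (cup m)), mul_assoc _ (oo l (cap m)), s3, ← mul_assoc _ (oo _ (Dual.single m).rcap)]
    refine congrArg (· * _) ?_
    refine (congrArg (· * _) s4).trans ?_
    exact oI_mul_oo _ (by simp)

theorem Good.mul_cap {F : Ops orP} (m : ℕ+) (h : Good a (l ++ ([OrOb.down m, OrOb.up m] ++ r)) F) :
    Good a (l ++ ([] ++ r)) (F * oo l (cap m)) := by
  refine ⟨h.exists_term_mul _, ?_⟩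
  obtain ⟨f, hf⟩ := h.exists_term
  have h2 := h.isUp
  rw [bend_middle, bend_down_up] at h2
  rw [mul_assoc, oo_mul_bend_middle, bend_nil]
  set v := upPart r with hv
  set c := downPart l with hc
  set X : Term UpGen ([m] ++ v) (v ++ [m]) := crossWords thickCross [m] v
  set Y : Term UpGen (c ++ [m]) ([m] ++ c) := crossWords thickCross c [m]
  set F' := F * bend (l ++ [OrOb.down m, OrOb.up m]) r [] with hF'
  have eX : ∀ w, oo w (toOr X) = oc w [OrOb.up m] (ups v) := fun w => oo_toOr_crossWords w [m] v
  have eY : ∀ w, oo w (toOr Y) = oc w (ups c) [OrOb.up m] := fun w => oo_toOr_crossWords w c [m]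
  have hY : (toOr Y).HasParity OrGen.par 0 :=
    toOr_parity (crossWords_even (P := upP) (X := thickCross) (fun x y => thickCross_parity x y) _ _)
  have h3 := IsUp.mul_oo (c := upPart l) (d := []) (h2.cast rfl (by simp [upPart_append, upPart, v])) X
  have h4 := IsUp.oo_mul (c := a ++ downPart r) (d := []) (h3.cast (by simp [downPart_append, downPart, c]) rfl) Y
  have h5 := IsUp.rightTrace (k := m) (s := a ++ downPart r ++ c) (u := upPart l ++ v) (h4.cast (by simp) (by simp))
  refine IsUp.cast ?_ (s := a ++ downPart r ++ c) (u := upPart l ++ v) ?_ ?_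
  · refine Eq.subst (motive := IsUp _ _) ?_ h5
    set W := l ++ [OrOb.down m, OrOb.up m] ++ ups v with hW
    set B := oc (l ++ [OrOb.down m]) (ups (m :: v)) [OrOb.up m] * oo l (cap m) with hB
    have slideF : ∀ {p q : List OrOb} (t : Term OrGen p q), t.HasParity OrGen.par 0 → ∀ z : List ℕ+,
        oo (ups (a ++ downPart r ++ z)) t * F' = F' * oo (W ++ ups z) t := fun t ht z => by
      have k1 : F * oo (l ++ [OrOb.down m, OrOb.up m] ++ (r ++ ups (downPart r) ++ ups z)) t =
          oo (ups (a ++ downPart r ++ z)) t * F := by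
        rw [hf]
        exact oo_slide_right f ht (ups (downPart r) ++ ups z) (by simp) (by simp)
      have k2 : bend (l ++ [OrOb.down m, OrOb.up m]) r [] * oo (W ++ ups z) t =
          oo (l ++ [OrOb.down m, OrOb.up m] ++ (r ++ ups (downPart r) ++ ups z)) t *
            bend (l ++ [OrOb.down m, OrOb.up m]) r [] :=
        oo_slide_left _ (bendTerm_parity [] r) (ups z) (by simp [W, v]) (by simp)
      rw [hF', mul_assoc F, k2, ← mul_assoc, ← mul_assoc, k1]
    have e1 : bend [] l ([m] ++ v) * oo (ups (upPart l)) (toOr X) =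
        oc l [OrOb.up m] (ups v) * (oc (l ++ ups v) [OrOb.up m] (ups c) * bend [] l v) := by
      have k := bend_natural (v := [m] ++ v) (u := v ++ [m]) [] l (toOr X)
      rw [bend_append_single] at k
      rw [← eX]
      exact k
    have e2 : bend [] l v * oo (ups (upPart l ++ v)) (Dual.single m).rcap =
        oo (l ++ ups v ++ ups c) (Dual.single m).rcap * bend [] l v :=
      oo_slide_left _ (bendTerm_parity v l) [] (by simp) (by simp [c])
    have e3 : oI (l ++ ups v ++ ups c) * bend [] l v = bend [] l v :=
      oI_mul_oo _ ⟨[], by simp [c]⟩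
    have s1 : oc (W ++ [OrOb.up m]) [OrOb.down m] (ups c) * oc (l ++ [OrOb.down m]) (ups (m :: v)) [OrOb.up m] =
        oc (l ++ [OrOb.down m]) (ups (m :: v)) [OrOb.up m] * oc (l ++ [OrOb.down m, OrOb.up m] ++
          ([OrOb.up m] ++ ups v)) [OrOb.down m] (ups c) :=
      (oo_slide_oc (crossWords_even (P := orP) orCross_even _ _) _ _ [] (by simp) (by simp [W])).symm
    have s2 : oc (l ++ [OrOb.down m, OrOb.up m] ++ ([OrOb.up m] ++ ups v)) [OrOb.down m] (ups c) * oo l (cap m) =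
        oo l (cap m) * oc (l ++ ([OrOb.up m] ++ ups v)) [OrOb.down m] (ups c) :=
      (oo_slide_oc (cap_parity m) _ _ ([OrOb.up m] ++ ups v) (by simp) (by simp)).symm
    have s3 : oc (l ++ ([OrOb.up m] ++ ups v)) [OrOb.down m] (ups c) * oc l [OrOb.up m] (ups v) =
        oc l [OrOb.up m] (ups v) * oc (l ++ ups v ++ [OrOb.up m]) [OrOb.down m] (ups c) :=
      (oo_slide_oc (crossWords_even (P := orP) orCross_even _ _) _ _ [] (by simp) (by simp)).symm
    have h6 := trace_past W (l ++ ups v) (ups c) m (B * oc l [OrOb.up m] (ups v)) (by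
      rw [hB, ← mul_assoc, ← mul_assoc, s1, mul_assoc _ _ (oo l (cap m)), s2, ← mul_assoc,
        mul_assoc _ _ (oc l _ _), s3]
      simp only [mul_assoc])
    have h7 := trace_down_up l m v
    have e9 : bend [] l (upPart [OrOb.down m, OrOb.up m] ++ v) = bend [] l ([m] ++ v) := rfl
    have e10 : bend [] l (upPart [] ++ v) = bend [] l v := rfl
    have s4 : oo (ups (a ++ downPart r ++ c)) (cup m) * oo (ups (a ++ downPart r)) (toOr Y) * F' =
        F' * (oo (W ++ ups c) (cup m) * oc W (ups c) [OrOb.up m]) := by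
      have k := slideF (toOr Y) hY []
      rw [List.append_nil] at k
      rw [mul_assoc, k, ← mul_assoc, slideF _ (cup_parity m), eY]
      simp [mul_assoc]
    rw [rightTrace, e9, e10]
    calc _ = (oo (ups (a ++ downPart r ++ c)) (cup m) * oo (ups (a ++ downPart r)) (toOr Y) * F') * B *
          (bend [] l ([m] ++ v) * oo (ups (upPart l)) (toOr X)) *
          oo (ups (upPart l ++ v)) (Dual.single m).rcap := by
          rw [hF', hB]; simp only [mul_assoc]
      _ = (oo (ups (a ++ downPart r ++ c)) (cup m) * oo (ups (a ++ downPart r)) (toOr Y) * F') * B *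
          oc l [OrOb.up m] (ups v) * oc (l ++ ups v) [OrOb.up m] (ups c) *
          (bend [] l v * oo (ups (upPart l ++ v)) (Dual.single m).rcap) := by
          rw [e1]; simp only [mul_assoc]
      _ = F' * (oo (W ++ ups c) (cup m) * oc W (ups c) [OrOb.up m] * (B * oc l [OrOb.up m] (ups v)) *
          oc (l ++ ups v) [OrOb.up m] (ups c) * oo (l ++ ups v ++ ups c) (Dual.single m).rcap) * bend [] l v := by
          rw [s4, e2]; simp only [mul_assoc]
      _ = F' * (oo l (cap m) * oI (l ++ ups v)) * (oI (l ++ ups v ++ ups c) * bend [] l v) := by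
          rw [h6, hB, h7]; simp only [mul_assoc]
      _ = _ := by rw [e3, hF']; simp only [mul_assoc]
  · simp [downPart_append, c]
  · simp [upPart_append, v]

theorem Good.mul (t : Term OrGen x y) : ∀ (l r : List OrOb) (F : Ops orP), Good a (l ++ (x ++ r)) F →
    Good a (l ++ (y ++ r)) (F * oo l t) := by
  induction t with
  | id x =>
    intro l r F h
    obtain ⟨f, hf⟩ := h.exists_term
    rw [oo_id, hf, oo_mul_oI f ⟨r, by simp⟩, ← hf]
    exact h
  | gen g =>
    intro l r F h
    cases g with
    | dot k => exact h.mul_toOr (p := [k]) (q := [k]) (.gen (.dot k))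
    | merge i j k e => exact h.mul_toOr (p := [i, j]) (q := [k]) (.gen (.merge i j k e))
    | split i j k e => exact h.mul_toOr (p := [k]) (q := [i, j]) (.gen (.split i j k e))
    | cup k => exact h.mul_cup k
    | cap k => exact h.mul_cap k
    | rightCross k m => exact h.mul_rightCross k m
  | comp s t hs ht =>
    intro l r F h
    rw [oo_comp, ← mul_assoc]
    exact ht _ _ _ (hs _ _ _ h)
  | @tensor p q p' q' x y s t hx hy hs ht =>
    intro l r F h
    subst hx hy
    have h1 := ht (l ++ p) r F (by simpa using h)
    have h2 := hs l (q' ++ r) (F * oo (l ++ p) t) (by simpa using h1)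
    rw [oo_tensor, ← mul_assoc]
    simpa using h2
  | @zero p q =>
    intro l r F h
    have e : oo l (Term.zero : Term OrGen p q) = 0 := oo_zero l
    rw [e, mul_zero]
    exact ⟨⟨0, (oo_zero _).symm⟩, by rw [zero_mul]; exact .zero⟩
  | add s t hs ht =>
    intro l r F h
    have e : oo l (s.add t) = oo l s + oo l t := oo_add l s t
    have h1 := hs l r F h
    have h2 := ht l r F h
    obtain ⟨f, hf⟩ := h1.exists_term
    obtain ⟨g, hg⟩ := h2.exists_term
    rw [e, mul_add]
    exact ⟨⟨f + g, by rw [hf, hg, oo_add]⟩, by rw [add_mul]; exact h1.isUp.add h2.isUp⟩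
  | smul z t ht =>
    intro l r F h
    have e : oo l (t.smul z) = z • oo l t := oo_smul l z t
    have h1 := ht l r F h
    obtain ⟨f, hf⟩ := h1.exists_term
    rw [e, mul_smul_comm]
    exact ⟨⟨z • f, by rw [hf, oo_smul]⟩, by rw [smul_mul_assoc]; exact h1.isUp.smul z⟩

/-- Oriented webs between upward words are upward. -/
theorem exists_upward (t : Term OrGen (ups a) (ups b)) : ∃ s : Term UpGen a b, orMor t = orMor (toOr s) := by
  have h0 : Good a ([] ++ (ups a ++ [])) (oI (ups a)) := by
    rw [List.nil_append, List.append_nil]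
    refine ⟨⟨.id _, (oo_id [] (ups a)).symm⟩, ?_⟩
    rw [bend_ups, downPart_ups, upPart_ups, List.append_nil, List.nil_append, oI_mul_oI List.prefix_rfl]
    exact ⟨.id a, (oo_toOr_id [] a).symm⟩
  have h := (h0.mul t).isUp
  rw [List.nil_append, List.append_nil, bend_ups, downPart_ups, upPart_ups, List.append_nil,
    List.append_nil, oI_mul_oo t (by simp), oo_mul_oI t (by simp)] at h
  obtain ⟨s, hs⟩ := h
  exact ⟨s, oo_inj hs⟩

theorem full_theta : theta.toFunctor.Full where
  map_surjective {a b} f := by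
    obtain ⟨t, rfl⟩ := mor_surj (P := orP) f
    obtain ⟨s, hs⟩ := exists_upward (a := a.word) (b := b.word) t
    exact ⟨upMor s, hs.symm⟩

theorem upMor_mem_span (t : Term UpGen a b) :
    upMor t ∈ Submodule.span ℂ {f | ∃ v : Term UpGen a b, v.IsWeb ∧ f = upMor v} := by
  induction t with
  | id a => exact Submodule.subset_span ⟨_, .id a, rfl⟩
  | gen g => exact Submodule.subset_span ⟨_, .gen g, rfl⟩
  | @comp a b c s t hs ht =>
    refine Submodule.span_le.mpr ?_ (Submodule.map₂_span_span ℂ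
      (Linear.comp (upObj a) (upObj b) (upObj c)) _ _ ▸
      Submodule.apply_mem_map₂ _ hs ht)
    rintro _ ⟨_, ⟨v, hv, rfl⟩, _, ⟨v', hv', rfl⟩, rfl⟩
    exact Submodule.subset_span ⟨_, .comp hv hv', rfl⟩
  | tensor s t hx hy hs ht =>
    subst hx hy
    refine Submodule.span_le.mpr ?_ (Submodule.map₂_span_span ℂ
      (MonoidalSupercategory.tensorHom (C := WebUp)) _ _ ▸ Submodule.apply_mem_map₂ _ hs ht)
    rintro _ ⟨_, ⟨v, hv, rfl⟩, _, ⟨v', hv', rfl⟩, rfl⟩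
    exact Submodule.subset_span ⟨_, .tensor hv hv' rfl rfl, rfl⟩
  | zero => exact Submodule.zero_mem _
  | add s t hs ht => exact Submodule.add_mem _ hs ht
  | smul z t ht => exact Submodule.smul_mem _ z ht

/-- Oriented webs between upward words are linear combinations of upward webs. -/
theorem orMor_mem_span (t : Term OrGen (ups a) (ups b)) :
    orMor t ∈ Submodule.span ℂ {f | ∃ v : Term UpGen a b, v.IsWeb ∧ f = orMor (toOr v)} := by
  obtain ⟨s, hs⟩ := exists_upward t
  rw [hs]
  have h : ∀ f ∈ Submodule.span ℂ {f | ∃ v : Term UpGen a b, v.IsWeb ∧ f = upMor v},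
      theta.map f ∈ Submodule.span ℂ {f | ∃ v : Term UpGen a b, v.IsWeb ∧ f = orMor (toOr v)} := by
    intro f hf
    induction hf using Submodule.span_induction with
    | mem f h =>
      obtain ⟨v, hv, rfl⟩ := h
      exact Submodule.subset_span ⟨v, hv, rfl⟩
    | zero =>
      have h := theta.map_smul (0 : ℂ) (0 : upObj a ⟶ upObj b)
      rw [zero_smul, zero_smul] at h
      rw [h]
      exact Submodule.zero_mem _
    | add f g _ _ hf hg =>
      rw [theta.map_add]
      exact Submodule.add_mem _ hf hg
    | smul z f _ hf =>
      rw [theta.map_smul]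
      exact Submodule.smul_mem _ z hf
  exact h _ (upMor_mem_span s)

end

section Symmetrizers

variable {R : Type} [Ring R] [Algebra ℂ R]

/-- The relations between the simple transpositions. -/
structure IsCoxeter (s : ℕ → R) : Prop where
  sq : ∀ i, s i * s i = 1
  braid : ∀ i, s i * s (i + 1) * s i = s (i + 1) * s i * s (i + 1)
  comm : ∀ i j, i + 2 ≤ j → s i * s j = s j * s i

/-- The sum `1 + s_{k-1} + s_{k-1} s_{k-2} + … + s_{k-1} ⋯ s_0`. -/
def cosetSum (s : ℕ → R) : ℕ → R
  | 0 => 1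
  | k + 1 => 1 + s k * cosetSum s k

/-- The symmetrizer on `k` strands. -/
noncomputable def symz (s : ℕ → R) : ℕ → R
  | 0 => 1
  | k + 1 => ((k : ℂ) + 1)⁻¹ • (symz s k * cosetSum s k)

/-- The cycle `s_{k-1} ⋯ s_0`. -/
def cyDown (s : ℕ → R) : ℕ → R
  | 0 => 1
  | k + 1 => s k * cyDown s k

/-- The cycle `s_0 ⋯ s_{k-1}`. -/
def cyUp (s : ℕ → R) : ℕ → R
  | 0 => 1
  | k + 1 => cyUp s k * s k

variable {s t : ℕ → R}

theorem succ_ne (k : ℕ) : ((k : ℂ) + 1) ≠ 0 := Nat.cast_add_one_ne_zero k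

theorem symz_one : symz s 1 = 1 := by simp [symz, cosetSum]

theorem smul_symz_succ (k : ℕ) : ((k : ℂ) + 1) • symz s (k + 1) = symz s k * cosetSum s k := by
  rw [symz, smul_smul, mul_inv_cancel₀ (succ_ne k), one_smul]

theorem cosetSum_twist {x : R} : ∀ {k : ℕ}, (∀ i < k, x * s i = t i * x) →
    x * cosetSum s k = cosetSum t k * x
  | 0, _ => by simp [cosetSum]
  | k + 1, h => by
    have ih := cosetSum_twist fun i hi => h i (Nat.lt_succ_of_lt hi)
    rw [cosetSum, cosetSum, mul_add, add_mul, ← mul_assoc, h k (Nat.lt_succ_self k), mul_assoc, ih,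
      mul_one, one_mul, mul_assoc]

theorem symz_twist {x : R} : ∀ {k : ℕ}, (∀ i, i + 1 < k → x * s i = t i * x) →
    x * symz s k = symz t k * x
  | 0, _ => by simp [symz]
  | k + 1, h => by
    have ih := symz_twist (k := k) fun i hi => h i (by omega)
    have hc := cosetSum_twist (k := k) fun i hi => h i (by omega)
    rw [symz, symz, mul_smul_comm, smul_mul_assoc, ← mul_assoc, ih, mul_assoc, hc, mul_assoc]

theorem map_symz {S : Type} [Ring S] [Algebra ℂ S] (φ : R →ₐ[ℂ] S) (k : ℕ) :
    φ (symz s k) = symz (fun i => φ (s i)) k := by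
  have h : ∀ k, φ (cosetSum s k) = cosetSum (fun i => φ (s i)) k := by
    intro k
    induction k with
    | zero => exact map_one φ
    | succ k ih => rw [cosetSum, cosetSum, map_add, map_mul, map_one, ih]
  induction k with
  | zero => exact map_one φ
  | succ k ih => rw [symz, symz, map_smul, map_mul, ih, h]

theorem mul_cosetSum {y : R} : ∀ {k : ℕ}, (∀ i < k, y * s i = y) →
    y * cosetSum s k = ((k : ℂ) + 1) • y
  | 0, _ => by simp [cosetSum]
  | k + 1, h => by
    rw [cosetSum, mul_add, ← mul_assoc, h k (Nat.lt_succ_self k),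
      mul_cosetSum fun i hi => h i (Nat.lt_succ_of_lt hi), mul_one]
    push_cast
    module

theorem cosetSum_mul {y : R} : ∀ {k : ℕ}, (∀ i < k, s i * y = y) →
    cosetSum s k * y = ((k : ℂ) + 1) • y
  | 0, _ => by simp [cosetSum]
  | k + 1, h => by
    rw [cosetSum, add_mul, mul_assoc, cosetSum_mul fun i hi => h i (Nat.lt_succ_of_lt hi),
      mul_smul_comm, h k (Nat.lt_succ_self k), one_mul]
    push_cast
    module

theorem mul_symz {y : R} : ∀ {k : ℕ}, (∀ i, i + 1 < k → y * s i = y) → y * symz s k = y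
  | 0, _ => by simp [symz]
  | k + 1, h => by
    rw [symz, mul_smul_comm, ← mul_assoc, mul_symz fun i hi => h i (by omega),
      mul_cosetSum fun i hi => h i (by omega), smul_smul, inv_mul_cancel₀ (succ_ne k), one_smul]

theorem symz_mul {y : R} : ∀ {k : ℕ}, (∀ i, i + 1 < k → s i * y = y) → symz s k * y = y
  | 0, _ => by simp [symz]
  | k + 1, h => by
    rw [symz, smul_mul_assoc, mul_assoc, cosetSum_mul fun i hi => h i (by omega), mul_smul_comm,
      symz_mul fun i hi => h i (by omega), smul_smul, inv_mul_cancel₀ (succ_ne k), one_smul]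

namespace IsCoxeter

theorem op (h : IsCoxeter s) : IsCoxeter fun i => MulOpposite.op (s i) where
  sq i := congrArg MulOpposite.op (h.sq i)
  braid i := by
    have := congrArg MulOpposite.op (h.braid i)
    simpa only [MulOpposite.op_mul, mul_assoc] using this
  comm i j hij := congrArg MulOpposite.op (h.comm i j hij).symm

theorem shift (h : IsCoxeter s) (a : ℕ) : IsCoxeter fun i => s (a + i) where
  sq i := h.sq _
  braid i := h.braid _
  comm i j hij := h.comm _ _ (by omega)

theorem commute_symz (h : IsCoxeter s) {j k : ℕ} (hjk : k ≤ j) :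
    s j * symz s k = symz s k * s j :=
  symz_twist fun i hi => (h.comm i j (by omega)).symm

theorem symz_mul_gen (h : IsCoxeter s) : ∀ {k i : ℕ}, i + 1 < k → symz s k * s i = symz s k
  | k + 1, i, hi => by
    have key : ∀ k i, i < k → symz s k * cosetSum s k * s i = symz s k * cosetSum s k := by
      intro k
      induction k with
      | zero => intro i hi; omega
      | succ k ih =>
        intro i hi
        have inv : ∀ i < k, symz s (k + 1) * s i = symz s (k + 1) := fun i hi => by
          rw [symz, smul_mul_assoc, ih i hi]
        have abs : symz s (k + 1) * symz s k = symz s (k + 1) :=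
          mul_symz fun i hi => inv i (by omega)
        rw [cosetSum, mul_add, add_mul, mul_one]
        rcases Nat.lt_succ_iff_lt_or_eq.1 hi with hi | rfl
        · have e : symz s (k + 1) * (s k * cosetSum s k) =
              symz s (k + 1) * s k * (symz s k * cosetSum s k) := by
            rw [← mul_assoc _ (symz s k), mul_assoc _ (s k), h.commute_symz le_rfl,
              ← mul_assoc (symz s (k + 1)) (symz s k), abs, mul_assoc]
          rw [e, inv i hi, mul_assoc _ _ (s i), ih i hi]
        · rcases i with _ | j
          · simp only [cosetSum, mul_one]
            rw [mul_assoc _ (s 0), h.sq, mul_one, add_comm]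
          · have c : cosetSum s j * s (j + 1) = s (j + 1) * cosetSum s j :=
              (cosetSum_twist fun i hi => (h.comm i (j + 1) (by omega)).symm).symm
            have e : symz s (j + 2) * (s (j + 1) * cosetSum s (j + 1)) =
                symz s (j + 2) * s (j + 1) + symz s (j + 2) * (s (j + 1) * s j * cosetSum s j) := by
              rw [cosetSum]; noncomm_ring
            rw [e, add_mul, mul_assoc _ (s (j + 1)), h.sq, mul_one, mul_assoc _ _ (s (j + 1)),
              mul_assoc _ _ (s (j + 1)), c, ← mul_assoc _ (s (j + 1)), ← h.braid j,
              mul_assoc _ _ (s j), mul_assoc (s j), ← mul_assoc _ (s j), inv j (Nat.lt_succ_self j)]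
            exact add_left_comm _ _ _
    rw [symz, smul_mul_assoc, key k i (by omega)]

theorem op_symz (h : IsCoxeter s) (k : ℕ) :
    MulOpposite.op (symz s k) = symz (fun i => MulOpposite.op (s i)) k := by
  have h1 : symz (fun i => MulOpposite.op (s i)) k * MulOpposite.op (symz s k) =
      MulOpposite.op (symz s k) :=
    symz_mul fun i hi => congrArg MulOpposite.op (h.symz_mul_gen hi)
  have h2 : symz s k * MulOpposite.unop (symz (fun i => MulOpposite.op (s i)) k) =
      MulOpposite.unop (symz (fun i => MulOpposite.op (s i)) k) :=
    symz_mul fun i hi => congrArg MulOpposite.unop (h.op.symz_mul_gen hi)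
  rw [← h1]
  exact congrArg MulOpposite.op h2

theorem gen_mul_symz (h : IsCoxeter s) {k i : ℕ} (hi : i + 1 < k) : s i * symz s k = symz s k := by
  have := h.op.symz_mul_gen hi
  rw [← h.op_symz] at this
  exact congrArg MulOpposite.unop this

theorem symz_mul_symz (h : IsCoxeter s) (k : ℕ) : symz s k * symz s k = symz s k :=
  mul_symz fun _ hi => h.symz_mul_gen hi

theorem symz_mul_shift (h : IsCoxeter s) {a k m : ℕ} (hk : a + k ≤ m) :
    symz s m * symz (fun i => s (a + i)) k = symz s m :=
  mul_symz fun _ hi => h.symz_mul_gen (by omega)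

theorem shift_mul_symz (h : IsCoxeter s) {a k m : ℕ} (hk : a + k ≤ m) :
    symz (fun i => s (a + i)) k * symz s m = symz s m :=
  symz_mul fun _ hi => h.gen_mul_symz (by omega)

theorem symz_mul_le (h : IsCoxeter s) {k m : ℕ} (hk : k ≤ m) : symz s m * symz s k = symz s m :=
  mul_symz fun _ hi => h.symz_mul_gen (by omega)

theorem le_mul_symz (h : IsCoxeter s) {k m : ℕ} (hk : k ≤ m) : symz s k * symz s m = symz s m :=
  symz_mul fun _ hi => h.gen_mul_symz (by omega)

theorem smul_symz_right (h : IsCoxeter s) (k : ℕ) : ((k : ℂ) + 1) • symz s (k + 1) =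
    symz s k * (1 + (k : ℂ) • s (k - 1)) * symz s k := by
  rcases k with _ | k
  · simp [symz, cosetSum]
  have e : ((k + 1 : ℕ) : ℂ) • (symz s (k + 1) * s k * symz s (k + 1)) =
      symz s (k + 1) * s k * cosetSum s k := by
    rw [← mul_smul_comm, Nat.cast_add_one, smul_symz_succ, ← mul_assoc, mul_assoc _ (s k),
      h.commute_symz le_rfl, ← mul_assoc, h.symz_mul_le k.le_succ]
  rw [smul_symz_succ, cosetSum, Nat.add_sub_cancel, mul_add, mul_add, add_mul, mul_one,
    h.symz_mul_symz, mul_smul_comm, smul_mul_assoc, e, mul_assoc]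

theorem cosetSum_succ (k : ℕ) :
    cosetSum s (k + 1) = cosetSum (fun i => s (1 + i)) k + cyDown s (k + 1) := by
  induction k with
  | zero => simp [cosetSum, cyDown]
  | succ k ih =>
    rw [cosetSum, ih, cosetSum, cyDown, Nat.add_comm 1 k, mul_add, add_assoc]
    rfl

theorem smul_symz_cyDown (h : IsCoxeter s) (k : ℕ) : ((k : ℂ) + 1) • symz s (k + 1) =
    symz s k * ((k : ℂ) • 1 + cyDown s k) * symz (fun i => s (1 + i)) k := by
  have e : ((k : ℂ) + 1) • symz s (k + 1) =
      (k : ℂ) • (symz s k * symz (fun i => s (1 + i)) k) + symz s k * cyDown s k := by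
    rw [smul_symz_succ]
    rcases k with _ | k
    · simp [symz, cosetSum, cyDown]
    rw [cosetSum_succ, mul_add, ← mul_smul_comm, Nat.cast_add_one, smul_symz_succ, ← mul_assoc,
      h.symz_mul_shift (by omega)]
  rw [← h.symz_mul_shift (a := 1) (k := k) (by omega), ← smul_mul_assoc, e, mul_add, mul_smul_comm,
    mul_one, add_mul, add_mul, smul_mul_assoc, smul_mul_assoc, mul_assoc (symz s k) (symz _ k),
    (h.shift 1).symz_mul_symz]

theorem op_cyDown (k : ℕ) :
    MulOpposite.unop (cyDown (fun i => MulOpposite.op (s i)) k) = cyUp s k := by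
  induction k with
  | zero => rfl
  | succ k ih => rw [cyDown, cyUp, ← ih]; rfl

theorem smul_symz_cyUp (h : IsCoxeter s) (k : ℕ) : ((k : ℂ) + 1) • symz s (k + 1) =
    symz (fun i => s (1 + i)) k * ((k : ℂ) • 1 + cyUp s k) * symz s k := by
  have e := h.op.smul_symz_cyDown k
  rw [← h.op_symz, ← h.op_symz, ← (h.shift 1).op_symz] at e
  have e' := congrArg MulOpposite.unop e
  simp only [MulOpposite.unop_mul, MulOpposite.unop_add, MulOpposite.unop_op,
    MulOpposite.unop_smul, MulOpposite.unop_one, op_cyDown] at e'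
  rw [e', mul_assoc]

theorem cyUp_twist (h : IsCoxeter s) : ∀ {k i : ℕ}, i + 1 < k →
    cyUp s k * s i = s (1 + i) * cyUp s k
  | k + 1, i, hi => by
    rw [cyUp]
    rcases Nat.lt_succ_iff_lt_or_eq.1 hi with hi | rfl
    · rw [mul_assoc, ← h.comm i k (by omega), ← mul_assoc, h.cyUp_twist hi, mul_assoc]
    · have c : cyUp s i * s (i + 1) = s (i + 1) * cyUp s i := by
        have : ∀ m ≤ i, cyUp s m * s (i + 1) = s (i + 1) * cyUp s m := by
          intro m
          induction m with
          | zero => intro _; simp [cyUp]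
          | succ m ih =>
            intro hm
            rw [cyUp, mul_assoc, h.comm m (i + 1) (by omega), ← mul_assoc, ih (by omega), mul_assoc]
        exact this i le_rfl
      rw [cyUp, mul_assoc, mul_assoc, ← mul_assoc (s i), h.braid, ← mul_assoc, ← mul_assoc, c,
        Nat.add_comm 1 i]
      simp only [mul_assoc]

theorem smul_symz_left (h : IsCoxeter s) (k : ℕ) : ((k : ℂ) + 1) • symz s (k + 1) =
    symz (fun i => s (1 + i)) k * (1 + (k : ℂ) • s 0) * symz (fun i => s (1 + i)) k := by
  have cy : ∀ m ≤ k, cyUp s m * symz s (k + 1) = symz s (k + 1) := by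
    intro m
    induction m with
    | zero => intro _; simp [cyUp]
    | succ m ih => intro hm; rw [cyUp, mul_assoc, h.gen_mul_symz (by omega), ih (by omega)]
  have cy0 : ∀ m < k, cyUp s (m + 1) * symz (fun i => s (1 + i)) k =
      s 0 * symz (fun i => s (1 + i)) k := by
    intro m
    induction m with
    | zero => intro _; simp [cyUp]
    | succ m ih =>
      intro hm
      have := (h.shift 1).gen_mul_symz (k := k) (i := m) (by omega)
      rw [Nat.add_comm 1 m] at this
      rw [cyUp, mul_assoc, this, ih (by omega)]
  have cw : ∀ m ≤ k, cyUp s m * cosetSum s m * symz (fun i => s (1 + i)) k =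
      (1 + (m : ℂ) • s 0) * symz (fun i => s (1 + i)) k := by
    intro m
    induction m with
    | zero => intro _; simp [cyUp, cosetSum]
    | succ m ih =>
      intro hm
      have e : cyUp s (m + 1) * cosetSum s (m + 1) = cyUp s (m + 1) + cyUp s m * cosetSum s m := by
        rw [cosetSum, cyUp, mul_add, mul_one, mul_assoc _ (s m), ← mul_assoc (s m), h.sq, one_mul]
      rw [e, add_mul, ih (by omega), cy0 m (by omega), ← add_mul]
      congr 1
      push_cast
      module
  rw [← h.symz_mul_shift (a := 1) (k := k) (m := k + 1) (by omega), ← cy k le_rfl,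
    ← smul_mul_assoc, ← mul_smul_comm, smul_symz_succ, ← mul_assoc,
    symz_twist (t := fun i => s (1 + i)) fun i hi => h.cyUp_twist hi, mul_assoc, mul_assoc,
    ← mul_assoc (cyUp s k), cw k le_rfl, mul_assoc]

end IsCoxeter

end Symmetrizers

section LeavittSection

theorem koszul_add_left (p q r : ZMod 2) : koszul (p + q) r = koszul p r * koszul q r := by
  rcases eq_zero_or_one r with rfl | rfl
  · simp [koszul_zero_right]
  · have h : ∀ p, koszul p 1 = sgn p := fun p => by
      rw [koszul, sgn, show (1 : ZMod 2).val = 1 from rfl, mul_one]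
    rw [h, h, h, sgn_add]

/-- A ring with a parity operator `P` and with elements that delete (`δ`) and insert (`ι`) the first
letter of a word in the alphabet `Fin N × ZMod 2` (products are in diagrammatic order). -/
structure Leavitt (N : ℕ) (R : Type) [Ring R] [Algebra ℂ R] where
  P : R
  ι : Fin N × ZMod 2 → R
  δ : Fin N × ZMod 2 → R
  P_sq : P * P = 1
  ι_δ : ∀ x y, ι x * δ y = if x = y then 1 else 0
  sum_δ_ι : ∑ x, δ x * ι x = 1
  P_ι : ∀ x, P * ι x = koszul 1 x.2 • (ι x * P)
  P_δ : ∀ x, P * δ x = koszul 1 x.2 • (δ x * P)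

namespace Leavitt

variable {N : ℕ} {R : Type} [Ring R] [Algebra ℂ R] (L : Leavitt N R)

/-- The powers of the parity operator. -/
def Q (q : ZMod 2) : R := if q = 0 then 1 else L.P

theorem Q_zero : L.Q 0 = 1 := rfl

theorem Q_one : L.Q 1 = L.P := rfl

theorem Q_mul (q r : ZMod 2) : L.Q q * L.Q r = L.Q (q + r) := by
  rcases eq_zero_or_one q with rfl | rfl <;> rcases eq_zero_or_one r with rfl | rfl <;>
    simp [Q_zero, Q_one, L.P_sq, one_add_one]

theorem Q_sq (q : ZMod 2) : L.Q q * L.Q q = 1 := by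
  rw [L.Q_mul, CharTwo.add_self_eq_zero, Q_zero]

theorem Q_Q (q : ZMod 2) (G : R) : L.Q q * (L.Q q * G) = G := by
  rw [← mul_assoc, L.Q_sq, one_mul]

theorem Q_ι (q : ZMod 2) (x : Fin N × ZMod 2) :
    L.Q q * L.ι x = koszul x.2 q • (L.ι x * L.Q q) := by
  rcases eq_zero_or_one q with rfl | rfl
  · rw [Q_zero, koszul_zero_right, one_smul, one_mul, mul_one]
  · rw [Q_one, L.P_ι, koszul_comm]

theorem Q_δ (q : ZMod 2) (x : Fin N × ZMod 2) :
    L.Q q * L.δ x = koszul x.2 q • (L.δ x * L.Q q) := by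
  rcases eq_zero_or_one q with rfl | rfl
  · rw [Q_zero, koszul_zero_right, one_smul, one_mul, mul_one]
  · rw [Q_one, L.P_δ, koszul_comm]

/-- The action on all letters but the first. -/
def τ : R →ₐ[ℂ] R where
  toFun G := ∑ x, L.δ x * G * L.ι x
  map_one' := by simpa only [mul_one] using L.sum_δ_ι
  map_zero' := by simp
  map_add' G H := by simp only [mul_add, add_mul, Finset.sum_add_distrib]
  map_mul' G H := by
    rw [Finset.sum_mul_sum]
    refine Finset.sum_congr rfl fun x _ => ?_
    have : ∀ y, L.δ x * G * L.ι x * (L.δ y * H * L.ι y) =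
        if x = y then L.δ x * G * H * L.ι y else 0 := fun y => by
      rw [mul_assoc (L.δ x * G), mul_assoc (L.δ y), ← mul_assoc (L.ι x), L.ι_δ]
      split_ifs <;> simp [mul_assoc]
    simp only [this, Finset.sum_ite_eq, Finset.mem_univ, if_true]
    simp only [mul_assoc]
  commutes' z := by
    simp only [Algebra.algebraMap_eq_smul_one, mul_smul_comm, smul_mul_assoc, mul_one,
      ← Finset.smul_sum, L.sum_δ_ι]

theorem τ_apply (G : R) : L.τ G = ∑ x, L.δ x * G * L.ι x := rfl

theorem ι_τ (x : Fin N × ZMod 2) (G : R) : L.ι x * L.τ G = G * L.ι x := by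
  rw [τ_apply, Finset.mul_sum]
  simp only [← mul_assoc, L.ι_δ, ite_mul, one_mul, zero_mul, Finset.sum_ite_eq, Finset.mem_univ,
    if_true]

theorem τ_δ (x : Fin N × ZMod 2) (G : R) : L.τ G * L.δ x = L.δ x * G := by
  rw [τ_apply, Finset.sum_mul]
  simp only [mul_assoc, L.ι_δ, mul_ite, mul_one, mul_zero, Finset.sum_ite_eq', Finset.mem_univ,
    if_true]

/-- The action on all letters but the first `n`. -/
def sh : ℕ → (R →ₐ[ℂ] R)
  | 0 => AlgHom.id ℂ R
  | n + 1 => L.τ.comp (sh n)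

theorem sh_zero (G : R) : L.sh 0 G = G := rfl

theorem sh_succ (n : ℕ) (G : R) : L.sh (n + 1) G = L.τ (L.sh n G) := rfl

theorem sh_one (G : R) : L.sh 1 G = L.τ G := rfl

theorem sh_two (G : R) : L.sh 2 G = L.τ (L.τ G) := rfl

theorem sh_add (m n : ℕ) (G : R) : L.sh (m + n) G = L.sh m (L.sh n G) := by
  induction m with
  | zero => rw [Nat.zero_add, sh_zero]
  | succ m ih => rw [Nat.succ_add, sh_succ, ih, sh_succ]

theorem sh_τ (n : ℕ) (G : R) : L.sh n (L.τ G) = L.sh (n + 1) G := (L.sh_add n 1 G).symm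

theorem Q_τ (q : ZMod 2) (G : R) : L.Q q * L.τ G * L.Q q = L.τ (L.Q q * G * L.Q q) := by
  rw [τ_apply, τ_apply, Finset.mul_sum, Finset.sum_mul]
  refine Finset.sum_congr rfl fun x _ => ?_
  have h : L.ι x * L.Q q = koszul x.2 q • (L.Q q * L.ι x) := by
    rw [L.Q_ι, smul_smul, koszul_mul_self, one_smul]
  rw [← mul_assoc, ← mul_assoc, L.Q_δ, mul_assoc _ (L.ι x), h]
  simp only [smul_mul_assoc, mul_smul_comm, smul_smul, koszul_mul_self, one_smul, mul_assoc]

theorem Q_sh (q : ZMod 2) (n : ℕ) (G : R) :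
    L.Q q * L.sh n G * L.Q q = L.sh n (L.Q q * G * L.Q q) := by
  induction n with
  | zero => rfl
  | succ n ih => rw [sh_succ, Q_τ, ih, sh_succ]

/-- `F` has parity `p`, and it maps words whose first `m` letters have been singled out to such
words with `n` letters, acting on these letters only. -/
structure IsLocal (F : R) (m n : ℕ) (p : ZMod 2) : Prop where
  par : ∀ q, L.Q q * F = koszul p q • (F * L.Q q)
  slide : ∀ G, F * L.sh n G = L.sh m (L.Q p * G * L.Q p) * F

namespace IsLocal

variable {L} {F G : R} {m n k : ℕ} {p q : ZMod 2}

theorem conj (h : L.IsLocal F m n p) (q : ZMod 2) : L.Q q * F * L.Q q = koszul p q • F := by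
  rw [h.par, smul_mul_assoc, mul_assoc, L.Q_sq, mul_one]

theorem slide_even (h : L.IsLocal F m n 0) (G : R) : F * L.sh n G = L.sh m G * F := by
  rw [h.slide, L.Q_zero, one_mul, mul_one]

theorem slide_par (h : L.IsLocal F m n p) {a b : ℕ} (hG : L.IsLocal G a b q) :
    F * L.sh n G = koszul p q • (L.sh m G * F) := by
  rw [h.slide, hG.conj, koszul_comm, map_smul, smul_mul_assoc]

theorem mul (h : L.IsLocal F m n p) (h' : L.IsLocal G n k q) : L.IsLocal (F * G) m k (p + q) where
  par r := by
    rw [← mul_assoc, h.par, smul_mul_assoc, mul_assoc, h'.par, mul_smul_comm, smul_smul,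
      koszul_add_left, mul_assoc]
  slide H := by
    have e : L.Q (p + q) * H * L.Q (p + q) = L.Q p * (L.Q q * H * L.Q q) * L.Q p := by
      nth_rw 2 [add_comm p q]
      rw [← L.Q_mul, ← L.Q_mul]
      simp only [mul_assoc]
    rw [mul_assoc, h'.slide, ← mul_assoc, h.slide, mul_assoc, e]

theorem one (n : ℕ) : L.IsLocal 1 n n 0 where
  par q := by rw [koszul_zero_left, one_smul, one_mul, mul_one]
  slide G := by rw [L.Q_zero, one_mul, one_mul, mul_one, mul_one]

theorem zero (m n : ℕ) (p : ZMod 2) : L.IsLocal 0 m n p where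
  par q := by simp
  slide G := by simp

theorem add (h : L.IsLocal F m n p) (h' : L.IsLocal G m n p) : L.IsLocal (F + G) m n p where
  par q := by rw [mul_add, h.par, h'.par, add_mul, smul_add]
  slide H := by rw [add_mul, h.slide, h'.slide, mul_add]

theorem smul (z : ℂ) (h : L.IsLocal F m n p) : L.IsLocal (z • F) m n p where
  par q := by rw [mul_smul_comm, h.par, smul_mul_assoc, smul_comm]
  slide H := by rw [smul_mul_assoc, h.slide, mul_smul_comm]

theorem sum {α : Type} {s : Finset α} {f : α → R} (h : ∀ i ∈ s, L.IsLocal (f i) m n p) :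
    L.IsLocal (∑ i ∈ s, f i) m n p := by
  classical
  induction s using Finset.induction_on with
  | empty => exact zero m n p
  | insert a s ha ih =>
    rw [Finset.sum_insert ha]
    exact (h a (Finset.mem_insert_self a s)).add
      (ih fun i hi => h i (Finset.mem_insert_of_mem hi))

theorem sh (h : L.IsLocal F m n p) (k : ℕ) : L.IsLocal (L.sh k F) (k + m) (k + n) p where
  par q := by
    have : L.Q q * L.sh k F * L.Q q = koszul p q • L.sh k F := by rw [L.Q_sh, h.conj, map_smul]
    rw [← smul_mul_assoc, ← this, mul_assoc _ (L.Q q), L.Q_sq, mul_one]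
  slide G := by rw [L.sh_add, ← map_mul, h.slide, map_mul, L.sh_add]

theorem pad (h : L.IsLocal F m n p) (k : ℕ) : L.IsLocal F (m + k) (n + k) p where
  par := h.par
  slide G := by rw [L.sh_add, h.slide, L.Q_sh, L.sh_add]

theorem cast (h : L.IsLocal F m n p) {m' n' : ℕ} {p' : ZMod 2} (hm : m = m') (hn : n = n')
    (hp : p = p') : L.IsLocal F m' n' p' := by
  subst hm hn hp; exact h

theorem eq_zero (h : L.IsLocal F 0 0 1) : F = 0 := by
  have h1 := h.par 1
  have h2 := h.slide L.P
  rw [← L.Q_one, sh_zero, sh_zero, L.Q_sq, one_mul] at h2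
  rw [← h2, show koszul 1 1 = -1 from sgn_one, neg_one_smul] at h1
  have h3 : F * L.Q 1 = 0 := by
    refine (smul_eq_zero.1 (?_ : (2 : ℂ) • (F * L.Q 1) = 0)).resolve_left two_ne_zero
    rw [two_smul]
    exact add_eq_zero_iff_eq_neg.2 h1
  rw [← mul_one F, ← L.Q_sq 1, ← mul_assoc, h3, zero_mul]

end IsLocal

/-- Insert the letter `x`. -/
def ins (x : Fin N × ZMod 2) : R := L.Q x.2 * L.ι x

/-- Delete the letter `x`. -/
def del (x : Fin N × ZMod 2) : R := L.δ x * L.Q x.2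

theorem ins_del (x y : Fin N × ZMod 2) : L.ins x * L.del y = if x = y then 1 else 0 := by
  rw [ins, del, mul_assoc, ← mul_assoc (L.ι x), L.ι_δ]
  split_ifs with h
  · rw [h, one_mul, L.Q_sq]
  · rw [zero_mul, mul_zero]

theorem sum_del_ins : ∑ x, L.del x * L.ins x = 1 := by
  rw [← L.sum_δ_ι]
  exact Finset.sum_congr rfl fun x _ => by rw [del, ins, mul_assoc, L.Q_Q]

theorem isLocal_ins (x : Fin N × ZMod 2) : L.IsLocal (L.ins x) 0 1 x.2 where
  par q := by
    rw [ins, ← mul_assoc, L.Q_mul, add_comm, ← L.Q_mul, mul_assoc, L.Q_ι, mul_smul_comm, mul_assoc]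
  slide G := by rw [ins, sh_one, mul_assoc, L.ι_τ, sh_zero, mul_assoc _ (L.Q _) (_ * _), L.Q_Q, mul_assoc]

theorem isLocal_del (x : Fin N × ZMod 2) : L.IsLocal (L.del x) 1 0 x.2 where
  par q := by
    rw [del, ← mul_assoc, L.Q_δ, smul_mul_assoc, mul_assoc, mul_assoc, L.Q_mul, L.Q_mul, add_comm]
  slide G := by rw [del, sh_one, ← mul_assoc, L.τ_δ, sh_zero, mul_assoc, mul_assoc, mul_assoc, L.Q_sq, mul_one]

/-- The first letter moves past the next `m` letters. -/
def pass (m : ℕ) : R := ∑ x, L.del x * L.sh m (L.ins x)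

/-- The swap of the first two letters. -/
def s : R := L.pass 1

theorem pass_zero : L.pass 0 = 1 := L.sum_del_ins

theorem isLocal_pass (m : ℕ) : L.IsLocal (L.pass m) (m + 1) (m + 1) 0 :=
  .sum fun x _ => ((((L.isLocal_del x).pad m).mul (k := m + 1)
    (((L.isLocal_ins x).sh m).cast (by omega) rfl rfl)).cast (by omega) rfl (CharTwo.add_self_eq_zero _))

theorem pass_succ (m : ℕ) : L.pass (m + 1) = L.pass m * L.sh m L.s := by
  simp only [pass, s, map_sum, map_mul, sh_one]
  rw [Finset.sum_mul_sum]
  refine Finset.sum_congr rfl fun x _ => ?_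
  have : ∀ y, L.del x * L.sh m (L.ins x) * (L.sh m (L.del y) * L.sh m (L.τ (L.ins y))) =
      if x = y then L.del x * L.sh m (L.τ (L.ins y)) else 0 := fun y => by
    rw [mul_assoc, ← mul_assoc (L.sh m _) (L.sh m _), ← map_mul, L.ins_del]
    split_ifs <;> simp
  simp only [this, Finset.sum_ite_eq, Finset.mem_univ, if_true]
  rw [sh_τ]

theorem pass_succ' (m : ℕ) : L.pass (m + 1) = L.s * L.τ (L.pass m) := by
  simp only [pass, s, map_sum, map_mul, sh_one]
  rw [Finset.sum_mul_sum, Finset.sum_comm]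
  refine Finset.sum_congr rfl fun x _ => ?_
  have : ∀ y, L.del y * L.τ (L.ins y) * (L.τ (L.del x) * L.τ (L.sh m (L.ins x))) =
      if y = x then L.del y * L.τ (L.sh m (L.ins x)) else 0 := fun y => by
    rw [mul_assoc, ← mul_assoc (L.τ _) (L.τ _), ← map_mul, L.ins_del]
    split_ifs <;> simp
  simp only [this, Finset.sum_ite_eq', Finset.mem_univ, if_true, sh_succ]

theorem pass_natural {F : R} {m n : ℕ} {p : ZMod 2} (h : L.IsLocal F m n p) :
    L.τ F * L.pass n = L.pass m * F := by
  rw [pass, pass, Finset.mul_sum, Finset.sum_mul]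
  refine Finset.sum_congr rfl fun x _ => ?_
  have h1 := h.slide_par (L.isLocal_ins x)
  have h2 : L.del x * F = koszul x.2 p • (L.τ F * L.del x) := (L.isLocal_del x).slide_par h
  have h3 : L.τ F * L.del x = koszul x.2 p • (L.del x * F) := by
    rw [h2, smul_smul, koszul_mul_self, one_smul]
  rw [← mul_assoc, h3, smul_mul_assoc, mul_assoc, h1, mul_smul_comm, smul_smul, koszul_comm,
    koszul_mul_self, one_smul, mul_assoc]

theorem isLocal_s : L.IsLocal L.s 2 2 0 := L.isLocal_pass 1

theorem s_sq : L.s * L.s = 1 := by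
  have e : L.s * L.s = ∑ x, ∑ y, L.del x * L.τ (L.ins x) * (L.del y * L.τ (L.ins y)) := by
    simp only [s, pass, sh_one]
    exact Finset.sum_mul_sum _ _ _ _
  rw [e, ← L.sum_del_ins]
  refine Finset.sum_congr rfl fun x _ => ?_
  have : ∀ y, L.del x * L.τ (L.ins x) * (L.del y * L.τ (L.ins y)) =
      L.del x * (L.del y * L.ins y) * L.ins x := fun y => by
    have h1 : L.del y * L.ins x = koszul y.2 x.2 • (L.τ (L.ins x) * L.del y) :=
      (L.isLocal_del y).slide_par (L.isLocal_ins x)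
    have h2 : L.ins x * L.τ (L.ins y) = koszul x.2 y.2 • (L.ins y * L.ins x) :=
      (L.isLocal_ins x).slide_par (L.isLocal_ins y)
    have h3 : L.τ (L.ins x) * L.del y = koszul y.2 x.2 • (L.del y * L.ins x) := by
      rw [h1, smul_smul, koszul_mul_self, one_smul]
    rw [mul_assoc, ← mul_assoc (L.τ _), h3, smul_mul_assoc, mul_assoc (L.del y), h2]
    simp only [mul_smul_comm, smul_smul, koszul_comm x.2 y.2, koszul_mul_self, one_smul, mul_assoc]
  simp only [this, ← Finset.sum_mul, ← Finset.mul_sum, L.sum_del_ins, mul_one]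

/-- The dot on the first letter. -/
def d : R := ∑ x : Fin N × ZMod 2, L.del x * L.ins (x.1, x.2 + 1)

theorem isLocal_d : L.IsLocal L.d 1 1 1 :=
  .sum fun x _ => ((L.isLocal_del x).mul (L.isLocal_ins _)).cast rfl rfl (by
    change x.2 + (x.2 + 1) = 1
    rw [← add_assoc, CharTwo.add_self_eq_zero, zero_add])

theorem d_sq : L.d * L.d = 1 := by
  rw [← L.sum_del_ins, d, Finset.sum_mul]
  refine Finset.sum_congr rfl fun x _ => ?_
  have : ∀ y : Fin N × ZMod 2, L.del x * L.ins (x.1, x.2 + 1) * (L.del y * L.ins (y.1, y.2 + 1)) =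
      if (x.1, x.2 + 1) = y then L.del x * L.ins (y.1, y.2 + 1) else 0 := fun y => by
    rw [mul_assoc, ← mul_assoc (L.ins _), L.ins_del]
    split_ifs <;> simp
  rw [Finset.mul_sum]
  simp only [this, Finset.sum_ite_eq, Finset.mem_univ, if_true, add_assoc, one_add_one, add_zero]

theorem d_τ_d : L.d * L.τ L.d = -(L.τ L.d * L.d) := by
  have := L.isLocal_d.slide_par L.isLocal_d
  rw [show koszul 1 1 = -1 from sgn_one, neg_one_smul] at this
  exact this

theorem τ_d_s : L.τ L.d * L.s = L.s * L.d := L.pass_natural L.isLocal_d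

/-- The cup on thin strands. -/
def cup : R := ∑ x, L.ins x * L.ins x

/-- The cap on thin strands. -/
def cap : R := ∑ x, L.del x * L.del x

theorem isLocal_cup : L.IsLocal L.cup 0 2 0 :=
  .sum fun x _ => ((L.isLocal_ins x).mul ((L.isLocal_ins x).pad 1)).cast rfl rfl
    (CharTwo.add_self_eq_zero _)

theorem isLocal_cap : L.IsLocal L.cap 2 0 0 :=
  .sum fun x _ => (((L.isLocal_del x).pad 1).mul (L.isLocal_del x)).cast rfl rfl
    (CharTwo.add_self_eq_zero _)

theorem cup_τ_cap : L.cup * L.τ L.cap = 1 := by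
  rw [cup, Finset.sum_mul, ← L.sum_del_ins]
  refine Finset.sum_congr rfl fun x _ => ?_
  rw [mul_assoc]
  have h : L.ins x * L.τ L.cap = L.cap * L.ins x := by
    have := (L.isLocal_ins x).slide_par L.isLocal_cap
    rwa [koszul_zero_right, one_smul] at this
  rw [h, cap, Finset.sum_mul, Finset.mul_sum]
  simp only [← mul_assoc, L.ins_del, ite_mul, one_mul, zero_mul, Finset.sum_ite_eq, Finset.mem_univ,
    if_true]

theorem τ_cup_cap : L.τ L.cup * L.cap = 1 := by
  rw [cap, Finset.mul_sum, ← L.sum_del_ins]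
  refine Finset.sum_congr rfl fun x _ => ?_
  rw [← mul_assoc]
  have h : L.τ L.cup * L.del x = L.del x * L.cup := by
    have := (L.isLocal_del x).slide_par L.isLocal_cup
    rw [koszul_zero_right, one_smul] at this
    exact this.symm
  rw [h, cup, Finset.mul_sum, Finset.sum_mul]
  simp only [mul_assoc, L.ins_del, mul_ite, mul_one, mul_zero, Finset.sum_ite_eq', Finset.mem_univ,
    if_true]

end Leavitt

end LeavittSection

section LeavittGrid

namespace Leavitt

variable {N : ℕ} {R : Type} [Ring R] [Algebra ℂ R] (L : Leavitt N R)

/-- The swap of two adjacent letters. -/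
def S (i : ℕ) : R := L.sh i L.s

theorem S_zero : L.S 0 = L.s := rfl

theorem sh_S (a i : ℕ) : L.sh a (L.S i) = L.S (a + i) := (L.sh_add a i _).symm

theorem isLocal_S (i n : ℕ) (h : i + 2 ≤ n) : L.IsLocal (L.S i) n n 0 :=
  (((L.isLocal_s).sh i).pad (n - (i + 2))).cast (by omega) (by omega) rfl

theorem isCoxeter : IsCoxeter L.S where
  sq i := by rw [S, ← map_mul, L.s_sq, map_one]
  braid i := by
    have h : L.τ L.s * L.pass 2 = L.pass 2 * L.s := L.pass_natural L.isLocal_s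
    have h2 : L.pass 2 = L.s * L.τ L.s := L.pass_succ 1
    rw [h2] at h
    rw [S, S, ← sh_τ, ← map_mul, ← map_mul, ← map_mul, ← map_mul, ← h, mul_assoc]
  comm i j hij := by
    obtain ⟨r, rfl⟩ := Nat.exists_eq_add_of_le hij
    rw [S, S, add_assoc, L.sh_add i, ← map_mul, ← map_mul, L.sh_add 2, L.isLocal_s.slide_even]

/-- The symmetrizer on the first `k` letters. -/
noncomputable def sym (k : ℕ) : R := symz L.S k

theorem sh_sym (a k : ℕ) : L.sh a (L.sym k) = symz (fun i => L.S (a + i)) k := by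
  rw [sym, map_symz]
  simp only [sh_S]

theorem sym_zero : L.sym 0 = 1 := rfl

theorem sym_one : L.sym 1 = 1 := symz_one

theorem isLocal_sym (k : ℕ) : L.IsLocal (L.sym k) k k 0 := by
  have h : ∀ k, L.IsLocal (cosetSum L.S k) (k + 1) (k + 1) 0 := by
    intro k
    induction k with
    | zero => exact .one _
    | succ k ih =>
      exact (IsLocal.one _).add (((L.isLocal_S k (k + 2) le_rfl).mul (ih.pad 1)).cast rfl rfl
        (add_zero 0))
  induction k with
  | zero => exact .one _
  | succ k ih => exact ((((ih.pad 1).mul (h k)).cast rfl rfl (add_zero 0)).smul _ :)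

theorem sym_mul_sh (k : ℕ) (G : R) : L.sym k * L.sh k G = L.sh k G * L.sym k :=
  (L.isLocal_sym k).slide_even G

theorem sym_sq (k : ℕ) : L.sym k * L.sym k = L.sym k := L.isCoxeter.symz_mul_symz k

/-- The first `k` letters move past the next `l` letters. -/
def grid : ℕ → ℕ → R
  | 0, _ => 1
  | k + 1, l => L.τ (grid k l) * L.pass l

theorem grid_zero : ∀ k, L.grid k 0 = 1
  | 0 => rfl
  | k + 1 => by rw [grid, grid_zero k, map_one, one_mul, pass_zero]

theorem isLocal_grid : ∀ k l, L.IsLocal (L.grid k l) (k + l) (k + l) 0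
  | 0, l => .one _
  | k + 1, l => ((((isLocal_grid k l).sh 1).mul (k := 1 + (k + l)) (((L.isLocal_pass l).pad k).cast
      (by omega) (by omega) rfl))).cast (by omega) (by omega) (add_zero 0)

theorem grid_natural {F : R} {m n : ℕ} {p : ZMod 2} (h : L.IsLocal F m n p) (k : ℕ) :
    L.sh k F * L.grid k n = L.grid k m * F := by
  induction k with
  | zero => rw [sh_zero, grid, grid, mul_one, one_mul]
  | succ k ih =>
    rw [grid, grid, sh_succ, ← mul_assoc, ← map_mul, ih, map_mul, mul_assoc, L.pass_natural h,
      mul_assoc]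

theorem pass_add (a b : ℕ) : L.pass (a + b) = L.pass a * L.sh a (L.pass b) := by
  induction b with
  | zero => rw [pass_zero, map_one, mul_one, add_zero]
  | succ b ih => rw [← add_assoc, pass_succ, ih, pass_succ, map_mul, L.sh_add, mul_assoc]

theorem grid_add (l a b : ℕ) : L.grid l (a + b) = L.grid l a * L.sh a (L.grid l b) := by
  induction l with
  | zero => simp only [grid, map_one, mul_one]
  | succ l ih =>
    have h : L.τ (L.sh a (L.grid l b)) * L.pass a = L.pass a * L.sh a (L.τ (L.grid l b)) := by
      rw [sh_τ, (L.isLocal_pass a).slide_even, sh_succ]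
    rw [grid, grid, grid, ih, pass_add, map_mul, map_mul]
    simp only [← mul_assoc]
    rw [mul_assoc (L.τ (L.grid l a)), h]
    simp only [← mul_assoc]

theorem pass_mul_grid (l : ℕ) : L.pass l * L.grid l 1 = 1 := by
  induction l with
  | zero => rw [pass_zero, grid, one_mul]
  | succ l ih =>
    rw [pass_succ', grid, mul_assoc, ← mul_assoc (L.τ _), ← map_mul, ih, map_one, one_mul]
    exact L.s_sq

theorem grid_mul_grid (k l : ℕ) : L.grid k l * L.grid l k = 1 := by
  induction k with
  | zero => rw [grid_zero, grid, one_mul]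
  | succ k ih =>
    rw [add_comm k 1, grid_add, add_comm 1 k, grid, mul_assoc, ← mul_assoc (L.pass l),
      pass_mul_grid, one_mul, sh_one, ← map_mul, ih, map_one]

theorem grid_natural_left {F : R} {m n : ℕ} {p : ZMod 2} (h : L.IsLocal F m n p) (l : ℕ) :
    F * L.grid n l = L.grid m l * L.sh l F := by
  rw [← mul_one (L.sh l F), ← L.grid_mul_grid l n, ← mul_assoc (L.sh l F), L.grid_natural h,
    ← mul_assoc, ← mul_assoc, L.grid_mul_grid, one_mul]

/-- Nested cups. -/
def ncup : ℕ → R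
  | 0 => 1
  | k + 1 => L.cup * L.τ (ncup k)

/-- Nested caps. -/
def ncap : ℕ → R
  | 0 => 1
  | k + 1 => L.τ (ncap k) * L.cap

theorem isLocal_ncup : ∀ k, L.IsLocal (L.ncup k) 0 (k + k) 0
  | 0 => .one _
  | k + 1 => (((L.isLocal_cup).pad 0).mul (k := (1 + (k + k)) + 1) ((((isLocal_ncup k).sh 1).pad 1).cast
      rfl rfl rfl)).cast rfl (by omega) (add_zero 0)

theorem isLocal_ncap : ∀ k, L.IsLocal (L.ncap k) (k + k) 0 0
  | 0 => .one _
  | k + 1 => ((((isLocal_ncap k).sh 1).pad 1).mul (n := 2) L.isLocal_cap).cast (by omega) rfl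
      (add_zero 0)

theorem ncup_succ (k : ℕ) : L.ncup (k + 1) = L.ncup k * L.sh k L.cup := by
  induction k with
  | zero => simp [ncup, sh_zero]
  | succ k ih => rw [ncup, ih, map_mul, ← mul_assoc, ← ncup, ih, sh_succ]

theorem ncap_succ (k : ℕ) : L.ncap (k + 1) = L.sh k L.cap * L.ncap k := by
  induction k with
  | zero => simp [ncap, sh_zero]
  | succ k ih => rw [ncap, ih, map_mul, mul_assoc, ← ncap, ih, sh_succ]

theorem ncup_mul_ncap (k : ℕ) : L.ncup k * L.sh k (L.ncap k) = 1 := by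
  induction k with
  | zero => rw [ncup, ncap, map_one, mul_one]
  | succ k ih =>
    have h : L.ncup k * L.sh k (L.sh k L.cap) = L.cap * L.ncup k := by
      rw [← sh_add, (L.isLocal_ncup k).slide_even, sh_zero]
    rw [ncup, ncap_succ, sh_succ, map_mul, map_mul, mul_assoc, ← mul_assoc (L.τ _), ← map_mul, h,
      map_mul, mul_assoc, ← map_mul, ih, map_one, mul_one, cup_τ_cap]

theorem sh_ncup_mul_ncap (k : ℕ) : L.sh k (L.ncup k) * L.ncap k = 1 := by
  induction k with
  | zero => rw [ncup, ncap, map_one, mul_one]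
  | succ k ih =>
    have h : L.sh k (L.sh k L.cup) * L.ncap k = L.ncap k * L.cup := by
      rw [← sh_add]
      exact ((L.isLocal_ncap k).slide_even L.cup).symm
    rw [ncup_succ, ncap, sh_succ, map_mul, map_mul, ← mul_assoc, mul_assoc (L.τ _), ← map_mul, h,
      map_mul, ← mul_assoc, ← map_mul, ih, map_one, one_mul, τ_cup_cap]

theorem cup_cup_s : L.cup * (L.τ L.cup * L.s) = L.cup * (L.τ L.cup * L.S 2) := by
  have h : L.τ L.cup * L.s = L.cup * L.τ L.s := by
    have h1 : L.τ L.cup * L.pass 2 = L.pass 0 * L.cup := L.pass_natural L.isLocal_cup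
    have h2 : L.pass 2 = L.s * L.τ L.s := L.pass_succ 1
    rw [h2, pass_zero, one_mul] at h1
    nth_rw 2 [← h1]
    rw [mul_assoc, mul_assoc, ← map_mul, L.s_sq, map_one, mul_one]
  have h3 : L.τ L.cup * L.S 2 = L.τ (L.cup * L.τ L.s) := (map_mul _ _ _).symm
  have h4 : L.cup * L.τ (L.τ L.cup) = L.cup * L.cup := L.isLocal_cup.slide_even L.cup
  rw [h3, ← h, map_mul, ← mul_assoc, ← mul_assoc, h4, mul_assoc, h, ← mul_assoc]

theorem s_cap_cap : L.s * (L.τ L.cap * L.cap) = L.S 2 * (L.τ L.cap * L.cap) := by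
  have h : L.s * L.τ L.cap = L.τ L.s * L.cap := by
    have h1 : L.τ L.cap * L.pass 0 = L.pass 2 * L.cap := L.pass_natural L.isLocal_cap
    have h2 : L.pass 2 = L.s * L.τ L.s := L.pass_succ 1
    rw [h2, pass_zero, mul_one] at h1
    rw [h1, ← mul_assoc, ← mul_assoc, L.s_sq, one_mul]
  have h3 : L.S 2 * L.τ L.cap = L.τ (L.τ L.s * L.cap) := by rw [map_mul]; rfl
  have h4 : L.τ (L.τ L.cap) * L.cap = L.cap * L.cap := by
    rw [← sh_two, ← L.isLocal_cap.slide_even, sh_zero]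
  rw [← mul_assoc, ← mul_assoc, h3, ← h, map_mul, mul_assoc (L.τ L.s), h4, h, mul_assoc]

theorem ncup_mul_S : ∀ {k i : ℕ}, i + 1 < k → L.ncup k * L.S i = L.ncup k * L.S (k + k - 2 - i)
  | k + 2, 0, _ => by
    have h : L.s * L.τ (L.τ (L.ncup k)) = L.τ (L.τ (L.ncup k)) * L.s := L.isLocal_s.slide_even _
    have h2 : L.S (k + 2 + (k + 2) - 2 - 0) = L.τ (L.τ (L.sh (k + k) L.s)) := by
      rw [S, show k + 2 + (k + 2) - 2 - 0 = k + k + 1 + 1 by omega, sh_succ, sh_succ]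
    have h3 : L.S 2 = L.τ (L.τ L.s) := rfl
    have h4 : L.τ (L.τ (L.ncup k)) * L.τ (L.τ (L.sh (k + k) L.s)) =
        L.τ (L.τ L.s) * L.τ (L.τ (L.ncup k)) := by
      rw [← map_mul, ← map_mul, (L.isLocal_ncup k).slide_even, sh_zero, map_mul, map_mul]
    rw [h2, ncup, ncup, S_zero, map_mul]
    simp only [mul_assoc]
    rw [h4, ← h, ← mul_assoc (L.τ L.cup), ← mul_assoc L.cup, L.cup_cup_s, h3]
    simp only [mul_assoc]
  | k + 1, i + 1, hi => by
    have h : ∀ j, L.S (j + 1) = L.τ (L.S j) := fun j => rfl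
    rw [show k + 1 + (k + 1) - 2 - (i + 1) = (k + k - 2 - i) + 1 by omega, h, h, ncup, mul_assoc,
      mul_assoc, ← map_mul, ← map_mul, ncup_mul_S (by omega)]

theorem S_mul_ncap : ∀ {k i : ℕ}, i + 1 < k → L.S i * L.ncap k = L.S (k + k - 2 - i) * L.ncap k
  | k + 2, 0, _ => by
    have h : L.s * L.τ (L.τ (L.ncap k)) = L.τ (L.τ (L.ncap k)) * L.s := L.isLocal_s.slide_even _
    have h2 : L.S (k + 2 + (k + 2) - 2 - 0) = L.τ (L.τ (L.sh (k + k) L.s)) := by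
      rw [S, show k + 2 + (k + 2) - 2 - 0 = k + k + 1 + 1 by omega, sh_succ, sh_succ]
    have h3 : L.S 2 = L.τ (L.τ L.s) := rfl
    have h4 : L.τ (L.τ (L.sh (k + k) L.s)) * L.τ (L.τ (L.ncap k)) =
        L.τ (L.τ (L.ncap k)) * L.τ (L.τ L.s) := by
      rw [← map_mul, ← map_mul, ← (L.isLocal_ncap k).slide_even, sh_zero, map_mul, map_mul]
    rw [h2, ncap, ncap, S_zero, map_mul]
    simp only [← mul_assoc]
    rw [h4, h]
    simp only [mul_assoc]
    rw [L.s_cap_cap, h3]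
  | k + 1, i + 1, hi => by
    have h : ∀ j, L.S (j + 1) = L.τ (L.S j) := fun j => rfl
    rw [show k + 1 + (k + 1) - 2 - (i + 1) = (k + k - 2 - i) + 1 by omega, h, h, ncap, ← mul_assoc,
      ← mul_assoc, ← map_mul, ← map_mul, S_mul_ncap (by omega)]

theorem ncup_absorb (k : ℕ) : L.ncup k * L.sym k * L.sh k (L.sym k) = L.ncup k * L.sym k := by
  rw [L.sh_sym]
  refine mul_symz fun i hi => ?_
  have h1 : L.sym k * L.S (k + i) = L.S (k + i) * L.sym k := by
    rw [← sh_S, sym_mul_sh]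
  have h2 := L.ncup_mul_S (k := k) (i := k - 2 - i) (by omega)
  rw [show k + k - 2 - (k - 2 - i) = k + i by omega] at h2
  rw [mul_assoc, h1, ← mul_assoc, ← h2, mul_assoc]
  exact congrArg (L.ncup k * ·) (L.isCoxeter.gen_mul_symz (by omega))

theorem ncap_absorb (k : ℕ) : L.sh k (L.sym k) * (L.sym k * L.ncap k) = L.sym k * L.ncap k := by
  rw [L.sh_sym]
  refine symz_mul fun i hi => ?_
  have h1 : L.S (k + i) * L.sym k = L.sym k * L.S (k + i) := by
    rw [← sh_S, sym_mul_sh]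
  have h2 := L.S_mul_ncap (k := k) (i := k - 2 - i) (by omega)
  rw [show k + k - 2 - (k - 2 - i) = k + i by omega] at h2
  rw [← mul_assoc, h1, mul_assoc, ← h2, ← mul_assoc]
  exact congrArg (· * L.ncap k) (L.isCoxeter.symz_mul_gen (by omega))

theorem rotate_grid (k l : ℕ) : L.sh k (L.sh l (L.ncup k) * L.grid l k) * L.ncap k =
    L.grid k l := by
  have h : L.sh l (L.ncup k) * L.grid l k = L.ncup k * L.sh k (L.grid k l) := by
    have h1 := L.grid_natural (L.isLocal_ncup k) l
    rw [grid_add, grid_zero, one_mul] at h1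
    nth_rw 2 [← h1]
    rw [mul_assoc, mul_assoc, ← map_mul, grid_mul_grid, map_one, mul_one]
  rw [h, map_mul, mul_assoc, ← sh_add, ← (L.isLocal_ncap k).slide_even, sh_zero, ← mul_assoc,
    sh_ncup_mul_ncap, one_mul]

/-- The sum of the dots on the first `k` letters. -/
def dots : ℕ → R
  | 0 => 0
  | k + 1 => L.d + L.τ (dots k)

theorem isLocal_dots : ∀ k, L.IsLocal (L.dots k) k k 1
  | 0 => .zero _ _ _
  | k + 1 => ((L.isLocal_d.pad k).cast (by omega) (by omega) rfl).add
      (((isLocal_dots k).sh 1).cast (by omega) (by omega) rfl)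

theorem d_mul_τ {G : R} {m n : ℕ} (hG : L.IsLocal G m n 1) : L.d * L.τ G = -(L.τ G * L.d) := by
  have := L.isLocal_d.slide_par hG
  rw [show koszul 1 1 = -1 from sgn_one, neg_one_smul] at this
  exact this

theorem dots_sq (k : ℕ) : L.dots k * L.dots k = (k : ℂ) • 1 := by
  induction k with
  | zero => simp [dots]
  | succ k ih =>
    rw [dots, add_mul, mul_add, mul_add, L.d_sq, L.d_mul_τ (L.isLocal_dots k), ← map_mul, ih,
      map_smul, map_one, Nat.cast_succ, add_smul, one_smul]
    abel

theorem dots_add (k l : ℕ) : L.dots (k + l) = L.dots k + L.sh k (L.dots l) := by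
  induction k with
  | zero => rw [Nat.zero_add, dots, zero_add, sh_zero]
  | succ k ih => rw [Nat.succ_add, dots, ih, dots, map_add, add_assoc, sh_succ]

theorem s_mul_d : L.s * L.d = L.τ L.d * L.s := L.τ_d_s.symm

theorem d_mul_s : L.d * L.s = L.s * L.τ L.d := by
  have : L.s * (L.s * L.d) * L.s = L.s * (L.τ L.d * L.s) * L.s := by rw [L.s_mul_d]
  rwa [← mul_assoc, L.s_sq, one_mul, mul_assoc L.s, mul_assoc (L.τ _), L.s_sq, mul_one] at this

/-- The dot on a letter. -/
def D (i : ℕ) : R := L.sh i L.d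

theorem sh_D (a i : ℕ) : L.sh a (L.D i) = L.D (a + i) := (L.sh_add a i _).symm

theorem S_mul_D (i : ℕ) : L.S i * L.D i = L.D (i + 1) * L.S i := by
  rw [S, D, D, ← sh_τ, ← map_mul, L.s_mul_d, map_mul]

theorem D_mul_S (i : ℕ) : L.D i * L.S i = L.S i * L.D (i + 1) := by
  rw [S, D, D, ← sh_τ, ← map_mul, L.d_mul_s, map_mul]

theorem D_sq (i : ℕ) : L.D i * L.D i = 1 := by rw [D, ← map_mul, L.d_sq, map_one]

theorem D_mul_D {i j : ℕ} (h : i < j) : L.D i * L.D j = -(L.D j * L.D i) := by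
  obtain ⟨r, rfl⟩ := Nat.exists_eq_add_of_lt h
  rw [D, D, add_assoc, L.sh_add i, ← map_mul, ← map_mul, sh_succ,
    L.d_mul_τ ((L.isLocal_d).sh r), map_neg]

theorem S_comm_dots : ∀ {k i : ℕ}, i + 1 < k → L.S i * L.dots k = L.dots k * L.S i
  | k + 2, 0, _ => by
    have h : L.s * L.τ (L.τ (L.dots k)) = L.τ (L.τ (L.dots k)) * L.s := L.isLocal_s.slide_even _
    rw [S_zero, dots, dots, map_add, mul_add, mul_add, add_mul, add_mul, h, L.s_mul_d, ← L.d_mul_s]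
    abel
  | k + 1, i + 1, hi => by
    have h : L.d * L.τ (L.S i) = L.τ (L.S i) * L.d := L.isLocal_d.slide_par (L.isLocal_S i _ le_rfl)
      |>.trans (by rw [koszul_zero_right, one_smul]; rfl)
    have h2 : L.S (i + 1) = L.τ (L.S i) := rfl
    rw [h2, dots, mul_add, add_mul, ← h, ← map_mul, S_comm_dots (by omega), map_mul]

theorem sym_comm_dots (k : ℕ) : L.sym k * L.dots k = L.dots k * L.sym k :=
  (symz_twist fun _ hi => (L.S_comm_dots hi).symm).symm

end Leavitt

end LeavittGrid

section TermValues

/-- The thickness of a strand. -/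
def OrOb.thick : OrOb → ℕ
  | .up k => k
  | .down k => k

/-- The total thickness of a word. -/
def thick : List OrOb → ℕ
  | [] => 0
  | x :: a => x.thick + thick a

theorem thick_append (a b : List OrOb) : thick (a ++ b) = thick a + thick b := by
  induction a with
  | nil => exact (Nat.zero_add _).symm
  | cons k a ih => rw [List.cons_append, thick, ih, thick, Nat.add_assoc]

namespace Leavitt

variable {N : ℕ} {R : Type} [Ring R] [Algebra ℂ R] (L : Leavitt N R)

/-- The value of the identity of a word: a product of symmetrizers. -/
noncomputable def idv : List OrOb → R
  | [] => 1
  | x :: a => L.sh x.thick (idv a) * L.sym x.thick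

theorem isLocal_idv : ∀ a, L.IsLocal (L.idv a) (thick a) (thick a) 0
  | [] => .one _
  | x :: a => (((isLocal_idv a).sh x.thick).mul ((L.isLocal_sym x.thick).pad (thick a))).cast rfl rfl
      (add_zero 0)

theorem idv_append (a b : List OrOb) : L.idv (a ++ b) = L.sh (thick a) (L.idv b) * L.idv a := by
  induction a with
  | nil => rw [idv, mul_one]; rfl
  | cons x a ih => rw [List.cons_append, idv, ih, map_mul, ← sh_add, idv, thick, mul_assoc]

theorem idv_mul_sh (a : List OrOb) (G : R) :
    L.idv a * L.sh (thick a) G = L.sh (thick a) G * L.idv a := (L.isLocal_idv a).slide_even G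

theorem idv_sq (a : List OrOb) : L.idv a * L.idv a = L.idv a := by
  induction a with
  | nil => exact one_mul 1
  | cons x a ih =>
    rw [idv, mul_assoc, ← mul_assoc (L.sym _), L.sym_mul_sh, mul_assoc, L.sym_sq, ← mul_assoc,
      ← map_mul, ih]

/-- The value of a generator. -/
noncomputable def genv : ∀ {a b : List OrOb}, OrGen a b → R
  | _, _, .dot k => L.dots k * L.sym k
  | _, _, .merge _ _ m _ => L.sym m
  | _, _, .split k _ m _ => ((m : ℕ).choose k : ℂ) • L.sym m
  | _, _, .cup k => L.ncup k * L.sym k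
  | _, _, .cap k => L.sym k * L.ncap k
  | _, _, .rightCross k l => L.sh k (L.sym l) * L.sym k * L.grid k l

/-- The value of a term. -/
noncomputable def val : ∀ {a b : List OrOb}, Term OrGen a b → R
  | _, _, .id a => L.idv a
  | _, _, .gen g => L.genv g
  | _, _, .comp s t => val s * val t
  | _, _, .tensor (a := a) s t _ _ => L.sh (thick a) (val t) * val s
  | _, _, .zero => 0
  | _, _, .add s t => val s + val t
  | _, _, .smul z t => z • val t

theorem val_comp {a b c : List OrOb} (s : Term OrGen a b) (t : Term OrGen b c) :
    L.val (s ⨟ t) = L.val s * L.val t := rfl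

theorem val_tensor {a b c d x y : List OrOb} (s : Term OrGen a b) (t : Term OrGen c d)
    (hx : x = a ++ c) (hy : y = b ++ d) :
    L.val (.tensor s t hx hy) = L.sh (thick a) (L.val t) * L.val s := rfl

theorem val_idLeft (a : List OrOb) {b c x y : List OrOb} (t : Term OrGen b c) (hx : x = a ++ b)
    (hy : y = a ++ c) : L.val (Term.idLeft a t hx hy) = L.sh (thick a) (L.val t) * L.idv a := rfl

theorem val_idRight (a : List OrOb) {b c x y : List OrOb} (t : Term OrGen b c) (hx : x = b ++ a)
    (hy : y = c ++ a) : L.val (Term.idRight t a hx hy) = L.sh (thick b) (L.idv a) * L.val t := rfl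

theorem isLocal_genv {a b : List OrOb} (g : OrGen a b) :
    L.IsLocal (L.genv g) (thick a) (thick b) (OrGen.par a b g) := by
  cases g with
  | dot k => exact ((L.isLocal_dots k).mul (L.isLocal_sym k)).cast rfl rfl rfl
  | merge k l m h =>
    subst h
    exact (L.isLocal_sym _).cast (by simp [thick, OrOb.thick]) rfl rfl
  | split k l m h =>
    subst h
    exact ((L.isLocal_sym _).smul _).cast rfl (by simp [thick, OrOb.thick]) rfl
  | cup k =>
    exact ((L.isLocal_ncup k).mul ((L.isLocal_sym k).pad k)).cast rfl rfl (add_zero 0)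
  | cap k =>
    exact (((L.isLocal_sym k).pad k).mul (L.isLocal_ncap k)).cast rfl rfl (add_zero 0)
  | rightCross k l =>
    exact ((((L.isLocal_sym l).sh k).mul ((L.isLocal_sym k).pad l)).mul (L.isLocal_grid k l)).cast
      rfl (Nat.add_comm _ _) rfl

theorem isLocal_val {a b : List OrOb} {t : Term OrGen a b} {p : ZMod 2}
    (h : t.HasParity OrGen.par p) : L.IsLocal (L.val t) (thick a) (thick b) p := by
  induction h with
  | id a => exact L.isLocal_idv a
  | gen g => exact L.isLocal_genv g
  | comp _ _ h h' => exact h.mul h'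
  | tensor _ _ hx hy h h' =>
    subst hx hy
    rw [thick_append, thick_append]
    exact ((h'.sh _).mul (h.pad _)).cast rfl rfl (add_comm _ _)
  | zero p => exact .zero _ _ _
  | add _ _ h h' => exact h.add h'
  | smul z _ h => exact h.smul z

theorem slide_val {G : R} {m n : ℕ} (hG : L.IsLocal G m n 0) {a b : List OrOb}
    (t : Term OrGen a b) : L.val t * L.sh (thick b) G = L.sh (thick a) G * L.val t := by
  have even : ∀ q, koszul q 0 = 1 := koszul_zero_right
  induction t generalizing G m n with
  | id a => exact L.idv_mul_sh a G
  | gen g =>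
    have := (L.isLocal_genv g).slide_par hG
    rwa [even, one_smul] at this
  | comp s t hs ht => rw [val_comp, mul_assoc, ht hG, ← mul_assoc, hs hG, mul_assoc]
  | tensor s t hx hy hs ht =>
    subst hx hy
    rw [val_tensor, thick_append, thick_append, sh_add, mul_assoc, hs (hG.sh _), ← mul_assoc,
      ← map_mul, ht hG, map_mul, ← sh_add, mul_assoc]
  | zero => exact (zero_mul _).trans (mul_zero _).symm
  | add s t hs ht => exact (add_mul _ _ _).trans ((congrArg₂ (· + ·) (hs hG) (ht hG)).trans
      (mul_add _ _ _).symm)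
  | smul z t ht => exact (smul_mul_assoc _ _ _).trans ((congrArg (z • ·) (ht hG)).trans
      (mul_smul_comm _ _ _).symm)

theorem idv_pair (x y : OrOb) : L.idv [x, y] = L.sh x.thick (L.sym y.thick) * L.sym x.thick := by
  rw [idv, idv, idv, map_one, one_mul]

theorem idv_single (x : OrOb) : L.idv [x] = L.sym x.thick := by
  rw [idv, idv, map_one, one_mul]

theorem sh_mul_sym_mul {m : ℕ} (k l : ℕ) (h : k + l = m) :
    L.sh k (L.sym l) * L.sym k * L.sym m = L.sym m := by
  rw [mul_assoc, show L.sym k * L.sym m = L.sym m from L.isCoxeter.le_mul_symz (by omega), sh_sym]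
  exact L.isCoxeter.shift_mul_symz (by omega)

theorem sym_mul_sh_mul {m : ℕ} (k l : ℕ) (h : k + l = m) :
    L.sym m * (L.sh k (L.sym l) * L.sym k) = L.sym m := by
  rw [← sym_mul_sh, ← mul_assoc, show L.sym m * L.sym k = L.sym m from
    L.isCoxeter.symz_mul_le (by omega), sh_sym]
  exact L.isCoxeter.symz_mul_shift (by omega)

theorem sh_mul_sym_mul_grid (k l : ℕ) : L.sh k (L.sym l) * L.sym k * L.grid k l =
    L.grid k l * (L.sh l (L.sym k) * L.sym l) := by
  rw [mul_assoc, L.grid_natural_left (L.isLocal_sym k), ← mul_assoc, L.grid_natural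
    (L.isLocal_sym l), mul_assoc, L.sym_mul_sh]

theorem sh_mul_sym_sq (k l : ℕ) : L.sh k (L.sym l) * L.sym k * (L.sh k (L.sym l) * L.sym k) =
    L.sh k (L.sym l) * L.sym k := by
  rw [mul_assoc, ← mul_assoc (L.sym k), L.sym_mul_sh, mul_assoc, L.sym_sq, ← mul_assoc, ← map_mul,
    L.sym_sq]

theorem idv_mul_genv {a b : List OrOb} (g : OrGen a b) : L.idv a * L.genv g = L.genv g := by
  cases g with
  | dot k =>
    rw [idv_single]
    exact (mul_assoc _ _ _).symm.trans ((congrArg (· * L.sym k) (L.sym_comm_dots k)).trans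
      ((mul_assoc _ _ _).trans (congrArg (L.dots k * ·) (L.sym_sq k))))
  | merge k l m h =>
    rw [idv_pair]
    exact L.sh_mul_sym_mul _ _ (by subst h; rfl)
  | split k l m h =>
    rw [idv_single]
    exact (mul_smul_comm _ _ _).trans (congrArg (_ • ·) (L.sym_sq m))
  | cup k => exact one_mul _
  | cap k =>
    rw [idv_pair, mul_assoc]
    refine (congrArg (L.sh k (L.sym k) * ·) ?_).trans (L.ncap_absorb k)
    exact (mul_assoc _ _ _).symm.trans (congrArg (· * L.ncap k) (L.sym_sq k))
  | rightCross k l =>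
    rw [idv_pair]
    exact (mul_assoc _ _ _).symm.trans (congrArg (· * L.grid k l) (L.sh_mul_sym_sq k l))

theorem genv_mul_idv {a b : List OrOb} (g : OrGen a b) : L.genv g * L.idv b = L.genv g := by
  cases g with
  | dot k =>
    rw [idv_single]
    exact (mul_assoc _ _ _).trans (congrArg (L.dots k * ·) (L.sym_sq k))
  | merge k l m h =>
    rw [idv_single]
    exact L.sym_sq m
  | split k l m h =>
    rw [idv_pair]
    exact (smul_mul_assoc _ _ _).trans
      (congrArg (_ • ·) (L.sym_mul_sh_mul _ _ (by subst h; rfl)))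
  | cup k =>
    rw [idv_pair]
    refine (mul_assoc _ _ _).symm.trans ?_
    refine (congrArg (· * L.sym k) (L.ncup_absorb k)).trans ?_
    exact (mul_assoc _ _ _).trans (congrArg (L.ncup k * ·) (L.sym_sq k))
  | cap k => exact mul_one _
  | rightCross k l =>
    rw [idv_pair]
    change L.sh k (L.sym l) * L.sym k * L.grid k l * (L.sh l (L.sym k) * L.sym l) = _
    rw [mul_assoc, ← sh_mul_sym_mul_grid, ← mul_assoc, sh_mul_sym_sq]
    rfl

theorem idv_mul_val {a b : List OrOb} (t : Term OrGen a b) : L.idv a * L.val t = L.val t := by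
  induction t with
  | id a => exact L.idv_sq a
  | gen g => exact L.idv_mul_genv g
  | comp s t hs ht => rw [val_comp, ← mul_assoc, hs]
  | tensor s t hx hy hs ht =>
    subst hx
    rw [val_tensor, idv_append, mul_assoc, ← mul_assoc (L.idv _), L.idv_mul_sh, mul_assoc, hs,
      ← mul_assoc, ← map_mul, ht]
  | zero => exact mul_zero _
  | add s t hs ht => exact (mul_add _ _ _).trans (congrArg₂ (· + ·) hs ht)
  | smul z t ht => exact (mul_smul_comm _ _ _).trans (congrArg (z • ·) ht)

theorem val_mul_idv {a b : List OrOb} (t : Term OrGen a b) : L.val t * L.idv b = L.val t := by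
  induction t with
  | id a => exact L.idv_sq a
  | gen g => exact L.genv_mul_idv g
  | comp s t hs ht => rw [val_comp, mul_assoc, ht]
  | tensor s t hx hy hs ht =>
    subst hy
    rw [val_tensor, idv_append, mul_assoc, ← mul_assoc (L.val s), L.slide_val (L.isLocal_idv _),
      mul_assoc, hs, ← mul_assoc, ← map_mul, ht]
  | zero => exact zero_mul _
  | add s t hs ht => exact (add_mul _ _ _).trans (congrArg₂ (· + ·) hs ht)
  | smul z t ht => exact (smul_mul_assoc _ _ _).trans (congrArg (z • ·) ht)

theorem val_tensor_assoc {a b c d e f ac bd ce df x y : List OrOb} (s : Term OrGen a b)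
    (t : Term OrGen c d) (r : Term OrGen e f) (h₁ : ac = a ++ c) (h₂ : bd = b ++ d)
    (h₃ : x = ac ++ e) (h₄ : y = bd ++ f) (h₅ : ce = c ++ e) (h₆ : df = d ++ f)
    (h₇ : x = a ++ ce) (h₈ : y = b ++ df) :
    L.val ((s.tensor t h₁ h₂).tensor r h₃ h₄) = L.val (s.tensor (t.tensor r h₅ h₆) h₇ h₈) := by
  subst h₁
  rw [val_tensor, val_tensor, val_tensor, val_tensor, thick_append, sh_add, map_mul, mul_assoc]

theorem val_eqv (hrel : ∀ {a b : List OrOb} {s t : Term OrGen a b}, OrRel s t → L.val s = L.val t)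
    {a b : List orPres.Ob} {s t : Term orPres.Gen a b} (h : orPres.Eqv s t) :
    L.val (a := a) (b := b) s = L.val (a := a) (b := b) t := by
  induction h with
  | rel h => exact hrel h
  | refl s => rfl
  | symm _ h => exact h.symm
  | trans _ _ h h' => exact h.trans h'
  | comp _ _ h h' => exact congrArg₂ (· * ·) h h'
  | tensor _ _ hx hy h h' => exact congrArg₂ (fun x y => L.sh _ y * x) h h'
  | add _ _ h h' => exact congrArg₂ (· + ·) h h'
  | smul z _ h => exact congrArg (z • ·) h
  | add_comm s t => exact add_comm _ _
  | add_assoc s t r => exact add_assoc _ _ _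
  | add_zero s => exact add_zero _
  | add_neg s => exact (congrArg (L.val s + ·) (neg_one_smul _ _)).trans (add_neg_cancel _)
  | one_smul s => exact one_smul _ _
  | mul_smul z w s => exact mul_smul _ _ _
  | smul_add z s t => exact smul_add _ _ _
  | add_smul z w s => exact add_smul _ _ _
  | add_comp s s' t => exact add_mul _ _ _
  | comp_add s t t' => exact mul_add _ _ _
  | smul_comp z s t => exact smul_mul_assoc _ _ _
  | comp_smul z s t => exact mul_smul_comm _ _ _
  | add_tensor s s' t hx hy => exact mul_add _ _ _
  | tensor_add s t t' hx hy =>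
    exact (congrArg (· * L.val s) (map_add _ _ _)).trans (add_mul _ _ _)
  | smul_tensor z s t hx hy => exact mul_smul_comm _ _ _
  | tensor_smul z s t hx hy =>
    exact (congrArg (· * L.val s) (map_smul _ _ _)).trans (smul_mul_assoc _ _ _)
  | id_comp s => exact L.idv_mul_val s
  | comp_id s => exact L.val_mul_idv s
  | comp_assoc s t r => exact mul_assoc _ _ _
  | tensor_id hx hx' => subst hx; exact (L.idv_append _ _).symm
  | @interchange a b c a' b' c' x y z s t s' t' p q ht' hs hx hy hz =>
    have h := (L.isLocal_val hs).slide_par (L.isLocal_val ht')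
    refine (mul_assoc _ _ _).trans ((congrArg (L.sh (thick a) (L.val t) * ·)
      ((mul_assoc _ _ _).symm.trans (congrArg (· * L.val s') h))).trans ?_)
    rw [koszul_comm, smul_mul_assoc, mul_smul_comm]
    refine congrArg (koszul p q • ·) ?_
    refine Eq.trans ?_ (congrArg (· * L.val (s.comp s')) (map_mul (L.sh (thick a)) _ _).symm)
    rw [mul_assoc, ← mul_assoc]
    rfl
  | tensor_assoc s t r h₁ h₂ h₃ h₄ h₅ h₆ h₇ h₈ =>
    exact L.val_tensor_assoc s t r h₁ h₂ h₃ h₄ h₅ h₆ h₇ h₈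
  | unit_tensor s ha hb => exact mul_one _
  | tensor_unit s ha hb => exact (congrArg (· * L.val s) (map_one _)).trans (one_mul _)

end Leavitt

end TermValues

section UpwardValues

theorem thick_up (k : ℕ) : thick ((up k).map OrOb.up) = k := by cases k <;> rfl

namespace Leavitt

variable {N : ℕ} {R : Type} [Ring R] [Algebra ℂ R] (L : Leavitt N R)

/-- The value of an upward term. -/
noncomputable def uval {a b : List ℕ+} (t : Term UpGen a b) : R := L.val (toOr t)

theorem idv_up (k : ℕ) : L.idv ((up k).map OrOb.up) = L.sym k := by
  rcases k with _ | k
  · rfl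
  · exact L.idv_single _

/-- Two adjacent symmetrizers. -/
noncomputable def bl (k l : ℕ) : R := L.sh k (L.sym l) * L.sym k

/-- Three adjacent symmetrizers. -/
noncomputable def blk (h k l : ℕ) : R := L.sh h (L.bl k l) * L.sym h

theorem idv_up_up (k l : ℕ) : L.idv ((up k ++ up l).map OrOb.up) = L.bl k l := by
  rw [List.map_append, idv_append, idv_up, idv_up, thick_up, bl]

section
variable {a b c x y : List ℕ+}

theorem uval_id (k : ℕ) : L.uval (.id (up k)) = L.sym k := L.idv_up k

theorem uval_comp (s : Term UpGen a b) (t : Term UpGen b c) :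
    L.uval (s ⨟ t) = L.uval s * L.uval t := rfl

theorem uval_add (s t : Term UpGen a b) : L.uval (s + t) = L.uval s + L.uval t := rfl

theorem uval_smul (z : ℂ) (t : Term UpGen a b) : L.uval (z • t) = z • L.uval t := rfl

theorem uval_sub (s t : Term UpGen a b) : L.uval (s - t) = L.uval s - L.uval t := by
  rw [sub_eq_add_neg, ← neg_one_smul ℂ]; rfl

theorem uval_idLeft (k : ℕ) (t : Term UpGen b c) (hx : x = up k ++ b) (hy : y = up k ++ c) :
    L.uval (Term.idLeft (up k) t hx hy) = L.sh k (L.uval t) * L.sym k := by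
  rw [← idv_up]
  conv_rhs => rw [← thick_up k]
  rw [thick_up]
  refine (L.val_idLeft _ (toOr t) (by rw [hx, List.map_append]) (by rw [hy, List.map_append])).trans
    ?_
  rw [thick_up]
  rfl

theorem uval_idRight (l : ℕ) (t : Term UpGen b c) (hx : x = b ++ up l) (hy : y = c ++ up l) :
    L.uval (Term.idRight t (up l) hx hy) = L.sh (thick (b.map OrOb.up)) (L.sym l) * L.uval t := by
  rw [← idv_up]
  rfl

theorem uval_ofEq (h : a = b) : L.uval (Term.ofEq h) = L.idv (a.map OrOb.up) := by
  subst h; rfl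

theorem uval_dt (k : ℕ) : L.uval (dt k) = L.dots k * L.sym k := by
  rcases k with _ | k
  · exact (zero_mul _).symm
  · rfl

theorem uval_mrg (k l : ℕ) {m : ℕ} (h : k + l = m) : L.uval (mrg k l h) = L.sym m := by
  subst h
  rcases k with _ | k
  · exact (L.uval_ofEq _).trans ((congrArg L.idv (by simp [up])).trans (L.idv_up _))
  rcases l with _ | l
  · exact (L.uval_ofEq (a := up (k + 1) ++ up 0) (b := up (k + 1 + 0)) (by simp [up])).trans
      ((congrArg L.idv (a₂ := (up (k + 1 + 0)).map OrOb.up) (by simp [up])).trans (L.idv_up _))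
  · rfl

theorem uval_spl (k l : ℕ) {m : ℕ} (h : k + l = m) :
    L.uval (spl k l h) = (m.choose k : ℂ) • L.sym m := by
  subst h
  rcases k with _ | k
  · rw [Nat.choose_zero_right, Nat.cast_one, one_smul]
    exact (L.uval_ofEq _).trans ((congrArg L.idv (by simp [up])).trans (L.idv_up _))
  rcases l with _ | l
  · rw [Nat.add_zero, Nat.choose_self, Nat.cast_one, one_smul]
    exact (L.uval_ofEq (a := up (k + 1 + 0)) (b := up (k + 1) ++ up 0) (by simp [up])).trans
      ((congrArg L.idv (by simp [up])).trans (L.idv_up _))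
  · rfl

theorem uval_mul_τ (ρ : Term UpGen (up 1) (up 1)) {G : R} {m n : ℕ} (hG : L.IsLocal G m n 0) :
    L.uval ρ * L.τ G = L.τ G * L.uval ρ := L.slide_val hG (toOr ρ)

end

theorem bl_sq (k l : ℕ) : L.bl k l * L.bl k l = L.bl k l := L.sh_mul_sym_sq k l

theorem isLocal_bl (k l : ℕ) : L.IsLocal (L.bl k l) (k + l) (k + l) 0 :=
  (((L.isLocal_sym l).sh k).mul ((L.isLocal_sym k).pad l)).cast rfl rfl (add_zero 0)

theorem blk_eq (h k l : ℕ) : L.blk h k l = L.sh (h + k) (L.sym l) * L.bl h k := by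
  rw [blk, bl, bl, map_mul, ← sh_add, mul_assoc]

theorem blk_zero_right (h k : ℕ) : L.blk h k 0 = L.bl h k := by
  rw [blk_eq, sym_zero, map_one, one_mul]

theorem blk_mul_S {h k l i : ℕ} (hi : i + 1 < h ∨ (h ≤ i ∧ i + 1 < h + k) ∨
    (h + k ≤ i ∧ i + 1 < h + k + l)) : L.blk h k l * L.S i = L.blk h k l := by
  have key : ∀ {k i : ℕ}, i + 1 < k → L.sym k * L.S i = L.sym k :=
    fun hi => L.isCoxeter.symz_mul_gen hi
  rcases hi with hi | ⟨h1, hi⟩ | ⟨h1, hi⟩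
  · rw [blk, mul_assoc, key hi]
  · obtain ⟨j, rfl⟩ := Nat.exists_eq_add_of_le h1
    rw [← sh_S, blk, mul_assoc, sym_mul_sh, ← mul_assoc, ← map_mul, bl, mul_assoc,
      key (by omega)]
  · obtain ⟨j, rfl⟩ := Nat.exists_eq_add_of_le h1
    rw [← sh_S, blk_eq, mul_assoc, (L.isLocal_bl h k).slide_even, ← mul_assoc, ← map_mul,
      key (by omega)]

theorem S_mul_blk {h k l i : ℕ} (hi : i + 1 < h ∨ (h ≤ i ∧ i + 1 < h + k) ∨
    (h + k ≤ i ∧ i + 1 < h + k + l)) : L.S i * L.blk h k l = L.blk h k l := by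
  have key : ∀ {k i : ℕ}, i + 1 < k → L.S i * L.sym k = L.sym k :=
    fun hi => L.isCoxeter.gen_mul_symz hi
  rcases hi with hi | ⟨h1, hi⟩ | ⟨h1, hi⟩
  · rw [blk, ← sym_mul_sh, ← mul_assoc, key hi]
  · obtain ⟨j, rfl⟩ := Nat.exists_eq_add_of_le h1
    rw [← sh_S, blk, ← mul_assoc, ← map_mul, bl, ← L.sym_mul_sh k, ← mul_assoc, key (by omega)]
  · obtain ⟨j, rfl⟩ := Nat.exists_eq_add_of_le h1
    rw [← sh_S, blk_eq, ← mul_assoc, ← map_mul, key (by omega)]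

theorem S_mul_sh_uval (ρ : Term UpGen (up 1) (up 1)) {i j : ℕ} (hij : i + 1 < j ∨ j < i) :
    L.S i * L.sh j (L.uval ρ) = L.sh j (L.uval ρ) * L.S i := by
  rcases hij with hij | hij
  · exact (L.isLocal_S i j (by omega)).slide_even _
  · obtain ⟨r, rfl⟩ := Nat.exists_eq_add_of_lt hij
    have h : L.S (j + r + 1) = L.sh j (L.τ (L.S r)) := by rw [sh_τ, sh_S]; congr 1; omega
    rw [h, ← map_mul, ← map_mul, L.uval_mul_τ ρ (L.isLocal_S r _ le_rfl)]

section
variable (ρ : Term UpGen (up 1) (up 1)) {h k l j a m : ℕ}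

theorem blk_rung_mul (hm : a + m ≤ h ∨ (h ≤ a ∧ a + m ≤ h + k) ∨ (h + k ≤ a ∧ a + m ≤ h + k + l))
    (hj : a + m ≤ j ∨ j < a) :
    L.blk h k l * L.sh j (L.uval ρ) * L.sh a (L.sym m) = L.blk h k l * L.sh j (L.uval ρ) := by
  rw [sh_sym]
  refine mul_symz fun i hi => ?_
  rw [mul_assoc, ← L.S_mul_sh_uval ρ (by omega), ← mul_assoc, L.blk_mul_S (by omega)]

theorem mul_rung_blk (hm : a + m ≤ h ∨ (h ≤ a ∧ a + m ≤ h + k) ∨ (h + k ≤ a ∧ a + m ≤ h + k + l))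
    (hj : a + m ≤ j ∨ j < a) :
    L.sh a (L.sym m) * (L.sh j (L.uval ρ) * L.blk h k l) = L.sh j (L.uval ρ) * L.blk h k l := by
  rw [sh_sym]
  refine symz_mul fun i hi => ?_
  rw [← mul_assoc, L.S_mul_sh_uval ρ (by omega), mul_assoc, L.S_mul_blk (by omega)]

end

section
variable (ρ σ τ : Term UpGen (up 1) (up 1)) (h k l : ℕ)

theorem uval_ladE : L.uval (ladE ρ k l) =
    ((l : ℂ) + 1) • (L.bl k (l + 1) * L.sh k (L.uval ρ) * L.bl (k + 1) l) := by
  have e : L.sym (l + 1) * L.sh 1 (L.sym l) = L.sym (l + 1) := by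
    rw [sh_sym]; exact L.isCoxeter.symz_mul_shift (by omega)
  rw [ladE, uval_comp, uval_idLeft, uval_idRight, uval_comp, uval_idRight, uval_mrg, uval_spl,
    List.map_append, thick_append, thick_up, thick_up, Nat.choose_one_right, smul_mul_assoc,
    ← mul_assoc (L.sym (l + 1)), e, bl, bl, map_smul, map_mul, smul_mul_assoc, smul_mul_assoc,
    Nat.cast_succ, mul_assoc _ (L.sym k) (L.sh k _), L.sym_mul_sh]
  simp only [mul_assoc]

theorem uval_ladF : L.uval (ladF ρ k l) =
    ((k : ℂ) + 1) • (L.bl (k + 1) l * L.sh k (L.uval ρ) * L.bl k (l + 1)) := by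
  rw [ladF, uval_comp, uval_idRight, uval_comp, uval_idLeft, uval_idLeft, uval_mrg, uval_spl,
    thick_up, Nat.choose_succ_self_right, smul_mul_assoc, mul_smul_comm, smul_mul_assoc, bl, bl,
    Nat.cast_succ]
  congr 1
  simp only [mul_assoc]
  rw [← mul_assoc (L.sym k), L.sym_mul_sh, mul_assoc, L.sym_sq]

theorem sh_bl_rung (c : ℂ) (k' l' : ℕ) (r : R) :
    L.sh h (c • (L.bl k l * r * L.bl k' l')) * L.sym h =
      c • (L.blk h k l * L.sh h r * L.blk h k' l') := by
  rw [map_smul, smul_mul_assoc, map_mul, map_mul, blk, blk, mul_assoc _ (L.sym h) (L.sh h r),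
    L.sym_mul_sh]
  simp only [mul_assoc]
  rw [← mul_assoc (L.sym h), L.sym_mul_sh, mul_assoc _ (L.sym h), L.sym_sq]

theorem sh_mul_bl_rung (c : ℂ) {h k h' k' : ℕ} (hk : h + k = h' + k') {j : ℕ} (hj : j < h' + k') :
    L.sh (h + k) (L.sym l) * (c • (L.bl h k * L.sh j (L.uval ρ) * L.bl h' k')) =
      c • (L.blk h k l * L.sh j (L.uval ρ) * L.blk h' k' l) := by
  have e : L.sh j (L.uval ρ) * L.sh (h + k) (L.sym l) =
      L.sh (h + k) (L.sym l) * L.sh j (L.uval ρ) := by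
    obtain ⟨r, hr⟩ := Nat.exists_eq_add_of_lt hj
    rw [hk, hr, Nat.add_assoc, sh_add, sh_succ, ← map_mul, ← map_mul,
      L.uval_mul_τ ρ ((L.isLocal_sym l).sh r)]
  rw [mul_smul_comm, blk_eq, blk_eq, ← hk, ← mul_assoc _ (L.sh (h + k) _),
    mul_assoc _ (L.sh j _) (L.sh (h + k) _), e, mul_assoc _ (L.bl h k),
    ← mul_assoc (L.bl h k), (L.isLocal_bl h k).slide_even, mul_assoc _ (L.bl h k), ← mul_assoc _
    (L.sh (h + k) (L.sym l)), ← map_mul, L.sym_sq]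
  simp only [mul_assoc]

end

theorem sh_sym_left (a l : ℕ) : ((l : ℂ) + 1) • L.sh a (L.sym (l + 1)) =
    L.sh (a + 1) (L.sym l) * (1 + (l : ℂ) • L.S a) * L.sh (a + 1) (L.sym l) := by
  have h := congrArg (L.sh a) (L.isCoxeter.smul_symz_left l)
  rw [← sh_sym, map_mul, map_mul, map_add, map_one, map_smul, map_smul, sh_S, ← sh_add] at h
  exact h

theorem sym_right (k : ℕ) : ((k : ℂ) + 1) • L.sym (k + 1) =
    L.sym k * (1 + (k : ℂ) • L.S (k - 1)) * L.sym k := L.isCoxeter.smul_symz_right k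

theorem sh_sym_down (a k : ℕ) : ((k : ℂ) + 1) • L.sh a (L.sym (k + 1)) =
    L.sh a (L.sym k) * ((k : ℂ) • 1 + L.sh a (cyDown L.S k)) * L.sh (a + 1) (L.sym k) := by
  have h := congrArg (L.sh a) (L.isCoxeter.smul_symz_cyDown k)
  rw [← sh_sym, map_mul, map_mul, map_add, map_smul, map_smul, map_one, ← sh_add] at h
  exact h

theorem sh_sym_up (a k : ℕ) : ((k : ℂ) + 1) • L.sh a (L.sym (k + 1)) =
    L.sh (a + 1) (L.sym k) * ((k : ℂ) • 1 + L.sh a (cyUp L.S k)) * L.sh a (L.sym k) := by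
  have h := congrArg (L.sh a) (L.isCoxeter.smul_symz_cyUp k)
  rw [← sh_sym, map_mul, map_mul, map_add, map_smul, map_smul, map_one, ← sh_add] at h
  exact h

theorem D_mul_cyDown (a k : ℕ) :
    L.D (a + k) * L.sh a (cyDown L.S k) = L.sh a (cyDown L.S k) * L.D a := by
  have h : L.D k * cyDown L.S k = cyDown L.S k * L.D 0 := by
    induction k with
    | zero => rw [cyDown, one_mul, mul_one]
    | succ k ih => rw [cyDown, ← mul_assoc, ← S_mul_D, mul_assoc, ih, mul_assoc]
  rw [← sh_D, ← map_mul, h, map_mul, sh_D, add_zero]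

theorem D_mul_cyUp (a k : ℕ) :
    L.D a * L.sh a (cyUp L.S k) = L.sh a (cyUp L.S k) * L.D (a + k) := by
  have h : L.D 0 * cyUp L.S k = cyUp L.S k * L.D k := by
    induction k with
    | zero => rw [cyUp, one_mul, mul_one]
    | succ k ih => rw [cyUp, ← mul_assoc, ih, mul_assoc, D_mul_S, mul_assoc]
  rw [← L.sh_D a k, ← map_mul, ← h, map_mul, sh_D, add_zero]

theorem blk_sq (h k l : ℕ) : L.blk h k l * L.blk h k l = L.blk h k l := by
  rw [blk, mul_assoc, ← mul_assoc (L.sym h), sym_mul_sh, mul_assoc, sym_sq, ← mul_assoc, ← map_mul,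
    bl_sq]

/-- Two composable values meet in an idempotent, which is then absorbed up to its essential part. -/
theorem glue {X Y B Z M B₁ B₂ c : R} (c₁ : ℂ) {c₂ : ℂ} (hB : B * B = B) (hZ : B = Z * M)
    (hX : X * Z = X) (hM : c₂ • M = B₁ * c * B₂) (hX₁ : X * B₁ = X) (hY : B₂ * Y = Y) :
    c₁ • (X * B) * (c₂ • (B * Y)) = c₁ • (X * c * Y) := by
  rw [smul_mul_assoc]
  congr 1
  rw [mul_smul_comm, mul_assoc X, ← mul_assoc B, hB, hZ, ← mul_assoc X,
    ← mul_assoc X, hX, ← smul_mul_assoc c₂, ← mul_smul_comm c₂, hM, ← mul_assoc, ← mul_assoc,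
    hX₁, mul_assoc _ B₂, hY]

section
variable (ρ σ τ : Term UpGen (up 1) (up 1)) (h k l : ℕ)

theorem uval_ladFE : L.uval (ladFE ρ σ k l) = (k : ℂ) • (L.blk k l 0 * L.sh (k - 1) (L.uval ρ) *
    (1 + (l : ℂ) • L.S (k - 1)) * (L.sh (k - 1) (L.uval σ) * L.blk k l 0)) := by
  rcases k with _ | k
  · rw [Nat.cast_zero, zero_smul]; rfl
  rw [ladFE, uval_comp, uval_ladF, uval_ladE, Nat.cast_succ, Nat.add_sub_cancel, mul_assoc _ _
    (L.bl (k + 1) l), ← blk_zero_right]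
  refine glue _ (L.bl_sq _ _) (L.sym_mul_sh _ _).symm ?_ (L.sh_sym_left k l) ?_ ?_
  · exact L.blk_rung_mul ρ (a := 0) (by omega) (by omega)
  · exact L.blk_rung_mul ρ (by omega) (by omega)
  · exact L.mul_rung_blk σ (by omega) (by omega)

theorem uval_ladEF : L.uval (ladEF ρ σ k l) = (l : ℂ) • (L.blk k l 0 * L.sh k (L.uval ρ) *
    (1 + (k : ℂ) • L.S (k - 1)) * (L.sh k (L.uval σ) * L.blk k l 0)) := by
  rcases l with _ | l
  · rw [Nat.cast_zero, zero_smul]; rfl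
  rw [ladEF, uval_comp, uval_ladF, uval_ladE, Nat.cast_succ, mul_assoc _ _
    (L.bl k (l + 1)), ← L.blk_zero_right k]
  refine glue _ (L.bl_sq _ _) rfl ?_ (L.sym_right k) ?_ ?_
  · exact L.blk_rung_mul ρ (by omega) (by omega)
  · exact L.blk_rung_mul ρ (a := 0) (by omega) (by omega)
  · exact L.mul_rung_blk σ (a := 0) (by omega) (by omega)

theorem uval_idLeft_ladE {x y : List ℕ+} (hx : x = up h ++ (up k ++ up (l + 1)))
    (hy : y = up h ++ (up (k + 1) ++ up l)) : L.uval (Term.idLeft (up h) (ladE ρ k l) hx hy) =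
    ((l : ℂ) + 1) • (L.blk h k (l + 1) * L.sh (h + k) (L.uval ρ) * L.blk h (k + 1) l) := by
  rw [uval_idLeft, uval_ladE, sh_bl_rung, sh_add]

theorem uval_idLeft_ladF {x y : List ℕ+} (hx : x = up h ++ (up (k + 1) ++ up l))
    (hy : y = up h ++ (up k ++ up (l + 1))) : L.uval (Term.idLeft (up h) (ladF ρ k l) hx hy) =
    ((k : ℂ) + 1) • (L.blk h (k + 1) l * L.sh (h + k) (L.uval ρ) * L.blk h k (l + 1)) := by
  rw [uval_idLeft, uval_ladF, sh_bl_rung, sh_add]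

theorem uval_idRight_ladE {x y : List ℕ+} (hx : x = (up h ++ up (k + 1)) ++ up l)
    (hy : y = (up (h + 1) ++ up k) ++ up l) : L.uval (Term.idRight (ladE ρ h k) (up l) hx hy) =
    ((k : ℂ) + 1) • (L.blk h (k + 1) l * L.sh h (L.uval ρ) * L.blk (h + 1) k l) := by
  rw [uval_idRight, uval_ladE, List.map_append, thick_append, thick_up, thick_up,
    L.sh_mul_bl_rung ρ _ _ (by omega) (by omega)]

theorem uval_idRight_ladF {x y : List ℕ+} (hx : x = (up (h + 1) ++ up k) ++ up l)
    (hy : y = (up h ++ up (k + 1)) ++ up l) : L.uval (Term.idRight (ladF ρ h k) (up l) hx hy) =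
    ((h : ℂ) + 1) • (L.blk (h + 1) k l * L.sh h (L.uval ρ) * L.blk h (k + 1) l) := by
  rw [uval_idRight, uval_ladF, List.map_append, thick_append, thick_up, thick_up,
    L.sh_mul_bl_rung ρ _ _ (by omega) (by omega)]

theorem blk_eq_mul (h k l : ℕ) :
    L.blk h k l = L.sh (h + k) (L.sym l) * L.sym h * L.sh h (L.sym k) := by
  rw [blk_eq, bl, mul_assoc, sym_mul_sh]

theorem uval_ladE2E1 : L.uval (ladE2E1 σ τ h k l) = ((l : ℂ) + 1) •
    (L.blk h k (l + 1) * L.sh (h + k) (L.uval τ) * ((k : ℂ) • 1 + L.sh h (cyDown L.S k)) *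
      (L.sh h (L.uval σ) * L.blk (h + 1) k l)) := by
  rw [ladE2E1, uval_comp, uval_idLeft_ladE, uval_idRight_ladE, mul_assoc _ _ (L.blk (h + 1) k l)]
  refine glue _ (L.blk_sq _ _ _) (L.blk_eq_mul _ _ _) ?_ (L.sh_sym_down h k) ?_ ?_
  · rw [← mul_assoc, L.blk_rung_mul τ (by omega) (by omega)]
    exact L.blk_rung_mul τ (a := 0) (by omega) (by omega)
  · exact L.blk_rung_mul τ (by omega) (by omega)
  · exact L.mul_rung_blk σ (by omega) (by omega)

theorem uval_ladF1F2 : L.uval (ladF1F2 σ τ h k l) = ((h : ℂ) + 1) •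
    (L.blk (h + 1) k l * L.sh h (L.uval σ) * ((k : ℂ) • 1 + L.sh h (cyUp L.S k)) *
      (L.sh (h + k) (L.uval τ) * L.blk h k (l + 1))) := by
  rw [ladF1F2, uval_comp, uval_idLeft_ladF, uval_idRight_ladF, mul_assoc _ _ (L.blk h k (l + 1))]
  refine glue _ (L.blk_sq _ _ _) (L.blk_eq_mul _ _ _) ?_ (L.sh_sym_up h k) ?_ ?_
  · rw [← mul_assoc, L.blk_rung_mul σ (by omega) (by omega)]
    exact L.blk_rung_mul σ (a := 0) (by omega) (by omega)
  · exact L.blk_rung_mul σ (by omega) (by omega)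
  · exact L.mul_rung_blk τ (by omega) (by omega)

theorem glue_cancel {X Y B B₁ B₂ : R} (c₁ c₂ : ℂ) (hB : B * B = B) (hB' : B = B₁ * B₂)
    (hX : X * B₁ = X) (hY : B₂ * Y = Y) : c₁ • (X * B) * (c₂ • (B * Y)) = (c₁ * c₂) • (X * Y) := by
  rw [smul_mul_smul_comm, mul_assoc X, ← mul_assoc B, hB, hB', ← mul_assoc, ← mul_assoc, hX,
    mul_assoc, hY]

theorem uval_ladE1E2 : L.uval (ladE1E2 σ τ h k l) = ((k : ℂ) * ((l : ℂ) + 1)) •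
    (L.blk h k (l + 1) * L.sh h (L.uval σ) * (L.sh (h + k) (L.uval τ) * L.blk (h + 1) k l)) := by
  rcases k with _ | k
  · rw [Nat.cast_zero, zero_mul, zero_smul]; rfl
  rw [ladE1E2, uval_comp, uval_idLeft_ladE, uval_idRight_ladE, mul_assoc _ _ (L.blk (h + 1) _ l),
    show h + 1 + k = h + (k + 1) by omega, Nat.cast_succ]
  refine glue_cancel _ _ (L.blk_sq _ _ _) rfl ?_ ?_
  · rw [bl, map_mul, ← sh_add, ← mul_assoc]
    rw [L.blk_rung_mul σ (a := h + 1 + k) (m := l + 1) (by omega) (by omega)]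
    exact L.blk_rung_mul σ (by omega) (by omega)
  · exact L.mul_rung_blk τ (h := h + 1) (k := k + 1) (l := l) (a := 0) (m := h + 1) (by omega)
      (by omega)

theorem uval_ladF2F1 : L.uval (ladF2F1 σ τ h k l) = ((k : ℂ) * ((h : ℂ) + 1)) •
    (L.blk (h + 1) k l * L.sh (h + k) (L.uval τ) * (L.sh h (L.uval σ) * L.blk h k (l + 1))) := by
  rcases k with _ | k
  · rw [Nat.cast_zero, zero_mul, zero_smul]; rfl
  rw [ladF2F1, uval_comp, uval_idLeft_ladF, uval_idRight_ladF, mul_assoc _ _ (L.blk h _ _),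
    show h + 1 + k = h + (k + 1) by omega, Nat.cast_succ]
  refine glue_cancel _ _ (L.blk_sq _ _ _) ((L.blk_eq _ _ _).trans
    ((L.isLocal_bl _ _).slide_even _).symm) ?_ ?_
  · rw [bl, ← mul_assoc, L.blk_rung_mul τ (a := h + 1) (m := k) (by omega) (by omega)]
    exact L.blk_rung_mul τ (h := h + 1) (k := k + 1) (l := l) (a := 0) (m := h + 1) (by omega)
      (by omega)
  · exact L.mul_rung_blk σ (h := h) (k := k + 1) (l := l + 1) (a := h + 1 + k) (m := l + 1)
      (by omega) (by omega)

end

/-! The defining relations. -/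

theorem uval_plain : L.uval plain = 1 := (L.uval_id 1).trans L.sym_one

theorem uval_dot : L.uval (dt 1) = L.d := by
  rw [uval_dt, sym_one, mul_one, dots, dots, map_zero, add_zero]

theorem uval_dumbbell : L.uval dumbbell = 1 + L.s := by
  rw [dumbbell, uval_comp, uval_mrg, uval_spl, mul_smul_comm, sym_sq]
  have h := L.sym_right 1
  rw [sym_one, Nat.cast_one, one_smul, one_mul, mul_one] at h
  rw [← L.S_zero, Nat.choose_one_right, ← h]
  norm_num

theorem sym_dots_sandwich (k : ℕ) :
    ∀ i < k, (k : ℂ) • (L.sym k * L.D i * L.sym k) = L.dots k * L.sym k := by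
  have step : ∀ i, i + 1 < k → L.sym k * L.D (i + 1) * L.sym k = L.sym k * L.D i * L.sym k := by
    intro i hi
    have h : L.D (i + 1) = L.S i * L.D i * L.S i := by
      rw [S_mul_D, mul_assoc, S, ← map_mul, s_sq, map_one, mul_one]
    have h1 : L.sym k * L.S i = L.sym k := L.isCoxeter.symz_mul_gen hi
    have h2 : L.S i * L.sym k = L.sym k := L.isCoxeter.gen_mul_symz hi
    rw [h, ← mul_assoc, ← mul_assoc, h1, mul_assoc _ (L.S i), h2]
  have all : ∀ i < k, L.sym k * L.D i * L.sym k = L.sym k * L.d * L.sym k := by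
    intro i
    induction i with
    | zero => intro _; rfl
    | succ i ih => intro hi; rw [step i hi, ih (by omega)]
  have sum : ∀ m ≤ k, (m : ℂ) • (L.sym k * L.d * L.sym k) = L.sym k * L.dots m * L.sym k := by
    intro m
    induction m with
    | zero => intro _; simp [dots]
    | succ m ih =>
      intro hm
      have e : L.sh m (L.dots 1) = L.D m := by rw [dots, dots, map_zero, add_zero]; rfl
      rw [dots_add, mul_add, add_mul, ← ih (by omega), e, all m hm, Nat.cast_succ, add_smul,
        one_smul]
  intro i hi
  rw [all i hi, sum k le_rfl, sym_comm_dots, mul_assoc, sym_sq]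

theorem uval_idRight_dt (k l : ℕ) {x y : List ℕ+} (hx : x = up k ++ up l) (hy : y = up k ++ up l) :
    L.uval (Term.idRight (dt k) (up l) hx hy) = L.dots k * L.bl k l := by
  have h := (L.isLocal_dots k).slide_par (L.isLocal_sym l)
  rw [koszul_zero_right, one_smul] at h
  rw [uval_idRight, uval_dt, thick_up, ← mul_assoc, ← h, mul_assoc]
  rfl

theorem uval_idLeft_dt (k l : ℕ) {x y : List ℕ+} (hx : x = up k ++ up l) (hy : y = up k ++ up l) :
    L.uval (Term.idLeft (up k) (dt l) hx hy) = L.sh k (L.dots l) * L.bl k l := by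
  rw [uval_idLeft, uval_dt, map_mul, mul_assoc]
  rfl

theorem bl_sandwich_left (k l : ℕ) : (k : ℂ) • (L.blk k l 0 * L.D (k - 1) * L.blk k l 0) =
    L.dots k * L.bl k l := by
  rcases k with _ | k
  · rw [Nat.cast_zero, zero_smul, dots, zero_mul]
  have h1 : L.D k * L.sh (k + 1) (L.sym l) = L.sh (k + 1) (L.sym l) * L.D k := by
    have := ((L.isLocal_d).sh k).slide_par (L.isLocal_sym l)
    rwa [koszul_zero_right, one_smul] at this
  have h2 := (L.isLocal_dots (k + 1)).slide_par (L.isLocal_sym l)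
  rw [koszul_zero_right, one_smul] at h2
  have h3 := L.sym_dots_sandwich (k + 1) k (Nat.lt_succ_self k)
  rw [blk_zero_right, Nat.add_sub_cancel]
  calc _ = ((k + 1 : ℕ) : ℂ) • (L.sh (k + 1) (L.sym l) * (L.sh (k + 1) (L.sym l) *
        (L.sym (k + 1) * L.D k * L.sym (k + 1)))) := by
        rw [bl]
        simp only [mul_assoc]
        rw [← mul_assoc (L.D k), h1, mul_assoc, ← mul_assoc (L.sym (k + 1)) (L.sh _ _), sym_mul_sh,
          mul_assoc]
    _ = _ := by
        rw [← mul_assoc, ← map_mul, sym_sq, ← mul_smul_comm, h3, ← mul_assoc, ← h2, mul_assoc]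
        rfl

theorem bl_sandwich_right (k l : ℕ) : (l : ℂ) • (L.blk k l 0 * L.D k * L.blk k l 0) =
    L.sh k (L.dots l) * L.bl k l := by
  rcases l with _ | l
  · rw [Nat.cast_zero, zero_smul, dots, map_zero, zero_mul]
  have h3 := congrArg (L.sh k) (L.sym_dots_sandwich (l + 1) 0 (Nat.succ_pos l))
  rw [map_smul, map_mul, map_mul, map_mul, sh_D] at h3
  have h4 : L.sym k * L.D k = L.D k * L.sym k := L.sym_mul_sh k L.d
  rw [blk_zero_right, bl, mul_assoc _ (L.sym k), h4]
  calc _ = ((l + 1 : ℕ) : ℂ) • (L.sh k (L.sym (l + 1)) * L.D (k + 0) * L.sh k (L.sym (l + 1)) *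
        L.sym k) := by
        rw [add_zero]
        simp only [mul_assoc]
        rw [← mul_assoc (L.sym k), sym_mul_sh, mul_assoc, sym_sq]
    _ = _ := by rw [← smul_mul_assoc, h3, mul_assoc]

theorem uval_relation {a b : List ℕ+} {s t : Term UpGen a b} (h : UpRel s t) :
    L.uval s = L.uval t := by
  have choose_bl : ∀ k l, L.bl k l * L.sym (k + l) = L.sym (k + l) :=
    fun k l => L.sh_mul_sym_mul k l rfl
  have D_eq : ∀ i, L.sh i L.d = L.D i := fun _ => rfl
  cases h with
  | merge_assoc h k l =>
    rw [uval_comp, uval_comp, uval_idRight, uval_idLeft, uval_mrg, uval_mrg, uval_mrg, uval_mrg,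
      List.map_append, thick_append, thick_up, thick_up, L.sh_mul_sym_mul _ _ rfl,
      L.sh_mul_sym_mul _ _ (by omega)]
  | split_assoc h k l =>
    rw [uval_comp, uval_comp, uval_idRight, uval_idLeft, uval_spl, uval_spl, uval_spl, uval_spl,
      thick_up, map_smul]
    simp only [mul_smul_comm, smul_mul_assoc]
    rw [L.sym_mul_sh_mul _ _ rfl, L.sym_mul_sh_mul _ _ (by omega), smul_smul, smul_smul]
    congr 1
    have e := Nat.choose_mul (n := h + k + l) (k := h + k) (s := h) (by omega)
    rw [show h + k + l - h = k + l by omega, show h + k - h = k by omega] at e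
    rw [mul_comm ((h + k).choose h : ℂ), mul_comm ((k + l).choose k : ℂ)]
    exact_mod_cast e
  | digon k l =>
    rw [uval_comp, uval_mrg, uval_spl, uval_smul, uval_id, smul_mul_assoc, sym_sq]
    rw [Nat.choose_symm_add]
  | dot_dot k =>
    rw [uval_comp, uval_smul, uval_id, uval_dt, mul_assoc, ← mul_assoc (L.sym k), sym_comm_dots,
      mul_assoc, sym_sq, ← mul_assoc, dots_sq, smul_mul_assoc, one_mul]
  | dot_merge k l =>
    rw [uval_add, uval_comp, uval_comp, uval_comp, uval_idRight_dt, uval_idLeft_dt, uval_mrg,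
      uval_dt, ← mul_assoc, sym_comm_dots, mul_assoc, sym_sq, dots_add, mul_assoc _ (L.bl k l),
      mul_assoc _ (L.bl k l), choose_bl, add_mul]
  | dot_split k l =>
    rw [uval_add, uval_comp, uval_comp, uval_comp, uval_idRight_dt, uval_idLeft_dt, uval_spl,
      uval_dt, ← mul_add, ← add_mul, ← dots_add, smul_mul_assoc, ← mul_assoc, sym_comm_dots,
      mul_assoc _ (L.sym _) (L.bl k l), bl, L.sym_mul_sh_mul _ _ rfl, mul_smul_comm, mul_assoc,
      sym_sq]
  | dumbbell =>
    have hd : L.uval ((dt 1).tens (dt 1)) = L.τ L.d * L.d :=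
      congrArg₂ (fun x y => L.τ x * y) L.uval_dot L.uval_dot
    have h1 : L.τ L.d * L.d * (L.s * (L.τ L.d * L.d)) = L.s := by
      rw [mul_assoc, ← mul_assoc L.d, L.d_mul_s, mul_assoc, ← mul_assoc (L.τ L.d) (L.τ L.d),
        ← map_mul, d_sq, map_one, one_mul, ← mul_assoc, τ_d_s, mul_assoc, d_sq, mul_one]
    have h2 : L.τ L.d * L.d * (L.τ L.d * L.d) = -1 := by
      rw [mul_assoc, ← mul_assoc L.d, d_τ_d, neg_mul, mul_assoc, d_sq, mul_one, mul_neg, ← map_mul,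
        d_sq, map_one]
    rw [uval_add, uval_comp, uval_comp, uval_dumbbell, hd, add_mul, mul_add, one_mul, h1, h2,
      uval_smul, show L.uval (Term.id (up 1 ++ up 1)) = 1 from (L.idv_up_up 1 1).trans (by
        rw [bl, sym_one, map_one, one_mul])]
    module
  | square_switch k l =>
    rw [uval_sub, uval_smul, uval_ladFE, uval_ladEF, uval_plain, map_one, map_one, one_mul, mul_one,
      show L.uval (Term.id (up k ++ up l)) = L.blk k l 0 from
        (L.idv_up_up k l).trans (L.blk_zero_right k l).symm]
    simp only [mul_add, add_mul, mul_smul_comm, smul_mul_assoc, mul_one, blk_sq]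
    module
  | square_switch_dot k l =>
    have e : ∀ X : R, (k : ℂ) • (L.D k * (L.S (k - 1) * X)) =
        (k : ℂ) • (L.S (k - 1) * (L.D (k - 1) * X)) := fun X => by
      rcases k with _ | k
      · rw [Nat.cast_zero, zero_smul, zero_smul]
      · rw [← mul_assoc, Nat.add_sub_cancel, ← S_mul_D, mul_assoc]
    rw [uval_sub, uval_sub, uval_ladFE, uval_ladEF, uval_plain, uval_dot, map_one, map_one, one_mul,
      mul_one, uval_idRight_dt, uval_idLeft_dt, ← bl_sandwich_left, ← bl_sandwich_right, D_eq, D_eq]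
    have e' := congrArg (fun Y => (l : ℂ) • (L.blk k l 0 * Y)) (e (L.blk k l 0))
    simp only [mul_add, add_mul, mul_smul_comm, smul_mul_assoc, mul_one, mul_assoc] at e' ⊢
    linear_combination (norm := module) -e'
  | square_switch_dot' k l =>
    have e : ∀ X : R, (k : ℂ) • (L.D (k - 1) * (L.S (k - 1) * X)) =
        (k : ℂ) • (L.S (k - 1) * (L.D k * X)) := fun X => by
      rcases k with _ | k
      · rw [Nat.cast_zero, zero_smul, zero_smul]
      · rw [← mul_assoc, Nat.add_sub_cancel, D_mul_S, mul_assoc]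
    rw [uval_sub, uval_sub, uval_ladFE, uval_ladEF, uval_plain, uval_dot, map_one, map_one, one_mul,
      mul_one, uval_idRight_dt, uval_idLeft_dt, ← bl_sandwich_left, ← bl_sandwich_right, D_eq, D_eq]
    have e' := congrArg (fun Y => (l : ℂ) • (L.blk k l 0 * Y)) (e (L.blk k l 0))
    simp only [mul_add, add_mul, mul_smul_comm, smul_mul_assoc, mul_one, mul_assoc] at e' ⊢
    linear_combination (norm := module) e'
  | double_rungs h k l =>
    have hc : ∀ X, L.D (h + k) * (L.sh h (cyDown L.S k) * X) = L.sh h (cyDown L.S k) * (L.D h * X) :=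
      fun X => by rw [← mul_assoc, D_mul_cyDown, mul_assoc]
    have hd : ∀ X, L.D h * (L.D h * X) = X := fun X => by rw [← mul_assoc, D_sq, one_mul]
    have ha : ∀ X, (k : ℂ) • (L.D h * (L.D (h + k) * X)) = -((k : ℂ) • (L.D (h + k) * (L.D h * X))) :=
        fun X => by
      rcases k with _ | k
      · simp
      · rw [← mul_assoc, L.D_mul_D (by omega), neg_mul, mul_assoc, smul_neg]
    rw [uval_sub, uval_add, uval_ladE2E1, uval_ladE2E1, uval_ladE1E2, uval_ladE1E2, uval_plain,
      uval_dot, map_one, map_one, D_eq, D_eq]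
    simp only [mul_add, add_mul, mul_smul_comm, smul_mul_assoc, mul_one, one_mul, mul_assoc, hc, hd]
    have := congrArg (fun Y => ((l : ℂ) + 1) • (L.blk h k (l + 1) * Y)) (ha (L.blk (h + 1) k l))
    simp only [mul_smul_comm, mul_neg] at this
    linear_combination (norm := module) -this
  | double_rungs_dot h k l =>
    have hc : ∀ X, L.D (h + k) * (L.sh h (cyDown L.S k) * X) = L.sh h (cyDown L.S k) * (L.D h * X) :=
      fun X => by rw [← mul_assoc, D_mul_cyDown, mul_assoc]
    rw [uval_sub, uval_sub, uval_ladE2E1, uval_ladE2E1, uval_ladE1E2, uval_ladE1E2, uval_plain,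
      uval_dot, map_one, map_one, D_eq, D_eq]
    simp only [mul_add, add_mul, mul_smul_comm, smul_mul_assoc, mul_one, one_mul, mul_assoc, hc]
    module
  | double_rungs' h k l =>
    have hc : ∀ X, L.D h * (L.sh h (cyUp L.S k) * X) = L.sh h (cyUp L.S k) * (L.D (h + k) * X) :=
      fun X => by rw [← mul_assoc, D_mul_cyUp, mul_assoc]
    have hd : ∀ X, L.D (h + k) * (L.D (h + k) * X) = X := fun X => by
      rw [← mul_assoc, D_sq, one_mul]
    have ha : ∀ X, (k : ℂ) • (L.D h * (L.D (h + k) * X)) = -((k : ℂ) • (L.D (h + k) * (L.D h * X))) :=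
        fun X => by
      rcases k with _ | k
      · simp
      · rw [← mul_assoc, L.D_mul_D (by omega), neg_mul, mul_assoc, smul_neg]
    rw [uval_sub, uval_add, uval_ladF1F2, uval_ladF1F2, uval_ladF2F1, uval_ladF2F1, uval_plain,
      uval_dot, map_one, map_one, D_eq, D_eq]
    simp only [mul_add, add_mul, mul_smul_comm, smul_mul_assoc, mul_one, one_mul, mul_assoc, hc, hd]
    have := congrArg (fun Y => ((h : ℂ) + 1) • (L.blk (h + 1) k l * Y)) (ha (L.blk h k (l + 1)))
    simp only [mul_smul_comm, mul_neg] at this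
    linear_combination (norm := module) -this
  | double_rungs_dot' h k l =>
    have hc : ∀ X, L.D h * (L.sh h (cyUp L.S k) * X) = L.sh h (cyUp L.S k) * (L.D (h + k) * X) :=
      fun X => by rw [← mul_assoc, D_mul_cyUp, mul_assoc]
    rw [uval_sub, uval_sub, uval_ladF1F2, uval_ladF1F2, uval_ladF2F1, uval_ladF2F1, uval_plain,
      uval_dot, map_one, map_one, D_eq, D_eq]
    simp only [mul_add, add_mul, mul_smul_comm, smul_mul_assoc, mul_one, one_mul, mul_assoc, hc]
    module

end Leavitt

end UpwardValues

section OrientedValues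

theorem thick_map_ones : ∀ k : ℕ, thick ((ones k).map OrOb.up) = k
  | 0 => rfl
  | k + 1 => by
    rw [ones, List.map_append, thick_append, thick_up, thick_map_ones k, Nat.add_comm]

namespace Leavitt

variable {N : ℕ} {R : Type} [Ring R] [Algebra ℂ R] (L : Leavitt N R)

theorem idv_ones : ∀ k : ℕ, L.idv ((ones k).map OrOb.up) = 1
  | 0 => rfl
  | k + 1 => by
    rw [ones, List.map_append, idv_append, idv_ones k, map_one, idv_up, sym_one, mul_one]

theorem uval_idLeft_one {b c x y : List ℕ+} (t : Term UpGen b c) (hx : x = up 1 ++ b)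
    (hy : y = up 1 ++ c) : L.uval (Term.idLeft (up 1) t hx hy) = L.τ (L.uval t) := by
  rw [uval_idLeft, sym_one, mul_one, sh_one]

theorem uval_idRight_ones {b c x y : List ℕ+} (t : Term UpGen b c) (k : ℕ) (hx : x = b ++ ones k)
    (hy : y = c ++ ones k) : L.uval (Term.idRight t (ones k) hx hy) = L.uval t := by
  refine (L.val_idRight _ (toOr t) (by rw [hx, List.map_append])
    (by rw [hy, List.map_append])).trans ?_
  rw [idv_ones, map_one, one_mul]
  rfl

theorem uval_explode (k : ℕ) : L.uval (explode k) = (k.factorial : ℂ) • L.sym k := by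
  induction k with
  | zero => rw [Nat.factorial_zero, Nat.cast_one, one_smul]; rfl
  | succ k ih =>
    have e : L.sym (k + 1) * L.τ (L.sym k) = L.sym (k + 1) := by
      rw [← sh_one, sh_sym]; exact L.isCoxeter.symz_mul_shift (by omega)
    have h1 : L.uval (spl 1 k (m := k + 1) (by omega)) = ((k + 1 : ℕ) : ℂ) • L.sym (k + 1) :=
      (L.uval_spl 1 k _).trans (by rw [Nat.choose_one_right])
    refine (congrArg₂ (· * ·) h1 (L.uval_idLeft_one (explode k) _ rfl)).trans ?_
    rw [ih, map_smul, smul_mul_smul_comm, e, Nat.factorial_succ, Nat.cast_mul]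

theorem uval_implode (k : ℕ) : L.uval (implode k) = L.sym k := by
  induction k with
  | zero => rfl
  | succ k ih =>
    have e : L.τ (L.sym k) * L.sym (k + 1) = L.sym (k + 1) := by
      rw [← sh_one, sh_sym]; exact L.isCoxeter.shift_mul_symz (by omega)
    refine (congrArg₂ (· * ·) (L.uval_idLeft_one (implode k) rfl rfl) (L.uval_mrg 1 k _)).trans ?_
    rw [ih, e]

theorem uval_thinCross : L.uval thinCross = L.s := by
  rw [thinCross, uval_sub, uval_dumbbell, show L.uval (Term.id (up 1 ++ up 1)) = 1 from
    (L.idv_up_up 1 1).trans (by rw [bl, sym_one, map_one, one_mul]), add_sub_cancel_left]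

theorem uval_thinPass (l : ℕ) : L.uval (thinPass l) = L.pass l := by
  induction l with
  | zero =>
    rw [pass_zero, thinPass]
    exact (L.uval_ofEq (a := up 1 ++ ones 0) (b := up 1) rfl).trans (L.idv_ones 1)
  | succ l ih =>
    refine (congrArg₂ (· * ·) (L.uval_idRight_ones thinCross l rfl rfl)
      (L.uval_idLeft_one (thinPass l) rfl rfl)).trans ?_
    rw [uval_thinCross, ih, pass_succ']

theorem uval_thinGrid (k l : ℕ) : L.uval (thinGrid k l) = L.grid k l := by
  induction k with
  | zero =>
    rw [thinGrid]
    exact (L.uval_ofEq (a := ones l) (b := ones l ++ ones 0) (List.append_nil _).symm).trans (L.idv_ones l)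
  | succ k ih =>
    refine (congrArg₂ (· * ·) (L.uval_idLeft_one (thinGrid k l) rfl rfl)
      (L.uval_idRight_ones (thinPass l) k rfl rfl)).trans ?_
    rw [uval_thinPass, ih, grid]

theorem bl_mul_grid (k l : ℕ) : L.bl k l * L.grid k l = L.grid k l * L.bl l k :=
  L.sh_mul_sym_mul_grid k l

theorem uval_thickCross (k l : ℕ+) : L.uval (thickCross k l) = L.bl k l * L.grid k l := by
  have h1 : L.uval (Term.tensor (explode k) (explode l) (x := [k, l]) (by simp [up_coe]) rfl) =
      ((k : ℕ).factorial * (l : ℕ).factorial : ℂ) • L.bl k l := by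
    refine (L.val_tensor (toOr (explode k)) (toOr (explode l)) _ _).trans ?_
    rw [thick_up]
    change L.sh k (L.uval (explode l)) * L.uval (explode k) = _
    rw [uval_explode, uval_explode, map_smul, smul_mul_smul_comm, mul_comm (Nat.cast _)]
    rfl
  have h2 : L.uval (Term.tensor (implode l) (implode k) (y := [l, k]) rfl (by simp [up_coe])) =
      L.bl l k := by
    refine (L.val_tensor (toOr (implode l)) (toOr (implode k)) _ _).trans ?_
    rw [thick_map_ones]
    change L.sh l (L.uval (implode k)) * L.uval (implode l) = _
    rw [uval_implode, uval_implode]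
    rfl
  have h3 : ((k : ℕ).factorial * (l : ℕ).factorial : ℂ) ≠ 0 :=
    mul_ne_zero (Nat.cast_ne_zero.2 (Nat.factorial_ne_zero _))
      (Nat.cast_ne_zero.2 (Nat.factorial_ne_zero _))
  rw [thickCross, uval_smul, uval_comp, uval_comp, h1, h2, uval_thinGrid, smul_mul_assoc,
    smul_smul, one_div, inv_mul_cancel₀ h3, one_smul, ← bl_mul_grid, ← mul_assoc, bl_sq]

theorem val_leftCross (k l : ℕ+) : L.val (leftCross k l) = L.bl k l * L.grid k l := by
  have h0 : L.val (leftCross k l) = L.sh (k + l) (L.ncup k * L.sym k) * L.idv [.down k, .up l] *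
      (L.sh k (L.sh (l + k) (L.idv [OrOb.down k]) * L.uval (thickCross l k)) * L.idv [.down k] *
        (L.sh (k + k) (L.idv [.up l, .down k]) * (L.sym k * L.ncap k))) := rfl
  rw [h0, idv_pair, idv_pair, idv_single, uval_thickCross]
  change L.sh (k + l) (L.ncup k * L.sym k) * L.bl k l *
    (L.sh k (L.sh (l + k) (L.sym k) * (L.bl l k * L.grid l k)) * L.sym k *
      (L.sh (k + k) (L.bl l k) * (L.sym k * L.ncap k))) = _
  generalize (k : ℕ) = k
  generalize (l : ℕ) = l
  have cap : L.sh (k + k) (L.bl l k) * (L.sym k * L.ncap k) = L.sym k * L.ncap k * L.bl l k :=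
    ((((L.isLocal_sym k).pad k).mul (L.isLocal_ncap k)).cast rfl rfl
      (add_zero 0)).slide_even (L.bl l k) |>.symm
  have cup : L.sh (k + l) (L.ncup k * L.sym k) * L.sh (k + l) (L.sh k (L.sym k) * L.sym k) =
      L.sh (k + l) (L.ncup k * L.sym k) := by
    rw [← map_mul, ← mul_assoc, ncup_absorb, mul_assoc, sym_sq]
  have mid : L.sh k (L.sh (l + k) (L.sym k) * (L.bl l k * L.grid l k)) =
      L.sh (k + l) (L.sh k (L.sym k) * L.sym k) * L.sh k (L.sym l) * L.sh k (L.grid l k) := by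
    rw [bl, map_mul, map_mul, map_mul, map_mul, ← sh_add, ← sh_add, ← sh_add, Nat.add_assoc k l k]
    simp only [mul_assoc]
  have hl : L.bl k l * L.sh k (L.sym l) = L.bl k l := by
    rw [bl, mul_assoc, sym_mul_sh, ← mul_assoc, ← map_mul, sym_sq]
  have hk : L.bl k l * L.sym k = L.bl k l := by rw [bl, mul_assoc, sym_sq]
  have gr : L.sh (k + l) (L.sym k) * L.sh k (L.grid l k) = L.sh k (L.grid l k) * L.sh k (L.sym k) := by
    rw [sh_add, ← map_mul, L.grid_natural (L.isLocal_sym k), map_mul]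
  have cl : L.sh (k + l) (L.ncup k * L.sym k) * L.sh k (L.sym l) =
      L.sh k (L.sym l) * L.sh (k + l) (L.ncup k * L.sym k) := by
    rw [sh_add, ← map_mul, ← map_mul, sym_mul_sh]
  calc _ = L.bl k l * (L.sh (k + l) (L.ncup k * L.sym k) * L.sh (k + l) (L.sh k (L.sym k) * L.sym k)) *
        L.sh k (L.sym l) * L.sh k (L.grid l k) * (L.sym k * (L.sym k * L.ncap k)) * L.bl l k := by
        rw [cap, mid, ← (L.isLocal_bl k l).slide_even]
        simp only [mul_assoc]
    _ = L.bl k l * L.sh (k + l) (L.ncup k) * (L.sh (k + l) (L.sym k) * L.sh k (L.grid l k)) *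
        (L.sym k * L.ncap k) * L.bl l k := by
        rw [cup, mul_assoc (L.bl k l), cl, ← mul_assoc (L.bl k l), hl, ← mul_assoc (L.sym k), sym_sq, map_mul]
        simp only [mul_assoc]
    _ = L.bl k l * (L.sh (k + l) (L.ncup k) * L.sh k (L.grid l k) * L.sym k) * L.ncap k *
        L.bl l k := by
        rw [gr, mul_assoc _ (_ * L.sh k (L.sym k)), mul_assoc _ (L.sh k (L.sym k)), ncap_absorb]
        simp only [mul_assoc]
    _ = L.bl k l * L.grid k l * L.bl l k := by
        rw [sh_add, ← map_mul, ← sym_mul_sh, ← mul_assoc, hk, mul_assoc (L.bl k l), rotate_grid]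
    _ = _ := by rw [mul_assoc, ← bl_mul_grid, ← mul_assoc, bl_sq]

theorem val_rel {a b : List OrOb} {s t : Term OrGen a b} (h : OrRel s t) :
    L.val s = L.val t := by
  cases h with
  | upward h => exact L.uval_relation h
  | zigzag_up k =>
    refine Eq.trans (?_ : _ = L.sym k) (L.idv_single (OrOb.up k)).symm
    change L.idv [.up k] * (L.ncup k * L.sym k) * (L.sh k (L.sym k * L.ncap k) * L.idv [.up k]) = _
    rw [idv_single]
    change L.sym k * (L.ncup k * L.sym k) * (L.sh k (L.sym k * L.ncap k) * L.sym k) = _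
    generalize (k : ℕ) = k
    rw [map_mul, mul_assoc (L.sh k _), mul_assoc, ← mul_assoc _ (L.sh k (L.sym k)), ncup_absorb,
      ← sym_mul_sh, mul_assoc, ← mul_assoc (L.sym k) (L.sym k), sym_sq, sym_mul_sh, ← mul_assoc _
      (L.sh k _), ncup_mul_ncap, one_mul, sym_sq]
  | zigzag_down k =>
    refine Eq.trans (?_ : _ = L.sym k) (L.idv_single (OrOb.down k)).symm
    change L.sh k (L.ncup k * L.sym k) * L.idv [.down k] *
      (L.sh (k + k) (L.idv [.down k]) * (L.sym k * L.ncap k)) = _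
    rw [idv_single]
    change L.sh k (L.ncup k * L.sym k) * L.sym k * (L.sh (k + k) (L.sym k) * (L.sym k * L.ncap k)) = _
    generalize (k : ℕ) = k
    have cap : L.sh (k + k) (L.sym k) * (L.sym k * L.ncap k) = L.sym k * L.ncap k * L.sym k :=
      ((((L.isLocal_sym k).pad k).mul (L.isLocal_ncap k)).cast rfl rfl
        (add_zero 0)).slide_even (L.sym k) |>.symm
    rw [cap, ← mul_assoc, mul_assoc _ (L.sym k) (_ * _), ← mul_assoc (L.sym k) (L.sym k), sym_sq,
      map_mul, mul_assoc _ (L.sh k (L.sym k)), ncap_absorb, ← mul_assoc, ← sym_mul_sh, mul_assoc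
      (L.sym k), sh_ncup_mul_ncap, mul_one, sym_sq]
  | left_right k l =>
    refine Eq.trans (?_ : _ = L.bl k l) (L.idv_pair (OrOb.down k) (OrOb.up l)).symm
    have h : L.val (rightCross l k) = L.bl l k * L.grid l k := rfl
    rw [val_comp, val_leftCross, h, bl_mul_grid, mul_assoc, ← mul_assoc (L.bl l k), bl_sq,
      ← mul_assoc, ← bl_mul_grid, mul_assoc, grid_mul_grid, mul_one]
  | right_left k l =>
    refine Eq.trans (?_ : _ = L.bl l k) (L.idv_pair (OrOb.up l) (OrOb.down k)).symm
    have h : L.val (rightCross l k) = L.bl l k * L.grid l k := rfl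
    rw [val_comp, val_leftCross, h, bl_mul_grid, mul_assoc, ← mul_assoc (L.bl k l), bl_sq,
      ← mul_assoc, ← bl_mul_grid, mul_assoc, grid_mul_grid, mul_one]
  | delete_bubble k =>
    refine (L.isLocal_val (p := 1) ?_).eq_zero
    exact .even_comp (cup_parity k) (.even_comp (rightCross_parity k k)
      (.comp_even (.idLeft (.gen (OrGen.dot k)) _ _) (cap_parity k)))

theorem val_eq_of_orMor_eq {a b : List OrOb} {s t : Term OrGen a b} (h : orMor s = orMor t) :
    L.val s = L.val t := L.val_eqv L.val_rel (mor_exact h)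

end Leavitt

end OrientedValues

section Separation

namespace Leavitt

variable {N : ℕ} {R : Type} [Ring R] [Algebra ℂ R] (L : Leavitt N R)

/-! ### Values of thin webs -/

theorem uval_congr {a b : List ℕ+} {s t : Term UpGen a b} (h : uo [] s = uo [] t) :
    L.uval s = L.uval t := L.val_eq_of_orMor_eq (oo_inj (oo_toOr_congr h []))

/-- The family `F` of operators is represented by a thin web of value `G`. -/
def Rep (n : ℕ) (F : UpFam) (G : R) : Prop :=
  ∃ t : Term UpGen (ones n) (ones n), F = (fun w => uo w t) ∧ L.uval t = G

variable {L} {n : ℕ} {p : ZMod 2} {F F' : UpFam} {G G' : R}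

namespace Rep

theorem unique (h : L.Rep n F G) (h' : L.Rep n F G') : G = G' := by
  obtain ⟨s, rfl, rfl⟩ := h
  obtain ⟨t, e, rfl⟩ := h'
  exact L.uval_congr (congrFun e [])

theorem one (n : ℕ) : L.Rep n (thinI n) 1 :=
  ⟨.id _, funext fun w => (uo_id w (ones n)).symm, L.idv_ones n⟩

theorem zero (n : ℕ) : L.Rep n 0 0 := ⟨0, funext fun w => (uo_zero w).symm, rfl⟩

theorem add (h : L.Rep n F G) (h' : L.Rep n F' G') : L.Rep n (F + F') (G + G') := by
  obtain ⟨s, rfl, rfl⟩ := h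
  obtain ⟨t, rfl, rfl⟩ := h'
  exact ⟨s + t, funext fun w => (uo_add w s t).symm, rfl⟩

theorem smul (c : ℂ) (h : L.Rep n F G) : L.Rep n (c • F) (c • G) := by
  obtain ⟨s, rfl, rfl⟩ := h
  exact ⟨c • s, funext fun w => (uo_smul w c s).symm, rfl⟩

theorem sum {f : ℕ → UpFam} {g : ℕ → R} {m : ℕ} (h : ∀ j < m, L.Rep n (f j) (g j)) :
    L.Rep n (∑ j ∈ Finset.range m, f j) (∑ j ∈ Finset.range m, g j) := by
  induction m with
  | zero => rw [Finset.sum_range_zero, Finset.sum_range_zero]; exact zero n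
  | succ m ih =>
    rw [Finset.sum_range_succ, Finset.sum_range_succ]
    exact (ih fun j hj => h j (by omega)).add (h m (by omega))

theorem mul (h : L.Rep n F G) (h' : L.Rep n F' G') : L.Rep n (F * F') (G * G') := by
  obtain ⟨s, rfl, rfl⟩ := h
  obtain ⟨t, rfl, rfl⟩ := h'
  exact ⟨s ⨟ t, funext fun w => (uo_comp w s t).symm, rfl⟩

theorem shift (h : L.Rep n F G) : L.Rep (n + 1) (QWeb.sh F) (L.τ G) := by
  obtain ⟨t, rfl, rfl⟩ := h
  exact ⟨Term.idLeft (up 1) t rfl rfl, funext fun w =>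
    (uo_idLeft w (a := up 1) t rfl rfl).symm, L.uval_idLeft_one t rfl rfl⟩

theorem dot (h : L.Rep n F G) : L.Rep (n + 1) (QWeb.sh F * thinD) (L.τ G * L.d) := by
  obtain ⟨t, rfl, rfl⟩ := h
  refine ⟨(dt 1).tens t, funext fun w => (uo_tens w (dt 1) t).symm, ?_⟩
  refine (L.val_tensor (toOr (dt 1)) (toOr t) _ _).trans ?_
  rw [thick_up]
  exact congrArg (_ * ·) L.uval_dot

theorem thinI_mul (h : L.Rep n F G) : thinI n * F = F := by
  obtain ⟨t, rfl, -⟩ := h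
  exact funext fun w => uI_mul_uo t List.prefix_rfl

theorem cross (n : ℕ) : L.Rep (n + 2) (thinI (n + 2) * thinX) L.s :=
  ⟨Term.idRight thinCross (ones n) rfl rfl, funext fun w => by
      refine Eq.trans ?_ (uo_idRight w (a := ones n) thinCross rfl rfl).symm
      rfl,
    (L.uval_idRight_ones thinCross n rfl rfl).trans L.uval_thinCross⟩

end Rep

variable (L) in
/-- The value of `cyc j`. -/
def cycv : ℕ → R
  | 0 => 1
  | j + 1 => L.τ (cycv j) * L.s

theorem rep_cyc : ∀ (j n : ℕ), j < n → L.Rep n (cyc j * thinI n) (L.cycv j)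
  | 0, n, _ => by
    rw [cyc_zero_mul (IsMk.one n)]
    exact Rep.one n
  | j + 1, 0, h => absurd h (by omega)
  | j + 1, 1, h => absurd h (by omega)
  | j + 1, n + 2, h => by
    have h1 := (rep_cyc j (n + 1) (by omega)).shift.mul (Rep.cross (L := L) n)
    have e : QWeb.sh (cyc j * thinI (n + 1)) * (thinI (n + 2) * thinX) = cyc (j + 1) * thinI (n + 2) := by
      rw [sh_mul, sh_thinI, mul_assoc, ← mul_assoc (thinI _), (IsMk.one (n + 2)).mul_thinI,
        cyc_succ, mul_assoc, thinX_mul_thinI]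
    rw [e] at h1
    exact h1

theorem Rep.cyc_mul (h : L.Rep n F G) {j : ℕ} (hj : j < n) : L.Rep n (cyc j * F) (L.cycv j * G) := by
  have h1 := (rep_cyc (L := L) j n hj).mul h
  rwa [mul_assoc, h.thinI_mul] at h1

/-! ### Inserting words of even letters -/

variable (L)

/-- Insert a word of even letters. -/
def insWord : List (Fin N) → R
  | [] => 1
  | x :: v => insWord v * L.ι (x, 0)

theorem ι_ι_s (x y : Fin N) : L.ι (x, 0) * L.ι (y, 0) * L.s = L.ι (y, 0) * L.ι (x, 0) := by
  have h : L.ι (y, 0) * L.s = L.τ (L.ι (y, 0)) := by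
    rw [s, pass, Finset.mul_sum, Finset.sum_eq_single (y, 0)]
    · rw [del, ins, Q_zero, mul_one, one_mul, ← mul_assoc, L.ι_δ, if_pos rfl, one_mul, sh_one]
    · intro z _ hz
      rw [del, ← mul_assoc, ← mul_assoc, L.ι_δ, if_neg hz.symm, zero_mul, zero_mul]
    · exact fun h => absurd (Finset.mem_univ _) h
  rw [mul_assoc, h, L.ι_τ]

theorem ι_d (x : Fin N) : L.ι (x, 0) * L.d = L.P * L.ι (x, 1) := by
  rw [d, Finset.mul_sum, Finset.sum_eq_single (x, 0)]
  · rw [del, ins, Q_zero, mul_one, ← mul_assoc, L.ι_δ, if_pos rfl, one_mul, zero_add, Q_one]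
  · intro z _ hz
    rw [del, ← mul_assoc, ← mul_assoc, L.ι_δ, if_neg hz.symm, zero_mul, zero_mul]
  · exact fun h => absurd (Finset.mem_univ _) h

theorem insWord_mul_cycv : ∀ (v : List (Fin N)) (j : ℕ) (hj : j < v.length),
    L.insWord v * L.cycv j = L.insWord (v.eraseIdx j) * L.ι (v[j], 0)
  | [], j, hj => absurd hj (Nat.not_lt_zero j)
  | x :: v, 0, _ => by rw [cycv, mul_one]; rfl
  | x :: v, j + 1, hj => by
    have hj' : j < v.length := Nat.lt_of_succ_lt_succ hj
    rw [cycv, insWord, ← mul_assoc, mul_assoc (L.insWord v), L.ι_τ, ← mul_assoc,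
      insWord_mul_cycv v j hj', mul_assoc, mul_assoc, ← mul_assoc (L.ι _), ι_ι_s, ← mul_assoc]
    rfl

/-- The coefficients of a normal form are determined by its values on words of distinct even letters. -/
theorem insWord_mul_coeff {m : ℕ} (hn : n < N) {Z Z' : ℕ → R} (hm : m < n + 1)
    (h : ∀ v : List (Fin N), v.Nodup → v.length = n + 1 → L.insWord v *
      ∑ j ∈ Finset.range (n + 1), L.cycv j * (L.τ (Z j) + L.τ (Z' j) * L.d) = 0)
    {w : List (Fin N)} (hw : w.Nodup) (hl : w.length = n) :
    L.insWord w * Z m = 0 ∧ L.insWord w * Z' m = 0 := by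
  obtain ⟨x, hx⟩ : ∃ x, x ∉ w := by
    by_contra! hc
    have h1 : Finset.univ ⊆ w.toFinset := fun x _ => List.mem_toFinset.2 (hc x)
    have h2 := Finset.card_le_card h1
    have h3 := w.toFinset_card_le
    rw [Finset.card_univ, Fintype.card_fin] at h2
    omega
  set v := w.insertIdx m x with hv
  have hp : v.Perm (x :: w) := List.perm_insertIdx x w (by omega)
  have hnd : v.Nodup := hp.nodup_iff.2 (List.nodup_cons.2 ⟨hx, hw⟩)
  have hlen : v.length = n + 1 := by rw [hp.length_eq, List.length_cons, hl]
  have hvm : v[m]'(by omega) = x := List.getElem_insertIdx_self _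
  have he : v.eraseIdx m = w := List.eraseIdx_insertIdx_self x
  have key : ∀ y : Fin N × ZMod 2, y.1 = x → L.insWord w * (Z m * (L.ι (x, 0) * L.δ y)) +
      L.insWord w * (Z' m * (L.P * (L.ι (x, 1) * L.δ y))) = 0 := by
    intro y hy
    have h1 := congrArg (· * L.δ y) (h v hnd hlen)
    beta_reduce at h1
    rw [zero_mul, Finset.mul_sum, Finset.sum_mul, Finset.sum_eq_single m] at h1
    · rw [← mul_assoc, L.insWord_mul_cycv v m (by omega), hvm, he, mul_add, mul_assoc _ _ (L.τ _),
        mul_assoc _ _ (L.τ _ * _), L.ι_τ, ← mul_assoc (L.ι _), L.ι_τ, mul_assoc (Z' m), ι_d,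
        add_mul] at h1
      simpa only [mul_assoc] using h1
    · intro j hj hjm
      have hj' : j < v.length := by rw [hlen]; exact Finset.mem_range.1 hj
      have hne : v[j] ≠ x := fun e => hjm (hnd.getElem_inj_iff.1 (e.trans hvm.symm))
      have hz : ∀ q, L.ι (v[j], q) * L.δ y = 0 := fun q => by
        rw [L.ι_δ, if_neg]
        rintro rfl
        exact hne hy
      rw [← mul_assoc, L.insWord_mul_cycv v j hj', mul_add, mul_assoc _ _ (L.τ _),
        mul_assoc _ _ (L.τ _ * _), L.ι_τ, ← mul_assoc (L.ι _), L.ι_τ, mul_assoc (Z' j), ι_d,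
        add_mul]
      simp only [mul_assoc, hz, mul_zero, add_zero]
    · exact fun hc => absurd (Finset.mem_range.2 hm) hc
  constructor
  · have h1 := key (x, 0) rfl
    rwa [L.ι_δ, L.ι_δ, if_pos rfl, if_neg (by simp), mul_one, mul_zero, mul_zero, mul_zero,
      add_zero] at h1
  · have h1 := key (x, 1) rfl
    rw [L.ι_δ, L.ι_δ, if_pos rfl, if_neg (by simp), mul_one, mul_zero, mul_zero, zero_add] at h1
    rw [← mul_one (Z' m), ← L.P_sq, ← mul_assoc, ← mul_assoc, mul_assoc (L.insWord w), h1, zero_mul]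

variable {L}

/-- Thin webs on few strands are determined by their values. -/
theorem eq_zero_of_rep [Nontrivial R] : ∀ {n : ℕ} {p : ZMod 2} {F : UpFam} {G : R}, n ≤ N →
    IsMk n p F → L.Rep n F G →
    (∀ v : List (Fin N), v.Nodup → v.length = n → L.insWord v * G = 0) → F = 0
  | 0, p, F, G, _, hF, hG, h => by
    obtain ⟨c, rfl⟩ : ∃ c : ℂ, F = c • thinI 0 := by
      have h1 : F ∈ Submodule.span ℂ {thinI 0} :=
        Submodule.span_mono (by rintro _ ⟨-, rfl⟩; rfl) hF
      obtain ⟨c, hc⟩ := Submodule.mem_span_singleton.1 h1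
      exact ⟨c, hc.symm⟩
    have h1 := h [] List.nodup_nil rfl
    rw [insWord, one_mul, hG.unique ((Rep.one 0).smul c)] at h1
    rw [(smul_eq_zero.1 h1).resolve_right one_ne_zero, zero_smul]
  | n + 1, p, F, G, hn, hF, hG, h => by
    obtain ⟨z, z', hz, hz', e⟩ := hF.isNF
    have r : ∀ {q : ZMod 2} {y : UpFam}, IsMk n q y → ∃ Y : R, L.Rep n y Y := fun hy => by
      obtain ⟨t, -, rfl⟩ := hy.exists_term
      exact ⟨_, t, rfl, rfl⟩
    choose Z hZ using fun j => r (hz j)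
    choose Z' hZ' using fun j => r (hz' j)
    have e' : G = ∑ j ∈ Finset.range (n + 1), L.cycv j * (L.τ (Z j) + L.τ (Z' j) * L.d) :=
      hG.unique (e ▸ Rep.sum fun j hj => ((hZ j).shift.add (hZ' j).dot).cyc_mul hj)
    subst e'
    have hc : ∀ {j : ℕ}, j < n + 1 → z j = 0 ∧ z' j = 0 := fun {j} hj =>
      ⟨eq_zero_of_rep (Nat.le_of_succ_le hn) (hz j) (hZ j) fun w hw hl =>
          (L.insWord_mul_coeff hn hj h hw hl).1,
        eq_zero_of_rep (Nat.le_of_succ_le hn) (hz' j) (hZ' j) fun w hw hl =>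
          (L.insWord_mul_coeff hn hj h hw hl).2⟩
    rw [e]
    refine Finset.sum_eq_zero fun j hj => ?_
    rw [(hc (Finset.mem_range.1 hj)).1, (hc (Finset.mem_range.1 hj)).2]
    exact (congrArg (cyc j * ·) (zero_add _)).trans ((congrArg (cyc j * ·) (zero_mul thinD)).trans
      (mul_zero _))

/-- Homogeneous webs are determined by their values. -/
theorem uo_eq_zero_of_parity [Nontrivial R] {a b : List ℕ+} {t : Term UpGen a b}
    (ht : t.HasParity UpGen.par p) (hN : sz a ≤ N) (h : L.uval t = 0) (w : List ℕ+) :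
    uo w t = 0 := by
  by_cases hs : sz a = sz b
  · have hc : conj t = 0 := by
      refine eq_zero_of_rep (L := L) (G := 0) hN ((isMackey ht).isMk hs)
        ⟨imWord a ⨟ t ⨟ exWord b ⨟ Term.ofEq (congrArg ones hs.symm), funext fun w => ?_, ?_⟩
        fun v _ _ => mul_zero _
      · rw [uo_comp, uo_comp, uo_comp, uo_ofEq, uo_mul_uI _ List.prefix_rfl, ← mul_assoc]
        rfl
      · rw [uval_comp, uval_comp, h, zero_mul, mul_zero]
    have h1 := uo_eq_conj w t
    rw [hc] at h1
    have h2 : (facWord a * facWord b) • uo w t = 0 := h1.trans (by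
      rw [Pi.zero_apply, mul_zero, zero_mul])
    exact (smul_eq_zero.1 h2).resolve_left (mul_ne_zero (facWord_ne_zero a) (facWord_ne_zero b))
  · exact (isMackey ht).zero hs w

/-- Webs are determined by their values. -/
theorem uo_eq_zero [Nontrivial R] {a b : List ℕ+} {t : Term UpGen a b} (hN : sz a ≤ N)
    (h : L.uval t = 0) : uo [] t = 0 := by
  obtain ⟨s, s', hs, hs', e⟩ := exists_homogeneous t
  have h0 : L.uval s + L.uval s' = 0 := (L.uval_congr (e [])).symm.trans h
  have c0 : L.P * L.uval s * L.P = L.uval s :=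
    ((L.isLocal_val (toOr_parity hs)).conj 1).trans (by rw [koszul_zero_left, one_smul]; rfl)
  have c1 : L.P * L.uval s' * L.P = -L.uval s' :=
    ((L.isLocal_val (toOr_parity hs')).conj 1).trans (by
      rw [show koszul 1 1 = -1 from sgn_one, neg_one_smul]; rfl)
  have h1 : L.uval s' = L.uval s := by
    have h2 : L.P * (L.uval s + L.uval s') * L.P = 0 := by rw [h0, mul_zero, zero_mul]
    rw [mul_add, add_mul, c0, c1, ← sub_eq_add_neg, sub_eq_zero] at h2
    exact h2.symm
  have h2 : L.uval s = 0 := by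
    rw [h1, ← two_smul ℂ] at h0
    exact (smul_eq_zero.1 h0).resolve_left two_ne_zero
  rw [e, uo_add, uo_eq_zero_of_parity (L := L) hs hN h2,
    uo_eq_zero_of_parity (L := L) hs' hN (h1.trans h2), add_zero]

end Leavitt

end Separation

section Model

/-- Functions of a parity and an infinite word. -/
abbrev WordFun (N : ℕ) : Type := ZMod 2 × Stream' (Fin N × ZMod 2) → ℂ

theorem koszul_one_mul (p q : ZMod 2) : koszul 1 q * sgn (p + q) = sgn p := by
  have h : koszul 1 q = sgn q := by rw [koszul, sgn, show (1 : ZMod 2).val = 1 from rfl, one_mul]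
  rw [h, ← sgn_add, add_comm p, ← add_assoc, CharTwo.add_self_eq_zero, zero_add]

/-- The ring generated by insertion and deletion of letters, acting on functions of words. -/
noncomputable def wordLeavitt (N : ℕ) : Leavitt N (Module.End ℂ (WordFun N)) where
  P :=
    { toFun ψ z := sgn z.1 * ψ z
      map_add' ψ φ := funext fun z => mul_add _ _ _
      map_smul' c ψ := funext fun z => mul_left_comm _ _ _ }
  ι x :=
    { toFun ψ z := ψ (z.1 + x.2, z.2.cons x)
      map_add' ψ φ := rfl
      map_smul' c ψ := rfl }
  δ x :=
    { toFun ψ z := if z.2.head = x then ψ (z.1 + x.2, z.2.tail) else 0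
      map_add' ψ φ := funext fun z => by
        by_cases h : z.2.head = x <;> simp [h]
      map_smul' c ψ := funext fun z => by
        by_cases h : z.2.head = x <;> simp [h] }
  P_sq := by
    refine LinearMap.ext fun ψ => funext fun z => ?_
    change sgn z.1 * (sgn z.1 * ψ z) = ψ z
    rw [← mul_assoc, ← sgn_add, CharTwo.add_self_eq_zero, sgn_zero, one_mul]
  ι_δ x y := by
    refine LinearMap.ext fun ψ => funext fun z => ?_
    change (if x = y then ψ (z.1 + x.2 + y.2, z.2) else 0) = _
    split_ifs with h
    · subst h
      rw [add_assoc, CharTwo.add_self_eq_zero, add_zero]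
      rfl
    · rfl
  sum_δ_ι := by
    refine LinearMap.ext fun ψ => funext fun z => ?_
    rw [LinearMap.sum_apply, Finset.sum_apply]
    have h : ∀ x : Fin N × ZMod 2, (if z.2.head = x then
        ψ (z.1 + x.2 + x.2, z.2.tail.cons x) else 0) = if z.2.head = x then ψ z else 0 := fun x => by
      split_ifs with h
      · rw [add_assoc, CharTwo.add_self_eq_zero, add_zero, ← h, Stream'.eta]
      · rfl
    refine (Finset.sum_congr rfl fun x _ => h x).trans ?_
    rw [Finset.sum_ite_eq, if_pos (Finset.mem_univ _)]
    rfl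
  P_ι x := by
    refine LinearMap.ext fun ψ => funext fun z => ?_
    change sgn z.1 * ψ _ = koszul 1 x.2 * (sgn (z.1 + x.2) * ψ _)
    rw [← mul_assoc, koszul_one_mul]
  P_δ x := by
    refine LinearMap.ext fun ψ => funext fun z => ?_
    change sgn z.1 * (if z.2.head = x then ψ _ else 0) =
      koszul 1 x.2 * (if z.2.head = x then sgn (z.1 + x.2) * ψ _ else 0)
    split_ifs
    · rw [← mul_assoc, koszul_one_mul]
    · rw [mul_zero, mul_zero]

/-- Upward webs that are equal as oriented webs are equal. -/
theorem upMor_eq_of_orMor_eq {a b : List ℕ+} {s t : Term UpGen a b}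
    (h : orMor (toOr s) = orMor (toOr t)) : upMor s = upMor t := by
  have : Nonempty (Stream' (Fin (sz a + 1) × ZMod 2)) := ⟨Stream'.const (0, 0)⟩
  have h1 := (wordLeavitt (sz a + 1)).val_eq_of_orMor_eq h
  have h2 : (wordLeavitt (sz a + 1)).uval (s - t) = 0 := by
    rw [Leavitt.uval_sub]
    exact sub_eq_zero.2 h1
  have h3 := Leavitt.uo_eq_zero (L := wordLeavitt (sz a + 1)) (Nat.le_succ _) h2
  rw [uo_sub] at h3
  exact op_inj (P := upP) (sub_eq_zero.1 h3)

theorem faithful_theta : theta.toFunctor.Faithful where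
  map_injective {a b} f g h := by
    obtain ⟨s, rfl⟩ := mor_surj (P := upP) f
    obtain ⟨t, rfl⟩ := mor_surj (P := upP) g
    exact upMor_eq_of_orMor_eq (a := a.word) (b := b.word) h

end Model
end QWeb

theorem theoremT :
    QWeb.IsSymmetricBraiding QWeb.upBraiding ∧ QWeb.IsSymmetricBraiding QWeb.orBraiding ∧
    QWeb.theta.PreservesBraiding QWeb.upBraiding QWeb.orBraiding ∧
    (∀ a : List ℕ+, QWeb.theta.obj (QWeb.upObj a) = QWeb.orObj (a.map QWeb.OrOb.up)) ∧
    (∀ (a b : List ℕ+) (t : QWeb.Term QWeb.UpGen a b),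
      QWeb.theta.map (QWeb.upMor t) = QWeb.orMor (QWeb.toOr t)) ∧
    QWeb.theta.toFunctor.Full ∧ QWeb.theta.toFunctor.Faithful ∧
    ∀ (a b : List ℕ+) (w : QWeb.Term QWeb.OrGen (a.map QWeb.OrOb.up) (b.map QWeb.OrOb.up)),
      w.IsWeb → QWeb.orMor w ∈ Submodule.span ℂ
        {f | ∃ v : QWeb.Term QWeb.UpGen a b, v.IsWeb ∧ f = QWeb.orMor (QWeb.toOr v)} := by
  exact ⟨QWeb.isSymmetricBraiding_upBraiding, QWeb.isSymmetricBraiding_orBraiding,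
    QWeb.preservesBraiding_theta, fun a => rfl, fun a b t => rfl, QWeb.full_theta,
    QWeb.faithful_theta, fun a b w _ => QWeb.orMor_mem_span w⟩
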